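/- A \emph{network} is a finite simple graph $N$ whose vertices are points of $\mathbb{R}^2$; an edge $\{p,q\}$ is identified with the segment $pq$, and the length of $N$ is the sum of the Euclidean lengths of its edges. A \emph{Manhattan path} for a pair $(s,t)$ of points is an $s$--$t$ path with axis-aligned edges whose length is the Manhattan distance $d(s,t)=|s_x-t_x|+|s_y-t_y|$. In the generalized minimum Manhattan network (GMMN) problem we are given a set $P$ of $n$ pairs of points in $\mathbb{R}^2$, and have to find a network of minimum length among all networks that consist of axis-aligned edges and contain a Manhattan path for every pair in $P$. The \emph{Hanan grid} $\mathcal{H}(P)$ is the grid network whose vertices are the points $(x,y)$ such that $x$ is the $x$-coordinate and $y$ is the $y$-coordinate of points appearing in $P$, and whose edges are the axis-aligned segments joining two distinct vertices and containing no further vertex. The \emph{intersection graph} of $P$ has vertex set $P$, and two distinct pairs are adjacent if some edge of $\mathcal{H}(P)$ has both its endpoints in each of their two bounding boxes. \textbf{Theorem.} There exists an $O(n^2)$-time algorithm for the GMMN problem when the intersection graph is restricted to a star. That is, there are a fixed program for the unit-cost real RAM and a constant $C$ such that for every $n \ge 1$ and every set $P$ of $n$ pairs of points in $\mathbb{R}^2$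 whose intersection graph is a star (with $n-1$ leaves), the program, given a list of the pairs in $P$ in any order, halts within $C n^2$ steps and outputs a tuple $(\pi_v)_{v\in P}$, where $\pi_v$ is a Manhattan path for $v$ that is a subgraph of $\mathcal{H}(P)$, such that the union $\bigcup_{v\in P}\pi_v$ is a minimum-length solution of the GMMN problem for $P$. -/

import Mathlib

namespace GMMN

/-! ## Points, networks and Manhattan paths -/

/-- Points of the plane; the lattice operations `⊓`, `⊔` and `≤` are coordinatewise. -/
abbrev Pt : Type := ℝ × ℝ

/-- The Euclidean length of the segment `pq`. -/
noncomputable def segLen (p q : Pt) : ℝ := √((p.1 - q.1) ^ 2 + (p.2 - q.2) ^ 2)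

/-- The Manhattan distance. -/
noncomputable def manhattan (p q : Pt) : ℝ := |p.1 - q.1| + |p.2 - q.2|

theorem segLen_comm (p q : Pt) : segLen p q = segLen q p := by
  unfold segLen
  congr 1
  ring

/-- The Euclidean length of an unordered pair of points. -/
noncomputable def edgeLen (e : Sym2 Pt) : ℝ := Sym2.lift ⟨segLen, segLen_comm⟩ e

/-- A segment is axis-aligned if it is vertical or horizontal. -/
def AxisAligned (e : Sym2 Pt) : Prop :=
  ∃ p q : Pt, e = s(p, q) ∧ (p.1 = q.1 ∨ p.2 = q.2)

/-- A geometric network: a finite simple graph whose vertices are points of the plane. -/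
structure Network where
  verts : Finset Pt
  edges : Finset (Sym2 Pt)
  mem_verts : ∀ e ∈ edges, ∀ p ∈ e, p ∈ verts
  not_isDiag : ∀ e ∈ edges, ¬ e.IsDiag

namespace Network

/-- The length of a network. -/
noncomputable def length (N : Network) : ℝ := ∑ e ∈ N.edges, edgeLen e

/-- `M` is a subgraph of `N`. -/
def IsSubgraph (M N : Network) : Prop := M.verts ⊆ N.verts ∧ M.edges ⊆ N.edges

/-- `π` is the `s`–`t` path with vertex sequence `l = [p₀, …, pₖ]`, `p₀ = s`, `pₖ = t`: its vertices
are the `pᵢ` and its edges are the `{pᵢ₋₁, pᵢ}`. -/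
def IsPathAlong (π : Network) (s t : Pt) (l : List Pt) : Prop :=
  l.head? = some s ∧ l.getLast? = some t ∧ π.verts = l.toFinset ∧
    π.edges = ((l.zip l.tail).map fun e => s(e.1, e.2)).toFinset

/-- `π` is an `s`–`t` path. -/
def IsPath (π : Network) (s t : Pt) : Prop := ∃ l, π.IsPathAlong s t l

/-- `π` is a Manhattan path for the pair `v`. -/
def IsMPath (π : Network) (v : Pt × Pt) : Prop :=
  π.IsPath v.1 v.2 ∧ (∀ e ∈ π.edges, AxisAligned e) ∧ π.length = manhattan v.1 v.2

/-- The union of a finite family of networks. -/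
noncomputable def iUnion {ι : Type*} [Fintype ι] (π : ι → Network) : Network where
  verts := Finset.univ.biUnion fun i => (π i).verts
  edges := Finset.univ.biUnion fun i => (π i).edges
  mem_verts := by
    intro e he p hp
    obtain ⟨i, hi, hei⟩ := Finset.mem_biUnion.1 he
    exact Finset.mem_biUnion.2 ⟨i, hi, (π i).mem_verts e hei p hp⟩
  not_isDiag := by
    intro e he
    obtain ⟨i, _, hei⟩ := Finset.mem_biUnion.1 he
    exact (π i).not_isDiag e hei

end Network

/-! ## The generalized minimum Manhattan network problem -/

/-- `N` consists of axis-aligned edges and contains a Manhattan path for every pair in `P`. -/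
def IsFeasibleNetwork (P : Finset (Pt × Pt)) (N : Network) : Prop :=
  (∀ e ∈ N.edges, AxisAligned e) ∧
    ∀ v ∈ P, ∃ π : Network, π.IsSubgraph N ∧ π.IsMPath v

/-- `N` is a solution of the problem: a feasible network of minimum length, among all
feasible networks in the plane. -/
def IsMinimumNetwork (P : Finset (Pt × Pt)) (N : Network) : Prop :=
  IsFeasibleNetwork P N ∧ ∀ N' : Network, IsFeasibleNetwork P N' → N.length ≤ N'.length

/-! ## The Hanan grid and the intersection graph -/

/-- The vertices of the Hanan grid: all points both of whose coordinates occur in `P`. -/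
noncomputable def hananVerts (P : Finset (Pt × Pt)) : Finset Pt :=
  (P.image (fun v => v.1.1) ∪ P.image fun v => v.2.1) ×ˢ
    (P.image (fun v => v.1.2) ∪ P.image fun v => v.2.2)

/-- `e` is an edge of the Hanan grid: an axis-aligned segment between two distinct grid vertices that
contains no third one. -/
def IsHananEdge (P : Finset (Pt × Pt)) (e : Sym2 Pt) : Prop :=
  ∃ p ∈ hananVerts P, ∃ q ∈ hananVerts P, e = s(p, q) ∧ p ≠ q ∧ segLen p q = manhattan p q ∧
    segment ℝ p q ∩ (hananVerts P : Set Pt) = {p, q}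

open scoped Classical in
/-- The Hanan grid of `P`. -/
noncomputable def hanan (P : Finset (Pt × Pt)) : Network where
  verts := hananVerts P
  edges := (hananVerts P).sym2.filter (IsHananEdge P)
  mem_verts := by
    intro e he p hp
    exact Finset.mem_sym2_iff.1 (Finset.mem_filter.1 he).1 p hp
  not_isDiag := by
    intro e he
    obtain ⟨p, _, q, _, rfl, hne, _⟩ := (Finset.mem_filter.1 he).2
    simpa using hne

/-- The bounding box of a pair. -/
def box (v : Pt × Pt) : Set Pt := Set.Icc (v.1 ⊓ v.2) (v.1 ⊔ v.2)

open scoped Classical in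
/-- The subgraph of the Hanan grid of `P` induced by its vertices in the bounding box of `v`. -/
noncomputable def hananBox (P : Finset (Pt × Pt)) (v : Pt × Pt) : Network where
  verts := (hanan P).verts.filter (· ∈ box v)
  edges := (hanan P).edges.filter fun e => ∀ p ∈ e, p ∈ box v
  mem_verts := by
    intro e he p hp
    obtain ⟨h1, h2⟩ := Finset.mem_filter.1 he
    exact Finset.mem_filter.2 ⟨(hanan P).mem_verts e h1 p hp, h2 p hp⟩
  not_isDiag := by
    intro e he
    exact (hanan P).not_isDiag e (Finset.mem_filter.1 he).1

/-- The intersection graph of `P`. -/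
noncomputable def intersectionGraph (P : Finset (Pt × Pt)) : SimpleGraph {v // v ∈ P} where
  Adj u v := u ≠ v ∧ ((hananBox P u).edges ∩ (hananBox P v).edges).Nonempty
  symm := ⟨fun u v h => ⟨h.1.symm, by rw [Finset.inter_comm]; exact h.2⟩⟩
  loopless := ⟨fun _ h => h.1 rfl⟩

/-- A graph is a star if, for some vertex `r` (the center), its edges are exactly the pairs consisting
of `r` and another vertex. -/
def IsStar {V : Type*} (G : SimpleGraph V) : Prop := ∃ r : V, G = SimpleGraph.starGraph r

/-- The tuples consisting of one Manhattan path on the Hanan grid for every pair in `P`. -/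
def Feas (P : Finset (Pt × Pt)) : Set ({v // v ∈ P} → Network) :=
  {π | ∀ v, (π v).IsMPath v ∧ (π v).IsSubgraph (hanan P)}

/-- The tuples in `Feas P` whose union has minimum length. -/
def Opt (P : Finset (Pt × Pt)) : Set ({v // v ∈ P} → Network) :=
  {π | π ∈ Feas P ∧ ∀ π' ∈ Feas P, (Network.iUnion π).length ≤ (Network.iUnion π').length}

/-! ## Algorithms: random access machines over the reals

A machine has integer registers (natural numbers) and real registers, and integer and real arrays
with indirect addressing. Integers can be added, subtracted and compared; reals can be added,
subtracted and compared. There is no conversion between the two sorts, and there are no other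
operations. Each operation takes one unit of time. -/

namespace RAM

/-- A memory configuration: integer registers, real registers, integer arrays, real arrays. -/
structure State where
  ireg : ℕ → ℕ
  rreg : ℕ → ℝ
  iarr : ℕ → ℕ → ℕ
  rarr : ℕ → ℕ → ℝ

/-- Integer expressions: constants, registers, array entries, sums and truncated differences. -/
inductive IExpr where
  | const (c : ℕ)
  | reg (x : ℕ)
  | get (a : ℕ) (i : IExpr)
  | add (e f : IExpr)
  | sub (e f : IExpr)

/-- Real expressions: zero, registers, array entries, sums and differences. -/
inductive RExpr where
  | zero
  | reg (x : ℕ)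
  | get (a : ℕ) (i : IExpr)
  | add (e f : RExpr)
  | sub (e f : RExpr)

/-- Tests: comparisons of integers or of reals, and their Boolean combinations. -/
inductive Test where
  | ilt (e f : IExpr)
  | rlt (e f : RExpr)
  | neg (b : Test)
  | conj (b c : Test)

/-- Programs. -/
inductive Cmd where
  | skip
  | iset (x : ℕ) (e : IExpr)
  | rset (x : ℕ) (e : RExpr)
  | iput (a : ℕ) (i : IExpr) (e : IExpr)
  | rput (a : ℕ) (i : IExpr) (e : RExpr)
  | seq (c d : Cmd)
  | ite (b : Test) (c d : Cmd)
  | loop (b : Test) (c : Cmd)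

def IExpr.eval (σ : State) : IExpr → ℕ
  | .const c => c
  | .reg x => σ.ireg x
  | .get a i => σ.iarr a (i.eval σ)
  | .add e f => e.eval σ + f.eval σ
  | .sub e f => e.eval σ - f.eval σ

noncomputable def RExpr.eval (σ : State) : RExpr → ℝ
  | .zero => 0
  | .reg x => σ.rreg x
  | .get a i => σ.rarr a (i.eval σ)
  | .add e f => e.eval σ + f.eval σ
  | .sub e f => e.eval σ - f.eval σ

def Test.Holds (σ : State) : Test → Prop
  | .ilt e f => e.eval σ < f.eval σ
  | .rlt e f => e.eval σ < f.eval σ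
  | .neg b => ¬ b.Holds σ
  | .conj b c => b.Holds σ ∧ c.Holds σ

/-- The time to evaluate an integer expression: the number of its nodes. -/
def IExpr.cost : IExpr → ℕ
  | .const _ => 1
  | .reg _ => 1
  | .get _ i => i.cost + 1
  | .add e f => e.cost + f.cost + 1
  | .sub e f => e.cost + f.cost + 1

/-- The time to evaluate a real expression. -/
def RExpr.cost : RExpr → ℕ
  | .zero => 1
  | .reg _ => 1
  | .get _ i => i.cost + 1
  | .add e f => e.cost + f.cost + 1
  | .sub e f => e.cost + f.cost + 1

/-- The time to evaluate a test. -/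
def Test.cost : Test → ℕ
  | .ilt e f => e.cost + f.cost + 1
  | .rlt e f => e.cost + f.cost + 1
  | .neg b => b.cost + 1
  | .conj b c => b.cost + c.cost + 1

namespace State

def setI (σ : State) (x : ℕ) (k : ℕ) : State :=
  { σ with ireg := Function.update σ.ireg x k }

noncomputable def setR (σ : State) (x : ℕ) (z : ℝ) : State :=
  { σ with rreg := Function.update σ.rreg x z }

def putI (σ : State) (a i : ℕ) (k : ℕ) : State :=
  { σ with iarr := Function.update σ.iarr a (Function.update (σ.iarr a) i k) }

noncomputable def putR (σ : State) (a i : ℕ) (z : ℝ) : State :=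
  { σ with rarr := Function.update σ.rarr a (Function.update (σ.rarr a) i z) }

end State

/-- `Exec c σ τ T`: the program `c`, started in `σ`, halts in `τ` after exactly `T` units of time. -/
inductive Exec : Cmd → State → State → ℕ → Prop where
  | skip (σ : State) : Exec .skip σ σ 1
  | iset (σ : State) (x : ℕ) (e : IExpr) :
      Exec (.iset x e) σ (σ.setI x (e.eval σ)) (e.cost + 1)
  | rset (σ : State) (x : ℕ) (e : RExpr) :
      Exec (.rset x e) σ (σ.setR x (e.eval σ)) (e.cost + 1)
  | iput (σ : State) (a : ℕ) (i : IExpr) (e : IExpr) :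
      Exec (.iput a i e) σ (σ.putI a (i.eval σ) (e.eval σ)) (i.cost + e.cost + 1)
  | rput (σ : State) (a : ℕ) (i : IExpr) (e : RExpr) :
      Exec (.rput a i e) σ (σ.putR a (i.eval σ) (e.eval σ)) (i.cost + e.cost + 1)
  | seq {c d : Cmd} {σ τ υ : State} {S T : ℕ} :
      Exec c σ τ S → Exec d τ υ T → Exec (.seq c d) σ υ (S + T)
  | ite_true {b : Test} {c d : Cmd} {σ τ : State} {T : ℕ} :
      b.Holds σ → Exec c σ τ T → Exec (.ite b c d) σ τ (b.cost + 1 + T)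
  | ite_false {b : Test} {c d : Cmd} {σ τ : State} {T : ℕ} :
      ¬ b.Holds σ → Exec d σ τ T → Exec (.ite b c d) σ τ (b.cost + 1 + T)
  | loop_true {b : Test} {c : Cmd} {σ τ υ : State} {S T : ℕ} :
      b.Holds σ → Exec c σ τ S → Exec (.loop b c) τ υ T →
        Exec (.loop b c) σ υ (b.cost + 1 + S + T)
  | loop_false {b : Test} {c : Cmd} {σ : State} :
      ¬ b.Holds σ → Exec (.loop b c) σ σ (b.cost + 1)

/-- The input format: the number of pairs is in integer register `0`, the coordinates of the
`i`-th pair are in the `i`-th entries of the real arrays `0, 1, 2, 3`, and all other memory is `0`. -/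
noncomputable def input (L : List (Pt × Pt)) : State where
  ireg x := if x = 0 then L.length else 0
  rreg _ := 0
  iarr _ _ := 0
  rarr a i :=
    let v := L.getD i 0
    if a = 0 then v.1.1 else if a = 1 then v.1.2 else if a = 2 then v.2.1
    else if a = 3 then v.2.2 else 0

/-- The output format: the vertex sequences of the paths are stored one after the other, with
coordinates in the real arrays `4` and `5`; entry `i` of the integer array `0` is the position at
which the `i`-th sequence starts, entry `i + 1` the position just after its end. -/
def outputPath (σ : State) (i : ℕ) : List Pt :=
  (List.range' (σ.iarr 0 i) (σ.iarr 0 (i + 1) - σ.iarr 0 i)).map fun k =>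
    (σ.rarr 4 k, σ.rarr 5 k)

end RAM

end GMMN

/-! After loop erasure a Manhattan path contains an axis-aligned geodesic: a list of points that is
monotone in both coordinates (`exists_geo_of_isMPath`). So every feasible network contains one
geodesic per pair. In a star, the boxes of two distinct leaves meet in at most one point (`adj_iff`,
`leavesDisjoint_of_isCenter`), so leaf paths share no edge. Hence, for every family of geodesics,
the length of the union plus the length that the path of the center `r` shares with leaf paths is
the fixed sum of all Manhattan distances (`weight_unionEdges_add_overlap`). Minimizing the length
means maximizing `overlap`.

Reflect the plane so that the center goes up and to the right. A leaf that does not have strictly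
negative slope can follow the center through its whole box. A leaf of negative slope (`Opp`) can
share points of a single horizontal or vertical line only, because two common points are ordered
increasingly by one path and decreasingly by the other (`share_coord`). The largest possible overlap
is therefore computed by a dynamic program over grid points. Its context remembers what happened in
the labelled box of the last edge: `0` nothing relevant, `1` or `2` a horizontal or vertical run of
collected edges is in progress, `3` or `4` such a run is over and nothing more may be collected in
this box (the code then records the direction of the last edge). Only boxes of negative slope carry
a nonzero label.

Upper bound (`overlap_le_value`). Competitors may leave the grid. Round all coordinates to
neighbouring grid coordinates with one threshold θ, uniform in [0, 1]. Rounding is monotone, keeps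
points inside their boxes and has the right mean, so the overlap is the average of the rounded
shared lengths. Each of these is at most the value of the dynamic program, by induction backwards
along the path of the center with the invariant `Bounded`.

Lower bound (`Follows.value_le_overlap`). Follow optimal decisions from the start (`Trace`). A
monotone path visits a box in one stretch, and the contexts force the edges collected in a box of
negative slope onto one line (`Trace.straight`). So each leaf path can walk to the first collected
edge of its box, follow the center, and walk on to its end (`Trace.unitStep_part`). `Follows.solved`
combines both bounds.

Time. The boxes of the leaves share no edges, so together they have O(n²) grid points
(`Layout.sum_area_le`) and can be labelled in that time; the tables have five entries for each of at
most 4n² grid points; each output path has O(n) points. The programs are verified by a small program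
logic with time bounds (`wp`, `Agree`), and `wp_program` assembles everything. -/

namespace GMMN

/-! ## Geodesic lists of points -/

/-- The edges of the path with vertex sequence `l`. -/
noncomputable def pathEdges (l : List Pt) : Finset (Sym2 Pt) :=
  ((l.zip l.tail).map fun e => s(e.1, e.2)).toFinset

/-- The total length of a set of edges. -/
noncomputable def weight (S : Finset (Sym2 Pt)) : ℝ := ∑ e ∈ S, edgeLen e

/-- Moving from `p` to `q` does not move away from `v.2` when travelling from `v.1` to `v.2`. -/
def Dir (v : Pt × Pt) (p q : Pt) : Prop :=
  ((v.1.1 ≤ v.2.1 → p.1 ≤ q.1) ∧ (v.2.1 ≤ v.1.1 → q.1 ≤ p.1)) ∧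
    ((v.1.2 ≤ v.2.2 → p.2 ≤ q.2) ∧ (v.2.2 ≤ v.1.2 → q.2 ≤ p.2))

/-- A nondegenerate axis-aligned step in the direction of `v`. -/
def Step (v : Pt × Pt) (p q : Pt) : Prop := p ≠ q ∧ (p.1 = q.1 ∨ p.2 = q.2) ∧ Dir v p q

/-- `l` is the vertex sequence of an axis-aligned geodesic from `v.1` to `v.2`. -/
def Geo (v : Pt × Pt) (l : List Pt) : Prop :=
  l.head? = some v.1 ∧ l.getLast? = some v.2 ∧ l.IsChain (Step v)

theorem pathEdges_singleton (p : Pt) : pathEdges [p] = ∅ := by simp [pathEdges]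

theorem pathEdges_cons_cons (p q : Pt) (l : List Pt) :
    pathEdges (p :: q :: l) = insert s(p, q) (pathEdges (q :: l)) := by
  simp [pathEdges]

theorem exists_mem_of_mem_pathEdges {R : Pt → Pt → Prop} {l : List Pt} (hl : l.IsChain R)
    {e : Sym2 Pt} (he : e ∈ pathEdges l) : ∃ p ∈ l, ∃ q ∈ l, e = s(p, q) ∧ R p q := by
  induction l with
  | nil => simp [pathEdges] at he
  | cons p l ih =>
    cases l with
    | nil => simp [pathEdges] at he
    | cons q l =>
      rw [pathEdges_cons_cons, Finset.mem_insert] at he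
      rw [List.isChain_cons_cons] at hl
      rcases he with rfl | he
      · exact ⟨p, by simp, q, by simp, rfl, hl.1⟩
      · obtain ⟨a, ha, b, hb, h⟩ := ih hl.2 he
        exact ⟨a, List.mem_cons_of_mem _ ha, b, List.mem_cons_of_mem _ hb, h⟩

theorem isChain_true (l : List Pt) : l.IsChain fun _ _ => True := by
  induction l with
  | nil => simp
  | cons p l ih =>
    cases l with
    | nil => simp
    | cons q l => exact List.isChain_cons_cons.2 ⟨trivial, ih⟩

theorem mem_of_mem_pathEdges {l : List Pt} {e : Sym2 Pt} (he : e ∈ pathEdges l) {p : Pt}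
    (hp : p ∈ e) : p ∈ l := by
  obtain ⟨a, ha, b, hb, rfl, -⟩ := exists_mem_of_mem_pathEdges (isChain_true l) he
  rcases Sym2.mem_iff.1 hp with rfl | rfl <;> assumption

theorem pathEdges_append_right (l₁ l₂ : List Pt) : pathEdges l₂ ⊆ pathEdges (l₁ ++ l₂) := by
  induction l₁ with
  | nil => simp
  | cons p l ih =>
    refine ih.trans ?_
    rw [List.cons_append]
    cases l ++ l₂ with
    | nil => simp [pathEdges]
    | cons q l =>
      rw [pathEdges_cons_cons]
      exact Finset.subset_insert _ _

theorem mem_pathEdges_append_pair (l₁ l₂ : List Pt) (p q : Pt) :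
    s(p, q) ∈ pathEdges (l₁ ++ p :: q :: l₂) := by
  refine pathEdges_append_right l₁ _ ?_
  rw [pathEdges_cons_cons]
  exact Finset.mem_insert_self _ _

theorem weight_mono {S T : Finset (Sym2 Pt)} (h : S ⊆ T) : weight S ≤ weight T := by
  refine Finset.sum_le_sum_of_subset_of_nonneg h fun e _ _ => ?_
  induction e with
  | _ p q => exact Real.sqrt_nonneg _

theorem segLen_eq_manhattan {p q : Pt} (h : p.1 = q.1 ∨ p.2 = q.2) :
    segLen p q = manhattan p q := by
  unfold segLen manhattan
  rcases h with h | h <;> simp [h, Real.sqrt_sq_eq_abs]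

theorem edgeLen_mk (p q : Pt) : edgeLen s(p, q) = segLen p q := rfl

/-! ### Geodesics -/

theorem Dir.refl (v : Pt × Pt) (p : Pt) : Dir v p p := by simp [Dir]

theorem Dir.trans {v : Pt × Pt} {p q z : Pt} (h : Dir v p q) (h' : Dir v q z) : Dir v p z :=
  ⟨⟨fun a => (h.1.1 a).trans (h'.1.1 a), fun a => (h'.1.2 a).trans (h.1.2 a)⟩,
    ⟨fun a => (h.2.1 a).trans (h'.2.1 a), fun a => (h'.2.2 a).trans (h.2.2 a)⟩⟩

/-- In each coordinate at least one of the two implications of `Dir` is active. If the coordinate is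
constant along `v`, both are, and they freeze it. -/
theorem Dir.antisymm {v : Pt × Pt} {p q : Pt} (h : Dir v p q) (h' : Dir v q p) : p = q := by
  ext
  · rcases le_total v.1.1 v.2.1 with a | a
    · exact le_antisymm (h.1.1 a) (h'.1.1 a)
    · exact le_antisymm (h'.1.2 a) (h.1.2 a)
  · rcases le_total v.1.2 v.2.2 with a | a
    · exact le_antisymm (h.2.1 a) (h'.2.1 a)
    · exact le_antisymm (h'.2.2 a) (h.2.2 a)

theorem Dir.manhattan_add {v : Pt × Pt} {p q z : Pt} (h : Dir v p q) (h' : Dir v q z) :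
    manhattan p z = manhattan p q + manhattan q z := by
  unfold manhattan
  have h1 : |p.1 - z.1| = |p.1 - q.1| + |q.1 - z.1| := by
    rcases le_total v.1.1 v.2.1 with a | a
    · have := h.1.1 a; have := h'.1.1 a
      rw [abs_of_nonpos, abs_of_nonpos, abs_of_nonpos] <;> linarith
    · have := h.1.2 a; have := h'.1.2 a
      rw [abs_of_nonneg, abs_of_nonneg, abs_of_nonneg] <;> linarith
  have h2 : |p.2 - z.2| = |p.2 - q.2| + |q.2 - z.2| := by
    rcases le_total v.1.2 v.2.2 with a | a
    · have := h.2.1 a; have := h'.2.1 a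
      rw [abs_of_nonpos, abs_of_nonpos, abs_of_nonpos] <;> linarith
    · have := h.2.2 a; have := h'.2.2 a
      rw [abs_of_nonneg, abs_of_nonneg, abs_of_nonneg] <;> linarith
  rw [h1, h2]; ring

theorem isChain_step_pairwise {v : Pt × Pt} {l : List Pt} (h : l.IsChain (Step v)) :
    l.Pairwise fun p q => p ≠ q ∧ Dir v p q := by
  have : Trans (fun p q => p ≠ q ∧ Dir v p q) (fun p q => p ≠ q ∧ Dir v p q)
      (fun p q => p ≠ q ∧ Dir v p q) := ⟨fun {a b c} h h' =>
    ⟨fun e => h.1 (h.2.antisymm (e ▸ h'.2)), h.2.trans h'.2⟩⟩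
  exact List.IsChain.pairwise (h.imp fun p q hs => ⟨hs.1, hs.2.2⟩)

theorem dir_of_mem_of_getLast {v : Pt × Pt} {l : List Pt} (h : l.IsChain (Step v)) {t : Pt}
    (ht : l.getLast? = some t) {p : Pt} (hp : p ∈ l) : Dir v p t := by
  obtain ⟨l', rfl⟩ := List.getLast?_eq_some_iff.1 ht
  rcases List.mem_append.1 hp with hp | hp
  · exact ((List.pairwise_append.1 (isChain_step_pairwise h)).2.2 p hp t (by simp)).2
  · rw [List.mem_singleton.1 hp]; exact Dir.refl _ _

theorem dir_of_head_of_mem {v : Pt × Pt} {l : List Pt} (h : l.IsChain (Step v)) {t : Pt}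
    (ht : l.head? = some t) {p : Pt} (hp : p ∈ l) : Dir v t p := by
  obtain ⟨l', rfl⟩ := List.head?_eq_some_iff.1 ht
  rcases List.mem_cons.1 hp with rfl | hp
  · exact Dir.refl _ _
  · exact ((List.pairwise_cons.1 (isChain_step_pairwise h)).1 p hp).2

theorem mem_box_iff {v : Pt × Pt} {p : Pt} : p ∈ box v ↔
    (min v.1.1 v.2.1 ≤ p.1 ∧ p.1 ≤ max v.1.1 v.2.1) ∧
      (min v.1.2 v.2.2 ≤ p.2 ∧ p.2 ≤ max v.1.2 v.2.2) := by
  simp only [box, Set.mem_Icc, Prod.le_def, Prod.fst_inf, Prod.snd_inf, Prod.fst_sup, Prod.snd_sup]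
  tauto

theorem mem_box_of_dir {v : Pt × Pt} {p : Pt} (h : Dir v v.1 p) (h' : Dir v p v.2) : p ∈ box v := by
  rw [mem_box_iff]
  constructor
  · rcases le_total v.1.1 v.2.1 with a | a
    · rw [min_eq_left a, max_eq_right a]; exact ⟨h.1.1 a, h'.1.1 a⟩
    · rw [min_eq_right a, max_eq_left a]; exact ⟨h'.1.2 a, h.1.2 a⟩
  · rcases le_total v.1.2 v.2.2 with a | a
    · rw [min_eq_left a, max_eq_right a]; exact ⟨h.2.1 a, h'.2.1 a⟩
    · rw [min_eq_right a, max_eq_left a]; exact ⟨h'.2.2 a, h.2.2 a⟩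

theorem Geo.mem_box {v : Pt × Pt} {l : List Pt} (h : Geo v l) {p : Pt} (hp : p ∈ l) : p ∈ box v :=
  mem_box_of_dir (dir_of_head_of_mem h.2.2 h.1 hp) (dir_of_mem_of_getLast h.2.2 h.2.1 hp)

theorem Geo.dir_total {v : Pt × Pt} {l : List Pt} (h : Geo v l) {p q : Pt} (hp : p ∈ l)
    (hq : q ∈ l) : Dir v p q ∨ Dir v q p := by
  have hpw := isChain_step_pairwise h.2.2
  obtain ⟨a, b, rfl⟩ := List.append_of_mem hp
  rw [List.pairwise_append, List.pairwise_cons] at hpw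
  rcases List.mem_append.1 hq with hq | hq
  · exact Or.inr (hpw.2.2 q hq p (by simp)).2
  · rcases List.mem_cons.1 hq with rfl | hq
    · exact Or.inl (Dir.refl _ _)
    · exact Or.inl (hpw.2.1.1 q hq).2

theorem weight_pathEdges_of_isChain {v : Pt × Pt} {p t : Pt} {l : List Pt}
    (h : (p :: l).IsChain (Step v)) (ht : (p :: l).getLast? = some t) :
    weight (pathEdges (p :: l)) = manhattan p t := by
  induction l generalizing p with
  | nil =>
    simp only [List.getLast?_singleton, Option.some.injEq] at ht
    simp [pathEdges_singleton, weight, manhattan, ht]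
  | cons q l ih =>
    have hq := List.isChain_cons_cons.1 h
    rw [List.getLast?_cons_cons] at ht
    have hpw := List.pairwise_cons.1 (isChain_step_pairwise h)
    have hn : s(p, q) ∉ pathEdges (q :: l) := fun hmem =>
      (hpw.1 p (mem_of_mem_pathEdges hmem (Sym2.mem_mk_left p q))).1 rfl
    rw [pathEdges_cons_cons, weight, Finset.sum_insert hn, edgeLen_mk,
      segLen_eq_manhattan hq.1.2.1]
    change _ + weight (pathEdges (q :: l)) = _
    rw [ih hq.2 ht, Dir.manhattan_add hq.1.2.2 (dir_of_mem_of_getLast hq.2 ht (by simp))]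

theorem Geo.weight_pathEdges {v : Pt × Pt} {l : List Pt} (h : Geo v l) :
    weight (pathEdges l) = manhattan v.1 v.2 := by
  obtain ⟨h1, h2, h3⟩ := h
  obtain ⟨l', rfl⟩ := List.head?_eq_some_iff.1 h1
  exact weight_pathEdges_of_isChain h3 h2

/-! ### Extracting a geodesic from a Manhattan path -/

/-- Loop erasure, needed because `IsPathAlong` allows repeated vertices. If the new first point
occurs later, everything between is cut out; the remaining edges are old ones. -/
theorem exists_nodup_sublist (l : List Pt) (t : Pt) (ht : l.getLast? = some t) :
    ∃ l' : List Pt, l'.head? = l.head? ∧ l'.getLast? = some t ∧ l'.Nodup ∧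
      pathEdges l' ⊆ pathEdges l := by
  induction l with
  | nil => simp at ht
  | cons p l ih =>
    cases l with
    | nil => exact ⟨[p], by simpa using ht⟩
    | cons q l =>
      rw [List.getLast?_cons_cons] at ht
      obtain ⟨l', h1, h2, h3, h4⟩ := ih ht
      by_cases hp : p ∈ l'
      · obtain ⟨a, b, rfl⟩ := List.append_of_mem hp
        refine ⟨p :: b, by simp, by simpa using h2, (List.nodup_append.1 h3).2.1, ?_⟩
        rw [pathEdges_cons_cons]
        exact ((pathEdges_append_right a _).trans h4).trans (Finset.subset_insert _ _)
      · obtain ⟨l'', rfl⟩ := List.head?_eq_some_iff.1 h1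
        refine ⟨p :: q :: l'', by simp, by rwa [List.getLast?_cons_cons],
          List.nodup_cons.2 ⟨hp, h3⟩, ?_⟩
        rw [pathEdges_cons_cons, pathEdges_cons_cons]
        exact Finset.insert_subset_insert _ h4

/-- The linear functional `ε x + δ y` grows along an axis-aligned step by at most its length.
Summation gives the bound, and equality forces every single step to be nonnegative in both signed
coordinates. -/
theorem isChain_of_weight_le (ε δ : ℝ) (hε : ε = 1 ∨ ε = -1) (hδ : δ = 1 ∨ δ = -1) (l : List Pt)
    (p t : Pt) (ht : (p :: l).getLast? = some t) (hn : (p :: l).Nodup)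
    (ha : ∀ e ∈ pathEdges (p :: l), AxisAligned e) :
    ε * (t.1 - p.1) + δ * (t.2 - p.2) ≤ weight (pathEdges (p :: l)) ∧
      (weight (pathEdges (p :: l)) ≤ ε * (t.1 - p.1) + δ * (t.2 - p.2) →
        (p :: l).IsChain fun a b => a ≠ b ∧ (a.1 = b.1 ∨ a.2 = b.2) ∧
          0 ≤ ε * (b.1 - a.1) ∧ 0 ≤ δ * (b.2 - a.2)) := by
  induction l generalizing p with
  | nil =>
    simp only [List.getLast?_singleton, Option.some.injEq] at ht
    simp [pathEdges_singleton, weight, ht]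
  | cons q l ih =>
    rw [List.getLast?_cons_cons] at ht
    rw [List.nodup_cons] at hn
    rw [pathEdges_cons_cons] at ha ⊢
    have hn' : s(p, q) ∉ pathEdges (q :: l) := fun hmem =>
      hn.1 (mem_of_mem_pathEdges hmem (Sym2.mem_mk_left p q))
    have hal : p.1 = q.1 ∨ p.2 = q.2 := by
      obtain ⟨a, b, hab, h⟩ := ha _ (Finset.mem_insert_self _ _)
      rcases Sym2.eq_iff.1 hab with ⟨rfl, rfl⟩ | ⟨rfl, rfl⟩
      · exact h
      · exact h.imp Eq.symm Eq.symm
    obtain ⟨ih1, ih2⟩ := ih q ht hn.2 fun e he => ha e (Finset.mem_insert_of_mem he)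
    have hw : weight (insert s(p, q) (pathEdges (q :: l))) =
        |p.1 - q.1| + |p.2 - q.2| + weight (pathEdges (q :: l)) := by
      rw [weight, Finset.sum_insert hn', edgeLen_mk, segLen_eq_manhattan hal]
      rfl
    rw [hw]
    have e1 : ε * (q.1 - p.1) ≤ |p.1 - q.1| := by
      rcases hε with rfl | rfl
      · have := neg_le_abs (p.1 - q.1); linarith
      · have := le_abs_self (p.1 - q.1); linarith
    have e2 : δ * (q.2 - p.2) ≤ |p.2 - q.2| := by
      rcases hδ with rfl | rfl
      · have := neg_le_abs (p.2 - q.2); linarith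
      · have := le_abs_self (p.2 - q.2); linarith
    refine ⟨by linarith, fun h => List.isChain_cons_cons.2 ⟨⟨?_, hal, ?_, ?_⟩, ih2 (by linarith)⟩⟩
    · rintro rfl; exact hn.1 (by simp)
    · have := abs_nonneg (p.1 - q.1); linarith
    · have := abs_nonneg (p.2 - q.2); linarith

theorem exists_sign (a b : ℝ) : ∃ ε : ℝ, (ε = 1 ∨ ε = -1) ∧ ε * (b - a) = |a - b| := by
  rcases le_total a b with h | h
  · exact ⟨1, Or.inl rfl, by rw [abs_of_nonpos (by linarith)]; ring⟩
  · exact ⟨-1, Or.inr rfl, by rw [abs_of_nonneg (by linarith)]; ring⟩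

/-- For the signs given by `v`, the functional of `isChain_of_weight_le` grows in total by the
Manhattan distance, which is the length of `π`. So the equality case applies to the loop-erased
list. -/
theorem exists_geo_of_isMPath {π : Network} {v : Pt × Pt} (h : π.IsMPath v) :
    ∃ l, Geo v l ∧ pathEdges l ⊆ π.edges := by
  obtain ⟨⟨l, h1, h2, -, h4⟩, hax, hlen⟩ := h
  obtain ⟨l', g1, g2, g3, g4⟩ := exists_nodup_sublist l _ h2
  have hsub : pathEdges l' ⊆ π.edges := by rw [h4]; exact g4
  rw [h1] at g1
  obtain ⟨l'', rfl⟩ := List.head?_eq_some_iff.1 g1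
  refine ⟨_, ⟨g1, g2, ?_⟩, hsub⟩
  obtain ⟨ε, hε, hε'⟩ := exists_sign v.1.1 v.2.1
  obtain ⟨δ, hδ, hδ'⟩ := exists_sign v.1.2 v.2.2
  obtain ⟨h5, h6⟩ := isChain_of_weight_le ε δ hε hδ l'' v.1 v.2 g2 g3 fun e he => hax e (hsub he)
  have hw : weight (pathEdges (v.1 :: l'')) ≤ ε * (v.2.1 - v.1.1) + δ * (v.2.2 - v.1.2) := by
    refine (weight_mono hsub).trans ?_
    change π.length ≤ _
    rw [hlen, hε', hδ']; rfl
  -- If the end points of `v` agree in a coordinate, both signs are admissible there. Using all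
  -- admissible signs gives both implications of `Dir`.
  have both : ∀ (ε δ : ℝ), (ε = 1 ∨ ε = -1) → (δ = 1 ∨ δ = -1) →
      ε * (v.2.1 - v.1.1) = |v.1.1 - v.2.1| → δ * (v.2.2 - v.1.2) = |v.1.2 - v.2.2| →
      (v.1 :: l'').IsChain fun a b => a ≠ b ∧ (a.1 = b.1 ∨ a.2 = b.2) ∧
          0 ≤ ε * (b.1 - a.1) ∧ 0 ≤ δ * (b.2 - a.2) := by
    intro ε' δ' hε1 hδ1 hε2 hδ2
    refine (isChain_of_weight_le ε' δ' hε1 hδ1 l'' v.1 v.2 g2 g3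
      fun e he => hax e (hsub he)).2 ?_
    rw [hε2, hδ2, ← hε', ← hδ']; exact hw
  have imp : ∀ ε δ : ℝ, (ε = 1 ∨ ε = -1) → (δ = 1 ∨ δ = -1) →
      ε * (v.2.1 - v.1.1) = |v.1.1 - v.2.1| → δ * (v.2.2 - v.1.2) = |v.1.2 - v.2.2| →
      ∀ i (hi : i + 1 < (v.1 :: l'').length), 0 ≤ ε * ((v.1 :: l'')[i + 1].1 - (v.1 :: l'')[i].1) ∧
        0 ≤ δ * ((v.1 :: l'')[i + 1].2 - (v.1 :: l'')[i].2) := fun ε δ a b c d i hi =>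
    (List.isChain_iff_getElem.1 (both ε δ a b c d) i hi).2.2
  have ch := h6 hw
  rw [List.isChain_iff_getElem] at ch ⊢
  intro i hi
  obtain ⟨c1, c2, -, -⟩ := ch i hi
  have sgn : ∀ a b : ℝ, a ≤ b → (1 : ℝ) * (b - a) = |a - b| := fun a b h => by
    rw [abs_of_nonpos (by linarith)]; ring
  have sgn' : ∀ a b : ℝ, b ≤ a → (-1 : ℝ) * (b - a) = |a - b| := fun a b h => by
    rw [abs_of_nonneg (by linarith)]; ring
  refine ⟨c1, c2, ⟨fun a => ?_, fun a => ?_⟩, ⟨fun a => ?_, fun a => ?_⟩⟩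
  · have := (imp 1 δ (Or.inl rfl) hδ (sgn _ _ a) hδ' i hi).1; linarith
  · have := (imp (-1) δ (Or.inr rfl) hδ (sgn' _ _ a) hδ' i hi).1; linarith
  · have := (imp ε 1 hε (Or.inl rfl) hε' (sgn _ _ a) i hi).2; linarith
  · have := (imp ε (-1) hε (Or.inr rfl) hε' (sgn' _ _ a) i hi).2; linarith

/-! ### Families of geodesics -/

/-- The edges of the paths of the members of a family. -/
noncomputable def unionEdges (s : Finset ℕ) (m : ℕ → List Pt) : Finset (Sym2 Pt) :=
  s.biUnion fun k => pathEdges (m k)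

/-- The length that the path of `r` shares with the others. -/
noncomputable def overlap (n r : ℕ) (m : ℕ → List Pt) : ℝ :=
  weight (pathEdges (m r) ∩ unionEdges ((Finset.range n).erase r) m)

theorem Geo.exists_of_mem_pathEdges {v : Pt × Pt} {l : List Pt} (h : Geo v l) {e : Sym2 Pt}
    (he : e ∈ pathEdges l) : ∃ p ∈ l, ∃ q ∈ l, e = s(p, q) ∧ Step v p q :=
  exists_mem_of_mem_pathEdges h.2.2 he

/-- The boxes of any two pairs other than `r` have at most one point in common. -/
def LeavesDisjoint (n r : ℕ) (v : ℕ → Pt × Pt) : Prop :=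
  ∀ k < n, ∀ k' < n, k ≠ r → k' ≠ r → k ≠ k' → (box (v k) ∩ box (v k')).Subsingleton

/-- The two distinct ends of a common edge would lie in both boxes. -/
theorem disjoint_pathEdges {v w : Pt × Pt} {l l' : List Pt} (h : Geo v l) (h' : Geo w l')
    (hs : (box v ∩ box w).Subsingleton) : Disjoint (pathEdges l) (pathEdges l') := by
  rw [Finset.disjoint_left]
  intro e he he'
  obtain ⟨p, hp, q, hq, rfl, hpq⟩ := h.exists_of_mem_pathEdges he
  refine hpq.1 (hs ⟨h.mem_box hp, h'.mem_box ?_⟩ ⟨h.mem_box hq, h'.mem_box ?_⟩)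
  · exact mem_of_mem_pathEdges he' (Sym2.mem_mk_left p q)
  · exact mem_of_mem_pathEdges he' (Sym2.mem_mk_right p q)

/-- The leaf paths are edge-disjoint, so their union has the sum of their lengths; the path of `r`
is added by inclusion and exclusion. The right side does not depend on `m`, which turns the
minimization into the maximization of `overlap`. -/
theorem weight_unionEdges_add_overlap {n r : ℕ} (hr : r < n) {v : ℕ → Pt × Pt} {m : ℕ → List Pt}
    (hd : LeavesDisjoint n r v) (hm : ∀ k < n, Geo (v k) (m k)) :
    weight (unionEdges (Finset.range n) m) + overlap n r m =
      ∑ k ∈ Finset.range n, manhattan (v k).1 (v k).2 := by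
  have hr' : r ∈ Finset.range n := Finset.mem_range.2 hr
  have h1 : unionEdges (Finset.range n) m =
      pathEdges (m r) ∪ unionEdges ((Finset.range n).erase r) m := by
    conv_lhs => rw [← Finset.insert_erase hr', unionEdges, Finset.biUnion_insert]
    rfl
  have h2 : weight (unionEdges ((Finset.range n).erase r) m) =
      ∑ k ∈ (Finset.range n).erase r, manhattan (v k).1 (v k).2 := by
    rw [weight, unionEdges, Finset.sum_biUnion]
    · refine Finset.sum_congr rfl fun k hk => ?_
      exact (hm k (Finset.mem_range.1 (Finset.mem_of_mem_erase hk))).weight_pathEdges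
    · intro k hk k' hk' hne
      simp only [Finset.coe_erase, Finset.coe_range, Set.mem_sdiff, Set.mem_Iio,
        Set.mem_singleton_iff] at hk hk'
      exact disjoint_pathEdges (hm k hk.1) (hm k' hk'.1) (hd k hk.1 k' hk'.1 hk.2 hk'.2 hne)
  rw [h1, overlap, weight, weight, Finset.sum_union_inter]
  change weight _ + weight _ = _
  rw [h2, (hm r hr).weight_pathEdges, Finset.add_sum_erase _
    (fun k => manhattan (v k).1 (v k).2) hr']

end GMMN


/-! ### The recursion for the largest shareable length, and certificates for upper bounds by it. -/

namespace GMMN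

/-! ## The dynamic program -/

/-- First coordinate of the grid point after a horizontal (`d = true`) or vertical step. -/
def nx (d : Bool) (i : ℕ) : ℕ := if d then i + 1 else i

/-- Second coordinate of the grid point after a horizontal (`d = true`) or vertical step. -/
def ny (d : Bool) (j : ℕ) : ℕ := if d then j else j + 1

/-- The context code of a shared run in direction `d`. -/
def runCtx (d : Bool) : ℕ := if d then 1 else 2

/-- The context code after the shared run, if the last step was in direction `d`. -/
def doneCtx (d : Bool) : ℕ := if d then 3 else 4

/-- The label of the last edge, as far as the context `c` depends on it. -/
def ctxLabel (I : Bool → ℕ → ℕ → ℕ) (c i j : ℕ) : ℕ :=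
  if c = 0 then 0 else if c = 1 ∨ c = 3 then I true i j else I false i j

/-- The last edge and the next edge, in direction `d`, belong to the same labelled box. -/
abbrev Same (I : Bool → ℕ → ℕ → ℕ) (c i j : ℕ) (d : Bool) : Prop :=
  ctxLabel I c i j ≠ 0 ∧ ctxLabel I c i j = I d (nx d i) (ny d j)

/-- The context after a step in direction `d` that is not shared. -/
def skipCtx (I : Bool → ℕ → ℕ → ℕ) (c i j : ℕ) (d : Bool) : ℕ :=
  if Same I c i j d then doneCtx d else 0

/-- A step in direction `d` stays in the box of the center. -/
abbrev Avail (tx ty i j : ℕ) (d : Bool) : Prop := if d then i < tx else j < ty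

/-- The best value of a step in direction `d`. -/
noncomputable def stepValue (I : Bool → ℕ → ℕ → ℕ) (G : Bool → ℕ → ℕ → ℝ) (V : ℕ → ℕ → ℕ → ℝ)
    (c i j : ℕ) (d : Bool) : ℝ :=
  if ¬ Same I c i j d ∨ c = runCtx d then
    max (V (skipCtx I c i j d) (nx d i) (ny d j))
      (G d (nx d i) (ny d j) + V (runCtx d) (nx d i) (ny d j))
  else V (skipCtx I c i j d) (nx d i) (ny d j)

/-- The value function of the dynamic program; the first argument is the number of steps left. -/
noncomputable def valueAux (I : Bool → ℕ → ℕ → ℕ) (G : Bool → ℕ → ℕ → ℝ) (tx ty : ℕ) :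
    ℕ → ℕ → ℕ → ℕ → ℝ
  | 0, _, _, _ => 0
  | k + 1, c, i, j =>
    if i < tx then
      if j < ty then max (stepValue I G (valueAux I G tx ty k) c i j true)
          (stepValue I G (valueAux I G tx ty k) c i j false)
      else stepValue I G (valueAux I G tx ty k) c i j true
    else stepValue I G (valueAux I G tx ty k) c i j false

/-- The value function: the largest length that can be shared from `(i, j)` on, in context `c`. -/
noncomputable def value (I : Bool → ℕ → ℕ → ℕ) (G : Bool → ℕ → ℕ → ℝ) (tx ty c i j : ℕ) : ℝ :=
  valueAux I G tx ty ((tx - i) + (ty - j)) c i j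

section Value

variable {I : Bool → ℕ → ℕ → ℕ} {G : Bool → ℕ → ℕ → ℝ} {tx ty : ℕ}

theorem value_end (c : ℕ) : value I G tx ty c tx ty = 0 := by
  simp [value, valueAux]

theorem stepValue_congr {V V' : ℕ → ℕ → ℕ → ℝ} {c i j : ℕ} {d : Bool}
    (h : ∀ c', V c' (nx d i) (ny d j) = V' c' (nx d i) (ny d j)) :
    stepValue I G V c i j d = stepValue I G V' c i j d := by
  simp only [stepValue, h]

theorem valueAux_eq_value {k i j : ℕ} (h : (tx - i) + (ty - j) = k + 1) {d : Bool}
    (hd : Avail tx ty i j d) (c : ℕ) :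
    valueAux I G tx ty k c (nx d i) (ny d j) = value I G tx ty c (nx d i) (ny d j) := by
  have : (tx - nx d i) + (ty - ny d j) = k := by
    cases d <;> simp [Avail, nx, ny] at hd ⊢ <;> omega
  rw [value, this]

/-- The Bellman equation. The fuel of `valueAux` is the number of steps to the target, which drops
by exactly one with every available step. -/
theorem value_eq {c i j : ℕ} (hi : i ≤ tx) (hj : j ≤ ty) (h : i < tx ∨ j < ty) :
    value I G tx ty c i j =
      if i < tx then
        if j < ty then max (stepValue I G (value I G tx ty) c i j true)
          (stepValue I G (value I G tx ty) c i j false)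
        else stepValue I G (value I G tx ty) c i j true
      else stepValue I G (value I G tx ty) c i j false := by
  obtain ⟨k, hk⟩ : ∃ k, (tx - i) + (ty - j) = k + 1 := ⟨tx - i + (ty - j) - 1, by omega⟩
  have e : ∀ d, Avail tx ty i j d → stepValue I G (valueAux I G tx ty k) c i j d =
      stepValue I G (value I G tx ty) c i j d := fun d hd =>
    stepValue_congr fun c' => valueAux_eq_value hk hd c'
  rw [value, hk, valueAux]
  split_ifs with h1 h2
  · rw [e true (by simpa [Avail] using h1), e false (by simpa [Avail] using h2)]
  · rw [e true (by simpa [Avail] using h1)]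
  · rw [e false (by simp [Avail]; omega)]

theorem stepValue_le_value {c i j : ℕ} (hi : i ≤ tx) (hj : j ≤ ty) {d : Bool}
    (hd : Avail tx ty i j d) :
    stepValue I G (value I G tx ty) c i j d ≤ value I G tx ty c i j := by
  cases d
  · simp only [Avail, Bool.false_eq_true, if_false] at hd
    rw [value_eq hi hj (Or.inr hd)]
    simp only [hd, if_true]
    split_ifs
    · exact le_max_right _ _
    · exact le_rfl
  · simp only [Avail, if_true] at hd
    rw [value_eq hi hj (Or.inl hd)]
    simp only [hd, if_true]
    split_ifs
    · exact le_max_left _ _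
    · exact le_rfl

theorem skip_le_value {c i j : ℕ} (hi : i ≤ tx) (hj : j ≤ ty) {d : Bool}
    (hd : Avail tx ty i j d) :
    value I G tx ty (skipCtx I c i j d) (nx d i) (ny d j) ≤ value I G tx ty c i j := by
  refine le_trans ?_ (stepValue_le_value hi hj hd)
  rw [stepValue]
  split_ifs
  · exact le_max_left _ _
  · exact le_rfl

theorem collect_le_value {c i j : ℕ} (hi : i ≤ tx) (hj : j ≤ ty) {d : Bool}
    (hd : Avail tx ty i j d) (h : ¬ Same I c i j d ∨ c = runCtx d) :
    G d (nx d i) (ny d j) + value I G tx ty (runCtx d) (nx d i) (ny d j) ≤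
      value I G tx ty c i j := by
  refine le_trans ?_ (stepValue_le_value hi hj hd)
  rw [stepValue, if_pos h]
  exact le_max_right _ _

end Value

theorem ctxLabel_zero (I : Bool → ℕ → ℕ → ℕ) (i j : ℕ) : ctxLabel I 0 i j = 0 := by simp [ctxLabel]

theorem ctxLabel_runCtx (I : Bool → ℕ → ℕ → ℕ) (d : Bool) (i j : ℕ) :
    ctxLabel I (runCtx d) i j = I d i j := by cases d <;> simp [ctxLabel, runCtx]

theorem ctxLabel_doneCtx (I : Bool → ℕ → ℕ → ℕ) (d : Bool) (i j : ℕ) :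
    ctxLabel I (doneCtx d) i j = I d i j := by cases d <;> simp [ctxLabel, doneCtx]

/-- Context `0` remembers no box and hence never forbids collecting. -/
theorem not_same_zero (I : Bool → ℕ → ℕ → ℕ) (i j : ℕ) (d : Bool) : ¬ Same I 0 i j d := by
  simp [Same, ctxLabel_zero]

/-! ### Dual certificate -/

/-- The number of the grid line through `(i, j)` in direction `d`. -/
def lineCoord (d : Bool) (i j : ℕ) : ℕ := if d then j else i

/-- `S` is bounded by the values at `(i, j)`, where `S` is the shared length of a path starting at
`(i, j)` that shares with exactly the labelled boxes in `alive`,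
  with box `c` on the line `lin c`. -/
structure Bounded (I : Bool → ℕ → ℕ → ℕ) (V : ℕ → ℕ → ℕ → ℝ) (lin : ℕ → Bool × ℕ)
    (S : ℝ) (alive : Set ℕ) (i j : ℕ) : Prop where
  fresh : S ≤ V 0 i j
  done : ∀ d, I d i j ∉ alive → S ≤ V (doneCtx d) i j
  run : ∀ d, (I d i j ∈ alive → lin (I d i j) = (d, lineCoord d i j)) → S ≤ V (runCtx d) i j
  reach : ∀ c ∈ alive, lineCoord (lin c).1 i j ≤ (lin c).2
  zero : 0 ∉ alive

section Certificate

variable {I : Bool → ℕ → ℕ → ℕ} {G : Bool → ℕ → ℕ → ℝ} {tx ty : ℕ} {lin : ℕ → Bool × ℕ}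

/-- No step goes back across a grid line; this carries the field `reach` of `Bounded` backwards
along the path. -/
theorem lineCoord_le (d e : Bool) (i j : ℕ) :
    lineCoord d i j ≤ lineCoord d (nx e i) (ny e j) := by
  cases d <;> cases e <;> simp [lineCoord, nx, ny]

theorem lineCoord_next_self (d : Bool) (i j : ℕ) :
    lineCoord d (nx d i) (ny d j) = lineCoord d i j := by
  cases d <;> simp [lineCoord, nx, ny]

/-- A step that is not shared leaves `S` and `alive` unchanged, so only the contexts before and
after it have to be matched. -/
theorem Bounded.skip {S : ℝ} {alive : Set ℕ} {i j : ℕ} {d : Bool} (hi : i ≤ tx) (hj : j ≤ ty)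
    (hd : Avail tx ty i j d) (hG : 0 ≤ G d (nx d i) (ny d j))
    (h : Bounded I (value I G tx ty) lin S alive (nx d i) (ny d j)) :
    Bounded I (value I G tx ty) lin S alive i j where
  fresh := by
    refine h.fresh.trans ?_
    have := skip_le_value (I := I) (G := G) (c := 0) hi hj hd
    rwa [skipCtx, if_neg (not_same_zero I i j d)] at this
  done e he := by
    have := skip_le_value (I := I) (G := G) (c := doneCtx e) hi hj hd
    rw [skipCtx] at this
    split_ifs at this with hs
    · rw [Same, ctxLabel_doneCtx] at hs
      exact (h.done d (hs.2 ▸ he)).trans this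
    · exact h.fresh.trans this
  run e he := by
    have hskip := skip_le_value (I := I) (G := G) (c := runCtx e) hi hj hd
    rw [skipCtx] at hskip
    split_ifs at hskip with hs
    · rw [Same, ctxLabel_runCtx] at hs
      by_cases hde : e = d
      · subst hde
        -- Skipping inside a run on its own line would end the run. Collecting instead is allowed
        -- and, by `hG`, no worse, so the certificate uses that.
        have hc := collect_le_value (I := I) (G := G) (c := runCtx e) hi hj hd (Or.inr rfl)
        have : S ≤ value I G tx ty (runCtx e) (nx e i) (ny e j) := by
          refine h.run e fun hm => ?_
          rw [← hs.2] at hm ⊢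
          rw [he hm, lineCoord_next_self]
        linarith
      -- After a turn the line of the run lies strictly behind, so by `reach` its box is no longer
      -- alive.
      · refine (h.done d fun hm => ?_).trans hskip
        have h1 := h.reach _ hm
        rw [← hs.2] at hm h1
        rw [he hm] at h1
        cases e <;> cases d <;> simp [lineCoord, nx, ny] at h1 hde
    · exact h.fresh.trans hskip
  reach c hc := (lineCoord_le _ _ _ _).trans (h.reach c hc)
  zero := h.zero

/-- The label of the shared edge joins `alive`. Entering the run context is safe, since by `hl` the
line of this box is the current one. A context that forbids collecting either marks the box as done
although it is alive, or has a run on a line other than the one in `lin`; the premises of `done` and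
`run` exclude both. -/
theorem Bounded.collect {S : ℝ} {alive : Set ℕ} {i j : ℕ} {d : Bool} (hi : i ≤ tx) (hj : j ≤ ty)
    (hd : Avail tx ty i j d)
    (hl : I d (nx d i) (ny d j) ≠ 0 → lin (I d (nx d i) (ny d j)) = (d, lineCoord d i j))
    (h : Bounded I (value I G tx ty) lin S alive (nx d i) (ny d j)) :
    Bounded I (value I G tx ty) lin (G d (nx d i) (ny d j) + S)
      (alive ∪ {c | c ≠ 0 ∧ c = I d (nx d i) (ny d j)}) i j := by
  have key : S ≤ value I G tx ty (runCtx d) (nx d i) (ny d j) := by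
    refine h.run d fun hm => ?_
    rw [hl fun h0 => h.zero (h0 ▸ hm), lineCoord_next_self]
  have col : ∀ c, (¬ Same I c i j d ∨ c = runCtx d) →
      G d (nx d i) (ny d j) + S ≤ value I G tx ty c i j := fun c hc => by
    have := collect_le_value (I := I) (G := G) (c := c) hi hj hd hc
    linarith
  refine ⟨col 0 (Or.inl (not_same_zero I i j d)), fun e he => col _ (Or.inl fun hs => he ?_),
    fun e he => ?_, fun c hc => ?_, ?_⟩
  · rw [Same, ctxLabel_doneCtx] at hs
    exact Or.inr hs
  · refine col _ (or_iff_not_imp_left.2 fun hs => ?_)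
    rw [not_not, Same, ctxLabel_runCtx] at hs
    have h1 := he (Or.inr hs)
    have h2 := hl (hs.2 ▸ hs.1)
    rw [← hs.2, h1] at h2
    rw [(Prod.mk.inj h2).1]
  · rcases hc with hc | ⟨h0, rfl⟩
    · exact (lineCoord_le _ _ _ _).trans (h.reach c hc)
    · rw [hl h0]
  · rintro (h0 | h0)
    · exact h.zero h0
    · exact h0.1 rfl

/-- First coordinate after `k` steps in direction `d`. -/
def nxs (d : Bool) (k i : ℕ) : ℕ := if d then i + k else i

/-- Second coordinate after `k` steps in direction `d`. -/
def nys (d : Bool) (k j : ℕ) : ℕ := if d then j else j + k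

theorem nxs_succ (d : Bool) (k i : ℕ) : nxs d (k + 1) i = nx d (nxs d k i) := by
  cases d <;> simp [nxs, nx]; omega

theorem nys_succ (d : Bool) (k j : ℕ) : nys d (k + 1) j = ny d (nys d k j) := by
  cases d <;> simp [nys, ny]; omega

theorem Bounded.skips {S : ℝ} {alive : Set ℕ} {i j : ℕ} {d : Bool} (k : ℕ)
    (hi : nxs d k i ≤ tx) (hj : nys d k j ≤ ty)
    (hG : ∀ k' < k, 0 ≤ G d (nx d (nxs d k' i)) (ny d (nys d k' j)))
    (h : Bounded I (value I G tx ty) lin S alive (nxs d k i) (nys d k j)) :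
    Bounded I (value I G tx ty) lin S alive i j := by
  induction k with
  | zero => cases d <;> simpa [nxs, nys] using h
  | succ k ih =>
    have hi' : nxs d k i ≤ tx := by cases d <;> simp [nxs] at hi ⊢ <;> omega
    have hj' : nys d k j ≤ ty := by cases d <;> simp [nys] at hj ⊢ <;> omega
    refine ih hi' hj' (fun k' hk' => hG k' (by omega)) ?_
    rw [nxs_succ, nys_succ] at h
    refine Bounded.skip hi' hj' ?_ (hG k (by omega)) h
    cases d <;> simp [nxs, nys, Avail] at hi hj ⊢ <;> omega

/-- A rounded edge is a straight sequence of unit steps, whose gains are differences of the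
coordinate `Z` and telescope. -/
theorem Bounded.collects {S : ℝ} {alive : Set ℕ} {i j : ℕ} {d : Bool} (Z : ℕ → ℕ → ℝ) (k : ℕ)
    (hi : nxs d k i ≤ tx) (hj : nys d k j ≤ ty)
    (hG : ∀ k' < k, G d (nx d (nxs d k' i)) (ny d (nys d k' j)) =
      Z (nx d (nxs d k' i)) (ny d (nys d k' j)) - Z (nxs d k' i) (nys d k' j))
    (hl : ∀ k' < k, I d (nx d (nxs d k' i)) (ny d (nys d k' j)) ≠ 0 →
      lin (I d (nx d (nxs d k' i)) (ny d (nys d k' j))) = (d, lineCoord d i j))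
    (h : Bounded I (value I G tx ty) lin S alive (nxs d k i) (nys d k j)) :
    ∃ alive', Bounded I (value I G tx ty) lin (Z (nxs d k i) (nys d k j) - Z i j + S)
      alive' i j := by
  induction k generalizing S alive with
  | zero => exact ⟨alive, by cases d <;> simpa [nxs, nys] using h⟩
  | succ k ih =>
    have hi' : nxs d k i ≤ tx := by cases d <;> simp [nxs] at hi ⊢ <;> omega
    have hj' : nys d k j ≤ ty := by cases d <;> simp [nys] at hj ⊢ <;> omega
    have ha : Avail tx ty (nxs d k i) (nys d k j) d := by
      cases d <;> simp [nxs, nys, Avail] at hi hj ⊢ <;> omega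
    have hlc : lineCoord d (nxs d k i) (nys d k j) = lineCoord d i j := by
      cases d <;> simp [nxs, nys, lineCoord]
    rw [nxs_succ, nys_succ] at h
    have h1 := h.collect hi' hj' ha (by rw [hlc]; exact hl k (by omega))
    obtain ⟨al, h2⟩ :=
        ih hi' hj' (fun k' hk' => hG k' (by omega)) (fun k' hk' => hl k' (by omega)) h1
    refine ⟨al, ?_⟩
    rw [hG k (by omega)] at h2
    rw [nxs_succ, nys_succ]
    convert h2 using 1
    ring

end Certificate

end GMMN


/-! ### Monotone rounding to the grid with the correct mean, and instances written in grid indices.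
-/

namespace GMMN

/-! ## Randomized rounding to a grid -/

/-- The index of the last grid coordinate among `X 0, …, X N` that is at most `x`. -/
noncomputable def gridFloor (X : ℕ → ℝ) (N : ℕ) (x : ℝ) : ℕ :=
  open Classical in Nat.findGreatest (fun i => X i ≤ x) N

/-- Round `x` to the index of a neighbouring grid coordinate, with threshold `θ`. -/
noncomputable def gridRound (X : ℕ → ℝ) (N : ℕ) (θ x : ℝ) : ℕ :=
  open Classical in
  if X (gridFloor X N x) < x ∧
      θ * (X (gridFloor X N x + 1) - X (gridFloor X N x)) ≤ x - X (gridFloor X N x) then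
    gridFloor X N x + 1
  else gridFloor X N x

section Rounding

variable {X : ℕ → ℝ} {N : ℕ}

theorem gridFloor_le (x : ℝ) : gridFloor X N x ≤ N := Nat.findGreatest_le _

theorem apply_gridFloor_le {x : ℝ} (h : X 0 ≤ x) : X (gridFloor X N x) ≤ x :=
  Nat.findGreatest_spec (P := fun i => X i ≤ x) (Nat.zero_le N) h

theorem le_gridFloor {x : ℝ} {i : ℕ} (hi : i ≤ N) (h : X i ≤ x) : i ≤ gridFloor X N x :=
  Nat.le_findGreatest hi h

theorem lt_apply_of_gridFloor_lt {x : ℝ} {i : ℕ} (hi : i ≤ N) (h : gridFloor X N x < i) :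
    x < X i := by
  by_contra hx
  exact absurd (le_gridFloor hi (not_lt.1 hx)) (by omega)

theorem gridFloor_lt_of_lt {x : ℝ} (h1 : x ≤ X N) (h : X (gridFloor X N x) < x) :
    gridFloor X N x < N := by
  refine lt_of_le_of_ne (gridFloor_le x) fun e => ?_
  rw [e] at h
  exact absurd h (not_lt.2 h1)

theorem gridRound_le {θ x : ℝ} (h1 : x ≤ X N) : gridRound X N θ x ≤ N := by
  rw [gridRound]
  split_ifs with h
  · exact gridFloor_lt_of_lt h1 h.1
  · exact gridFloor_le x

theorem gridFloor_apply (hX : ∀ i j, i < j → j ≤ N → X i < X j) {i : ℕ} (hi : i ≤ N) :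
    gridFloor X N (X i) = i := by
  refine le_antisymm (not_lt.1 fun h => ?_) (le_gridFloor hi le_rfl)
  have h0 : X 0 ≤ X i := by
    rcases Nat.eq_zero_or_pos i with rfl | h
    · exact le_rfl
    · exact (hX 0 i h hi).le
  exact absurd (apply_gridFloor_le (N := N) h0) (not_le.2 (hX _ _ h (gridFloor_le _)))

/-- The strict inequality in `gridRound` is what makes this true for all θ: without it a threshold
`θ ≤ 0` would push grid coordinates up. -/
theorem gridRound_apply (hX : ∀ i j, i < j → j ≤ N → X i < X j) {θ : ℝ} {i : ℕ} (hi : i ≤ N) :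
    gridRound X N θ (X i) = i := by
  rw [gridRound, gridFloor_apply hX hi, if_neg]
  simp

/-- Within one cell the same threshold is compared with a larger offset. From different cells, `x`
rises at most to the next grid index, which is not above the cell of `y`. -/
theorem gridRound_mono {θ x y : ℝ} (h0 : X 0 ≤ x) (hxy : x ≤ y) :
    gridRound X N θ x ≤ gridRound X N θ y := by
  have hf : gridFloor X N x ≤ gridFloor X N y :=
    le_gridFloor (gridFloor_le x) ((apply_gridFloor_le h0).trans hxy)
  rcases hf.eq_or_lt with e | h
  · rw [gridRound, gridRound, ← e]
    split_ifs with h2 h3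
    · exact le_rfl
    · exact absurd ⟨h2.1.trans_le hxy, h2.2.trans (by linarith)⟩ h3
    · omega
    · exact le_rfl
  · have h2 : gridRound X N θ x ≤ gridFloor X N x + 1 := by
      rw [gridRound]; split_ifs <;> omega
    have h3 : gridFloor X N y ≤ gridRound X N θ y := by
      rw [gridRound]; split_ifs <;> omega
    omega

open MeasureTheory in
-- At relative position `c` in a cell of length `D`, rounding goes up exactly for `θ ≤ c`. So the
-- mean is the lower grid coordinate plus `c * D`, which is `x`.
theorem integral_gridRound {x : ℝ} (h0 : X 0 ≤ x) (h1 : x ≤ X N) :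
    IntervalIntegrable (fun θ => X (gridRound X N θ x)) volume 0 1 ∧
      ∫ θ in (0 : ℝ)..1, X (gridRound X N θ x) = x := by
  set f := gridFloor X N x with hf
  have hfx : X f ≤ x := apply_gridFloor_le h0
  rcases hfx.eq_or_lt with e | h
  · have : (fun θ => X (gridRound X N θ x)) = fun _ => x := by
      funext θ
      rw [gridRound, ← hf, if_neg (by rw [e]; simp), e]
    rw [this]
    exact ⟨intervalIntegrable_const, by simp⟩
  · have hN : f < N := gridFloor_lt_of_lt h1 h
    have hx1 : x < X (f + 1) := lt_apply_of_gridFloor_lt hN (Nat.lt_succ_self f)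
    set D := X (f + 1) - X f with hD
    have hD0 : 0 < D := by linarith
    set c := (x - X f) / D with hc
    have hc0 : 0 ≤ c := div_nonneg (by linarith) hD0.le
    have hc1 : c ≤ 1 := by rw [hc, div_le_one hD0]; linarith
    have : (fun θ => X (gridRound X N θ x)) =
        fun θ => X f + Set.indicator {θ | θ ≤ c} (fun _ => D) θ := by
      funext θ
      rw [gridRound, ← hf]
      by_cases hθ : θ ≤ c
      · rw [if_pos ⟨h, by rwa [hc, le_div_iff₀ hD0] at hθ⟩,
            Set.indicator_of_mem (show θ ∈ {θ | θ ≤ c} from hθ)]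
        ring
      · rw [if_neg (fun h2 => hθ (by rw [hc, le_div_iff₀ hD0]; exact h2.2)),
          Set.indicator_of_notMem (show θ ∉ {θ | θ ≤ c} from hθ), add_zero]
    have hint : IntervalIntegrable (Set.indicator {θ | θ ≤ c} fun _ => D) volume 0 1 := by
      rw [intervalIntegrable_iff]
      exact (intervalIntegrable_iff.1 intervalIntegrable_const).indicator measurableSet_Iic
    rw [this]
    refine ⟨intervalIntegrable_const.add hint, ?_⟩
    rw [intervalIntegral.integral_add intervalIntegrable_const hint,
      intervalIntegral.integral_indicator ⟨hc0, hc1⟩]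
    simp only [intervalIntegral.integral_const, smul_eq_mul]
    rw [hc]
    field_simp
    ring

end Rounding

/-! ## Instances in grid coordinates -/

/-- The coordinates of the pairs `v k`, `k < n`, as indices into strictly increasing sequences
`X`, `Y`. The center `r` is directed upwards and to the right. -/
structure Layout (n r : ℕ) (v : ℕ → Pt × Pt) where
  X : ℕ → ℝ
  Y : ℕ → ℝ
  NX : ℕ
  NY : ℕ
  sx : ℕ → ℕ
  sy : ℕ → ℕ
  tx : ℕ → ℕ
  ty : ℕ → ℕ
  X_lt : ∀ i j, i < j → j < NX → X i < X j
  Y_lt : ∀ i j, i < j → j < NY → Y i < Y j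
  sx_lt : ∀ k < n, sx k < NX
  tx_lt : ∀ k < n, tx k < NX
  sy_lt : ∀ k < n, sy k < NY
  ty_lt : ∀ k < n, ty k < NY
  eq : ∀ k < n, v k = ((X (sx k), Y (sy k)), (X (tx k), Y (ty k)))
  hr : r < n
  sx_le : sx r ≤ tx r
  sy_le : sy r ≤ ty r

namespace Layout

variable {n r : ℕ} {v : ℕ → Pt × Pt} (L : Layout n r v)

/-- The edge entering the grid point `(i, j)` in direction `d` is in the box of `v k`. -/
def InEdge (d : Bool) (k i j : ℕ) : Prop :=
  if d then (min (L.sx k) (L.tx k) < i ∧ i ≤ max (L.sx k) (L.tx k)) ∧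
      (min (L.sy k) (L.ty k) ≤ j ∧ j ≤ max (L.sy k) (L.ty k))
  else (min (L.sx k) (L.tx k) ≤ i ∧ i ≤ max (L.sx k) (L.tx k)) ∧
      (min (L.sy k) (L.ty k) < j ∧ j ≤ max (L.sy k) (L.ty k))

/-- The slopes of `v k` and of the center are opposite. -/
def Opp (k : ℕ) : Prop := (L.sx k < L.tx k ∧ L.ty k < L.sy k) ∨ (L.tx k < L.sx k ∧ L.sy k < L.ty k)

open Classical in
/-- The label of the edges in the box of `v k`. -/
noncomputable def lab (k : ℕ) : ℕ := if L.Opp k then k + 1 else 0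

/-- The length of the edge entering `(i, j)` in direction `d`. -/
def len (d : Bool) (i j : ℕ) : ℝ := if d then L.X i - L.X (i - 1) else L.Y j - L.Y (j - 1)

/-- `I` and `G` are the labels and gains of the edges. -/
def Labelled (I : Bool → ℕ → ℕ → ℕ) (G : Bool → ℕ → ℕ → ℝ) : Prop :=
  ∀ d i j, i < L.NX → j < L.NY →
    (∀ k < n, k ≠ r → L.InEdge d k i j → I d i j = L.lab k ∧ G d i j = L.len d i j) ∧
    ((∀ k < n, k ≠ r → ¬ L.InEdge d k i j) → I d i j = 0 ∧ G d i j = 0)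

theorem X_le {i j : ℕ} (h : i ≤ j) (hj : j < L.NX) : L.X i ≤ L.X j := by
  rcases h.eq_or_lt with rfl | h
  · exact le_rfl
  · exact (L.X_lt i j h hj).le

theorem Y_le {i j : ℕ} (h : i ≤ j) (hj : j < L.NY) : L.Y i ≤ L.Y j := by
  rcases h.eq_or_lt with rfl | h
  · exact le_rfl
  · exact (L.Y_lt i j h hj).le

theorem X_le_iff {i j : ℕ} (hi : i < L.NX) (hj : j < L.NX) : L.X i ≤ L.X j ↔ i ≤ j :=
  ⟨fun h => not_lt.1 fun h' => absurd (L.X_lt j i h' hi) (not_lt.2 h), fun h => L.X_le h hj⟩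

theorem Y_le_iff {i j : ℕ} (hi : i < L.NY) (hj : j < L.NY) : L.Y i ≤ L.Y j ↔ i ≤ j :=
  ⟨fun h => not_lt.1 fun h' => absurd (L.Y_lt j i h' hi) (not_lt.2 h), fun h => L.Y_le h hj⟩

theorem mem_box_iff {k : ℕ} (hk : k < n) {p : Pt} : p ∈ box (v k) ↔
    (L.X (min (L.sx k) (L.tx k)) ≤ p.1 ∧ p.1 ≤ L.X (max (L.sx k) (L.tx k))) ∧
      (L.Y (min (L.sy k) (L.ty k)) ≤ p.2 ∧ p.2 ≤ L.Y (max (L.sy k) (L.ty k))) := by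
  rw [GMMN.mem_box_iff, L.eq k hk]
  have hx : min (L.X (L.sx k)) (L.X (L.tx k)) = L.X (min (L.sx k) (L.tx k)) ∧
      max (L.X (L.sx k)) (L.X (L.tx k)) = L.X (max (L.sx k) (L.tx k)) := by
    rcases le_total (L.sx k) (L.tx k) with h | h
    · rw [min_eq_left h, max_eq_right h, min_eq_left (L.X_le h (L.tx_lt k hk)),
        max_eq_right (L.X_le h (L.tx_lt k hk))]
      exact ⟨rfl, rfl⟩
    · rw [min_eq_right h, max_eq_left h, min_eq_right (L.X_le h (L.sx_lt k hk)),
        max_eq_left (L.X_le h (L.sx_lt k hk))]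
      exact ⟨rfl, rfl⟩
  have hy : min (L.Y (L.sy k)) (L.Y (L.ty k)) = L.Y (min (L.sy k) (L.ty k)) ∧
      max (L.Y (L.sy k)) (L.Y (L.ty k)) = L.Y (max (L.sy k) (L.ty k)) := by
    rcases le_total (L.sy k) (L.ty k) with h | h
    · rw [min_eq_left h, max_eq_right h, min_eq_left (L.Y_le h (L.ty_lt k hk)),
        max_eq_right (L.Y_le h (L.ty_lt k hk))]
      exact ⟨rfl, rfl⟩
    · rw [min_eq_right h, max_eq_left h, min_eq_right (L.Y_le h (L.sy_lt k hk)),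
        max_eq_left (L.Y_le h (L.sy_lt k hk))]
      exact ⟨rfl, rfl⟩
  simp only [hx.1, hx.2, hy.1, hy.2]

theorem max_x_lt {k : ℕ} (hk : k < n) : max (L.sx k) (L.tx k) < L.NX :=
  max_lt (L.sx_lt k hk) (L.tx_lt k hk)

theorem max_y_lt {k : ℕ} (hk : k < n) : max (L.sy k) (L.ty k) < L.NY :=
  max_lt (L.sy_lt k hk) (L.ty_lt k hk)

/-- Rounding of first coordinates. -/
noncomputable def rx (θ x : ℝ) : ℕ := gridRound L.X (L.NX - 1) θ x

/-- Rounding of second coordinates. -/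
noncomputable def ry (θ y : ℝ) : ℕ := gridRound L.Y (L.NY - 1) θ y

/-- The region spanned by the grid. -/
def Region (p : Pt) : Prop :=
  (L.X 0 ≤ p.1 ∧ p.1 ≤ L.X (L.NX - 1)) ∧ (L.Y 0 ≤ p.2 ∧ p.2 ≤ L.Y (L.NY - 1))

theorem region_of_mem_box {k : ℕ} (hk : k < n) {p : Pt} (hp : p ∈ box (v k)) : L.Region p := by
  rw [L.mem_box_iff hk] at hp
  have := L.max_x_lt hk
  have := L.max_y_lt hk
  exact ⟨⟨(L.X_le (Nat.zero_le _) (by omega)).trans hp.1.1,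
      hp.1.2.trans (L.X_le (by omega) (by omega))⟩,
    ⟨(L.Y_le (Nat.zero_le _) (by omega)).trans hp.2.1, hp.2.2.trans (L.Y_le (by omega) (by omega))⟩⟩

theorem X_lt' : ∀ i j, i < j → j ≤ L.NX - 1 → L.X i < L.X j := fun i j h hj =>
  L.X_lt i j h (by omega)

theorem Y_lt' : ∀ i j, i < j → j ≤ L.NY - 1 → L.Y i < L.Y j := fun i j h hj =>
  L.Y_lt i j h (by omega)

theorem rx_apply {i : ℕ} (h : i < L.NX) (θ : ℝ) : L.rx θ (L.X i) = i :=
  gridRound_apply L.X_lt' (by omega)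

theorem ry_apply {i : ℕ} (h : i < L.NY) (θ : ℝ) : L.ry θ (L.Y i) = i :=
  gridRound_apply L.Y_lt' (by omega)

theorem rx_mono {p : Pt} {x : ℝ} (hp : L.Region p) (h : p.1 ≤ x) (θ : ℝ) :
    L.rx θ p.1 ≤ L.rx θ x :=
  gridRound_mono hp.1.1 h

theorem ry_mono {p : Pt} {y : ℝ} (hp : L.Region p) (h : p.2 ≤ y) (θ : ℝ) :
    L.ry θ p.2 ≤ L.ry θ y :=
  gridRound_mono hp.2.1 h

theorem NX_pos : 0 < L.NX := (Nat.zero_le _).trans_lt (L.sx_lt r L.hr)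

theorem NY_pos : 0 < L.NY := (Nat.zero_le _).trans_lt (L.sy_lt r L.hr)

theorem rx_lt {p : Pt} (hp : L.Region p) (θ : ℝ) : L.rx θ p.1 < L.NX := by
  have := gridRound_le (θ := θ) hp.1.2
  have := L.NX_pos
  unfold rx
  omega

theorem ry_lt {p : Pt} (hp : L.Region p) (θ : ℝ) : L.ry θ p.2 < L.NY := by
  have := gridRound_le (θ := θ) hp.2.2
  have := L.NY_pos
  unfold ry
  omega

theorem region_grid {i j : ℕ} (hi : i < L.NX) (hj : j < L.NY) : L.Region (L.X i, L.Y j) :=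
  ⟨⟨L.X_le (Nat.zero_le _) hi, L.X_le (by omega) (by have := L.NX_pos; omega)⟩,
    ⟨L.Y_le (Nat.zero_le _) hj, L.Y_le (by omega) (by have := L.NY_pos; omega)⟩⟩

/-- The sides of a box lie on grid lines, which rounding fixes; by monotonicity it cannot move a
point out of the box. -/
theorem rx_mem {k : ℕ} (hk : k < n) {p : Pt} (hp : p ∈ box (v k)) (θ : ℝ) :
    (min (L.sx k) (L.tx k) ≤ L.rx θ p.1 ∧ L.rx θ p.1 ≤ max (L.sx k) (L.tx k)) ∧
      (min (L.sy k) (L.ty k) ≤ L.ry θ p.2 ∧ L.ry θ p.2 ≤ max (L.sy k) (L.ty k)) := by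
  have hR := L.region_of_mem_box hk hp
  rw [L.mem_box_iff hk] at hp
  have h1 := L.max_x_lt hk
  have h2 := L.max_y_lt hk
  have h3 : min (L.sx k) (L.tx k) < L.NX := by omega
  have h4 : min (L.sy k) (L.ty k) < L.NY := by omega
  refine ⟨⟨?_, ?_⟩, ⟨?_, ?_⟩⟩
  · have := L.rx_mono (L.region_grid h3 h4) hp.1.1 θ
    rwa [L.rx_apply h3] at this
  · have := L.rx_mono hR hp.1.2 θ
    rwa [L.rx_apply h1] at this
  · have := L.ry_mono (L.region_grid h3 h4) hp.2.1 θ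
    rwa [L.ry_apply h4] at this
  · have := L.ry_mono hR hp.2.2 θ
    rwa [L.ry_apply h2] at this

theorem len_nonneg {d : Bool} {i j : ℕ} (hi : i < L.NX) (hj : j < L.NY) : 0 ≤ L.len d i j := by
  cases d
  · simpa [len] using L.Y_le (Nat.sub_le j 1) hj
  · simpa [len] using L.X_le (Nat.sub_le i 1) hi

theorem Labelled.gain_nonneg {L : Layout n r v} {I : Bool → ℕ → ℕ → ℕ} {G : Bool → ℕ → ℕ → ℝ}
    (h : L.Labelled I G) {d : Bool} {i j : ℕ} (hi : i < L.NX) (hj : j < L.NY) : 0 ≤ G d i j := by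
  by_cases hk : ∃ k < n, k ≠ r ∧ L.InEdge d k i j
  · obtain ⟨k, h1, h2, h3⟩ := hk
    rw [((h d i j hi hj).1 k h1 h2 h3).2]
    exact L.len_nonneg hi hj
  · rw [((h d i j hi hj).2 fun k h1 h2 h3 => hk ⟨k, h1, h2, h3⟩).2]

end Layout

end GMMN


/-! ### Upper bound: no family of geodesics in the plane shares more than the value of the dynamic
program. -/

namespace GMMN

/-! ## The value function bounds the shared length of all solutions -/

/-- The sum of `f p q` over the consecutive points `p`, `q` of a list with `s(p, q) ∈ U`. -/
noncomputable def sharedSum (U : Finset (Sym2 Pt)) (f : Pt → Pt → ℝ) : List Pt → ℝ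
  | p :: q :: l => (if s(p, q) ∈ U then f p q else 0) + sharedSum U f (q :: l)
  | _ => 0

theorem weight_pathEdges_inter (U : Finset (Sym2 Pt)) {l : List Pt} (h : l.Nodup) :
    weight (pathEdges l ∩ U) = sharedSum U segLen l := by
  induction l with
  | nil => simp [pathEdges, weight, sharedSum]
  | cons p l ih =>
    cases l with
    | nil => simp [pathEdges, weight, sharedSum]
    | cons q l =>
      have hn := List.nodup_cons.1 h
      have hn' : s(p, q) ∉ pathEdges (q :: l) := fun hmem =>
        hn.1 (mem_of_mem_pathEdges hmem (Sym2.mem_mk_left p q))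
      rw [pathEdges_cons_cons, sharedSum, ← ih hn.2]
      split_ifs with hU
      · rw [Finset.insert_inter_of_mem hU, weight, Finset.sum_insert (by simp [hn']), edgeLen_mk]
        rfl
      · rw [Finset.insert_inter_of_notMem hU, zero_add]

theorem sharedSum_congr {U : Finset (Sym2 Pt)} {f g : Pt → Pt → ℝ} {R : Pt → Pt → Prop}
    {l : List Pt} (h : l.IsChain R) (hfg : ∀ p q, R p q → f p q = g p q) :
    sharedSum U f l = sharedSum U g l := by
  induction l with
  | nil => rfl
  | cons p l ih =>
    cases l with
    | nil => rfl
    | cons q l =>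
      rw [List.isChain_cons_cons] at h
      rw [sharedSum, sharedSum, ih h.2, hfg p q h.1]

namespace Layout

variable {n r : ℕ} {v : ℕ → Pt × Pt} (L : Layout n r v)

/-- The increase of both coordinates from `p` to `q`, after rounding. -/
noncomputable def roundedLen (θ : ℝ) (p q : Pt) : ℝ :=
  (L.X (L.rx θ q.1) - L.X (L.rx θ p.1)) + (L.Y (L.ry θ q.2) - L.Y (L.ry θ p.2))

open MeasureTheory in
-- Linearity of the integral. Whether an edge counts as shared is decided by the unrounded paths and
-- so does not depend on θ.
theorem integral_sharedSum (U : Finset (Sym2 Pt)) {l : List Pt} (hl : ∀ p ∈ l, L.Region p) :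
    IntervalIntegrable (fun θ => sharedSum U (L.roundedLen θ) l) volume 0 1 ∧
      ∫ θ in (0 : ℝ)..1, sharedSum U (L.roundedLen θ) l =
        sharedSum U (fun p q => (q.1 - p.1) + (q.2 - p.2)) l := by
  induction l with
  | nil => simp [sharedSum]
  | cons p l ih =>
    cases l with
    | nil => simp [sharedSum]
    | cons q l =>
      obtain ⟨i1, i2⟩ := ih fun x hx => hl x (List.mem_cons_of_mem _ hx)
      simp only [sharedSum]
      split_ifs
      · have hp := hl p (by simp)
        have hq := hl q (by simp)
        obtain ⟨a1, a2⟩ := integral_gridRound hp.1.1 hp.1.2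
        obtain ⟨b1, b2⟩ := integral_gridRound hq.1.1 hq.1.2
        obtain ⟨c1, c2⟩ := integral_gridRound hp.2.1 hp.2.2
        obtain ⟨d1, d2⟩ := integral_gridRound hq.2.1 hq.2.2
        unfold roundedLen at i1 i2 ⊢
        unfold rx ry at i1 i2 ⊢
        refine ⟨((b1.sub a1).add (d1.sub c1)).add i1, ?_⟩
        rw [intervalIntegral.integral_add ((b1.sub a1).add (d1.sub c1)) i1,
          intervalIntegral.integral_add (b1.sub a1) (d1.sub c1),
            intervalIntegral.integral_sub b1 a1,
          intervalIntegral.integral_sub d1 c1, a2, b2, c2, d2, i2]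
      · simp only [zero_add]
        exact ⟨i1, i2⟩

theorem center_le (L : Layout n r v) : (v r).1.1 ≤ (v r).2.1 ∧ (v r).1.2 ≤ (v r).2.2 := by
  rw [L.eq r L.hr]
  exact ⟨L.X_le L.sx_le (L.tx_lt r L.hr), L.Y_le L.sy_le (L.ty_lt r L.hr)⟩

theorem le_of_dir_center (L : Layout n r v) {p q : Pt} (h : Dir (v r) p q) : p.1 ≤ q.1 ∧ p.2 ≤
    q.2 :=
  ⟨h.1.1 L.center_le.1, h.2.1 L.center_le.2⟩

/-- Along the center both coordinates grow together; along `k` one grows while the other falls. Two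
common points obey both orders, so they agree in a coordinate. -/
theorem share_coord {k : ℕ} (hk : k < n) (ho : L.Opp k) {l l' : List Pt} (h : Geo (v r) l)
    (h' : Geo (v k) l') {a b : Pt} (ha : a ∈ l) (ha' : a ∈ l') (hb : b ∈ l) (hb' : b ∈ l') :
    a.1 = b.1 ∨ a.2 = b.2 := by
  have hr : (a.1 ≤ b.1 ∧ a.2 ≤ b.2) ∨ (b.1 ≤ a.1 ∧ b.2 ≤ a.2) :=
    (h.dir_total ha hb).imp L.le_of_dir_center L.le_of_dir_center
  have ho' : (a.1 ≤ b.1 ∧ b.2 ≤ a.2) ∨ (b.1 ≤ a.1 ∧ a.2 ≤ b.2) := by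
    have hd := h'.dir_total ha' hb'
    rw [L.eq k hk] at hd
    have hx1 := L.sx_lt k hk
    have hx2 := L.tx_lt k hk
    have hy1 := L.sy_lt k hk
    have hy2 := L.ty_lt k hk
    rcases ho with ⟨o1, o2⟩ | ⟨o1, o2⟩
    · have e1 := L.X_le o1.le hx2
      have e2 := L.Y_le o2.le hy1
      exact hd.imp (fun e => ⟨e.1.1 e1, e.2.2 e2⟩) fun e => ⟨e.1.1 e1, e.2.2 e2⟩
    · have e1 := L.X_le o1.le hx1
      have e2 := L.Y_le o2.le hy2
      exact hd.symm.imp (fun e => ⟨e.1.2 e1, e.2.1 e2⟩) fun e => ⟨e.1.2 e1, e.2.1 e2⟩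
  rcases hr with ⟨h1, h2⟩ | ⟨h1, h2⟩ <;> rcases ho' with ⟨h3, h4⟩ | ⟨h3, h4⟩
  · exact Or.inr (le_antisymm h2 h4)
  · exact Or.inl (le_antisymm h1 h3)
  · exact Or.inl (le_antisymm h3 h1)
  · exact Or.inr (le_antisymm h4 h2)

/-- Given two distinct common points on a horizontal line, a third one off this line would have to
share its first coordinate with both of them. The same holds for vertical lines. -/
theorem exists_line {k : ℕ} (hk : k < n) (ho : L.Opp k) {l l' : List Pt} (h : Geo (v r) l)
    (h' : Geo (v k) l') : ∃ ln : Bool × ℝ, ∀ a ∈ l, a ∈ l' → ∀ b ∈ l, b ∈ l' → a ≠ b →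
      (a.2 = b.2 → ln = (true, a.2)) ∧ (a.1 = b.1 → ln = (false, a.1)) := by
  by_cases hE : ∃ a ∈ l, a ∈ l' ∧ ∃ b ∈ l, b ∈ l' ∧ a ≠ b ∧ a.2 = b.2
  · obtain ⟨a, a1, a2, b, b1, b2, hab, he⟩ := hE
    have hne : a.1 ≠ b.1 := fun e => hab (Prod.ext e he)
    have key : ∀ c ∈ l, c ∈ l' → c.2 = a.2 := by
      intro c c1 c2
      by_contra hc
      have e1 := (L.share_coord hk ho h h' a1 a2 c1 c2).resolve_right fun e => hc e.symm
      have e2 := (L.share_coord hk ho h h' b1 b2 c1 c2).resolve_right fun e =>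
          hc (e.symm.trans he.symm)
      exact hne (e1.trans e2.symm)
    refine ⟨(true, a.2), fun c c1 c2 e e1 e2 hce => ⟨fun _ => by rw [key c c1 c2], fun he' => ?_⟩⟩
    exact absurd (Prod.ext he' ((key c c1 c2).trans (key e e1 e2).symm)) hce
  · by_cases hF : ∃ a ∈ l, a ∈ l' ∧ ∃ b ∈ l, b ∈ l' ∧ a ≠ b ∧ a.1 = b.1
    · obtain ⟨a, a1, a2, b, b1, b2, hab, he⟩ := hF
      have hne : a.2 ≠ b.2 := fun e => hab (Prod.ext he e)
      have key : ∀ c ∈ l, c ∈ l' → c.1 = a.1 := by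
        intro c c1 c2
        by_contra hc
        have e1 := (L.share_coord hk ho h h' a1 a2 c1 c2).resolve_left fun e => hc e.symm
        have e2 := (L.share_coord hk ho h h' b1 b2 c1 c2).resolve_left
          fun e => hc (e.symm.trans he.symm)
        exact hne (e1.trans e2.symm)
      refine ⟨(false, a.1), fun c c1 c2 e e1 e2 hce =>
        ⟨fun he' => absurd ⟨c, c1, c2, e, e1, e2, hce, he'⟩ hE, fun _ => by rw [key c c1 c2]⟩⟩
    -- No two distinct common points agree in a coordinate, so the requirement is void and any line
    -- serves.
    · exact ⟨(true, 0), fun c c1 c2 e e1 e2 hce =>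
        ⟨fun he' => absurd ⟨c, c1, c2, e, e1, e2, hce, he'⟩ hE,
          fun he' => absurd ⟨c, c1, c2, e, e1, e2, hce, he'⟩ hF⟩⟩

theorem roundedLen_horizontal {p q : Pt} (h : p.2 = q.2) (θ : ℝ) :
    L.roundedLen θ p q = L.X (L.rx θ q.1) - L.X (L.rx θ p.1) := by
  simp [roundedLen, h]

theorem roundedLen_vertical {p q : Pt} (h : p.1 = q.1) (θ : ℝ) :
    L.roundedLen θ p q = L.Y (L.ry θ q.2) - L.Y (L.ry θ p.2) := by
  simp [roundedLen, h]

section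

variable {I : Bool → ℕ → ℕ → ℕ} {G : Bool → ℕ → ℕ → ℝ} {m : ℕ → List Pt}

/-- The lines of the shared runs in grid coordinates. -/
noncomputable def gridLine (θ : ℝ) (ln : ℕ → Bool × ℝ) (c : ℕ) : Bool × ℕ :=
  ((ln (c - 1)).1, if (ln (c - 1)).1 then L.ry θ (ln (c - 1)).2 else L.rx θ (ln (c - 1)).2)

/-- Induction from the end of the path of the center. Each edge is rounded to a straight run of unit
steps, possibly an empty one, and is handled by `Bounded.collects` if it is shared and by
`Bounded.skips` otherwise. -/
theorem exists_bounded (hI : L.Labelled I G) (hm : ∀ k < n, Geo (v k) (m k)) (θ : ℝ)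
    (ln : ℕ → Bool × ℝ)
    (hln : ∀ k < n, L.Opp k → ∀ a ∈ m r, a ∈ m k → ∀ b ∈ m r, b ∈ m k → a ≠ b →
      (a.2 = b.2 → ln k = (true, a.2)) ∧ (a.1 = b.1 → ln k = (false, a.1)))
    (l : List Pt) (p : Pt) (hc : (p :: l).IsChain (Step (v r)))
    (ht : (p :: l).getLast? = some (v r).2) (hmem : ∀ x ∈ p :: l, x ∈ m r) :
    ∃ alive, Bounded I (value I G (L.tx r) (L.ty r)) (L.gridLine θ ln)
      (sharedSum (unionEdges ((Finset.range n).erase r) m) (L.roundedLen θ) (p :: l)) alive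
      (L.rx θ p.1) (L.ry θ p.2) := by
  induction l generalizing p with
  | nil =>
    simp only [List.getLast?_singleton, Option.some.injEq] at ht
    have h1 : L.rx θ p.1 = L.tx r := by
      rw [ht, L.eq r L.hr]; exact L.rx_apply (L.tx_lt r L.hr) θ
    have h2 : L.ry θ p.2 = L.ty r := by
      rw [ht, L.eq r L.hr]; exact L.ry_apply (L.ty_lt r L.hr) θ
    rw [h1, h2]
    exact ⟨∅, ⟨(value_end _).ge, fun d _ => (value_end _).ge, fun d _ => (value_end _).ge,
      by simp, by simp⟩⟩
  | cons q l ih =>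
    rw [List.getLast?_cons_cons] at ht
    rw [List.isChain_cons_cons] at hc
    obtain ⟨al, hb⟩ := ih q hc.2 ht fun x hx => hmem x (List.mem_cons_of_mem _ hx)
    have hp := hmem p (by simp)
    have hq := hmem q (by simp)
    have hpb := (hm r L.hr).mem_box hp
    have hqb := (hm r L.hr).mem_box hq
    have hpR := L.region_of_mem_box L.hr hpb
    have hqR := L.region_of_mem_box L.hr hqb
    have hqt := L.rx_mem L.hr hqb θ
    rw [max_eq_right L.sx_le, max_eq_right L.sy_le] at hqt
    have hqx := L.rx_lt hqR θ
    have hqy := L.ry_lt hqR θ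
    obtain ⟨hpq1, hpq2⟩ := L.le_of_dir_center hc.1.2.2
    have hx := L.rx_mono hpR hpq1 θ
    have hy := L.ry_mono hpR hpq2 θ
    -- an edge shared with the path of `k` is labelled by `k`
    have hlab : ∀ d i j, i < L.NX → j < L.NY → ∀ k < n, k ≠ r → L.InEdge d k i j →
        I d i j ≠ 0 → I d i j = k + 1 ∧ L.Opp k := by
      intro d i j hi hj k hk hkr hin h0
      have h1 := ((hI d i j hi hj).1 k hk hkr hin).1
      rw [h1] at h0 ⊢
      by_cases ho : L.Opp k
      · exact ⟨if_pos ho, ho⟩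
      · exact absurd (if_neg ho) h0
    rw [sharedSum]
    rcases hc.1.2.1 with hax | hax
    · have hrx : L.rx θ q.1 = L.rx θ p.1 := by rw [hax]
      have e1 : nxs false (L.ry θ q.2 - L.ry θ p.2) (L.rx θ p.1) = L.rx θ q.1 := by
        simp [nxs, hrx]
      have e2 : nys false (L.ry θ q.2 - L.ry θ p.2) (L.ry θ p.2) = L.ry θ q.2 := by
        simp [nys]; omega
      rw [← e1, ← e2] at hb
      split_ifs with hU
      -- Both ends of a shared edge lie in the box of the leaf `k`, hence so do all unit steps of
      -- the rounded edge, and their gains are their lengths.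
      · obtain ⟨k, hk, hke⟩ := Finset.mem_biUnion.1 hU
        obtain ⟨hkr, hkn⟩ := Finset.mem_erase.1 hk
        rw [Finset.mem_range] at hkn
        have hpk := mem_of_mem_pathEdges hke (Sym2.mem_mk_left p q)
        have hqk := mem_of_mem_pathEdges hke (Sym2.mem_mk_right p q)
        have hpb' := L.rx_mem hkn ((hm k hkn).mem_box hpk) θ
        have hqb' := L.rx_mem hkn ((hm k hkn).mem_box hqk) θ
        have hin : ∀ k' < L.ry θ q.2 - L.ry θ p.2,
            L.InEdge false k (L.rx θ p.1) (L.ry θ p.2 + k' + 1) := fun k' hk' => by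
          simp only [InEdge, Bool.false_eq_true, if_false]; omega
        rw [L.roundedLen_vertical hax, ← e2]
        refine Bounded.collects (fun _ j => L.Y j) _ (by omega) (by omega) (fun k' hk' => ?_)
          (fun k' hk' => ?_) hb
        · simp only [nx, ny, nxs, nys, Bool.false_eq_true, if_false]
          rw [((hI false _ _ (by omega) (by omega)).1 k hkn hkr (hin k' hk')).2]
          simp [len]
        · simp only [nx, ny, nxs, nys, Bool.false_eq_true, if_false]
          intro h0
          obtain ⟨h1, h2⟩ := hlab false _ _ (by omega) (by omega) k hkn hkr (hin k' hk') h0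
          -- The edge itself shows which line `ln k` is. Its label is `k + 1`, which `gridLine`
          -- decodes by subtracting one.
          have h3 := (hln k hkn h2 p hp hpk q hq hqk hc.1.1).2 hax
          simp [h1, gridLine, h3, lineCoord]
      · rw [zero_add]
        refine ⟨al, Bounded.skips (d := false) (L.ry θ q.2 - L.ry θ p.2) (by omega) (by omega)
            (fun k' hk' => ?_) hb⟩
        apply hI.gain_nonneg <;> simp only [nx, ny, nxs, nys, Bool.false_eq_true,
            if_false] <;> omega
    · have hry : L.ry θ q.2 = L.ry θ p.2 := by rw [hax]
      have e1 : nxs true (L.rx θ q.1 - L.rx θ p.1) (L.rx θ p.1) = L.rx θ q.1 := by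
        simp [nxs]; omega
      have e2 : nys true (L.rx θ q.1 - L.rx θ p.1) (L.ry θ p.2) = L.ry θ q.2 := by
        simp [nys, hry]
      rw [← e1, ← e2] at hb
      split_ifs with hU
      · obtain ⟨k, hk, hke⟩ := Finset.mem_biUnion.1 hU
        obtain ⟨hkr, hkn⟩ := Finset.mem_erase.1 hk
        rw [Finset.mem_range] at hkn
        have hpk := mem_of_mem_pathEdges hke (Sym2.mem_mk_left p q)
        have hqk := mem_of_mem_pathEdges hke (Sym2.mem_mk_right p q)
        have hpb' := L.rx_mem hkn ((hm k hkn).mem_box hpk) θ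
        have hqb' := L.rx_mem hkn ((hm k hkn).mem_box hqk) θ
        have hin : ∀ k' < L.rx θ q.1 - L.rx θ p.1,
            L.InEdge true k (L.rx θ p.1 + k' + 1) (L.ry θ p.2) := fun k' hk' => by
          simp only [InEdge, if_true]; omega
        rw [L.roundedLen_horizontal hax, ← e1]
        refine Bounded.collects (fun i _ => L.X i) _ (by omega) (by omega) (fun k' hk' => ?_)
          (fun k' hk' => ?_) hb
        · simp only [nx, ny, nxs, nys, if_true]
          rw [((hI true _ _ (by omega) (by omega)).1 k hkn hkr (hin k' hk')).2]
          simp [len]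
        · simp only [nx, ny, nxs, nys, if_true]
          intro h0
          obtain ⟨h1, h2⟩ := hlab true _ _ (by omega) (by omega) k hkn hkr (hin k' hk') h0
          have h3 := (hln k hkn h2 p hp hpk q hq hqk hc.1.1).1 hax
          simp [h1, gridLine, h3, lineCoord]
      · rw [zero_add]
        refine ⟨al, Bounded.skips (d := true) (L.rx θ q.1 - L.rx θ p.1) (by omega) (by omega)
            (fun k' hk' => ?_) hb⟩
        apply hI.gain_nonneg <;> simp only [nx, ny, nxs, nys, if_true] <;> omega

/-- For every θ the field `fresh` bounds the rounded shared length by the value at the start, a grid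
point that rounding fixes. Integration over θ in [0, 1] turns the left side into the true overlap.
-/
theorem overlap_le_value (hI : L.Labelled I G) (hm : ∀ k < n, Geo (v k) (m k)) :
    overlap n r m ≤ value I G (L.tx r) (L.ty r) 0 (L.sx r) (L.sy r) := by
  have hln : ∀ k, ∃ ln : Bool × ℝ, k < n → L.Opp k → ∀ a ∈ m r, a ∈ m k → ∀ b ∈ m r, b ∈ m k →
      a ≠ b → (a.2 = b.2 → ln = (true, a.2)) ∧ (a.1 = b.1 → ln = (false, a.1)) := by
    intro k
    by_cases h : k < n ∧ L.Opp k
    · obtain ⟨ln, hln⟩ := L.exists_line h.1 h.2 (hm r L.hr) (hm k h.1)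
      exact ⟨ln, fun _ _ => hln⟩
    · exact ⟨(true, 0), fun h1 h2 => absurd ⟨h1, h2⟩ h⟩
  choose ln hln using hln
  have hg := hm r L.hr
  set U := unionEdges ((Finset.range n).erase r) m with hU
  have hle : ∀ θ, sharedSum U (L.roundedLen θ) (m r) ≤
      value I G (L.tx r) (L.ty r) 0 (L.sx r) (L.sy r) := by
    intro θ
    obtain ⟨l, hl⟩ := List.head?_eq_some_iff.1 hg.1
    obtain ⟨al, hb⟩ := L.exists_bounded hI hm θ ln hln l (v r).1 (hl ▸ hg.2.2) (hl ▸ hg.2.1)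
      (fun x hx => hl ▸ hx)
    have := hb.fresh
    rw [← hl] at this
    rw [L.eq r L.hr] at this
    simpa only [L.rx_apply (L.sx_lt r L.hr), L.ry_apply (L.sy_lt r L.hr)] using this
  obtain ⟨h1, h2⟩ := L.integral_sharedSum U fun p hp => L.region_of_mem_box L.hr (hg.mem_box hp)
  have hnodup : (m r).Nodup := (isChain_step_pairwise hg.2.2).imp fun h => h.1
  rw [overlap, weight_pathEdges_inter U hnodup, sharedSum_congr hg.2.2
    (g := fun p q => (q.1 - p.1) + (q.2 - p.2)), ← h2]
  · have := intervalIntegral.integral_mono_on zero_le_one h1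
      (g := fun _ => value I G (L.tx r) (L.ty r) 0 (L.sx r) (L.sy r))
      intervalIntegrable_const fun θ _ => hle θ
    simpa using this
  · intro p q hpq
    have := L.le_of_dir_center hpq.2.2
    rw [segLen_eq_manhattan hpq.2.1, manhattan, abs_of_nonpos (by linarith [this.1]),
      abs_of_nonpos (by linarith [this.2])]
    ring

end

end Layout

end GMMN


/-! ### Lower bound: an optimal trace is realized by paths on the grid. -/

namespace GMMN

/-! ## Solutions -/

/-- The first coordinates occurring in the pairs. -/
def xCoords (n : ℕ) (v : ℕ → Pt × Pt) : Set ℝ := {a | ∃ k < n, a = (v k).1.1 ∨ a = (v k).2.1}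

/-- The second coordinates occurring in the pairs. -/
def yCoords (n : ℕ) (v : ℕ → Pt × Pt) : Set ℝ := {a | ∃ k < n, a = (v k).1.2 ∨ a = (v k).2.2}

/-- `p` and `q` are points of the grid `A × B` with no grid line strictly between them. -/
def GridStep (A B : Set ℝ) (p q : Pt) : Prop :=
  (p.1 ∈ A ∧ p.2 ∈ B) ∧ (q.1 ∈ A ∧ q.2 ∈ B) ∧
    (∀ a ∈ A, ¬ (min p.1 q.1 < a ∧ a < max p.1 q.1)) ∧
    ∀ b ∈ B, ¬ (min p.2 q.2 < b ∧ b < max p.2 q.2)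

/-- The lists `out k` are geodesics for the pairs `v k` along the grid, of minimum total length. -/
def Solved (n : ℕ) (v : ℕ → Pt × Pt) (out : ℕ → List Pt) : Prop :=
  (∀ k < n, Geo (v k) (out k) ∧ (out k).IsChain (GridStep (xCoords n v) (yCoords n v))) ∧
    ∀ m : ℕ → List Pt, (∀ k < n, Geo (v k) (m k)) →
      weight (unionEdges (Finset.range n) out) ≤ weight (unionEdges (Finset.range n) m)

namespace Layout

variable {n r : ℕ} {v : ℕ → Pt × Pt} (L : Layout n r v)

/-! ### Tracing an optimal path of the center -/

/-- `P`, with collected edges `col` and contexts `ctx`, follows optimal decisions of the dynamic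
program. -/
structure Trace (I : Bool → ℕ → ℕ → ℕ) (G : Bool → ℕ → ℕ → ℝ) (m : ℕ) (Pi Pj : ℕ → ℕ)
    (col : ℕ → Prop) (ctx : ℕ → ℕ) : Prop where
  len_eq : m = (L.tx r - L.sx r) + (L.ty r - L.sy r)
  start_x : Pi 0 = L.sx r
  start_y : Pj 0 = L.sy r
  start_ctx : ctx 0 = 0
  step : ∀ e < m, ∃ d, Avail (L.tx r) (L.ty r) (Pi e) (Pj e) d ∧
    Pi (e + 1) = nx d (Pi e) ∧ Pj (e + 1) = ny d (Pj e) ∧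
    ((¬ col e ∧ ctx (e + 1) = skipCtx I (ctx e) (Pi e) (Pj e) d ∧
        value I G (L.tx r) (L.ty r) (ctx e) (Pi e) (Pj e) =
          value I G (L.tx r) (L.ty r) (ctx (e + 1)) (Pi (e + 1)) (Pj (e + 1))) ∨
      (col e ∧ (¬ Same I (ctx e) (Pi e) (Pj e) d ∨ ctx e = runCtx d) ∧ ctx (e + 1) = runCtx d ∧
        value I G (L.tx r) (L.ty r) (ctx e) (Pi e) (Pj e) =
          G d (Pi (e + 1)) (Pj (e + 1)) +
            value I G (L.tx r) (L.ty r) (ctx (e + 1)) (Pi (e + 1)) (Pj (e + 1))))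

namespace Trace

variable {L} {I : Bool → ℕ → ℕ → ℕ} {G : Bool → ℕ → ℕ → ℝ} {m : ℕ} {Pi Pj : ℕ → ℕ}
  {col : ℕ → Prop} {ctx : ℕ → ℕ}

theorem position (h : L.Trace I G m Pi Pj col ctx) {e : ℕ} (he : e ≤ m) :
    Pi e + Pj e = L.sx r + L.sy r + e ∧ L.sx r ≤ Pi e ∧ L.sy r ≤ Pj e ∧ Pi e ≤ L.tx r ∧
      Pj e ≤ L.ty r := by
  induction e with
  | zero => simp [h.start_x, h.start_y, L.sx_le, L.sy_le]
  | succ e ih =>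
    obtain ⟨d, h1, h2, h3, -⟩ := h.step e (by omega)
    have := ih (by omega)
    cases d <;> simp [Avail, nx, ny] at h1 h2 h3 <;> omega

theorem mono (h : L.Trace I G m Pi Pj col ctx) {e f : ℕ} (hef : e ≤ f) (hf : f ≤ m) :
    Pi e ≤ Pi f ∧ Pj e ≤ Pj f := by
  induction f, hef using Nat.le_induction with
  | base => exact ⟨le_rfl, le_rfl⟩
  | succ f hef ih =>
    obtain ⟨d, h1, h2, h3, -⟩ := h.step f (by omega)
    have := ih (by omega)
    cases d <;> simp [nx, ny] at h2 h3 <;> omega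

theorem last (h : L.Trace I G m Pi Pj col ctx) : Pi m = L.tx r ∧ Pj m = L.ty r := by
  have h1 := h.position le_rfl
  have h2 := h.len_eq
  have h3 := L.sx_le
  have h4 := L.sy_le
  omega

/-- The direction of an edge of the path. -/
def dir (Pi : ℕ → ℕ) (e : ℕ) : Bool := decide (Pi (e + 1) = Pi e + 1)

theorem step_dir (h : L.Trace I G m Pi Pj col ctx) {e : ℕ} (he : e < m) :
    Avail (L.tx r) (L.ty r) (Pi e) (Pj e) (dir Pi e) ∧
    Pi (e + 1) = nx (dir Pi e) (Pi e) ∧ Pj (e + 1) = ny (dir Pi e) (Pj e) ∧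
    ((¬ col e ∧ ctx (e + 1) = skipCtx I (ctx e) (Pi e) (Pj e) (dir Pi e) ∧
        value I G (L.tx r) (L.ty r) (ctx e) (Pi e) (Pj e) =
          value I G (L.tx r) (L.ty r) (ctx (e + 1)) (Pi (e + 1)) (Pj (e + 1))) ∨
      (col e ∧ (¬ Same I (ctx e) (Pi e) (Pj e) (dir Pi e) ∨ ctx e = runCtx (dir Pi e)) ∧
        ctx (e + 1) = runCtx (dir Pi e) ∧
        value I G (L.tx r) (L.ty r) (ctx e) (Pi e) (Pj e) =
          G (dir Pi e) (Pi (e + 1)) (Pj (e + 1)) +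
            value I G (L.tx r) (L.ty r) (ctx (e + 1)) (Pi (e + 1)) (Pj (e + 1)))) := by
  obtain ⟨d, h1, h2, h3, h4⟩ := h.step e he
  have : dir Pi e = d := by cases d <;> simp [dir, h2, nx]
  rw [this]
  exact ⟨h1, h2, h3, h4⟩

/-- The label of an edge of the path. -/
def label (I : Bool → ℕ → ℕ → ℕ) (Pi Pj : ℕ → ℕ) (e : ℕ) : ℕ :=
    I (dir Pi e) (Pi (e + 1)) (Pj (e + 1))

theorem lt_N (h : L.Trace I G m Pi Pj col ctx) {e : ℕ} (he : e ≤ m) : Pi e < L.NX ∧ Pj e <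
    L.NY := by
  have := h.position he
  have := L.tx_lt r L.hr
  have := L.ty_lt r L.hr
  omega

theorem inEdge_iff (h : L.Trace I G m Pi Pj col ctx) {e : ℕ} (he : e < m) (k : ℕ) :
    L.InEdge (dir Pi e) k (Pi (e + 1)) (Pj (e + 1)) ↔
      (min (L.sx k) (L.tx k) ≤ Pi e ∧ Pi (e + 1) ≤ max (L.sx k) (L.tx k)) ∧
      (min (L.sy k) (L.ty k) ≤ Pj e ∧ Pj (e + 1) ≤ max (L.sy k) (L.ty k)) := by
  obtain ⟨-, h2, h3, -⟩ := h.step_dir he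
  cases hd : dir Pi e <;> simp [hd, nx, ny] at h2 h3 <;> simp only [InEdge, h2, h3] <;> simp

/-- A nonzero label determines its leaf. Boxes are order-convex, so a monotone path meets each of
them in one stretch. -/
theorem label_eq_of_between (hI : L.Labelled I G) (h : L.Trace I G m Pi Pj col ctx) {e e' f : ℕ}
    (h1 : e ≤ e') (h2 : e' ≤ f) (hf : f < m) (hef : label I Pi Pj e = label I Pi Pj f)
    (h0 : label I Pi Pj e ≠ 0) : label I Pi Pj e' = label I Pi Pj e := by
  have key : ∀ e < m, label I Pi Pj e ≠ 0 → ∃ k < n, k ≠ r ∧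
      L.InEdge (dir Pi e) k (Pi (e + 1)) (Pj (e + 1)) ∧ label I Pi Pj e = k + 1 ∧ L.lab k = k +
        1 := by
    intro e he h0
    have hN := h.lt_N (e := e + 1) (by omega)
    by_contra hk
    refine h0 ((hI _ _ _ hN.1 hN.2).2 fun k hkn hkr hin => hk ⟨k, hkn, hkr, hin, ?_⟩).1
    have := ((hI _ _ _ hN.1 hN.2).1 k hkn hkr hin).1
    rw [label, this] at h0 ⊢
    unfold lab at h0 ⊢
    split_ifs at h0 ⊢
    · exact ⟨rfl, rfl⟩
    · exact absurd rfl h0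
  obtain ⟨k, hk, hkr, hin, hl, hl'⟩ := key e (by omega) h0
  obtain ⟨k', -, -, hin', hl2, -⟩ := key f hf (hef ▸ h0)
  obtain rfl : k = k' := by omega
  rw [h.inEdge_iff (by omega)] at hin hin'
  have hN := h.lt_N (e := e' + 1) (by omega)
  have a1 := h.mono h1 (by omega)
  have a2 := h.mono (show e' + 1 ≤ f + 1 by omega) (by omega)
  have := ((hI _ _ _ hN.1 hN.2).1 k hk hkr ((h.inEdge_iff (e := e') (by omega) k).2 (by omega))).1
  rw [hl, label, this, hl']

theorem runCtx_injective : Function.Injective runCtx := by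
  intro a b; cases a <;> cases b <;> simp [runCtx]

/-- A joint induction on prefixes of the trace. The first clause is the aim. The second says that
the context has not forgotten an edge collected in the box of the last edge, and that a run in
progress is still on the line of that edge. The third lets the label of the last edge be read off
from the context. -/
theorem straight_aux (hI : L.Labelled I G) (h : L.Trace I G m Pi Pj col ctx) (k : ℕ) (hk : k ≤ m) :
    (∀ e f, e ≤ f → f < k → col e → col f → label I Pi Pj e = label I Pi Pj f →
      label I Pi Pj e ≠ 0 → Pi e = Pi (f + 1) ∨ Pj e = Pj (f + 1)) ∧
    (∀ e < k, col e → label I Pi Pj e = label I Pi Pj (k - 1) → label I Pi Pj e ≠ 0 →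
      ctx k ≠ 0 ∧ ∀ d, ctx k = runCtx d → lineCoord d (Pi e) (Pj e) = lineCoord d (Pi k) (Pj k)) ∧
    (0 < k → ctx k = 0 ∨ ctx k = runCtx (dir Pi (k - 1)) ∨ ctx k = doneCtx (dir Pi (k - 1))) := by
  induction k with
  | zero => simp
  | succ k ih =>
    obtain ⟨A, B, C⟩ := ih (by omega)
    obtain ⟨-, hx, hy, hs⟩ := h.step_dir (show k < m by omega)
    simp only [Nat.add_sub_cancel]
    -- an edge before `k` with the label of edge `k` forces `Same`
    have hsame : ∀ e < k, col e → label I Pi Pj e = label I Pi Pj k → label I Pi Pj e ≠ 0 →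
        label I Pi Pj e = label I Pi Pj (k - 1) ∧ ctx k ≠ 0 ∧
          Same I (ctx k) (Pi k) (Pj k) (dir Pi k) := by
      intro e he hc hl h0
      have h1 := label_eq_of_between hI h (show e ≤ k - 1 by omega) (show k - 1 ≤ k by omega)
        (by omega) hl h0
      have h2 := (B e he hc h1.symm h0).1
      have h3 : ctxLabel I (ctx k) (Pi k) (Pj k) = label I Pi Pj (k - 1) := by
        rw [label, Nat.sub_add_cancel (by omega)]
        rcases (C (by omega)).resolve_left h2 with h4 | h4
        · rw [h4, ctxLabel_runCtx]
        · rw [h4, ctxLabel_doneCtx]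
      refine ⟨h1.symm, h2, ?_⟩
      rw [Same, h3, h1, ← hx, ← hy]
      exact ⟨h0, hl⟩
    rcases hs with ⟨hc, hctx, -⟩ | ⟨hc, hal, hctx, -⟩
    · refine ⟨fun e f hef hf he hcf => ?_, fun e he hce hl h0 => ?_, fun _ => ?_⟩
      · rcases Nat.lt_succ_iff_lt_or_eq.1 hf with hf | rfl
        · exact A e f hef hf he hcf
        · exact absurd hcf hc
      · have hek : e < k := by
          rcases Nat.lt_succ_iff_lt_or_eq.1 he with he | rfl
          · exact he
          · exact absurd hce hc
        have hsm := (hsame e hek hce hl h0).2.2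
        rw [hctx, skipCtx, if_pos hsm]
        constructor
        · cases dir Pi k <;> simp [doneCtx]
        · intro d; cases dir Pi k <;> cases d <;> simp [doneCtx, runCtx]
      · rw [hctx, skipCtx]
        split_ifs
        · exact Or.inr (Or.inr rfl)
        · exact Or.inl rfl
    · have hB : ∀ e < k + 1, col e → label I Pi Pj e = label I Pi Pj k → label I Pi Pj e ≠ 0 →
          lineCoord (dir Pi k) (Pi e) (Pj e) =
            lineCoord (dir Pi k) (Pi (k + 1)) (Pj (k + 1)) := by
        intro e he hce hl h0
        rw [hx, hy, lineCoord_next_self]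
        rcases Nat.lt_succ_iff_lt_or_eq.1 he with he | rfl
        · obtain ⟨h1, -, h3⟩ := hsame e he hce hl h0
          exact (B e he hce h1 h0).2 _ (hal.resolve_left (not_not.2 h3))
        · rfl
      refine ⟨fun e f hef hf he hcf hl h0 => ?_, fun e he hce hl h0 => ⟨?_, fun d hd => ?_⟩,
        fun _ => Or.inr (Or.inl hctx)⟩
      · rcases Nat.lt_succ_iff_lt_or_eq.1 hf with hf | rfl
        · exact A e f hef hf he hcf hl h0
        · have := hB e (by omega) he hl h0
          cases hd : dir Pi f <;> simp [hd, lineCoord] at this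
          · exact Or.inl this
          · exact Or.inr this
      · rw [hctx]; cases dir Pi k <;> simp [runCtx]
      · rw [hctx] at hd
        rw [← runCtx_injective hd]
        exact hB e he hce hl h0

/-- The collected edges in the box of a pair of opposite slope lie on one line. -/
theorem straight (hI : L.Labelled I G) (h : L.Trace I G m Pi Pj col ctx) {k : ℕ} (hk : k < n)
    (hkr : k ≠ r) (ho : L.Opp k) {e f : ℕ} (hef : e ≤ f) (hf : f < m) (ce : col e) (cf : col f)
    (he : L.InEdge (dir Pi e) k (Pi (e + 1)) (Pj (e + 1)))
    (hf' : L.InEdge (dir Pi f) k (Pi (f + 1)) (Pj (f + 1))) :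
    Pi e = Pi (f + 1) ∨ Pj e = Pj (f + 1) := by
  have h1 := h.lt_N (e := e + 1) (by omega)
  have h2 := h.lt_N (e := f + 1) (by omega)
  have l1 := ((hI _ _ _ h1.1 h1.2).1 k hk hkr he).1
  have l2 := ((hI _ _ _ h2.1 h2.2).1 k hk hkr hf').1
  refine (straight_aux hI h m le_rfl).1 e f hef hf ce cf (l1.trans l2.symm) ?_
  rw [label, l1, lab, if_pos ho]
  omega

open Classical in
-- Each decision attains the value, so the values telescope to the collected gains; at the target
-- the value is zero.
theorem sum_gain (h : L.Trace I G m Pi Pj col ctx) :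
    value I G (L.tx r) (L.ty r) 0 (L.sx r) (L.sy r) =
      ∑ e ∈ (Finset.range m).filter col, G (dir Pi e) (Pi (e + 1)) (Pj (e + 1)) := by
  have key : ∀ k ≤ m, value I G (L.tx r) (L.ty r) 0 (L.sx r) (L.sy r) =
      ∑ e ∈ (Finset.range k).filter col, G (dir Pi e) (Pi (e + 1)) (Pj (e + 1)) +
        value I G (L.tx r) (L.ty r) (ctx k) (Pi k) (Pj k) := by
    intro k hk
    induction k with
    | zero => simp [h.start_x, h.start_y, h.start_ctx]
    | succ k ih =>
      obtain ⟨-, -, -, hs⟩ := h.step_dir (show k < m by omega)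
      rw [ih (by omega), Finset.range_add_one, Finset.filter_insert]
      rcases hs with ⟨hc, -, hv⟩ | ⟨hc, -, -, hv⟩
      · rw [if_neg hc, hv]
      · rw [if_pos hc, Finset.sum_insert (by simp), hv]
        ring
  have := key m le_rfl
  rwa [h.last.1, h.last.2, value_end, add_zero] at this

end Trace

/-! ### Paths in grid coordinates -/

/-- The point with grid coordinates `p`. -/
def pt (p : ℕ × ℕ) : Pt := (L.X p.1, L.Y p.2)

/-- A unit step on the grid in the direction of `v k`. -/
def UnitStep (k : ℕ) (p q : ℕ × ℕ) : Prop :=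
  ((p.1 < L.NX ∧ p.2 < L.NY) ∧ (q.1 < L.NX ∧ q.2 < L.NY)) ∧
    ((p.2 = q.2 ∧ ((q.1 = p.1 + 1 ∧ L.sx k < L.tx k) ∨ (p.1 = q.1 + 1 ∧ L.tx k < L.sx k))) ∨
      (p.1 = q.1 ∧ ((q.2 = p.2 + 1 ∧ L.sy k < L.ty k) ∨ (p.2 = q.2 + 1 ∧ L.ty k < L.sy k))))

variable {L} in
theorem UnitStep.step {k : ℕ} (hk : k < n) {p q : ℕ × ℕ} (h : L.UnitStep k p q) :
    Step (v k) (L.pt p) (L.pt q) := by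
  obtain ⟨⟨⟨hp1, hp2⟩, hq1, hq2⟩, h⟩ := h
  have s1 := L.sx_lt k hk
  have s2 := L.sy_lt k hk
  have t1 := L.tx_lt k hk
  have t2 := L.ty_lt k hk
  have hXi : ∀ {a b}, a < L.NX → b < L.NX → (L.X a ≤ L.X b ↔ a ≤ b) := L.X_le_iff
  have hYi : ∀ {a b}, a < L.NY → b < L.NY → (L.Y a ≤ L.Y b ↔ a ≤ b) := L.Y_le_iff
  have hd : Dir (v k) (L.pt p) (L.pt q) := by
    rw [Dir, L.eq k hk]
    simp only [pt, hXi s1 t1, hXi t1 s1, hYi s2 t2, hYi t2 s2, hXi hp1 hq1, hXi hq1 hp1,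
      hYi hp2 hq2, hYi hq2 hp2]
    omega
  refine ⟨fun e => ?_, ?_, hd⟩
  · have e1 : L.X p.1 = L.X q.1 := congrArg Prod.fst e
    have e2 : L.Y p.2 = L.Y q.2 := congrArg Prod.snd e
    have a1 := (hXi hp1 hq1).1 e1.le
    have a2 := (hXi hq1 hp1).1 e1.ge
    have a3 := (hYi hp2 hq2).1 e2.le
    have a4 := (hYi hq2 hp2).1 e2.ge
    omega
  · rcases h with ⟨e, -⟩ | ⟨e, -⟩
    · exact Or.inr (by simp [pt, e])
    · exact Or.inl (by simp [pt, e])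

/-- The grid lines of the layout are exactly the ones through the coordinates of the pairs. -/
def Tight : Prop :=
  (∀ i < L.NX, L.X i ∈ xCoords n v) ∧ ∀ j < L.NY, L.Y j ∈ yCoords n v

theorem exists_of_mem_xCoords {a : ℝ} (ha : a ∈ xCoords n v) : ∃ i < L.NX, a = L.X i := by
  obtain ⟨k, hk, h⟩ := ha
  rw [L.eq k hk] at h
  rcases h with h | h
  · exact ⟨_, L.sx_lt k hk, h⟩
  · exact ⟨_, L.tx_lt k hk, h⟩

theorem exists_of_mem_yCoords {a : ℝ} (ha : a ∈ yCoords n v) : ∃ i < L.NY, a = L.Y i := by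
  obtain ⟨k, hk, h⟩ := ha
  rw [L.eq k hk] at h
  rcases h with h | h
  · exact ⟨_, L.sy_lt k hk, h⟩
  · exact ⟨_, L.ty_lt k hk, h⟩

theorem not_between {Z : ℕ → ℝ} {N : ℕ} (hZ : ∀ i j, i < j → j < N → Z i < Z j) {a b c : ℕ}
    (ha : a < N) (hb : b < N) (hc : c < N) (hab : a = b ∨ b = a + 1 ∨ a = b + 1) :
    ¬ (min (Z a) (Z b) < Z c ∧ Z c < max (Z a) (Z b)) := by
  have hlt : ∀ {x y}, x < N → Z x < Z y → x < y := by
    intro x y hx h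
    by_contra hxy
    rcases (not_lt.1 hxy).eq_or_lt with e | e
    · rw [e] at h; exact lt_irrefl _ h
    · exact lt_asymm h (hZ y x e hx)
  rintro ⟨h1, h2⟩
  rcases min_lt_iff.1 h1 with h1 | h1 <;> rcases lt_max_iff.1 h2 with h2 | h2
  · exact lt_asymm h1 h2
  · have := hlt ha h1; have := hlt hc h2; omega
  · have := hlt hb h1; have := hlt hc h2; omega
  · exact lt_asymm h1 h2

variable {L} in
theorem UnitStep.gridStep (hT : L.Tight) {k : ℕ} {p q : ℕ × ℕ} (h : L.UnitStep k p q) :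
    GridStep (xCoords n v) (yCoords n v) (L.pt p) (L.pt q) := by
  obtain ⟨⟨⟨hp1, hp2⟩, hq1, hq2⟩, h⟩ := h
  refine ⟨⟨hT.1 _ hp1, hT.2 _ hp2⟩, ⟨hT.1 _ hq1, hT.2 _ hq2⟩, fun a ha => ?_, fun b hb => ?_⟩
  · obtain ⟨c, hc, rfl⟩ := L.exists_of_mem_xCoords ha
    exact not_between L.X_lt hp1 hq1 hc (by omega)
  · obtain ⟨c, hc, rfl⟩ := L.exists_of_mem_yCoords hb
    exact not_between L.Y_lt hp2 hq2 hc (by omega)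

/-- `p` and `q` are consecutive in `l`, in one order or the other. -/
def Consecutive (l : List (ℕ × ℕ)) (p q : ℕ × ℕ) : Prop :=
  (∃ a b, l = a ++ p :: q :: b) ∨ ∃ a b, l = a ++ q :: p :: b

theorem mem_pathEdges_of_consecutive {l : List (ℕ × ℕ)} {p q : ℕ × ℕ} (h : Consecutive l p q) :
    s(L.pt p, L.pt q) ∈ pathEdges (l.map L.pt) := by
  rcases h with ⟨a, b, rfl⟩ | ⟨a, b, rfl⟩
  · simpa using mem_pathEdges_append_pair (a.map L.pt) (b.map L.pt) (L.pt p) (L.pt q)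
  · rw [Sym2.eq_swap]
    simpa using mem_pathEdges_append_pair (a.map L.pt) (b.map L.pt) (L.pt q) (L.pt p)

/-- The paths `ls k` follow the path `P` of the center along the collected edges in their boxes. -/
structure Follows (m : ℕ) (Pi Pj : ℕ → ℕ) (col : ℕ → Prop) (ls : ℕ → List (ℕ × ℕ)) : Prop where
  head : ∀ k < n, (ls k).head? = some (L.sx k, L.sy k)
  last : ∀ k < n, (ls k).getLast? = some (L.tx k, L.ty k)
  chain : ∀ k < n, (ls k).IsChain (L.UnitStep k)
  share : ∀ k < n, ∀ e < m, k = r ∨ col e → L.InEdge (Trace.dir Pi e) k (Pi (e + 1)) (Pj (e + 1)) →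
    Consecutive (ls k) (Pi e, Pj e) (Pi (e + 1), Pj (e + 1))

section

variable {L} {I : Bool → ℕ → ℕ → ℕ} {G : Bool → ℕ → ℕ → ℝ} {m : ℕ} {Pi Pj : ℕ → ℕ}
  {col : ℕ → Prop} {ctx : ℕ → ℕ} {ls : ℕ → List (ℕ × ℕ)}

theorem Follows.geo (hF : L.Follows m Pi Pj col ls) {k : ℕ} (hk : k < n) :
    Geo (v k) ((ls k).map L.pt) := by
  refine ⟨?_, ?_, ?_⟩
  · rw [List.head?_map, hF.head k hk, L.eq k hk]; rfl
  · rw [List.getLast?_map, hF.last k hk, L.eq k hk]; rfl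
  · rw [List.isChain_map]
    exact (hF.chain k hk).imp fun p q h => h.step hk

open Classical in
-- The collected edges of nonzero gain are pairwise distinct, have their gains as lengths, and lie
-- both on the path of the center and on a leaf path. The lists may share even more, hence only an
-- inequality.
theorem Follows.value_le_overlap (hI : L.Labelled I G) (h : L.Trace I G m Pi Pj col ctx)
    (hF : L.Follows m Pi Pj col ls) :
    value I G (L.tx r) (L.ty r) 0 (L.sx r) (L.sy r) ≤
      overlap n r fun k => (ls k).map L.pt := by
  set Q : ℕ → Pt := fun e => L.pt (Pi e, Pj e) with hQ
  -- The sum of the coordinates strictly increases along the path; this will make its edges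
  -- distinct.
  have hlt : ∀ e f, e < f → f ≤ m → (Q e).1 + (Q e).2 < (Q f).1 + (Q f).2 := by
    intro e f hef hf
    have h1 := h.mono hef.le hf
    have h2 := h.position (hef.le.trans hf)
    have h3 := h.position hf
    have h4 := h.lt_N hf
    have e1 := L.X_le h1.1 h4.1
    have e2 := L.Y_le h1.2 h4.2
    rcases lt_or_eq_of_le h1.1 with h5 | h5
    · have := L.X_lt _ _ h5 h4.1
      simp only [hQ, pt]; linarith
    · have := L.Y_lt (Pj e) (Pj f) (by omega) h4.2
      simp only [hQ, pt]; linarith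
  -- An optimal decision may also collect an edge outside all leaf boxes, with gain zero. Such edges
  -- are not shared and are dropped.
  set S := ((Finset.range m).filter col).filter fun e =>
    G (Trace.dir Pi e) (Pi (e + 1)) (Pj (e + 1)) ≠ 0 with hS
  have hmem : ∀ e ∈ S, e < m ∧ col e ∧ ∃ k < n, k ≠ r ∧
      L.InEdge (Trace.dir Pi e) k (Pi (e + 1)) (Pj (e + 1)) := by
    intro e he
    simp only [hS, Finset.mem_filter, Finset.mem_range] at he
    refine ⟨he.1.1, he.1.2, ?_⟩
    by_contra hk
    have hN := h.lt_N (e := e + 1) (by omega)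
    exact he.2 ((hI _ _ _ hN.1 hN.2).2 fun k h1 h2 h3 => hk ⟨k, h1, h2, h3⟩).2
  have hlen : ∀ e ∈ S, G (Trace.dir Pi e) (Pi (e + 1)) (Pj (e + 1)) =
      edgeLen s(Q e, Q (e + 1)) := by
    intro e he
    obtain ⟨hem, -, k, hk, hkr, hin⟩ := hmem e he
    have hN := h.lt_N (e := e + 1) (by omega)
    rw [((hI _ _ _ hN.1 hN.2).1 k hk hkr hin).2, edgeLen_mk]
    obtain ⟨-, hx, hy, -⟩ := h.step_dir hem
    have hle := h.mono (Nat.le_succ e) hem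
    have e1 := L.X_le hle.1 hN.1
    have e2 := L.Y_le hle.2 hN.2
    cases hd : Trace.dir Pi e
    · simp only [hd, nx, ny, Bool.false_eq_true, if_false] at hx hy
      rw [segLen_eq_manhattan (Or.inl (by simp [hQ, pt, hx]))]
      simp only [hQ, pt, manhattan, len, hx, hy, Bool.false_eq_true, if_false, sub_self, abs_zero,
        zero_add, Nat.add_sub_cancel]
      rw [abs_of_nonpos (by simp only [Nat.succ_eq_add_one, hy] at e2; linarith)]
      ring
    · simp only [hd, nx, ny, if_true] at hx hy
      rw [segLen_eq_manhattan (Or.inr (by simp [hQ, pt, hy]))]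
      simp only [hQ, pt, manhattan, len, hx, hy, if_true, sub_self, abs_zero,
        add_zero, Nat.add_sub_cancel]
      rw [abs_of_nonpos (by simp only [Nat.succ_eq_add_one, hx] at e1; linarith)]
      ring
  have hinj : Set.InjOn (fun e => s(Q e, Q (e + 1))) S := by
    intro e he f hf hef
    have he' := (hmem e he).1
    have hf' := (hmem f hf).1
    by_contra hne
    have key : ∀ e f, e < f → f < m → s(Q e, Q (e + 1)) ≠ s(Q f, Q (f + 1)) := by
      intro e f hlt' hfm heq
      have a1 := hlt e f hlt' (by omega)
      have a2 := hlt e (f + 1) (by omega) (by omega)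
      rcases Sym2.eq_iff.1 heq with ⟨h1, -⟩ | ⟨h1, -⟩
      · rw [h1] at a1; exact lt_irrefl _ a1
      · rw [h1] at a2; exact lt_irrefl _ a2
    rcases lt_or_gt_of_ne hne with h1 | h1
    · exact key e f h1 hf' hef
    · exact key f e h1 he' hef.symm
  have hsub : S.image (fun e => s(Q e, Q (e + 1))) ⊆ pathEdges ((ls r).map L.pt) ∩
      unionEdges ((Finset.range n).erase r) fun k => (ls k).map L.pt := by
    intro x hx
    obtain ⟨e, he, rfl⟩ := Finset.mem_image.1 hx
    obtain ⟨hem, hc, k, hk, hkr, hin⟩ := hmem e he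
    refine Finset.mem_inter.2
        ⟨L.mem_pathEdges_of_consecutive (hF.share r L.hr e hem (Or.inl rfl) ?_),
      Finset.mem_biUnion.2 ⟨k, by simp [hk, hkr],
        L.mem_pathEdges_of_consecutive (hF.share k hk e hem (Or.inr hc) hin)⟩⟩
    rw [h.inEdge_iff hem]
    have h1 := h.position hem.le
    have h2 := h.position (Nat.succ_le_of_lt hem)
    have h3 := L.sx_le
    have h4 := L.sy_le
    simp only [Nat.succ_eq_add_one] at h2
    omega
  rw [h.sum_gain, ← Finset.sum_filter_ne_zero, Finset.sum_congr rfl hlen]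
  have : ∑ e ∈ S, edgeLen s(Q e, Q (e + 1)) =
      weight (S.image fun e => s(Q e, Q (e + 1))) := by
    rw [weight, Finset.sum_image hinj]
  rw [this]
  exact weight_mono hsub

/-- Length plus overlap is the same for the constructed family and for any competitor `g`. The first
has overlap at least the value, the second at most the value. -/
theorem Follows.solved (hd : LeavesDisjoint n r v) (hT : L.Tight) (hI : L.Labelled I G)
    (h : L.Trace I G m Pi Pj col ctx) (hF : L.Follows m Pi Pj col ls) :
    Solved n v fun k => (ls k).map L.pt := by
  refine ⟨fun k hk => ⟨hF.geo hk, ?_⟩, fun g hg => ?_⟩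
  · rw [List.isChain_map]
    exact (hF.chain k hk).imp fun p q h => h.gridStep hT
  · have h1 := weight_unionEdges_add_overlap L.hr hd (m := fun k => (ls k).map L.pt)
      fun k hk => hF.geo hk
    have h2 := weight_unionEdges_add_overlap L.hr hd hg
    have h3 := hF.value_le_overlap hI h
    have h4 := L.overlap_le_value hI hg
    linarith

end

end Layout

end GMMN


/-! ### Reflections, stars in terms of boxes, and the passage from geodesic lists to networks. -/

namespace GMMN

/-! ## Reflections -/

/-- Multiply the coordinates by `a` and `b`. -/
def scale (a b : ℝ) (p : Pt) : Pt := (a * p.1, b * p.2)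

/-- Multiply the coordinates of both points by `a` and `b`. -/
def scalePair (a b : ℝ) (v : Pt × Pt) : Pt × Pt := (scale a b v.1, scale a b v.2)

theorem mul_mem_xCoords (a b : ℝ) {n : ℕ} {v : ℕ → Pt × Pt} {c : ℝ} (h : c ∈ xCoords n v) :
    a * c ∈ xCoords n fun k => scalePair a b (v k) := by
  obtain ⟨k, hk, h⟩ := h
  exact ⟨k, hk, h.imp (fun e => by rw [e]; rfl) fun e => by rw [e]; rfl⟩

theorem mul_mem_yCoords (a b : ℝ) {n : ℕ} {v : ℕ → Pt × Pt} {c : ℝ} (h : c ∈ yCoords n v) :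
    b * c ∈ yCoords n fun k => scalePair a b (v k) := by
  obtain ⟨k, hk, h⟩ := h
  exact ⟨k, hk, h.imp (fun e => by rw [e]; rfl) fun e => by rw [e]; rfl⟩

theorem not_between_mul {a : ℝ} (ha : a = 1 ∨ a = -1) {A : Set ℝ} {x y : ℝ} (h : ∀ c ∈ A,
    ¬ (min x y < c ∧ c < max x y))
    {A' : Set ℝ} (hA : ∀ c ∈ A', a * c ∈ A) :
    ∀ c ∈ A', ¬ (min (a * x) (a * y) < c ∧ c < max (a * x) (a * y)) := by
  intro c hc ⟨h1, h2⟩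
  refine h _ (hA c hc) ?_
  rcases ha with rfl | rfl
  · simp only [one_mul] at *
    exact ⟨h1, h2⟩
  · simp only [neg_mul, one_mul] at *
    rw [min_neg_neg] at h1
    rw [max_neg_neg] at h2
    exact ⟨by linarith, by linarith⟩

section Reflection

variable {a b : ℝ} (ha : a = 1 ∨ a = -1) (hb : b = 1 ∨ b = -1)
include ha hb

theorem scale_scale (p : Pt) : scale a b (scale a b p) = p := by
  rcases ha with rfl | rfl <;> rcases hb with rfl | rfl <;> simp [scale]

theorem scale_injective : Function.Injective (scale a b) := fun p q h => by
  rw [← scale_scale ha hb p, h, scale_scale ha hb]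

theorem edgeLen_map_scale (e : Sym2 Pt) : edgeLen (Sym2.map (scale a b) e) = edgeLen e := by
  induction e with
  | _ p q =>
    rw [Sym2.map_mk, edgeLen_mk, edgeLen_mk, segLen, segLen]
    congr 1
    rcases ha with rfl | rfl <;> rcases hb with rfl | rfl <;> simp only [scale] <;> ring

theorem step_scale {v : Pt × Pt} {p q : Pt} (h : Step v p q) :
    Step (scalePair a b v) (scale a b p) (scale a b q) := by
  obtain ⟨h1, h2, ⟨h3, h4⟩, h5, h6⟩ := h
  refine ⟨fun e => h1 (scale_injective ha hb e), h2.imp (fun e => by simp [scale, e])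
    fun e => by simp [scale, e], ?_⟩
  rcases ha with rfl | rfl <;> rcases hb with rfl | rfl <;>
    simp only [Dir, scalePair, scale, one_mul, neg_mul, neg_le_neg_iff]
  · exact ⟨⟨h3, h4⟩, h5, h6⟩
  · exact ⟨⟨h3, h4⟩, h6, h5⟩
  · exact ⟨⟨h4, h3⟩, h5, h6⟩
  · exact ⟨⟨h4, h3⟩, h6, h5⟩

theorem geo_scale {v : Pt × Pt} {l : List Pt} (h : Geo v l) :
    Geo (scalePair a b v) (l.map (scale a b)) := by
  refine ⟨by rw [List.head?_map, h.1]; rfl, by rw [List.getLast?_map, h.2.1]; rfl, ?_⟩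
  rw [List.isChain_map]
  exact h.2.2.imp fun p q h => step_scale ha hb h

theorem weight_unionEdges_scale (s : Finset ℕ) (m : ℕ → List Pt) :
    weight (unionEdges s fun k => (m k).map (scale a b)) = weight (unionEdges s m) := by
  have h1 : ∀ l : List Pt, pathEdges (l.map (scale a b)) =
      (pathEdges l).image (Sym2.map (scale a b)) := by
    intro l
    induction l with
    | nil => simp [pathEdges]
    | cons p l ih =>
      cases l with
      | nil => simp [pathEdges]
      | cons q l =>
        rw [List.map_cons, List.map_cons, pathEdges_cons_cons, pathEdges_cons_cons,
          Finset.image_insert, ← ih]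
        rfl
  have h2 : unionEdges s (fun k => (m k).map (scale a b)) =
      (unionEdges s m).image (Sym2.map (scale a b)) := by
    simp only [unionEdges, Finset.biUnion_image, h1]
  rw [h2, weight, Finset.sum_image ((Sym2.map.injective (scale_injective ha hb)).injOn)]
  exact Finset.sum_congr rfl fun e _ => edgeLen_map_scale ha hb e

theorem scalePair_scalePair (v : Pt × Pt) : scalePair a b (scalePair a b v) = v := by
  simp [scalePair, scale_scale ha hb]

/-- A reflection is an involution that preserves lengths, geodesics and neighbouring grid lines, so
competitors for `v` are reflected to competitors for the reflected pairs. -/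
theorem solved_scale {n : ℕ} {v : ℕ → Pt × Pt} {out : ℕ → List Pt}
    (h : Solved n (fun k => scalePair a b (v k)) out) :
    Solved n v fun k => (out k).map (scale a b) := by
  refine ⟨fun k hk => ⟨?_, ?_⟩, fun m hm => ?_⟩
  · have := geo_scale ha hb (h.1 k hk).1
    rwa [scalePair_scalePair ha hb] at this
  · rw [List.isChain_map]
    refine (h.1 k hk).2.imp fun p q hpq => ?_
    obtain ⟨⟨h1, h2⟩, ⟨h3, h4⟩, h5, h6⟩ := hpq
    have ex : ∀ {c}, c ∈ xCoords n (fun k => scalePair a b (v k)) → a * c ∈ xCoords n v := by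
      intro c hc
      have := mul_mem_xCoords a b hc
      simpa only [scalePair_scalePair ha hb] using this
    have ey : ∀ {c}, c ∈ yCoords n (fun k => scalePair a b (v k)) → b * c ∈ yCoords n v := by
      intro c hc
      have := mul_mem_yCoords a b hc
      simpa only [scalePair_scalePair ha hb] using this
    exact ⟨⟨ex h1, ey h2⟩, ⟨ex h3, ey h4⟩,
      not_between_mul ha h5 fun c hc => mul_mem_xCoords a b hc,
      not_between_mul hb h6 fun c hc => mul_mem_yCoords a b hc⟩
  · rw [weight_unionEdges_scale ha hb, ← weight_unionEdges_scale ha hb _ m]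
    exact h.2 _ fun k hk => geo_scale ha hb (hm k hk)

end Reflection

/-! ## The Hanan grid -/

/-- The pairs of a list, as a sequence. -/
def pairs (L : List (Pt × Pt)) (k : ℕ) : Pt × Pt := L.getD k 0

section Hanan

variable {P : Finset (Pt × Pt)} {L : List (Pt × Pt)}

theorem pairs_mem (hL : ∀ v, v ∈ L ↔ v ∈ P) {k : ℕ} (hk : k < L.length) : pairs L k ∈ P := by
  rw [← hL, pairs, List.getD_eq_getElem _ _ hk]
  exact List.getElem_mem hk

theorem exists_pairs_eq (hL : ∀ v, v ∈ L ↔ v ∈ P) {v : Pt × Pt} (hv : v ∈ P) :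
    ∃ k < L.length, pairs L k = v := by
  obtain ⟨k, hk, rfl⟩ := List.mem_iff_getElem.1 ((hL v).2 hv)
  exact ⟨k, hk, by rw [pairs, List.getD_eq_getElem _ _ hk]⟩

theorem mem_hananVerts_iff (hL : ∀ v, v ∈ L ↔ v ∈ P) (p : Pt) : p ∈ hananVerts P ↔
    p.1 ∈ xCoords L.length (pairs L) ∧ p.2 ∈ yCoords L.length (pairs L) := by
  simp only [hananVerts, Finset.mem_product, Finset.mem_union, Finset.mem_image, xCoords, yCoords,
    Set.mem_ofPred_eq]
  refine and_congr ?_ ?_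
  · constructor
    · rintro (⟨v, hv, h⟩ | ⟨v, hv, h⟩) <;> obtain ⟨k, hk, rfl⟩ := exists_pairs_eq hL hv
      · exact ⟨k, hk, Or.inl h.symm⟩
      · exact ⟨k, hk, Or.inr h.symm⟩
    · rintro ⟨k, hk, h | h⟩
      · exact Or.inl ⟨_, pairs_mem hL hk, h.symm⟩
      · exact Or.inr ⟨_, pairs_mem hL hk, h.symm⟩
  · constructor
    · rintro (⟨v, hv, h⟩ | ⟨v, hv, h⟩) <;> obtain ⟨k, hk, rfl⟩ := exists_pairs_eq hL hv
      · exact ⟨k, hk, Or.inl h.symm⟩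
      · exact ⟨k, hk, Or.inr h.symm⟩
    · rintro ⟨k, hk, h | h⟩
      · exact Or.inl ⟨_, pairs_mem hL hk, h.symm⟩
      · exact Or.inr ⟨_, pairs_mem hL hk, h.symm⟩

theorem isHananEdge_of_gridStep (hL : ∀ v, v ∈ L ↔ v ∈ P) {p q : Pt} (hne : p ≠ q)
    (hax : p.1 = q.1 ∨ p.2 = q.2)
    (h : GridStep (xCoords L.length (pairs L)) (yCoords L.length (pairs L)) p q) :
    IsHananEdge P s(p, q) := by
  obtain ⟨h1, h2, h3, h4⟩ := h
  have hp := (mem_hananVerts_iff hL p).2 h1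
  have hq := (mem_hananVerts_iff hL q).2 h2
  refine ⟨p, hp, q, hq, rfl, hne, segLen_eq_manhattan hax, Set.Subset.antisymm ?_ ?_⟩
  · rintro z ⟨⟨a, b, ha, hb, hab, rfl⟩, hz⟩
    rw [Finset.mem_coe, mem_hananVerts_iff hL] at hz
    -- Applied in both coordinates: a grid point on the segment has the coordinates of its ends, and
    -- since one coordinate is constant it is one of the ends.
    have key : ∀ x y c : ℝ, c ∈ Set.uIcc x y → ¬ (min x y < c ∧ c < max x y) → c = x ∨ c = y := by
      intro x y c hc hn
      rw [Set.uIcc, Set.mem_Icc] at hc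
      rcases hc.1.eq_or_lt with e | e
      · rcases min_choice x y with h | h
        · exact Or.inl (e.symm.trans h)
        · exact Or.inr (e.symm.trans h)
      · rcases hc.2.eq_or_lt with e' | e'
        · rcases max_choice x y with h | h
          · exact Or.inl (e'.trans h)
          · exact Or.inr (e'.trans h)
        · exact absurd ⟨e, e'⟩ hn
    have k1 := key p.1 q.1 (a • p + b • q).1
      ((convex_uIcc p.1 q.1) Set.left_mem_uIcc Set.right_mem_uIcc ha hb hab) (h3 _ hz.1)
    have k2 := key p.2 q.2 (a • p + b • q).2
      ((convex_uIcc p.2 q.2) Set.left_mem_uIcc Set.right_mem_uIcc ha hb hab) (h4 _ hz.2)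
    rw [Set.mem_insert_iff, Set.mem_singleton_iff]
    rcases hax with hax | hax
    · have k1' : (a • p + b • q).1 = p.1 := k1.elim id fun e => e.trans hax.symm
      exact k2.imp (fun e => Prod.ext k1' e) fun e => Prod.ext (k1'.trans hax) e
    · have k2' : (a • p + b • q).2 = p.2 := k2.elim id fun e => e.trans hax.symm
      exact k1.imp (fun e => Prod.ext e k2') fun e => Prod.ext e (k2'.trans hax)
  · rintro z (rfl | rfl)
    · exact ⟨left_mem_segment ℝ _ _, hp⟩
    · exact ⟨right_mem_segment ℝ _ _, hq⟩

theorem mem_hanan_edges {e : Sym2 Pt} : e ∈ (hanan P).edges ↔ IsHananEdge P e := by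
  simp only [hanan, Finset.mem_filter, Finset.mem_sym2_iff, and_iff_right_iff_imp]
  rintro ⟨p, hp, q, hq, rfl, -⟩ z hz
  rcases Sym2.mem_iff.1 hz with rfl | rfl <;> assumption

theorem exists_next {A : Set ℝ} (hA : A.Finite) {x y : ℝ} (hxy : x < y) (hy : y ∈ A) :
    ∃ c ∈ A, x < c ∧ c ≤ y ∧ ∀ a ∈ A, ¬ (min x c < a ∧ a < max x c) := by
  obtain ⟨c, ⟨hc, hxc⟩, hmin⟩ := Set.exists_min_image {a ∈ A | x < a} id
    (hA.subset fun a h => h.1) ⟨y, hy, hxy⟩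
  refine ⟨c, hc, hxc, hmin y ⟨hy, hxy⟩, fun a ha h => ?_⟩
  rw [min_eq_left hxc.le, max_eq_right hxc.le] at h
  exact absurd (hmin a ⟨ha, h.1⟩) (not_le.2 h.2)

theorem finite_xCoords (n : ℕ) (v : ℕ → Pt × Pt) : (xCoords n v).Finite := by
  refine ((Set.finite_Iio n).image (fun k => (v k).1.1) |>.union
    ((Set.finite_Iio n).image fun k => (v k).2.1)).subset ?_
  rintro a ⟨k, hk, h | h⟩
  · exact Or.inl ⟨k, hk, h.symm⟩
  · exact Or.inr ⟨k, hk, h.symm⟩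

theorem finite_yCoords (n : ℕ) (v : ℕ → Pt × Pt) : (yCoords n v).Finite := by
  refine ((Set.finite_Iio n).image (fun k => (v k).1.2) |>.union
    ((Set.finite_Iio n).image fun k => (v k).2.2)).subset ?_
  rintro a ⟨k, hk, h | h⟩
  · exact Or.inl ⟨k, hk, h.symm⟩
  · exact Or.inr ⟨k, hk, h.symm⟩

theorem max_min_mem {A : Set ℝ} {a b c d : ℝ} (ha : a ∈ A) (hb : b ∈ A) (hc : c ∈ A) (hd : d ∈ A) :
    max (min a b) (min c d) ∈ A ∧ min (max a b) (max c d) ∈ A := by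
  constructor
  · rcases max_choice (min a b) (min c d) with h | h <;> rw [h]
    · rcases min_choice a b with h | h <;> rw [h] <;> assumption
    · rcases min_choice c d with h | h <;> rw [h] <;> assumption
  · rcases min_choice (max a b) (max c d) with h | h <;> rw [h]
    · rcases max_choice a b with h | h <;> rw [h] <;> assumption
    · rcases max_choice c d with h | h <;> rw [h] <;> assumption

/-- The intersection of two boxes is a box whose corners are grid points. If it is more than a
point, one of its sides at the lower left corner is nondegenerate, and the first grid edge on this
side lies in both boxes. -/
theorem adj_iff (hL : ∀ v, v ∈ L ↔ v ∈ P) {u v : {v // v ∈ P}} (hne : u ≠ v) :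
    (intersectionGraph P).Adj u v ↔ ¬ (box u.1 ∩ box v.1).Subsingleton := by
  have hmem : ∀ w : Pt × Pt, ∀ e, e ∈ (hananBox P w).edges ↔
      IsHananEdge P e ∧ ∀ p ∈ e, p ∈ box w := by
    intro w e
    rw [← mem_hanan_edges]
    simp [hananBox]
  constructor
  · rintro ⟨-, e, he⟩ hs
    obtain ⟨h1, h2⟩ := Finset.mem_inter.1 he
    obtain ⟨⟨p, -, q, -, rfl, hpq, -⟩, h3⟩ := (hmem _ _).1 h1
    have h4 := ((hmem _ _).1 h2).2
    exact hpq (hs ⟨h3 p (Sym2.mem_mk_left p q), h4 p (Sym2.mem_mk_left p q)⟩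
      ⟨h3 q (Sym2.mem_mk_right p q), h4 q (Sym2.mem_mk_right p q)⟩)
  · intro hs
    refine ⟨hne, ?_⟩
    obtain ⟨u, hu⟩ := u
    obtain ⟨v, hv⟩ := v
    obtain ⟨k, hk, rfl⟩ := exists_pairs_eq hL hu
    obtain ⟨k', hk', rfl⟩ := exists_pairs_eq hL hv
    simp only at hs ⊢
    set u := pairs L k
    set v := pairs L k'
    have hx := max_min_mem (A := xCoords L.length (pairs L)) (a := u.1.1) (b := u.2.1) (c := v.1.1)
      (d := v.2.1) ⟨k, hk, Or.inl rfl⟩ ⟨k, hk, Or.inr rfl⟩ ⟨k', hk', Or.inl rfl⟩ ⟨k', hk',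
        Or.inr rfl⟩
    have hy := max_min_mem (A := yCoords L.length (pairs L)) (a := u.1.2) (b := u.2.2) (c := v.1.2)
      (d := v.2.2) ⟨k, hk, Or.inl rfl⟩ ⟨k, hk, Or.inr rfl⟩ ⟨k', hk', Or.inl rfl⟩ ⟨k', hk',
        Or.inr rfl⟩
    set x0 := max (min u.1.1 u.2.1) (min v.1.1 v.2.1)
    set x1 := min (max u.1.1 u.2.1) (max v.1.1 v.2.1)
    set y0 := max (min u.1.2 u.2.2) (min v.1.2 v.2.2)
    set y1 := min (max u.1.2 u.2.2) (max v.1.2 v.2.2)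
    have hbox : ∀ p : Pt, p ∈ box u ∩ box v ↔ (x0 ≤ p.1 ∧ p.1 ≤ x1) ∧ (y0 ≤ p.2 ∧ p.2 ≤ y1) := by
      intro p
      rw [Set.mem_inter_iff, mem_box_iff, mem_box_iff, max_le_iff, le_min_iff, max_le_iff,
          le_min_iff]
      tauto
    rw [Set.not_subsingleton_iff] at hs
    obtain ⟨p, hp, q, hq, hpq⟩ := hs
    rw [hbox] at hp hq
    have fin : ∀ c d : Pt, c ≠ d → (c.1 = d.1 ∨ c.2 = d.2) →
        GridStep (xCoords L.length (pairs L)) (yCoords L.length (pairs L)) c d →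
        c ∈ box u ∩ box v → d ∈ box u ∩ box v →
        ((hananBox P u).edges ∩ (hananBox P v).edges).Nonempty := by
      intro c d hcd hax hg hc hd
      have := isHananEdge_of_gridStep hL hcd hax hg
      refine ⟨s(c, d), Finset.mem_inter.2 ⟨(hmem _ _).2 ⟨this, fun z hz => ?_⟩,
        (hmem _ _).2 ⟨this, fun z hz => ?_⟩⟩⟩
      · rcases Sym2.mem_iff.1 hz with rfl | rfl
        exacts [hc.1, hd.1]
      · rcases Sym2.mem_iff.1 hz with rfl | rfl
        exacts [hc.2, hd.2]
    have triv : ∀ (A : Set ℝ) (x : ℝ), ∀ a ∈ A, ¬ (min x x < a ∧ a < max x x) := by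
      intro A x a _ h
      rw [min_self, max_self] at h
      exact lt_asymm h.1 h.2
    rcases lt_or_ge x0 x1 with hlt | hge
    · obtain ⟨c, hc, h1, h2, h3⟩ := exists_next (finite_xCoords _ _) hlt hx.2
      refine fin (x0, y0) (c, y0) (fun e => h1.ne (congrArg Prod.fst e)) (Or.inr rfl)
        ⟨⟨hx.1, hy.1⟩, ⟨hc, hy.1⟩, h3, triv _ _⟩ ((hbox _).2 ⟨⟨le_rfl, hlt.le⟩, le_rfl, ?_⟩)
        ((hbox _).2 ⟨⟨h1.le, h2⟩, le_rfl, ?_⟩) <;> exact hp.2.1.trans hp.2.2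
    -- Without horizontal extent, the two distinct points of the intersection must differ
    -- vertically.
    · have hlt : y0 < y1 := by
        by_contra hn
        refine hpq (Prod.ext ?_ ?_) <;> linarith [hp.1.1, hp.1.2, hq.1.1, hq.1.2, hp.2.1, hp.2.2,
          hq.2.1, hq.2.2, not_lt.1 hn]
      obtain ⟨c, hc, h1, h2, h3⟩ := exists_next (finite_yCoords _ _) hlt hy.2
      refine fin (x0, y0) (x0, c) (fun e => h1.ne (congrArg Prod.snd e)) (Or.inl rfl)
        ⟨⟨hx.1, hy.1⟩, ⟨hx.1, hc⟩, triv _ _, h3⟩ ((hbox _).2 ⟨⟨le_rfl, ?_⟩, le_rfl, hlt.le⟩)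
        ((hbox _).2 ⟨⟨le_rfl, ?_⟩, h1.le, h2⟩) <;> exact hp.1.1.trans hp.1.2

/-- The box of `r` has more than one point in common with every other box. -/
def IsCenter (n : ℕ) (v : ℕ → Pt × Pt) (r : ℕ) : Prop :=
  r < n ∧ ∀ k < n, k ≠ r → ¬ (box (v r) ∩ box (v k)).Subsingleton

theorem pairs_injOn (hn : L.Nodup) {k k' : ℕ} (hk : k < L.length) (hk' : k' < L.length)
    (h : pairs L k = pairs L k') : k = k' := by
  rw [pairs, pairs, List.getD_eq_getElem _ _ hk, List.getD_eq_getElem _ _ hk'] at h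
  exact (hn.getElem_inj_iff).1 h

theorem exists_isCenter (hn : L.Nodup) (hL : ∀ v, v ∈ L ↔ v ∈ P)
    (hs : IsStar (intersectionGraph P)) : ∃ r, IsCenter L.length (pairs L) r := by
  obtain ⟨⟨w, hw⟩, hr⟩ := hs
  obtain ⟨r, hr', rfl⟩ := exists_pairs_eq hL hw
  refine ⟨r, hr', fun k hk hkr => ?_⟩
  have hne : (⟨pairs L r, hw⟩ : {v // v ∈ P}) ≠ ⟨pairs L k, pairs_mem hL hk⟩ := fun e =>
    hkr (pairs_injOn hn hr' hk (congrArg Subtype.val e)).symm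
  refine (adj_iff hL hne).1 ?_
  rw [hr, SimpleGraph.starGraph_adj]
  simp [hne]

/-- The index `r` need not be the center `c` of the given star: with two pairs, both qualify. If two
leaves other than `r` overlapped, one of them would be `c`; since `r` overlaps the other one, that
pair would have to contain `c` as well, which is impossible. -/
theorem leavesDisjoint_of_isCenter (hn : L.Nodup) (hL : ∀ v, v ∈ L ↔ v ∈ P)
    (hs : IsStar (intersectionGraph P)) {r : ℕ} (h : IsCenter L.length (pairs L) r) :
    LeavesDisjoint L.length r (pairs L) := by
  obtain ⟨⟨w, hw⟩, hr⟩ := hs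
  obtain ⟨c, hc, rfl⟩ := exists_pairs_eq hL hw
  have key : ∀ k < L.length, ∀ k' < L.length, k ≠ k' →
      ¬ (box (pairs L k) ∩ box (pairs L k')).Subsingleton → k = c ∨ k' = c := by
    intro k hk k' hk' hne hsub
    have hne' : (⟨pairs L k, pairs_mem hL hk⟩ : {v // v ∈ P}) ≠ ⟨pairs L k', pairs_mem hL hk'⟩ :=
      fun e => hne (pairs_injOn hn hk hk' (congrArg Subtype.val e))
    have hadj := (adj_iff hL hne').2 hsub
    rw [hr, SimpleGraph.starGraph_adj] at hadj
    rcases hadj.2 with e | e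
    · exact Or.inl (pairs_injOn hn hk hc (congrArg Subtype.val e))
    · exact Or.inr (pairs_injOn hn hk' hc (congrArg Subtype.val e))
  intro k hk k' hk' h1 h2 hne
  by_contra hsub
  rcases key k hk k' hk' hne hsub with rfl | rfl
  · rcases key r h.1 k' hk' h2.symm (h.2 k' hk' h2) with e | e
    · exact h1 e.symm
    · exact hne e.symm
  · rcases key r h.1 k hk h1.symm (h.2 k hk h1) with e | e
    · exact h2 e.symm
    · exact hne e

/-! ## From geodesic lists to networks -/

open Classical in
/-- The network formed by the path with vertex sequence `l`. -/
noncomputable def networkOf (l : List Pt) : Network where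
  verts := l.toFinset
  edges := (pathEdges l).filter fun e => ¬ e.IsDiag
  mem_verts _ he _ hp := List.mem_toFinset.2 (mem_of_mem_pathEdges (Finset.mem_filter.1 he).1 hp)
  not_isDiag _ he := (Finset.mem_filter.1 he).2

theorem Geo.networkOf_edges {v : Pt × Pt} {l : List Pt} (h : Geo v l) :
    (networkOf l).edges = pathEdges l := by
  refine Finset.filter_true_of_mem fun e he => ?_
  obtain ⟨p, -, q, -, rfl, hpq⟩ := h.exists_of_mem_pathEdges he
  simpa using hpq.1

theorem Geo.isPathAlong {v : Pt × Pt} {l : List Pt} (h : Geo v l) :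
    (networkOf l).IsPathAlong v.1 v.2 l := ⟨h.1, h.2.1, rfl, h.networkOf_edges⟩

theorem Geo.axisAligned {v : Pt × Pt} {l : List Pt} (h : Geo v l) {e : Sym2 Pt}
    (he : e ∈ pathEdges l) : AxisAligned e := by
  obtain ⟨p, -, q, -, rfl, hpq⟩ := h.exists_of_mem_pathEdges he
  exact ⟨p, q, rfl, hpq.2.1⟩

theorem Geo.isMPath {v : Pt × Pt} {l : List Pt} (h : Geo v l) : (networkOf l).IsMPath v := by
  refine ⟨⟨l, h.isPathAlong⟩, fun e he => ?_, ?_⟩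
  · rw [h.networkOf_edges] at he
    exact h.axisAligned he
  · rw [Network.length, h.networkOf_edges]
    exact h.weight_pathEdges

/-- Every feasible network contains a family of geodesics, to which the optimality in `Solved`
applies. This covers competitors anywhere in the plane and, as a special case, the tuples in `Feas
P`. -/
theorem exists_solution_of_solved (hn : L.Nodup) (hL : ∀ v, v ∈ L ↔ v ∈ P) {out : ℕ → List Pt}
    (hS : Solved L.length (pairs L) out) :
    ∃ π : {v // v ∈ P} → Network,
      (∀ (i : ℕ) (v : {v // v ∈ P}), L[i]? = some v.1 → (π v).IsPathAlong v.1.1 v.1.2 (out i)) ∧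
      π ∈ Opt P ∧ IsMinimumNetwork P (Network.iUnion π) := by
  choose ix hix1 hix2 using fun v : {v // v ∈ P} => exists_pairs_eq hL v.2
  have hgeo : ∀ v : {v // v ∈ P}, Geo v.1 (out (ix v)) := fun v => by
    have := (hS.1 _ (hix1 v)).1
    rwa [hix2] at this
  set π : {v // v ∈ P} → Network := fun v => networkOf (out (ix v)) with hπ
  have hedges : (Network.iUnion π).edges = unionEdges (Finset.range L.length) out := by
    ext e
    simp only [Network.iUnion, unionEdges, Finset.mem_biUnion, Finset.mem_univ, true_and,
      Finset.mem_range]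
    constructor
    · rintro ⟨v, hv⟩
      rw [hπ, (hgeo v).networkOf_edges] at hv
      exact ⟨ix v, hix1 v, hv⟩
    · rintro ⟨k, hk, he⟩
      refine ⟨⟨pairs L k, pairs_mem hL hk⟩, ?_⟩
      rw [hπ, (hgeo _).networkOf_edges]
      rwa [pairs_injOn hn (hix1 _) hk (hix2 ⟨pairs L k, pairs_mem hL hk⟩)]
  have hfeas : ∀ π' : {v // v ∈ P} → Network, (∀ v, (π' v).IsMPath v) →
      IsFeasibleNetwork P (Network.iUnion π') := by
    intro π' h
    refine ⟨fun e he => ?_, fun v hv => ⟨π' ⟨v, hv⟩, ⟨?_, ?_⟩, h ⟨v, hv⟩⟩⟩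
    · obtain ⟨v, -, hv⟩ := Finset.mem_biUnion.1 he
      exact (h v).2.1 e hv
    · exact Finset.subset_biUnion_of_mem (fun v => (π' v).verts) (Finset.mem_univ _)
    · exact Finset.subset_biUnion_of_mem (fun v => (π' v).edges) (Finset.mem_univ _)
  have hmin : ∀ N : Network, IsFeasibleNetwork P N → (Network.iUnion π).length ≤ N.length := by
    intro N hN
    have : ∀ k, ∃ l, k < L.length → Geo (pairs L k) l ∧ pathEdges l ⊆ N.edges := by
      intro k
      by_cases hk : k < L.length
      · obtain ⟨π', h1, h2⟩ := hN.2 _ (pairs_mem hL hk)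
        obtain ⟨l, h3, h4⟩ := exists_geo_of_isMPath h2
        exact ⟨l, fun _ => ⟨h3, h4.trans h1.2⟩⟩
      · exact ⟨[], fun h => absurd h hk⟩
    choose m hm using this
    rw [Network.length, hedges]
    refine (hS.2 m fun k hk => (hm k hk).1).trans (weight_mono ?_)
    exact Finset.biUnion_subset.2 fun k hk => (hm k (Finset.mem_range.1 hk)).2
  have hF : π ∈ Feas P := by
    refine fun v => ⟨(hgeo v).isMPath, ?_, ?_⟩
    · intro p hp
      change p ∈ hananVerts P
      rw [mem_hananVerts_iff hL]
      have hp' : p ∈ out (ix v) := List.mem_toFinset.1 hp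
      have hc := (hS.1 _ (hix1 v)).2
      have h1 := (hgeo v).1
      generalize out (ix v) = l at hp' hc h1
      cases l with
      | nil => simp at hp'
      | cons q l =>
        -- The first point is an end of the pair and so a grid point. This is needed separately,
        -- since a path with one vertex has no `GridStep`.
        have hq : q.1 ∈ xCoords L.length (pairs L) ∧ q.2 ∈ yCoords L.length (pairs L) := by
          simp only [List.head?_cons, Option.some.injEq] at h1
          rw [h1]
          exact ⟨⟨ix v, hix1 v, Or.inl (by rw [hix2])⟩, ⟨ix v, hix1 v, Or.inl (by rw [hix2])⟩⟩
        clear h1 hp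
        induction l generalizing q with
        | nil => rw [List.mem_singleton.1 hp']; exact hq
        | cons z l ih =>
          rw [List.isChain_cons_cons] at hc
          rcases List.mem_cons.1 hp' with rfl | hp'
          · exact hq
          · exact ih z hp' hc.2 hc.1.2.1
    · intro e he
      rw [hπ, (hgeo v).networkOf_edges] at he
      have hc : (out (ix v)).IsChain fun p q => GridStep (xCoords L.length (pairs L))
          (yCoords L.length (pairs L)) p q ∧ Step v.1 p q := by
        have h1 := (hS.1 _ (hix1 v)).2
        have h2 := (hgeo v).2.2
        rw [List.isChain_iff_getElem] at h1 h2 ⊢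
        exact fun i hi => ⟨h1 i hi, h2 i hi⟩
      obtain ⟨p, -, q, -, rfl, hg, hs⟩ := exists_mem_of_mem_pathEdges hc he
      exact mem_hanan_edges.2 (isHananEdge_of_gridStep hL hs.1 hs.2.1 hg)
  refine ⟨π, fun i v hi => ?_, ⟨hF, fun π' hπ' => hmin _ (hfeas π' fun v => (hπ' v).1)⟩,
    hfeas π fun v => (hF v).1, hmin⟩
  obtain ⟨hil, hiv⟩ := List.getElem?_eq_some_iff.1 hi
  have : ix v = i := pairs_injOn hn (hix1 v) hil (by
    rw [hix2, pairs, List.getD_eq_getElem _ _ hil, hiv])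
  rw [hπ, ← this]
  exact (hgeo v).isPathAlong

end Hanan

end GMMN


/-! ### A program logic with time bounds: effects of loop-free code, frames, and a rule for counting
loops. -/

namespace GMMN

namespace RAM

/-! ## Program logic -/

namespace State

variable (σ : State)

@[simp] theorem setI_ireg (x k y : ℕ) : (σ.setI x k).ireg y = if y = x then k else σ.ireg y := by
  simp [setI, Function.update_apply]
@[simp] theorem setI_rreg (x k : ℕ) : (σ.setI x k).rreg = σ.rreg := rfl
@[simp] theorem setI_iarr (x k : ℕ) : (σ.setI x k).iarr = σ.iarr := rfl
@[simp] theorem setI_rarr (x k : ℕ) : (σ.setI x k).rarr = σ.rarr := rfl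
@[simp] theorem setR_rreg (x : ℕ) (z : ℝ) (y : ℕ) :
    (σ.setR x z).rreg y = if y = x then z else σ.rreg y := by
  simp [setR, Function.update_apply]
@[simp] theorem setR_ireg (x : ℕ) (z : ℝ) : (σ.setR x z).ireg = σ.ireg := rfl
@[simp] theorem setR_iarr (x : ℕ) (z : ℝ) : (σ.setR x z).iarr = σ.iarr := rfl
@[simp] theorem setR_rarr (x : ℕ) (z : ℝ) : (σ.setR x z).rarr = σ.rarr := rfl
@[simp] theorem putI_iarr (a i k b : ℕ) :
    (σ.putI a i k).iarr b = if b = a then Function.update (σ.iarr a) i k else σ.iarr b := by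
  simp [putI, Function.update_apply]
@[simp] theorem putI_ireg (a i k : ℕ) : (σ.putI a i k).ireg = σ.ireg := rfl
@[simp] theorem putI_rreg (a i k : ℕ) : (σ.putI a i k).rreg = σ.rreg := rfl
@[simp] theorem putI_rarr (a i k : ℕ) : (σ.putI a i k).rarr = σ.rarr := rfl
@[simp] theorem putR_rarr (a i : ℕ) (z : ℝ) (b : ℕ) :
    (σ.putR a i z).rarr b = if b = a then Function.update (σ.rarr a) i z else σ.rarr b := by
  simp [putR, Function.update_apply]
@[simp] theorem putR_ireg (a i : ℕ) (z : ℝ) : (σ.putR a i z).ireg = σ.ireg := rfl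
@[simp] theorem putR_rreg (a i : ℕ) (z : ℝ) : (σ.putR a i z).rreg = σ.rreg := rfl
@[simp] theorem putR_iarr (a i : ℕ) (z : ℝ) : (σ.putR a i z).iarr = σ.iarr := rfl

end State

/-- Disjunction of tests. -/
def Test.or (b c : Test) : Test := .neg (.conj (.neg b) (.neg c))

/-- Equality test for integers. -/
def Test.ieq (e f : IExpr) : Test := .conj (.neg (.ilt e f)) (.neg (.ilt f e))

@[simp] theorem Test.holds_ilt (σ : State) (e f : IExpr) :
    (Test.ilt e f).Holds σ ↔ e.eval σ < f.eval σ := Iff.rfl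
@[simp] theorem Test.holds_rlt (σ : State) (e f : RExpr) :
    (Test.rlt e f).Holds σ ↔ e.eval σ < f.eval σ := Iff.rfl
@[simp] theorem Test.holds_neg (σ : State) (b : Test) : (Test.neg b).Holds σ ↔ ¬ b.Holds σ :=
  Iff.rfl
@[simp] theorem Test.holds_conj (σ : State) (b c : Test) :
    (Test.conj b c).Holds σ ↔ b.Holds σ ∧ c.Holds σ := Iff.rfl
@[simp] theorem Test.holds_or (σ : State) (b c : Test) :
    (Test.or b c).Holds σ ↔ b.Holds σ ∨ c.Holds σ := by
  simp only [Test.or, Test.holds_neg, Test.holds_conj]; tauto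
@[simp] theorem Test.holds_ieq (σ : State) (e f : IExpr) :
    (Test.ieq e f).Holds σ ↔ e.eval σ = f.eval σ := by
  simp only [Test.ieq, Test.holds_neg, Test.holds_conj, Test.holds_ilt]; omega

/-- The composition of a list of commands. -/
def block : List Cmd → Cmd
  | [] => .skip
  | c :: cs => .seq c (block cs)

/-- `for x in 0, …, e - 1 do c`, for commands `c` that do not change `x` or the value of `e`. -/
def forLoop (x : ℕ) (e : IExpr) (c : Cmd) : Cmd :=
  .seq (.iset x (.const 0)) (.loop (.ilt (.reg x) e) (.seq c (.iset x (.add (.reg x) (.const 1)))))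

namespace Cmd

/-- A command without loops. -/
def loopFree : Cmd → Bool
  | seq c d => c.loopFree && d.loopFree
  | ite _ c d => c.loopFree && d.loopFree
  | loop _ _ => false
  | _ => true

open Classical in
/-- The effect of a command without loops. -/
noncomputable def run : Cmd → State → State
  | skip, σ => σ
  | iset x e, σ => σ.setI x (e.eval σ)
  | rset x e, σ => σ.setR x (e.eval σ)
  | iput a i e, σ => σ.putI a (i.eval σ) (e.eval σ)
  | rput a i e, σ => σ.putR a (i.eval σ) (e.eval σ)
  | seq c d, σ => d.run (c.run σ)
  | ite b c d, σ => if b.Holds σ then c.run σ else d.run σ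
  | loop _ _, σ => σ

/-- A time bound for a command without loops. -/
def size : Cmd → ℕ
  | skip => 1
  | iset _ e => e.cost + 1
  | rset _ e => e.cost + 1
  | iput _ i e => i.cost + e.cost + 1
  | rput _ i e => i.cost + e.cost + 1
  | seq c d => c.size + d.size
  | ite b c d => b.cost + 1 + (c.size + d.size)
  | loop _ _ => 0

/-- The command may write to the integer register `x`. -/
def wI (x : ℕ) : Cmd → Bool
  | iset y _ => x == y
  | seq c d => c.wI x || d.wI x
  | ite _ c d => c.wI x || d.wI x
  | loop _ c => c.wI x
  | _ => false

/-- The command may write to the real register `x`. -/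
def wR (x : ℕ) : Cmd → Bool
  | rset y _ => x == y
  | seq c d => c.wR x || d.wR x
  | ite _ c d => c.wR x || d.wR x
  | loop _ c => c.wR x
  | _ => false

/-- The command may write to the integer array `a`. -/
def wIA (a : ℕ) : Cmd → Bool
  | iput b _ _ => a == b
  | seq c d => c.wIA a || d.wIA a
  | ite _ c d => c.wIA a || d.wIA a
  | loop _ c => c.wIA a
  | _ => false

/-- The command may write to the real array `a`. -/
def wRA (a : ℕ) : Cmd → Bool
  | rput b _ _ => a == b
  | seq c d => c.wRA a || d.wRA a
  | ite _ c d => c.wRA a || d.wRA a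
  | loop _ c => c.wRA a
  | _ => false

end Cmd

theorem exec_run (c : Cmd) (h : c.loopFree = true) (σ : State) :
    ∃ t ≤ c.size, Exec c σ (c.run σ) t := by
  induction c generalizing σ with
  | skip => exact ⟨_, le_rfl, .skip σ⟩
  | iset x e => exact ⟨_, le_rfl, .iset σ x e⟩
  | rset x e => exact ⟨_, le_rfl, .rset σ x e⟩
  | iput a i e => exact ⟨_, le_rfl, .iput σ a i e⟩
  | rput a i e => exact ⟨_, le_rfl, .rput σ a i e⟩
  | seq c d ihc ihd =>
    simp only [Cmd.loopFree, Bool.and_eq_true] at h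
    obtain ⟨s, hs, h1⟩ := ihc h.1 σ
    obtain ⟨t, ht, h2⟩ := ihd h.2 (c.run σ)
    exact ⟨s + t, Nat.add_le_add hs ht, .seq h1 h2⟩
  | ite b c d ihc ihd =>
    simp only [Cmd.loopFree, Bool.and_eq_true] at h
    by_cases hb : b.Holds σ
    · obtain ⟨s, hs, h1⟩ := ihc h.1 σ
      refine ⟨_, ?_, by rw [Cmd.run, if_pos hb]; exact .ite_true hb h1⟩
      simp only [Cmd.size]; omega
    · obtain ⟨s, hs, h1⟩ := ihd h.2 σ
      refine ⟨_, ?_, by rw [Cmd.run, if_neg hb]; exact .ite_false hb h1⟩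
      simp only [Cmd.size]; omega
  | loop b c _ => simp [Cmd.loopFree] at h

/-- The memory that the command `c` does not write to is the same in `σ` and `τ`. -/
structure Agree (c : Cmd) (σ τ : State) : Prop where
  i : ∀ x, c.wI x = false → τ.ireg x = σ.ireg x
  r : ∀ x, c.wR x = false → τ.rreg x = σ.rreg x
  ia : ∀ a, c.wIA a = false → τ.iarr a = σ.iarr a
  ra : ∀ a, c.wRA a = false → τ.rarr a = σ.rarr a

theorem Agree.refl (c : Cmd) (σ : State) : Agree c σ σ :=
  ⟨fun _ _ => rfl, fun _ _ => rfl, fun _ _ => rfl, fun _ _ => rfl⟩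

theorem Agree.trans {c : Cmd} {σ τ υ : State} (h : Agree c σ τ) (h' : Agree c τ υ) : Agree c σ υ :=
  ⟨fun x hx => (h'.i x hx).trans (h.i x hx), fun x hx => (h'.r x hx).trans (h.r x hx),
    fun x hx => (h'.ia x hx).trans (h.ia x hx), fun x hx => (h'.ra x hx).trans (h.ra x hx)⟩

theorem Agree.mono {c d : Cmd} {σ τ : State} (h : Agree c σ τ) (hi : ∀ x, d.wI x = false → c.wI x =
    false)
    (hr : ∀ x, d.wR x = false → c.wR x = false) (hia : ∀ x, d.wIA x = false → c.wIA x = false)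
    (hra : ∀ x, d.wRA x = false → c.wRA x = false) : Agree d σ τ :=
  ⟨fun x hx => h.i x (hi x hx), fun x hx => h.r x (hr x hx), fun x hx => h.ia x (hia x hx),
    fun x hx => h.ra x (hra x hx)⟩

/-- The frame property. The sets of written registers and arrays are computed from the syntax, so
for concrete programs its side conditions hold by `rfl`. -/
theorem Exec.agree {c : Cmd} {σ τ : State} {T : ℕ} (h : Exec c σ τ T) : Agree c σ τ := by
  induction h with
  | skip => exact Agree.refl _ _
  | iset σ x e =>
    refine ⟨fun y hy => ?_, fun _ _ => rfl, fun _ _ => rfl, fun _ _ => rfl⟩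
    simp only [Cmd.wI, beq_eq_false_iff_ne] at hy
    simp [hy]
  | rset σ x e =>
    refine ⟨fun _ _ => rfl, fun y hy => ?_, fun _ _ => rfl, fun _ _ => rfl⟩
    simp only [Cmd.wR, beq_eq_false_iff_ne] at hy
    simp [hy]
  | iput σ a i e =>
    refine ⟨fun _ _ => rfl, fun _ _ => rfl, fun y hy => ?_, fun _ _ => rfl⟩
    simp only [Cmd.wIA, beq_eq_false_iff_ne] at hy
    simp [hy]
  | rput σ a i e =>
    refine ⟨fun _ _ => rfl, fun _ _ => rfl, fun _ _ => rfl, fun y hy => ?_⟩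
    simp only [Cmd.wRA, beq_eq_false_iff_ne] at hy
    simp [hy]
  | seq _ _ h1 h2 =>
    refine (h1.mono ?_ ?_ ?_ ?_).trans (h2.mono ?_ ?_ ?_ ?_) <;>
      simp +contextual [Cmd.wI, Cmd.wR, Cmd.wIA, Cmd.wRA]
  | ite_true _ _ h1 =>
    refine h1.mono ?_ ?_ ?_ ?_ <;> simp +contextual [Cmd.wI, Cmd.wR, Cmd.wIA, Cmd.wRA]
  | ite_false _ _ h1 =>
    refine h1.mono ?_ ?_ ?_ ?_ <;> simp +contextual [Cmd.wI, Cmd.wR, Cmd.wIA, Cmd.wRA]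
  | loop_true _ _ _ h1 h2 =>
    refine Agree.trans (c := .loop _ _) (h1.mono ?_ ?_ ?_ ?_) h2 <;>
      simp +contextual [Cmd.wI, Cmd.wR, Cmd.wIA, Cmd.wRA]
  | loop_false _ => exact Agree.refl _ _

/-- The command `c` halts on `σ` within time `T`, in a state that satisfies `Q`. -/
def wp (c : Cmd) (T : ℕ) (Q : State → Prop) (σ : State) : Prop :=
  ∃ τ t, Exec c σ τ t ∧ t ≤ T ∧ Q τ

section Rules

variable {c d : Cmd} {T T' : ℕ} {Q R : State → Prop} {σ : State}

theorem wp.mono (h : wp c T Q σ) (hT : T ≤ T') (hQ : ∀ τ, Agree c σ τ → Q τ → R τ) :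
    wp c T' R σ := by
  obtain ⟨τ, t, h1, h2, h3⟩ := h
  exact ⟨τ, t, h1, h2.trans hT, hQ τ h1.agree h3⟩

theorem wp_run (hc : c.loopFree = true) (h : Q (c.run σ)) (hT : c.size ≤ T) : wp c T Q σ := by
  obtain ⟨t, ht, h1⟩ := exec_run c hc σ
  exact ⟨_, t, h1, ht.trans hT, h⟩

theorem wp_seq {S : ℕ} (h : wp c S (wp d T Q) σ) (hT : S + T ≤ T') : wp (.seq c d) T' Q σ := by
  obtain ⟨τ, s, h1, h2, υ, t, h3, h4, h5⟩ := h
  exact ⟨υ, s + t, .seq h1 h3, by omega, h5⟩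

theorem wp_block_nil (h : Q σ) (hT : 1 ≤ T) : wp (block []) T Q σ := ⟨σ, 1, .skip σ, hT, h⟩

theorem wp_block_cons {cs : List Cmd} {S : ℕ} (h : wp c S (wp (block cs) T Q) σ) (hT : S + T ≤ T') :
    wp (block (c :: cs)) T' Q σ := wp_seq h hT

theorem wp_ite {b : Test} (h1 : b.Holds σ → wp c T Q σ) (h2 : ¬ b.Holds σ → wp d T Q σ)
    (hT : b.cost + 1 + T ≤ T') : wp (.ite b c d) T' Q σ := by
  by_cases hb : b.Holds σ
  · obtain ⟨τ, t, h3, h4, h5⟩ := h1 hb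
    exact ⟨τ, _, .ite_true hb h3, by omega, h5⟩
  · obtain ⟨τ, t, h3, h4, h5⟩ := h2 hb
    exact ⟨τ, _, .ite_false hb h3, by omega, h5⟩

theorem agree_forLoop_of_agree {x : ℕ} {e : IExpr} {τ : State} (h : Agree c σ τ) :
    Agree (forLoop x e c) σ τ := by
  refine h.mono ?_ ?_ ?_ ?_ <;>
    simp +contextual [forLoop, Cmd.wI, Cmd.wR, Cmd.wIA, Cmd.wRA]

theorem agree_forLoop_setI {x : ℕ} {e : IExpr} (k : ℕ) : Agree (forLoop x e c) σ (σ.setI x k) := by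
  refine ⟨fun y hy => ?_, fun _ _ => rfl, fun _ _ => rfl, fun _ _ => rfl⟩
  simp only [forLoop, Cmd.wI, Bool.or_eq_false_iff, beq_eq_false_iff_ne] at hy
  simp [hy.1]

/-- Memory untouched by the loop is available through `Agree`, so invariants mention only what
changes. Besides the body, a round costs `e.cost + 3` for the test and `4` for the increment;
initialization and last test cost `2` and `e.cost + 3`. The body time `t` may vary from round to
round, as needed when boxes of different sizes are labelled. -/
theorem wp_for (x : ℕ) (e : IExpr) (Inv : ℕ → State → Prop) (N : ℕ) (t : ℕ → ℕ)
    (hx : c.wI x = false) (hinit : Inv 0 (σ.setI x 0))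
    (hN : ∀ τ, Agree (forLoop x e c) σ τ → e.eval τ = N)
    (hstep : ∀ k < N, ∀ τ, Agree (forLoop x e c) σ τ → Inv k τ → τ.ireg x = k →
      wp c (t k) (fun υ => Inv (k + 1) (υ.setI x (k + 1))) τ)
    (hQ : ∀ τ, Agree (forLoop x e c) σ τ → Inv N τ → Q τ)
    (hT : ∑ k ∈ Finset.range N, (t k + (e.cost + 7)) + (e.cost + 5) ≤ T) :
    wp (forLoop x e c) T Q σ := by
  -- Induction on the number `j` of rounds that are left.
  have key : ∀ j, j ≤ N → ∀ τ, Agree (forLoop x e c) σ τ → Inv (N - j) τ → τ.ireg x = N - j →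
      wp (.loop (.ilt (.reg x) e) (.seq c (.iset x (.add (.reg x) (.const 1)))))
        (∑ k ∈ Finset.Ico (N - j) N, (t k + (e.cost + 7)) + (e.cost + 3)) Q τ := by
    intro j
    induction j with
    | zero =>
      intro _ τ hA hI hk
      refine ⟨τ, _, .loop_false ?_, ?_, hQ τ hA (by simpa using hI)⟩
      · simp [IExpr.eval, hN τ hA, hk]
      · simp only [Test.cost, IExpr.cost]; omega
    | succ j ih =>
      intro hj τ hA hI hk
      obtain ⟨υ, s, h1, h2, h3⟩ := hstep (N - (j + 1)) (by omega) τ hA hI hk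
      have hυ : υ.ireg x = N - (j + 1) := (h1.agree.i x hx).trans hk
      have hsucc : N - (j + 1) + 1 = N - j := by omega
      rw [hsucc] at h3
      have hA' : Agree (forLoop x e c) σ (υ.setI x (N - j)) :=
        (hA.trans (agree_forLoop_of_agree h1.agree)).trans (agree_forLoop_setI _)
      obtain ⟨φ, u, h4, h5, h6⟩ := ih (by omega) _ hA' h3 (by simp)
      have hset : Exec (.iset x (.add (.reg x) (.const 1))) υ (υ.setI x (N - j)) 4 := by
        have := Exec.iset υ x (.add (.reg x) (.const 1))
        simpa [IExpr.eval, IExpr.cost, hυ, hsucc] using this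
      refine ⟨φ, _, .loop_true ?_ (.seq h1 hset) h4, ?_, h6⟩
      · simp only [Test.holds_ilt, IExpr.eval, hN τ hA, hk]; omega
      · rw [Finset.sum_eq_sum_Ico_succ_bot (show N - (j + 1) < N by omega), hsucc]
        simp only [Test.cost, IExpr.cost]; omega
  obtain ⟨τ, s, h1, h2, h3⟩ :=
      key N le_rfl (σ.setI x 0) (agree_forLoop_setI 0) (by simpa using hinit)
    (by simp)
  refine ⟨τ, _, .seq (.iset σ x (.const 0)) h1, ?_, h3⟩
  simp only [Nat.sub_self, ← Finset.range_eq_Ico] at h2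
  simp only [IExpr.cost]
  omega

theorem wp_for_const (x : ℕ) (e : IExpr) (Inv : ℕ → State → Prop) (N t : ℕ)
    (hx : c.wI x = false) (hinit : Inv 0 (σ.setI x 0))
    (hN : ∀ τ, Agree (forLoop x e c) σ τ → e.eval τ = N)
    (hstep : ∀ k < N, ∀ τ, Agree (forLoop x e c) σ τ → Inv k τ → τ.ireg x = k →
      wp c t (fun υ => Inv (k + 1) (υ.setI x (k + 1))) τ)
    (hQ : ∀ τ, Agree (forLoop x e c) σ τ → Inv N τ → Q τ)
    (hT : N * (t + (e.cost + 7)) + (e.cost + 5) ≤ T) :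
    wp (forLoop x e c) T Q σ := by
  refine wp_for x e Inv N (fun _ => t) hx hinit hN hstep hQ ?_
  simpa using hT

end Rules

end RAM

end GMMN


/-! ### Testing all pairs of boxes for a center, and reflecting its direction to the positive
quadrant. -/

namespace GMMN

namespace RAM

/-! ## Finding the center and normalizing its direction -/

/-- Real register `x` becomes the minimum of `e` and `f`. -/
def setMin (x : ℕ) (e f : RExpr) : Cmd := .ite (.rlt e f) (.rset x e) (.rset x f)

/-- Real register `x` becomes the maximum of `e` and `f`. -/
def setMax (x : ℕ) (e f : RExpr) : Cmd := .ite (.rlt e f) (.rset x f) (.rset x e)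

@[simp] theorem run_setMin (x : ℕ) (e f : RExpr) (σ : State) :
    (setMin x e f).run σ = σ.setR x (min (e.eval σ) (f.eval σ)) := by
  simp only [setMin, Cmd.run, Test.holds_rlt]
  split_ifs with h
  · rw [min_eq_left h.le]
  · rw [min_eq_right (not_lt.1 h)]

@[simp] theorem run_setMax (x : ℕ) (e f : RExpr) (σ : State) :
    (setMax x e f).run σ = σ.setR x (max (e.eval σ) (f.eval σ)) := by
  simp only [setMax, Cmd.run, Test.holds_rlt]
  split_ifs with h
  · rw [max_eq_right h.le]
  · rw [max_eq_left (not_lt.1 h)]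

/-- Compute in the real registers `lo`, `hi` the ends of the intersection of the intervals that the
entries of the arrays `a`, `b` span at the indices in the integer registers `10` and `11`. -/
def interCmd (a b lo hi : ℕ) : Cmd :=
  block [setMin 0 (.get a (.reg 10)) (.get b (.reg 10)),
    setMin 1 (.get a (.reg 11)) (.get b (.reg 11)),
    setMax lo (.reg 0) (.reg 1),
    setMax 0 (.get a (.reg 10)) (.get b (.reg 10)), setMax 1 (.get a (.reg 11)) (.get b (.reg 11)),
    setMin hi (.reg 0) (.reg 1)]

/-- The box with lower left corner in the real registers `4`, `6` and upper right corner in the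
registers `5`, `7` has at least two points. -/
def overlapTest : Test :=
  .conj (.conj (.neg (.rlt (.reg 5) (.reg 4))) (.neg (.rlt (.reg 7) (.reg 6))))
    (.or (.rlt (.reg 4) (.reg 5)) (.rlt (.reg 6) (.reg 7)))

/-- Clear integer register `12` if the boxes of the pairs with indices in `10` and `11` have at most
one common point. -/
def checkPair : Cmd :=
  .ite (.ieq (.reg 10) (.reg 11)) .skip
    (block [interCmd 0 2 4 5, interCmd 1 3 6 7, .ite overlapTest .skip (.iset 12 (.const 0))])

/-- Store the index of a center in integer register `1`. -/
def findCenter : Cmd :=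
  forLoop 10 (.reg 0) (block [.iset 12 (.const 1), forLoop 11 (.reg 0) checkPair,
    .ite (.ieq (.reg 12) (.const 1)) (.iset 1 (.reg 10)) .skip])

/-- The pairs `v k`, `k < n`, are stored in the real arrays `0, 1, 2, 3`. -/
structure Stores (n : ℕ) (v : ℕ → Pt × Pt) (σ : State) : Prop where
  n_eq : σ.ireg 0 = n
  sx : ∀ k < n, σ.rarr 0 k = (v k).1.1
  sy : ∀ k < n, σ.rarr 1 k = (v k).1.2
  tx : ∀ k < n, σ.rarr 2 k = (v k).2.1
  ty : ∀ k < n, σ.rarr 3 k = (v k).2.2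

theorem Stores.congr {n : ℕ} {v : ℕ → Pt × Pt} {σ τ : State} (h : Stores n v σ)
    (h0 : τ.ireg 0 = σ.ireg 0) (ha : ∀ a < 4, τ.rarr a = σ.rarr a) : Stores n v τ :=
  ⟨h0.trans h.n_eq, fun k hk => by rw [ha 0 (by omega), h.sx k hk],
    fun k hk => by rw [ha 1 (by omega), h.sy k hk], fun k hk => by rw [ha 2 (by omega), h.tx k hk],
    fun k hk => by rw [ha 3 (by omega), h.ty k hk]⟩

/-- The ends of the intersection of two boxes. -/
theorem not_subsingleton_box_inter (u v : Pt × Pt) : ¬ (box u ∩ box v).Subsingleton ↔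
    (¬ (min (max u.1.1 u.2.1) (max v.1.1 v.2.1) < max (min u.1.1 u.2.1) (min v.1.1 v.2.1)) ∧
      ¬ (min (max u.1.2 u.2.2) (max v.1.2 v.2.2) < max (min u.1.2 u.2.2) (min v.1.2 v.2.2))) ∧
    (max (min u.1.1 u.2.1) (min v.1.1 v.2.1) < min (max u.1.1 u.2.1) (max v.1.1 v.2.1) ∨
      max (min u.1.2 u.2.2) (min v.1.2 v.2.2) < min (max u.1.2 u.2.2) (max v.1.2 v.2.2)) := by
  set x0 := max (min u.1.1 u.2.1) (min v.1.1 v.2.1) with hx0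
  set x1 := min (max u.1.1 u.2.1) (max v.1.1 v.2.1) with hx1
  set y0 := max (min u.1.2 u.2.2) (min v.1.2 v.2.2) with hy0
  set y1 := min (max u.1.2 u.2.2) (max v.1.2 v.2.2) with hy1
  have hbox : ∀ p : Pt, p ∈ box u ∩ box v ↔ (x0 ≤ p.1 ∧ p.1 ≤ x1) ∧ (y0 ≤ p.2 ∧ p.2 ≤ y1) := by
    intro p
    rw [Set.mem_inter_iff, mem_box_iff, mem_box_iff, max_le_iff, le_min_iff, max_le_iff, le_min_iff]
    tauto
  rw [Set.not_subsingleton_iff]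
  constructor
  · rintro ⟨p, hp, q, hq, hpq⟩
    rw [hbox] at hp hq
    refine ⟨⟨not_lt.2 (hp.1.1.trans hp.1.2), not_lt.2 (hp.2.1.trans hp.2.2)⟩, ?_⟩
    by_contra hn
    rw [not_or, not_lt, not_lt] at hn
    refine hpq (Prod.ext ?_ ?_) <;>
      linarith [hp.1.1, hp.1.2, hq.1.1, hq.1.2, hp.2.1, hp.2.2, hq.2.1, hq.2.2, hn.1, hn.2]
  · rintro ⟨⟨h1, h2⟩, h3⟩
    rw [not_lt] at h1 h2
    refine ⟨(x0, y0), (hbox _).2 ⟨⟨le_rfl, h1⟩, le_rfl, h2⟩, (x1, y1),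
      (hbox _).2 ⟨⟨h1, le_rfl⟩, h2, le_rfl⟩, fun e => ?_⟩
    rw [Prod.mk.injEq] at e
    rcases h3 with h | h
    · exact h.ne e.1
    · exact h.ne e.2

theorem run_checkPair {n : ℕ} {v : ℕ → Pt × Pt} {σ : State} (h : Stores n v σ) {u k : ℕ}
    (hu : u < n) (hk : k < n) (h10 : σ.ireg 10 = u) (h11 : σ.ireg 11 = k) :
    ((checkPair.run σ).ireg 12 = σ.ireg 12 ∧ (k ≠ u → ¬ (box (v u) ∩ box (v k)).Subsingleton)) ∨
      ((checkPair.run σ).ireg 12 = 0 ∧ k ≠ u ∧ (box (v u) ∩ box (v k)).Subsingleton) := by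
  by_cases hku : k = u
  · simp [checkPair, Cmd.run, IExpr.eval, h10, h11, hku]
  · have hku' : u ≠ k := fun e => hku e.symm
    by_cases hs : (box (v u) ∩ box (v k)).Subsingleton
    · right
      have := mt (not_subsingleton_box_inter (v u) (v k)).2 (not_not.2 hs)
      simp only [checkPair, Cmd.run, IExpr.eval, h10, h11, block, interCmd, overlapTest,
        Test.holds_ieq, hku', if_false, Test.holds_conj, Test.holds_neg, Test.holds_rlt,
        Test.holds_or, run_setMin, run_setMax, RExpr.eval, State.setR_rreg, State.setR_rarr,
        State.setR_ireg]
      simp only [h.sx k hk, h.sx u hu, h.sy k hk, h.sy u hu, h.tx k hk, h.tx u hu, h.ty k hk,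
        h.ty u hu, reduceIte, Nat.reduceEqDiff, OfNat.ofNat_ne_zero, OfNat.ofNat_ne_one,
          OfNat.zero_ne_ofNat,
        zero_ne_one]
      rw [if_neg this]
      simp [hs, hku]
    · left
      have := (not_subsingleton_box_inter (v u) (v k)).1 hs
      simp only [checkPair, Cmd.run, IExpr.eval, h10, h11, block, interCmd, overlapTest,
        Test.holds_ieq, hku', if_false, Test.holds_conj, Test.holds_neg, Test.holds_rlt,
        Test.holds_or, run_setMin, run_setMax, RExpr.eval, State.setR_rreg, State.setR_rarr,
        State.setR_ireg]
      simp only [h.sx k hk, h.sx u hu, h.sy k hk, h.sy u hu, h.tx k hk, h.tx u hu, h.ty k hk,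
        h.ty u hu, reduceIte, Nat.reduceEqDiff, OfNat.ofNat_ne_zero, OfNat.ofNat_ne_one,
          OfNat.zero_ne_ofNat,
        zero_ne_one]
      rw [if_pos this]
      simp [hs]

theorem wp_findCenter {n : ℕ} {v : ℕ → Pt × Pt} {σ : State} (h : Stores n v σ)
    (hc : ∃ r, IsCenter n v r) :
    wp findCenter (n * (n * 300 + 300) + 100) (fun τ => IsCenter n v (τ.ireg 1)) σ := by
  -- Once an index below `u` is a center, register `1` holds some center. A later center may
  -- overwrite an earlier one, which does no harm.
  refine wp_for_const 10 (.reg 0) (fun u τ => ∀ u' < u, IsCenter n v u' → IsCenter n v (τ.ireg 1))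
    n (n * 300 + 250) rfl (by simp) (fun τ hA => ?_) (fun u hu τ hA hI h10 => ?_)
    (fun τ hA hI => ?_) (by simp [IExpr.cost]; nlinarith)
  · exact (hA.i 0 rfl).trans h.n_eq
  · refine wp_block_cons (wp_run rfl ?_ le_rfl) (S := 2) (T := n * 300 + 248) (by omega)
    refine wp_block_cons (T := 100) (S := n * 220 + 40) (wp_for_const 11 (.reg 0) (fun k υ =>
      υ.ireg 12 = 1 ↔ ∀ k' < k, k' ≠ u → ¬ (box (v u) ∩ box (v k')).Subsingleton)
      n 200 rfl (by simp [Cmd.run, IExpr.eval]) (fun υ hB => ?_) (fun k hk υ hB hI' h11 => ?_)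
      (fun υ hB hI' => ?_) (by simp [IExpr.cost]; omega)) (by omega)
    · rw [IExpr.eval, hB.i 0 rfl]
      exact (hA.i 0 rfl).trans h.n_eq
    · refine wp_run rfl ?_ (by decide : checkPair.size ≤ 200)
      have hS : Stores n v υ := h.congr ((hB.i 0 rfl).trans (hA.i 0 rfl)) fun a ha => by
        interval_cases a <;> exact (hB.ra _ rfl).trans (hA.ra _ rfl)
      have h10' : υ.ireg 10 = u := (hB.i 10 rfl).trans h10
      rcases run_checkPair hS hu hk h10' h11 with ⟨e, h1⟩ | ⟨e, h1, h2⟩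
      · simp only [State.setI_ireg, Nat.reduceEqDiff, if_false, e, hI']
        constructor
        · intro h3 k' hk' hne
          rcases Nat.lt_succ_iff_lt_or_eq.1 hk' with hk' | rfl
          · exact h3 k' hk' hne
          · exact h1 hne
        · exact fun h3 k' hk' => h3 k' (by omega)
      · rw [State.setI_ireg, if_neg (by omega), e]
        exact iff_of_false (by omega) fun h3 => absurd h2 (h3 k (by omega) h1)
    · refine wp_block_cons (S := 30) (T := 1) (wp_run rfl ?_ (by decide)) (by omega)
      refine wp_block_nil ?_ le_rfl
      have h10' : υ.ireg 10 = u := (hB.i 10 rfl).trans h10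
      have h1 : υ.ireg 1 = τ.ireg 1 := hB.i 1 rfl
      simp only [Cmd.run, Test.holds_ieq, IExpr.eval, h10', hI']
      intro u' hu' hcu
      split_ifs with h2
      · simpa using ⟨hu, hI'.1 ((Test.holds_ieq _ _ _).1 h2)⟩
      · rcases Nat.lt_succ_iff_lt_or_eq.1 hu' with hu' | rfl
        · simpa [h1] using hI u' hu' hcu
        · exact absurd ((Test.holds_ieq υ (.reg 12) (.const 1)).2 (hI'.2 hcu.2)) h2
  · obtain ⟨r, hr⟩ := hc
    exact hI r hr.1 hr

/-- If the center goes against the direction of the axis with coordinates in the arrays `a`, `b`,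
then negate these coordinates, and record this in the integer register `f`. -/
def flip (f a b : ℕ) : Cmd :=
  .ite (.rlt (.get b (.reg 1)) (.get a (.reg 1)))
    (block [.iset f (.const 1), forLoop 10 (.reg 0)
      (block [.rput a (.reg 10) (.sub .zero (.get a (.reg 10))),
        .rput b (.reg 10) (.sub .zero (.get b (.reg 10)))])]) .skip

/-- Negate the first entries of the array `a`, up to the number in integer register `7`, if the
integer register `f` is `1`. -/
def unflip (f a : ℕ) : Cmd :=
  .ite (.ieq (.reg f) (.const 1))
    (forLoop 10 (.reg 7) (.rput a (.reg 10) (.sub .zero (.get a (.reg 10))))) .skip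

/-- The sign recorded in a flag. -/
def sign (f : ℕ) : ℝ := if f = 1 then -1 else 1

theorem sign_eq (f : ℕ) : sign f = 1 ∨ sign f = -1 := by
  unfold sign; split_ifs <;> simp

theorem wp_flip {n : ℕ} {σ : State} (f a b : ℕ) (hf : f ≠ 10 ∧ f ≠ 0 ∧ f ≠ 1) (hab : a ≠ b)
    (hn : σ.ireg 0 = n) (hr : σ.ireg 1 < n) (h0 : σ.ireg f = 0) :
    wp (flip f a b) (n * 30 + 30) (fun τ =>
      (∀ k < n, τ.rarr a k = sign (τ.ireg f) * σ.rarr a k ∧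
        τ.rarr b k = sign (τ.ireg f) * σ.rarr b k) ∧
      τ.rarr a (σ.ireg 1) ≤ τ.rarr b (σ.ireg 1)) σ := by
  refine wp_ite (T := n * 30 + 22) (fun hb => ?_) (fun hb => ?_)
      (by simp [Test.cost, RExpr.cost, IExpr.cost]; omega)
  · refine wp_block_cons (S := 2) (T := n * 30 + 20) (wp_run rfl ?_ le_rfl) (by omega)
    refine wp_block_cons (S := n * 30 + 10) (T := 1)
        (wp_for_const 10 (.reg 0) (fun k τ => τ.ireg f = 1 ∧
      (∀ i, τ.rarr a i = if i < k then - σ.rarr a i else σ.rarr a i) ∧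
      (∀ i, τ.rarr b i = if i < k then - σ.rarr b i else σ.rarr b i)) n 18 rfl ?_ (fun τ hA => ?_)
      (fun k hk τ hA hI h10 => ?_) (fun τ hA hI => ?_) (by simp [IExpr.cost]; omega)) (by omega)
    · simp [Cmd.run, IExpr.eval, hf]
    · rw [IExpr.eval, hA.i 0 (by simp [forLoop, Cmd.wI, block]), ← hn]
      simp [Cmd.run, hf.2.1.symm]
    · refine wp_run rfl ?_ (by simp [Cmd.size, block, IExpr.cost, RExpr.cost])
      obtain ⟨h1, h2, h3⟩ := hI
      have hba : b ≠ a := fun e => hab e.symm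
      simp only [block, Cmd.run, IExpr.eval, RExpr.eval, State.putR_ireg, h10, State.putR_rarr,
        State.setI_rarr, State.setI_ireg, if_neg hf.1, h1, true_and, if_neg hba, if_neg hab,
          if_true,
        Function.update_apply, h2, h3]
      constructor <;> intro i <;> split_ifs <;> first | omega | simp_all
    · refine wp_block_nil ?_ le_rfl
      obtain ⟨h1, h2, h3⟩ := hI
      simp only [Test.holds_rlt, RExpr.eval, IExpr.eval] at hb
      refine ⟨fun k hk => ?_, ?_⟩
      · simp [h1, h2, h3, hk, sign]
      · simp only [h2, h3, hr, if_true]; linarith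
  · refine wp_run rfl ?_ (by simp [Cmd.size])
    simp only [Test.holds_rlt, RExpr.eval, IExpr.eval, not_lt] at hb
    simpa [Cmd.run, h0, sign] using hb

theorem wp_unflip {σ : State} (f a : ℕ) :
    wp (unflip f a) (σ.ireg 7 * 30 + 30) (fun τ =>
      (∀ k < σ.ireg 7, τ.rarr a k = sign (σ.ireg f) * σ.rarr a k)) σ := by
  refine wp_ite (T := σ.ireg 7 * 30 + 15) (fun hb => ?_) (fun hb => ?_)
    (by simp [Test.ieq, Test.cost, IExpr.cost]; omega)
  · refine wp_for_const 10 (.reg 7) (fun k τ =>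
      (∀ i, τ.rarr a i = if i < k then - σ.rarr a i else σ.rarr a i)) (σ.ireg 7) 18 rfl (by simp)
      (fun τ hA => ?_) (fun k hk τ hA hI h10 => ?_) (fun τ hA hI => ?_)
        (by simp [IExpr.cost]; omega)
    · exact hA.i 7 rfl
    · refine wp_run rfl ?_ (by simp [Cmd.size, IExpr.cost, RExpr.cost])
      simp only [Cmd.run, IExpr.eval, RExpr.eval, h10, State.putR_rarr,
        State.setI_rarr, if_true, Function.update_apply, hI]
      intro i; split_ifs <;> first | omega | simp_all
    · intro k hk
      simp only [Test.holds_ieq, IExpr.eval] at hb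
      simp [hI, hk, hb, sign]
  · refine wp_run rfl ?_ (by simp [Cmd.size])
    simp only [Test.holds_ieq, IExpr.eval] at hb
    simp [Cmd.run, sign, hb]

end RAM

end GMMN


/-! ### Quadratic selection sort, ranks of the coordinates, and tabulated row offsets. -/

namespace GMMN

namespace RAM

/-! ## Sorting the coordinates -/

/-- If the entry of the array `a` at the index in integer register `11` is larger than the last
  number
found so far, and smaller than the best candidate for the next one, then make it the candidate. -/
def consider (cnt a : ℕ) : Cmd :=
  .ite (.conj (.or (.ieq (.reg cnt) (.const 0)) (.rlt (.reg 0) (.get a (.reg 11))))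
      (.or (.ieq (.reg 12) (.const 0)) (.rlt (.get a (.reg 11)) (.reg 1))))
    (block [.rset 1 (.get a (.reg 11)), .iset 12 (.const 1)]) .skip

/-- Append the candidate, if there is one, to the array `dst` of length `cnt`. -/
def appendBest (cnt dst : ℕ) : Cmd :=
  .ite (.ieq (.reg 12) (.const 1)) (block [.rput dst (.reg cnt) (.reg 1), .rset 0 (.reg 1),
    .iset cnt (.add (.reg cnt) (.const 1))]) .skip

/-- Store the distinct entries of the arrays `a` and `b`, in increasing order, in the array `dst`,
  and
their number in the integer register `cnt`. -/
def sortDistinct (cnt a b dst : ℕ) : Cmd :=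
  block [.iset cnt (.const 0), forLoop 10 (.add (.add (.reg 0) (.reg 0)) (.const 1))
    (block [.iset 12 (.const 0), forLoop 11 (.reg 0) (block [consider cnt a, consider cnt b]),
      appendBest cnt dst])]

/-- `best` is the least eligible element of `S` if `found = 1`, and there is none if `found = 0`. -/
def IsBest (elig : ℝ → Prop) (S : Set ℝ) (found : ℕ) (best : ℝ) : Prop :=
  (found = 0 ∧ ∀ x ∈ S, ¬ elig x) ∨
    (found = 1 ∧ best ∈ S ∧ elig best ∧ ∀ x ∈ S, elig x → best ≤ x)

theorem isBest_consider {cnt a : ℕ} {S : Set ℝ} {σ : State} {elig : ℝ → Prop}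
    (he : ∀ x, elig x ↔ σ.ireg cnt = 0 ∨ σ.rreg 0 < x)
    (h : IsBest elig S (σ.ireg 12) (σ.rreg 1)) :
    IsBest elig (insert (σ.rarr a (σ.ireg 11)) S) (((consider cnt a).run σ).ireg 12)
      (((consider cnt a).run σ).rreg 1) := by
  set x := σ.rarr a (σ.ireg 11) with hx
  by_cases hc : elig x ∧ (σ.ireg 12 = 0 ∨ x < σ.rreg 1)
  · have hrun : (consider cnt a).run σ = (σ.setR 1 x).setI 12 1 := by
      rw [consider, Cmd.run, if_pos]
      · simp [block, Cmd.run, RExpr.eval, IExpr.eval, hx]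
      · simpa [RExpr.eval, IExpr.eval, ← hx, ← he] using hc
    rw [hrun]
    refine Or.inr ⟨by simp, by simp, by simpa using hc.1, fun y hy hye => ?_⟩
    simp only [State.setI_rreg, State.setR_rreg, if_true]
    rcases hy with rfl | hy
    · exact le_rfl
    · rcases h with ⟨-, h2⟩ | ⟨h1, -, -, h4⟩
      · exact absurd hye (h2 y hy)
      · exact (hc.2.resolve_left (by omega)).le.trans (h4 y hy hye)
  · have hrun : (consider cnt a).run σ = σ := by
      rw [consider, Cmd.run, if_neg, Cmd.run]
      simpa [RExpr.eval, IExpr.eval, ← hx, ← he] using hc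
    rw [hrun]
    rcases h with ⟨h1, h2⟩ | ⟨h1, h2, h3, h4⟩
    · refine Or.inl ⟨h1, ?_⟩
      rintro y (rfl | hy)
      · exact fun hy => hc ⟨hy, Or.inl h1⟩
      · exact h2 y hy
    · refine Or.inr ⟨h1, Or.inr h2, h3, ?_⟩
      rintro y (rfl | hy) hye
      · by_contra hlt
        exact hc ⟨hye, Or.inr (not_le.1 hlt)⟩
      · exact h4 y hy hye

/-- The first `k` entries of `A` and `B`. -/
def entries (A B : ℕ → ℝ) (k : ℕ) : Set ℝ := {x | ∃ k' < k, x = A k' ∨ x = B k'}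

theorem entries_succ (A B : ℕ → ℝ) (k : ℕ) :
    entries A B (k + 1) = insert (B k) (insert (A k) (entries A B k)) := by
  ext x
  simp only [entries, Set.mem_ofPred_eq, Set.mem_insert_iff]
  constructor
  · rintro ⟨k', hk', h⟩
    rcases Nat.lt_succ_iff_lt_or_eq.1 hk' with hk' | rfl
    · exact Or.inr (Or.inr ⟨k', hk', h⟩)
    · tauto
  · rintro (h | h | ⟨k', hk', h⟩)
    · exact ⟨k, by omega, Or.inr h⟩
    · exact ⟨k, by omega, Or.inl h⟩
    · exact ⟨k', by omega, h⟩

/-- `X` enumerates `S` in increasing order up to `N`. -/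
structure Enumerates (X : ℕ → ℝ) (N : ℕ) (S : Set ℝ) : Prop where
  lt : ∀ i j, i < j → j < N → X i < X j
  mem : ∀ i < N, X i ∈ S
  cover : ∀ x ∈ S, ∃ i < N, X i = x

/-- This bounds the number of distinct coordinates, and with it the number of successful rounds of
the sort. -/
theorem card_le_of_strictMono {A B X : ℕ → ℝ} {n N : ℕ} (h1 : ∀ i j, i < j → j < N → X i < X j)
    (h2 : ∀ i < N, X i ∈ entries A B n) : N ≤ n + n := by
  have hinj : Set.InjOn X (Finset.range N : Set ℕ) := by
    intro i hi j hj hij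
    simp only [Finset.coe_range, Set.mem_Iio] at hi hj
    by_contra hne
    rcases lt_or_gt_of_ne hne with h | h
    · exact (h1 i j h hj).ne hij
    · exact (h1 j i h hi).ne hij.symm
  have hsub : (Finset.range N).image X ⊆ (Finset.range n).image A ∪ (Finset.range n).image B := by
    intro x hx
    obtain ⟨i, hi, rfl⟩ := Finset.mem_image.1 hx
    obtain ⟨k, hk, h | h⟩ := h2 i (Finset.mem_range.1 hi)
    · exact Finset.mem_union_left _ (Finset.mem_image.2 ⟨k, Finset.mem_range.2 hk, h.symm⟩)
    · exact Finset.mem_union_right _ (Finset.mem_image.2 ⟨k, Finset.mem_range.2 hk, h.symm⟩)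
  have h3 := Finset.card_le_card hsub
  rw [Finset.card_image_of_injOn hinj, Finset.card_range] at h3
  refine h3.trans ((Finset.card_union_le _ _).trans ?_)
  have h4 := Finset.card_image_le (s := Finset.range n) (f := A)
  have h5 := Finset.card_image_le (s := Finset.range n) (f := B)
  rw [Finset.card_range] at h4 h5
  omega

/-- Each round is a linear scan for the least number above the last one stored. The last clause of
the outer invariant says that either every round so far has stored a number, or all numbers are
already stored. -/
theorem wp_sortDistinct {n : ℕ} {σ : State} (cnt a b dst : ℕ)
    (hcnt : cnt ≠ 0 ∧ cnt ≠ 10 ∧ cnt ≠ 11 ∧ cnt ≠ 12) (ha : a ≠ dst) (hb : b ≠ dst)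
    (hn : σ.ireg 0 = n) :
    wp (sortDistinct cnt a b dst) ((n + n + 1) * (n * 100 + 100) + 100) (fun τ =>
      Enumerates (τ.rarr dst) (τ.ireg cnt) (entries (σ.rarr a) (σ.rarr b) n) ∧
        τ.ireg cnt ≤ n + n) σ := by
  obtain ⟨hc0, hc10, hc11, hc12⟩ := hcnt
  set S := entries (σ.rarr a) (σ.rarr b) n with hS
  refine wp_block_cons (S := 2) (T := (n + n + 1) * (n * 100 + 100) + 98) (wp_run rfl ?_ le_rfl)
    (by omega)
  refine wp_block_cons (S := (n + n + 1) * (n * 100 + 100) + 50) (T := 1)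
    (wp_for_const 10 _ (fun u τ =>
      (∀ i j, i < j → j < τ.ireg cnt → τ.rarr dst i < τ.rarr dst j) ∧
      (∀ i < τ.ireg cnt, τ.rarr dst i ∈ S) ∧
      (0 < τ.ireg cnt → τ.rreg 0 = τ.rarr dst (τ.ireg cnt - 1)) ∧
      (∀ x ∈ S, (∃ i < τ.ireg cnt, τ.rarr dst i = x) ∨ (τ.ireg cnt = 0 ∨ τ.rreg 0 < x)) ∧
      (τ.ireg cnt = u ∨ ∀ x ∈ S, ∃ i < τ.ireg cnt, τ.rarr dst i = x))
      (n + n + 1) (n * 100 + 80) ?_ ?_ (fun τ hA => ?_) (fun u hu τ hA hI h10 => ?_)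
      (fun τ hA hI => ?_) (by simp [IExpr.cost]; nlinarith)) (by omega)
  · simp [block, consider, appendBest, forLoop, Cmd.wI, hc10.symm]
  · simp [Cmd.run, IExpr.eval, hc10]
  · have := hA.i 0 (by simp [block, consider, appendBest, forLoop, Cmd.wI, hc0.symm])
    simp only [IExpr.eval, this]
    simp [Cmd.run, hc0.symm, hn]
  · have hn0 : τ.ireg 0 = n := by
      rw [hA.i 0 (by simp [block, consider, appendBest, forLoop, Cmd.wI, hc0.symm]), ← hn]
      simp [Cmd.run, hc0.symm]
    have hra : τ.rarr a = σ.rarr a := by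
      rw [hA.ra a (by simp [block, consider, appendBest, forLoop, Cmd.wRA, ha])]; rfl
    have hrb : τ.rarr b = σ.rarr b := by
      rw [hA.ra b (by simp [block, consider, appendBest, forLoop, Cmd.wRA, hb])]; rfl
    -- Real register `0` holds the last number stored. It has no meaning while nothing is stored,
    -- and then everything is eligible.
    set elig : ℝ → Prop := fun x => τ.ireg cnt = 0 ∨ τ.rreg 0 < x with helig
    refine wp_block_cons (S := 2) (T := n * 100 + 78) (wp_run rfl ?_ le_rfl) (by omega)
    refine wp_block_cons (S := n * 100 + 30) (T := 48) (wp_for_const 11 (.reg 0) (fun k υ =>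
      IsBest elig (entries (σ.rarr a) (σ.rarr b) k) (υ.ireg 12) (υ.rreg 1)) n 90 rfl ?_
      (fun υ hB => ?_) (fun k hk υ hB hI' h11 => ?_) (fun υ hB hI' => ?_)
      (by simp [IExpr.cost]; omega)) (by omega)
    · exact Or.inl ⟨by simp [Cmd.run, IExpr.eval], by simp [entries]⟩
    · rw [IExpr.eval, hB.i 0 rfl]; simpa [Cmd.run] using hn0
    · refine wp_run rfl ?_ (by simp [consider, Cmd.size, block, IExpr.cost, RExpr.cost, Test.cost,
          Test.or, Test.ieq])
      have hr0 : υ.rreg 0 = τ.rreg 0 := by rw [hB.r 0 rfl]; rfl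
      have hic : υ.ireg cnt = τ.ireg cnt := by
        rw [hB.i cnt (by simp [block, consider, forLoop, Cmd.wI, hc11, hc12])]
        simp [Cmd.run, hc12]
      have ea : υ.rarr a = σ.rarr a := by rw [hB.ra a rfl, ← hra]; rfl
      have eb : υ.rarr b = σ.rarr b := by rw [hB.ra b rfl, ← hrb]; rfl
      obtain ⟨t1, -, h1⟩ := exec_run (consider cnt a) rfl υ
      have hA1 := h1.agree
      have b1 := isBest_consider (a := a) (elig := elig) (σ := υ)
        (fun x => by rw [helig, hic, hr0]) hI'
      have b2 := isBest_consider (a := b) (elig := elig) (σ := (consider cnt a).run υ)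
        (fun x => by
          rw [helig, hA1.i cnt (by simp [block, consider, Cmd.wI, hc12]), hA1.r 0 rfl, hic, hr0]) b1
      rw [hA1.i 11 rfl, hA1.ra b rfl, h11, ea, eb] at b2
      rw [entries_succ]
      simpa [block, Cmd.run] using b2
    · refine wp_block_cons (S := 30) (T := 1) (wp_run rfl ?_
        (by simp [appendBest, Cmd.size, block, IExpr.cost, RExpr.cost, Test.cost, Test.ieq]))
          (by omega)
      refine wp_block_nil ?_ le_rfl
      have hr0 : υ.rreg 0 = τ.rreg 0 := by rw [hB.r 0 rfl]; rfl
      have hic : υ.ireg cnt = τ.ireg cnt := by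
        rw [hB.i cnt (by simp [block, consider, forLoop, Cmd.wI, hc11, hc12])]
        simp [Cmd.run, hc12]
      have hd : υ.rarr dst = τ.rarr dst := by rw [hB.ra dst rfl]; rfl
      obtain ⟨I1, I2, I3, I4, I5⟩ := hI
      rcases hI' with ⟨f0, hnone⟩ | ⟨f1, hbS, hbe, hmin⟩
      · have hrun : (appendBest cnt dst).run υ = υ := by
          rw [appendBest, Cmd.run, if_neg, Cmd.run]
          simp [IExpr.eval, f0]
        have hcov : ∀ x ∈ S, ∃ i < τ.ireg cnt, τ.rarr dst i = x := fun x hx =>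
          (I4 x hx).resolve_right (hnone x hx)
        simp only [hrun, State.setI_ireg, if_neg hc10, State.setI_rarr, State.setI_rreg, hic, hd,
            hr0]
        exact ⟨I1, I2, I3, I4, Or.inr hcov⟩
      · have hrun : (appendBest cnt dst).run υ =
            (((υ.putR dst (υ.ireg cnt) (υ.rreg 1)).setR 0 (υ.rreg 1)).setI cnt (υ.ireg cnt +
              1)) := by
          rw [appendBest, Cmd.run, if_pos]
          · simp [block, Cmd.run, RExpr.eval, IExpr.eval]
          · simp [IExpr.eval, f1]
        have hold : ∀ i < τ.ireg cnt, τ.rarr dst i < υ.rreg 1 := by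
          intro i hi
          have h1 := I3 (by omega)
          have h2 : τ.rreg 0 < υ.rreg 1 := hbe.resolve_left (by omega)
          rcases Nat.lt_or_ge i (τ.ireg cnt - 1) with h3 | h3
          · have := I1 i (τ.ireg cnt - 1) h3 (by omega)
            linarith
          · have : i = τ.ireg cnt - 1 := by omega
            rw [this, ← h1]; exact h2
        simp only [hrun, State.setI_ireg, if_neg hc10, State.setI_rarr, State.setI_rreg, hic, hd,
          if_true, State.setR_rreg, State.setR_rarr, State.putR_rarr, Function.update_apply,
          Nat.add_sub_cancel]
        refine ⟨fun i j hij hj => ?_, fun i hi => ?_, fun _ => by simp, fun x hx => ?_, Or.inl ?_⟩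
        · rw [if_neg (show i ≠ τ.ireg cnt by omega)]
          split_ifs with h1
          · exact hold i (by omega)
          · exact I1 i j hij (by omega)
        · split_ifs with h1
          · exact hbS
          · exact I2 i (by omega)
        · rcases I4 x hx with ⟨i, hi, hix⟩ | hex
          · exact Or.inl ⟨i, by omega, by rw [if_neg (by omega), hix]⟩
          · rcases (hmin x hx hex).eq_or_lt with e | hlt
            · exact Or.inl ⟨τ.ireg cnt, by omega, by rw [if_pos rfl, e]⟩
            · exact Or.inr (Or.inr hlt)
        · rcases I5 with h | h
          · rw [h]
          · obtain ⟨i, hi, he⟩ := h _ hbS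
            exact absurd he (hold i hi).ne
  · refine wp_block_nil ?_ le_rfl
    obtain ⟨I1, I2, -, -, I5⟩ := hI
    have hle := card_le_of_strictMono I1 I2
    -- There were `n + n + 1` rounds but at most `n + n` distinct numbers, so not every round stored
    -- one.
    exact ⟨⟨I1, I2, I5.resolve_left (by omega)⟩, hle⟩

/-- Store the positions of the entries of `src` in the sorted array `srt` in the array `dst`. -/
def indexOf (cnt src srt dst : ℕ) : Cmd :=
  forLoop 10 (.reg 0) (block [.iset 12 (.const 0),
    forLoop 11 (.reg cnt) (.ite (.rlt (.get srt (.reg 11)) (.get src (.reg 10)))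
      (.iset 12 (.add (.reg 11) (.const 1))) .skip),
    .iput dst (.reg 10) (.reg 12)])

theorem wp_indexOf {n : ℕ} {σ : State} (cnt src srt dst : ℕ)
    (hcnt : cnt ≠ 0 ∧ cnt ≠ 10 ∧ cnt ≠ 11 ∧ cnt ≠ 12) (hn : σ.ireg 0 = n) (hle : σ.ireg cnt ≤ n + n)
    (hlt : ∀ i j, i < j → j < σ.ireg cnt → σ.rarr srt i < σ.rarr srt j)
    (hcov : ∀ k < n, ∃ i < σ.ireg cnt, σ.rarr srt i = σ.rarr src k) :
    wp (indexOf cnt src srt dst) (n * (n * 100 + 100) + 100) (fun τ =>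
      ∀ k < n, τ.iarr dst k < σ.ireg cnt ∧ σ.rarr srt (τ.iarr dst k) = σ.rarr src k) σ := by
  obtain ⟨hc0, hc10, hc11, hc12⟩ := hcnt
  have hm : ∀ {i j}, i < σ.ireg cnt → j < σ.ireg cnt → (σ.rarr srt i < σ.rarr srt j ↔ i < j) := by
    intro i j hi hj
    refine ⟨fun h => ?_, fun h => hlt i j h hj⟩
    by_contra hij
    rcases (not_lt.1 hij).eq_or_lt with e | e
    · rw [e] at h; exact lt_irrefl _ h
    · exact lt_asymm h (hlt j i e hi)
  refine wp_for_const 10 (.reg 0) (fun u τ => ∀ k < u, τ.iarr dst k < σ.ireg cnt ∧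
    σ.rarr srt (τ.iarr dst k) = σ.rarr src k) n (n * 100 + 80) rfl (by simp) (fun τ hA => ?_)
    (fun u hu τ hA hI h10 => ?_) (fun τ hA hI => hI) (by simp [IExpr.cost]; nlinarith)
  · exact (hA.i 0 rfl).trans hn
  · obtain ⟨i0, hi0, he0⟩ := hcov u hu
    have hcτ : τ.ireg cnt = σ.ireg cnt :=
        hA.i cnt (by simp [block, forLoop, Cmd.wI, hc10, hc11, hc12])
    refine wp_block_cons (S := 2) (T := n * 100 + 78) (wp_run rfl ?_ le_rfl) (by omega)
    -- The entries below the sought one are exactly those at positions before `i0`, so the last such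
    -- position plus one, among the first `i`, is `min i i0`.
    refine wp_block_cons (S := n * 100 + 30) (T := 30) (wp_for_const 11 (.reg cnt) (fun i υ =>
      υ.ireg 12 = min i i0) (σ.ireg cnt) 30 rfl ?_
      (fun υ hB => ?_) (fun i hi υ hB hI' h11 => ?_) (fun υ hB hI' => ?_)
      (by simp [IExpr.cost]; nlinarith)) (by omega)
    · simp [Cmd.run, IExpr.eval]
    · rw [IExpr.eval, hB.i cnt (by simp [forLoop, Cmd.wI, hc11, hc12])]
      simp [Cmd.run, hc12, hcτ]
    · refine wp_run rfl ?_ (by simp [Cmd.size, IExpr.cost, RExpr.cost, Test.cost])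
      have e1 : υ.rarr srt = σ.rarr srt := by rw [hB.ra srt rfl, ← hA.ra srt rfl]; rfl
      have e2 : υ.rarr src = σ.rarr src := by rw [hB.ra src rfl, ← hA.ra src rfl]; rfl
      have e3 : υ.ireg 10 = u := by rw [hB.i 10 rfl, ← h10]; simp [Cmd.run]
      simp only [Cmd.run, Test.holds_rlt, RExpr.eval, IExpr.eval, e1, e2, e3, h11, ← he0, hm hi hi0]
      split_ifs with h
      · simp; omega
      · simp [hI']; omega
    · refine wp_block_cons (S := 20) (T := 1) (wp_run rfl ?_
        (by simp [Cmd.size, IExpr.cost])) (by omega)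
      refine wp_block_nil ?_ le_rfl
      have e3 : υ.ireg 10 = u := by rw [hB.i 10 rfl, ← h10]; simp [Cmd.run]
      have e4 : υ.iarr dst = τ.iarr dst := by rw [hB.ia dst rfl]; rfl
      have e5 : υ.ireg 12 = i0 := by rw [hI']; omega
      simp only [Cmd.run, IExpr.eval, e3, e5, State.setI_iarr, State.putI_iarr, if_true, e4,
        Function.update_apply]
      intro k hk
      split_ifs with h
      · exact ⟨hi0, by rw [h, he0]⟩
      · exact hI k (by omega)

/-- Store the multiples of twice the number of pairs in the integer array `5`. -/
def multiples : Cmd :=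
  block [.iset 6 (.add (.reg 0) (.reg 0)), .iset 12 (.const 0),
    forLoop 10 (.reg 6) (block [.iput 5 (.reg 10) (.reg 12), .iset 12 (.add (.reg 12) (.reg 6))])]

/-- Grid point `(i, j)` is stored at `i * (n + n) + j`. The machine cannot multiply, so the row
offsets are produced by repeated addition. -/
theorem wp_multiples {n : ℕ} {σ : State} (hn : σ.ireg 0 = n) :
    wp multiples (n * 60 + 40) (fun τ => τ.ireg 6 = n + n ∧ ∀ i < n + n, τ.iarr 5 i =
      i * (n + n)) σ := by
  refine wp_block_cons (S := 4) (T := n * 60 + 30) (wp_run rfl ?_ le_rfl) (by omega)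
  refine wp_block_cons (S := 2) (T := n * 60 + 28) (wp_run rfl ?_ le_rfl) (by omega)
  refine wp_block_cons (S := n * 60 + 20) (T := 1) (wp_for_const 10 (.reg 6) (fun u τ =>
    τ.ireg 6 = n + n ∧ τ.ireg 12 = u * (n + n) ∧ ∀ i < u, τ.iarr 5 i = i * (n + n))
      (n + n) 12 rfl ?_
    (fun τ hA => ?_) (fun u hu τ hA hI h10 => ?_) (fun τ hA hI => ?_)
    (by simp [IExpr.cost]; omega)) (by omega)
  · simp [Cmd.run, IExpr.eval, hn]
  · rw [IExpr.eval, hA.i 6 rfl]; simp [Cmd.run, IExpr.eval, hn]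
  · refine wp_run rfl ?_ (by simp [Cmd.size, block, IExpr.cost])
    obtain ⟨h1, h2, h3⟩ := hI
    simp [block, Cmd.run, IExpr.eval, h1, h2, h10, Function.update_apply]
    refine ⟨by ring, fun i hi => ?_⟩
    split_ifs with h
    · rw [h]
    · exact h3 i (by omega)
  · exact wp_block_nil ⟨hI.1, hI.2.2⟩ le_rfl

end RAM

end GMMN


/-! ### Labels and gains of edges: the boxes of the leaves are small in total and do not interfere.
-/

namespace GMMN

namespace Layout

variable {n r : ℕ} {v : ℕ → Pt × Pt} (L : Layout n r v)

theorem lt_of_inEdge {d : Bool} {k i j : ℕ} (hk : k < n) (h : L.InEdge d k i j) :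
    i < L.NX ∧ j < L.NY := by
  have h1 := L.max_x_lt hk
  have h2 := L.max_y_lt hk
  cases d <;> simp only [InEdge, Bool.false_eq_true, if_false, if_true] at h <;> omega

theorem mem_box_of_le {k i j : ℕ} (hk : k < n)
    (hi : min (L.sx k) (L.tx k) ≤ i ∧ i ≤ max (L.sx k) (L.tx k))
    (hj : min (L.sy k) (L.ty k) ≤ j ∧ j ≤ max (L.sy k) (L.ty k)) : L.pt (i, j) ∈ box (v k) := by
  have h1 := L.max_x_lt hk
  have h2 := L.max_y_lt hk
  exact (L.mem_box_iff hk).2 ⟨⟨L.X_le hi.1 (by omega), L.X_le hi.2 h1⟩,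
    ⟨L.Y_le hj.1 (by omega), L.Y_le hj.2 h2⟩⟩

/-- The boxes of two leaves have no common edge. -/
theorem inEdge_unique (hd : LeavesDisjoint n r v) {d : Bool} {k k' i j : ℕ} (hk : k < n)
    (hk' : k' < n) (hr : k ≠ r) (hr' : k' ≠ r) (h : L.InEdge d k i j) (h' : L.InEdge d k' i j) :
    k = k' := by
  by_contra hne
  have hs := hd k hk k' hk' hr hr' hne
  have hN := L.lt_of_inEdge hk h
  cases d
  · simp only [InEdge, Bool.false_eq_true, if_false] at h h'
    have := hs ⟨L.mem_box_of_le hk (i := i) (j := j) (by omega) (by omega),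
      L.mem_box_of_le hk' (i := i) (j := j) (by omega) (by omega)⟩
      ⟨L.mem_box_of_le hk (i := i) (j := j - 1) (by omega) (by omega),
      L.mem_box_of_le hk' (i := i) (j := j - 1) (by omega) (by omega)⟩
    exact (L.Y_lt (j - 1) j (by omega) hN.2).ne' (congrArg Prod.snd this)
  · simp only [InEdge, if_true] at h h'
    have := hs ⟨L.mem_box_of_le hk (i := i) (j := j) (by omega) (by omega),
      L.mem_box_of_le hk' (i := i) (j := j) (by omega) (by omega)⟩
      ⟨L.mem_box_of_le hk (i := i - 1) (j := j) (by omega) (by omega),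
      L.mem_box_of_le hk' (i := i - 1) (j := j) (by omega) (by omega)⟩
    exact (L.X_lt (i - 1) i (by omega) hN.1).ne' (congrArg Prod.fst this)

/-- The number of grid points in the box of `v k`. -/
def area (k : ℕ) : ℕ :=
  (max (L.sx k) (L.tx k) + 1 - min (L.sx k) (L.tx k)) *
    (max (L.sy k) (L.ty k) + 1 - min (L.sy k) (L.ty k))

open Classical in
/-- The edges in direction `d` in the box of `v k`, as their end points. -/
noncomputable def inEdges (d : Bool) (k : ℕ) : Finset (ℕ × ℕ) :=
  (Finset.range L.NX ×ˢ Finset.range L.NY).filter fun p => L.InEdge d k p.1 p.2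

/-- A box of extents `a` and `b` has `(a + 1) * (b + 1)` grid points and `a * (b + 1) + (a + 1) * b`
edges; the extra `1` pays for boxes that are a single point. -/
theorem area_le {k : ℕ} (hk : k < n) :
    L.area k ≤ 1 + (L.inEdges true k).card + (L.inEdges false k).card := by
  have h1 := L.max_x_lt hk
  have h2 := L.max_y_lt hk
  have e1 : L.inEdges true k = Finset.Ioc (min (L.sx k) (L.tx k)) (max (L.sx k) (L.tx k)) ×ˢ
      Finset.Icc (min (L.sy k) (L.ty k)) (max (L.sy k) (L.ty k)) := by
    ext ⟨i, j⟩
    simp only [inEdges, InEdge, Finset.mem_filter, Finset.mem_product, Finset.mem_range, if_true,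
      Finset.mem_Ioc, Finset.mem_Icc]
    omega
  have e2 : L.inEdges false k = Finset.Icc (min (L.sx k) (L.tx k)) (max (L.sx k) (L.tx k)) ×ˢ
      Finset.Ioc (min (L.sy k) (L.ty k)) (max (L.sy k) (L.ty k)) := by
    ext ⟨i, j⟩
    simp only [inEdges, InEdge, Finset.mem_filter, Finset.mem_product, Finset.mem_range,
      Bool.false_eq_true, if_false, Finset.mem_Ioc, Finset.mem_Icc]
    omega
  rw [e1, e2, Finset.card_product, Finset.card_product, Nat.card_Ioc, Nat.card_Icc, Nat.card_Icc,
    Nat.card_Ioc, area]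
  obtain ⟨a, ha⟩ : ∃ a, max (L.sx k) (L.tx k) = min (L.sx k) (L.tx k) + a :=
    ⟨_, (Nat.add_sub_of_le min_le_max).symm⟩
  obtain ⟨b, hb⟩ : ∃ b, max (L.sy k) (L.ty k) = min (L.sy k) (L.ty k) + b :=
    ⟨_, (Nat.add_sub_of_le min_le_max).symm⟩
  rw [ha, hb]
  have f1 : ∀ x y : ℕ, x + y + 1 - x = y + 1 := by intros; omega
  have f2 : ∀ x y : ℕ, x + y - x = y := by intros; omega
  simp only [f1, f2]
  nlinarith

open Classical in
/-- The boxes of the leaves have linearly many grid points in the size of the grid. -/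
theorem sum_area_le (hd : LeavesDisjoint n r v) :
    ∑ k ∈ Finset.range n, (if k = r then 0 else L.area k) ≤ n + 2 * (L.NX * L.NY) := by
  -- For different leaves these are disjoint sets of edges, each encoded by its end point in the
  -- grid.
  have hcard : ∀ d, ∑ k ∈ (Finset.range n).erase r, (L.inEdges d k).card ≤ L.NX * L.NY := by
    intro d
    rw [← Finset.card_biUnion]
    · refine (Finset.card_le_card (t := Finset.range L.NX ×ˢ Finset.range L.NY)
        (Finset.biUnion_subset.2 fun k _ => Finset.filter_subset _ _)).trans ?_
      simp
    · intro k hk k' hk' hne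
      rw [Finset.mem_coe, Finset.mem_erase, Finset.mem_range] at hk hk'
      refine Finset.disjoint_left.2 fun p hp hp' => hne ?_
      exact L.inEdge_unique hd hk.2 hk'.2 hk.1 hk'.1 (Finset.mem_filter.1 hp).2
        (Finset.mem_filter.1 hp').2
  have h1 : ∑ k ∈ Finset.range n, (if k = r then 0 else L.area k) =
      ∑ k ∈ (Finset.range n).erase r, L.area k := by
    rw [← Finset.sum_erase_add _ _ (Finset.mem_range.2 L.hr), if_pos rfl, add_zero]
    exact Finset.sum_congr rfl fun k hk => if_neg (Finset.ne_of_mem_erase hk)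
  rw [h1]
  calc _ ≤ ∑ k ∈ (Finset.range n).erase r,
    (1 + (L.inEdges true k).card + (L.inEdges false k).card) :=
        Finset.sum_le_sum fun k hk => L.area_le (Finset.mem_range.1 (Finset.mem_of_mem_erase hk))
    _ ≤ _ := by
        rw [Finset.sum_add_distrib, Finset.sum_add_distrib]
        have := hcard true
        have := hcard false
        have : ∑ k ∈ (Finset.range n).erase r, 1 ≤ n := by
          simpa using Finset.card_erase_le (s := Finset.range n) (a := r)
        omega

/-- The edges in `S` are labelled, and all others are not. -/
def LabelledOn (S : ℕ → ℕ → ℕ → Prop) (I : Bool → ℕ → ℕ → ℕ) (G : Bool → ℕ → ℕ → ℝ) (M : ℕ) :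
    Prop :=
  ∀ d i j, j < M →
    (∀ k, S k i j → L.InEdge d k i j → I d i j = L.lab k ∧ G d i j = L.len d i j) ∧
    ((∀ k, S k i j → ¬ L.InEdge d k i j) → I d i j = 0 ∧ G d i j = 0)

variable {L} in
-- Only triples whose edge lies in the box of `k` matter. This absorbs the differences between loop
-- ranges and box boundaries.
theorem LabelledOn.congr {S S' : ℕ → ℕ → ℕ → Prop} {I : Bool → ℕ → ℕ → ℕ} {G : Bool → ℕ → ℕ → ℝ}
    {M : ℕ} (h : L.LabelledOn S I G M)
    (hS : ∀ d k i j, L.InEdge d k i j → (S k i j ↔ S' k i j)) : L.LabelledOn S' I G M := by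
  intro d i j hj
  obtain ⟨h1, h2⟩ := h d i j hj
  exact ⟨fun k hk hin => h1 k ((hS d k i j hin).2 hk) hin,
    fun hk => h2 fun k hk' hin => hk k ((hS d k i j hin).1 hk') hin⟩

end Layout

namespace RAM

/-! ## Labelling the edges -/

/-- The layout `L` is stored in memory. -/
structure Loaded {n r : ℕ} {v : ℕ → Pt × Pt} (L : Layout n r v) (σ : State) : Prop where
  n_eq : σ.ireg 0 = n
  r_eq : σ.ireg 1 = r
  M_eq : σ.ireg 6 = n + n
  NX_le : L.NX ≤ n + n
  NY_le : L.NY ≤ n + n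
  rows : ∀ i < n + n, σ.iarr 5 i = i * (n + n)
  sx : σ.iarr 1 = L.sx
  sy : σ.iarr 2 = L.sy
  tx : σ.iarr 3 = L.tx
  ty : σ.iarr 4 = L.ty
  X : σ.rarr 6 = L.X
  Y : σ.rarr 7 = L.Y

theorem Loaded.congr {n r : ℕ} {v : ℕ → Pt × Pt} {L : Layout n r v} {σ τ : State} (h : Loaded L σ)
    (h0 : τ.ireg 0 = σ.ireg 0) (h1 : τ.ireg 1 = σ.ireg 1) (h6 : τ.ireg 6 = σ.ireg 6)
    (hia : ∀ a, 1 ≤ a → a ≤ 5 → τ.iarr a = σ.iarr a) (h7 : τ.rarr 6 = σ.rarr 6)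
    (h8 : τ.rarr 7 = σ.rarr 7) : Loaded L τ where
  n_eq := h0.trans h.n_eq
  r_eq := h1.trans h.r_eq
  M_eq := h6.trans h.M_eq
  NX_le := h.NX_le
  NY_le := h.NY_le
  rows i hi := by rw [hia 5 (by omega) (by omega)]; exact h.rows i hi
  sx := (hia 1 (by omega) (by omega)).trans h.sx
  sy := (hia 2 (by omega) (by omega)).trans h.sy
  tx := (hia 3 (by omega) (by omega)).trans h.tx
  ty := (hia 4 (by omega) (by omega)).trans h.ty
  X := h7.trans h.X
  Y := h8.trans h.Y

theorem Loaded.of_agree {n r : ℕ} {v : ℕ → Pt × Pt} {L : Layout n r v} {c : Cmd} {σ τ : State}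
    (h : Loaded L σ) (hA : Agree c σ τ) (h0 : c.wI 0 = false := by rfl)
    (h1 : c.wI 1 = false := by rfl) (h6 : c.wI 6 = false := by rfl)
    (hia : c.wIA 1 = false ∧ c.wIA 2 = false ∧ c.wIA 3 = false ∧ c.wIA 4 = false ∧
      c.wIA 5 = false := by exact ⟨rfl, rfl, rfl, rfl, rfl⟩)
    (h7 : c.wRA 6 = false := by rfl) (h8 : c.wRA 7 = false := by rfl) : Loaded L τ :=
  h.congr (hA.i 0 h0) (hA.i 1 h1) (hA.i 6 h6)
    (fun a ha ha' => by
      obtain ⟨e1, e2, e3, e4, e5⟩ := hia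
      interval_cases a
      exacts [hA.ia 1 e1, hA.ia 2 e2, hA.ia 3 e3, hA.ia 4 e4, hA.ia 5 e5])
    (hA.ra 6 h7) (hA.ra 7 h8)

/-- The labels of the edges stored in memory. -/
def labels (M : ℕ) (σ : State) (d : Bool) (i j : ℕ) : ℕ := σ.iarr (if d then 6 else 7) (i * M + j)

/-- The gains of the edges stored in memory. -/
def gains (M : ℕ) (σ : State) (d : Bool) (i j : ℕ) : ℝ := σ.rarr (if d then 8 else 9) (i * M + j)

theorem cell_inj {M i j i' j' : ℕ} (hj : j < M) (hj' : j' < M) :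
    i * M + j = i' * M + j' ↔ i = i' ∧ j = j' := by
  refine ⟨fun h => ?_, fun ⟨h1, h2⟩ => by rw [h1, h2]⟩
  have h1 : i = i' := by
    have e1 : (i * M + j) / M = i := by
      rw [Nat.add_comm, Nat.add_mul_div_right _ _ (by omega), Nat.div_eq_of_lt hj, zero_add]
    have e2 : (i' * M + j') / M = i' := by
      rw [Nat.add_comm, Nat.add_mul_div_right _ _ (by omega), Nat.div_eq_of_lt hj', zero_add]
    rw [← e1, ← e2, h]
  subst h1
  exact ⟨rfl, by omega⟩

/-- Integer register `x` becomes the minimum of `e` and `f`. -/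
def setIMin (x : ℕ) (e f : IExpr) : Cmd := .ite (.ilt e f) (.iset x e) (.iset x f)

/-- Integer register `x` becomes the maximum of `e` and `f`. -/
def setIMax (x : ℕ) (e f : IExpr) : Cmd := .ite (.ilt e f) (.iset x f) (.iset x e)

@[simp] theorem run_setIMin (x : ℕ) (e f : IExpr) (σ : State) :
    (setIMin x e f).run σ = σ.setI x (min (e.eval σ) (f.eval σ)) := by
  simp only [setIMin, Cmd.run, Test.holds_ilt]
  split_ifs with h
  · rw [min_eq_left h.le]
  · rw [min_eq_right (not_lt.1 h)]

@[simp] theorem run_setIMax (x : ℕ) (e f : IExpr) (σ : State) :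
    (setIMax x e f).run σ = σ.setI x (max (e.eval σ) (f.eval σ)) := by
  simp only [setIMax, Cmd.run, Test.holds_ilt]
  split_ifs with h
  · rw [max_eq_right h.le]
  · rw [max_eq_left (not_lt.1 h)]

/-- Load the ends of the box with the index in integer register `10` into the registers `11` to
`14`. -/
def loadBox : Cmd :=
  block [setIMin 11 (.get 1 (.reg 10)) (.get 3 (.reg 10)),
    setIMax 12 (.get 1 (.reg 10)) (.get 3 (.reg 10)),
    setIMin 13 (.get 2 (.reg 10)) (.get 4 (.reg 10)),
    setIMax 14 (.get 2 (.reg 10)) (.get 4 (.reg 10))]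

/-- The slope of the pair with the index in integer register `10` is negative. -/
def oppTest : Test :=
  .or (.conj (.ilt (.get 1 (.reg 10)) (.get 3 (.reg 10)))
    (.ilt (.get 4 (.reg 10)) (.get 2 (.reg 10))))
    (.conj (.ilt (.get 3 (.reg 10)) (.get 1 (.reg 10)))
      (.ilt (.get 2 (.reg 10)) (.get 4 (.reg 10))))

/-- Load the label of the edges in the box with the index in integer register `10` into register
`15`. -/
def loadLabel : Cmd :=
  .ite oppTest (.iset 15 (.add (.reg 10) (.const 1))) (.iset 15 (.const 0))

/-- Label the edges that enter one grid point of the current box. -/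
def labelPoint : Cmd :=
  block [.iset 18 (.add (.reg 11) (.reg 16)), .iset 19 (.add (.reg 13) (.reg 17)),
    .iset 20 (.add (.get 5 (.reg 18)) (.reg 19)),
    .ite (.ilt (.reg 11) (.reg 18)) (block [.iput 6 (.reg 20) (.reg 15),
      .rput 8 (.reg 20) (.sub (.get 6 (.reg 18)) (.get 6 (.sub (.reg 18) (.const 1))))]) .skip,
    .ite (.ilt (.reg 13) (.reg 19)) (block [.iput 7 (.reg 20) (.reg 15),
      .rput 9 (.reg 20) (.sub (.get 7 (.reg 19)) (.get 7 (.sub (.reg 19) (.const 1))))]) .skip]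

/-- Label the edges in the box with the index in integer register `10`. -/
def labelBox : Cmd :=
  block [loadBox, loadLabel, forLoop 16 (.sub (.add (.reg 12) (.const 1)) (.reg 11))
    (forLoop 17 (.sub (.add (.reg 14) (.const 1)) (.reg 13)) labelPoint)]

/-- Label all edges. -/
def labelEdges : Cmd :=
  forLoop 10 (.reg 0) (.ite (.ieq (.reg 10) (.reg 1)) .skip labelBox)

section

variable {n r : ℕ} {v : ℕ → Pt × Pt} {L : Layout n r v}

/-- Writing at one cell cannot spoil the label of another leaf, since by `inEdge_unique` no edge
belongs to two leaf boxes. Every other cell has a different address by `cell_inj`. -/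
theorem run_labelPoint (hd : LeavesDisjoint n r v) {σ : State} (h : Loaded L σ)
    {S : ℕ → ℕ → ℕ → Prop} (hS : ∀ k i j, S k i j → k < n ∧ k ≠ r) {k u w : ℕ} (hk : k < n)
    (hkr : k ≠ r) (h11 : σ.ireg 11 = min (L.sx k) (L.tx k)) (h13 : σ.ireg 13 =
      min (L.sy k) (L.ty k))
    (h15 : σ.ireg 15 = L.lab k) (h16 : σ.ireg 16 = u) (h17 : σ.ireg 17 = w)
    (hu : min (L.sx k) (L.tx k) + u ≤ max (L.sx k) (L.tx k))
    (hw : min (L.sy k) (L.ty k) + w ≤ max (L.sy k) (L.ty k))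
    (hI : L.LabelledOn S (labels (n + n) σ) (gains (n + n) σ) (n + n)) :
    L.LabelledOn (fun k' i j => S k' i j ∨ (k' = k ∧ i = min (L.sx k) (L.tx k) + u ∧
      j = min (L.sy k) (L.ty k) + w)) (labels (n + n) (labelPoint.run σ))
      (gains (n + n) (labelPoint.run σ)) (n + n) := by
  have h1 := L.max_x_lt hk
  have h2 := L.max_y_lt hk
  have h3 := h.NX_le
  have h4 := h.NY_le
  set i0 := min (L.sx k) (L.tx k) + u with hi0
  set j0 := min (L.sy k) (L.ty k) + w with hj0
  have hin : ∀ d, L.InEdge d k i0 j0 ↔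
      if d then min (L.sx k) (L.tx k) < i0 else min (L.sy k) (L.ty k) < j0 := by
    intro d
    cases d <;> simp only [Layout.InEdge, Bool.false_eq_true, if_false, if_true] <;> omega
  have hrow := h.rows i0 (by omega)
  have key : ∀ d i j, j < n + n →
      (i = i0 ∧ j = j0 ∧ L.InEdge d k i0 j0 → labels (n + n) (labelPoint.run σ) d i j = L.lab k ∧
        gains (n + n) (labelPoint.run σ) d i j = L.len d i0 j0) ∧
      (¬ (i = i0 ∧ j = j0 ∧ L.InEdge d k i0 j0) →
        labels (n + n) (labelPoint.run σ) d i j = labels (n + n) σ d i j ∧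
        gains (n + n) (labelPoint.run σ) d i j = gains (n + n) σ d i j) := by
    intro d i j hj
    have hc := cell_inj (i := i) (i' := i0) hj (show j0 < n + n by omega)
    have hX := h.X
    have hY := h.Y
    rw [hin]
    have e : labelPoint.run σ = (if min (L.sy k) (L.ty k) < j0 then fun τ : State =>
          (τ.putI 7 (i0 * (n + n) + j0) (L.lab k)).putR 9 (i0 * (n + n) + j0)
            (L.Y j0 - L.Y (j0 - 1))
          else id)
        ((if min (L.sx k) (L.tx k) < i0 then fun τ : State =>
          (τ.putI 6 (i0 * (n + n) + j0) (L.lab k)).putR 8 (i0 * (n + n) + j0)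
            (L.X i0 - L.X (i0 - 1))
          else id) (((σ.setI 18 i0).setI 19 j0).setI 20 (i0 * (n + n) + j0))) := by
      by_cases c1 : min (L.sx k) (L.tx k) < i0 <;> by_cases c2 : min (L.sy k) (L.ty k) < j0 <;>
        simp [labelPoint, block, Cmd.run, IExpr.eval, RExpr.eval, h11, h13, h15, h16, h17, ← hi0,
          ← hj0, hrow, c1, c2, hX, hY]
    rw [e]
    have aux : ∀ P : Prop, (i = i0 ∧ j = j0 ∧ P → i * (n + n) + j = i0 * (n + n) + j0) ∧
        (¬ (i = i0 ∧ j = j0 ∧ P) → P → ¬ i * (n + n) + j = i0 * (n + n) + j0) := fun P =>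
      ⟨fun hh => hc.2 ⟨hh.1, hh.2.1⟩, fun hh c e => hh ⟨(hc.1 e).1, (hc.1 e).2, c⟩⟩
    cases d
    · simp only [Bool.false_eq_true, if_false, labels, gains, Layout.len]
      refine ⟨fun hh => ?_, fun hh => ?_⟩
      · have e1 := (aux _).1 hh
        rw [if_pos hh.2.2]
        split_ifs <;> simp [e1]
      · by_cases c : min (L.sy k) (L.ty k) < j0
        · have e1 := (aux _).2 hh c
          rw [if_pos c]
          split_ifs <;> simp [e1]
        · rw [if_neg c]
          split_ifs <;> simp
    · simp only [if_true, labels, gains, Layout.len]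
      refine ⟨fun hh => ?_, fun hh => ?_⟩
      · have e1 := (aux _).1 hh
        rw [if_pos hh.2.2]
        split_ifs <;> simp [e1]
      · by_cases c : min (L.sx k) (L.tx k) < i0
        · have e1 := (aux _).2 hh c
          rw [if_pos c]
          split_ifs <;> simp [e1]
        · rw [if_neg c]
          split_ifs <;> simp
  intro d i j hj
  obtain ⟨k1, k2⟩ := key d i j hj
  obtain ⟨i1, i2⟩ := hI d i j hj
  by_cases hc : i = i0 ∧ j = j0 ∧ L.InEdge d k i0 j0
  · obtain ⟨e1, e2⟩ := k1 hc
    obtain ⟨rfl, rfl, hink⟩ := hc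
    refine ⟨fun k' hk' hin' => ?_, fun hno => absurd hink (hno k (Or.inr ⟨rfl, rfl, rfl⟩))⟩
    have : k' = k := by
      rcases hk' with hk' | ⟨rfl, -⟩
      · exact L.inEdge_unique hd (hS _ _ _ hk').1 hk (hS _ _ _ hk').2 hkr hin' hink
      · rfl
    subst this
    exact ⟨e1, e2⟩
  · obtain ⟨e1, e2⟩ := k2 hc
    rw [e1, e2]
    refine ⟨fun k' hk' hin' => ?_, fun hno => i2 fun k' hk' => hno k' (Or.inl hk')⟩
    rcases hk' with hk' | ⟨rfl, rfl, rfl⟩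
    · exact i1 k' hk' hin'
    · exact absurd ⟨rfl, rfl, hin'⟩ hc

/-- The set of finished points grows by whole columns of the box in the outer loop and by the points
of one column in the inner loop. -/
theorem wp_labelBox (hd : LeavesDisjoint n r v) {σ : State} (h : Loaded L σ)
    {S : ℕ → ℕ → ℕ → Prop} (hS : ∀ k i j, S k i j → k < n ∧ k ≠ r) {k : ℕ} (hk : k < n)
    (hkr : k ≠ r) (h10 : σ.ireg 10 = k)
    (hI : L.LabelledOn S (labels (n + n) σ) (gains (n + n) σ) (n + n)) :
    wp labelBox (L.area k * 150 + 150) (fun τ =>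
      L.LabelledOn (fun k' i j => S k' i j ∨ k' = k) (labels (n + n) τ) (gains (n + n) τ) (n + n))
        σ := by
  set x0 := min (L.sx k) (L.tx k) with hx0
  set x1 := max (L.sx k) (L.tx k) with hx1
  set y0 := min (L.sy k) (L.ty k) with hy0
  set y1 := max (L.sy k) (L.ty k) with hy1
  have hx01 : x0 ≤ x1 := min_le_max
  have hy01 : y0 ≤ y1 := min_le_max
  have harea : L.area k = (x1 + 1 - x0) * (y1 + 1 - y0) := rfl
  obtain ⟨A, hA⟩ : ∃ A, x1 + 1 - x0 = A := ⟨_, rfl⟩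
  obtain ⟨B, hB⟩ : ∃ B, y1 + 1 - y0 = B := ⟨_, rfl⟩
  have hB1 : 1 ≤ B := by omega
  have hA1 : 1 ≤ A := by omega
  rw [hA, hB] at harea
  have hAB : A ≤ A * B := by nlinarith
  rw [harea]
  refine wp_block_cons (S := 56) (T := A * B * 150 + 94) (wp_run rfl ?_ (by decide)) (by omega)
  refine wp_block_cons (S := 36) (T := A * B * 150 + 58) (wp_run rfl ?_ (by decide)) (by omega)
  set τ := loadLabel.run (loadBox.run σ) with hτ
  have hop : oppTest.Holds (loadBox.run σ) ↔ L.Opp k := by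
    simp [oppTest, loadBox, block, Cmd.run, IExpr.eval, h10, h.sx, h.sy, h.tx, h.ty, Layout.Opp]
  have hrun : loadBox.run σ = (((σ.setI 11 x0).setI 12 x1).setI 13 y0).setI 14 y1 := by
    simp [loadBox, block, Cmd.run, IExpr.eval, h10, h.sx, h.sy, h.tx, h.ty, hx0, hx1, hy0, hy1]
  have hτ' : τ = ((((σ.setI 11 x0).setI 12 x1).setI 13 y0).setI 14 y1).setI 15 (L.lab k) := by
    rw [hτ, loadLabel, Cmd.run, Layout.lab]
    by_cases ho : L.Opp k
    · rw [if_pos (hop.2 ho), if_pos ho, hrun]; simp [Cmd.run, IExpr.eval, h10]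
    · rw [if_neg (mt hop.1 ho), if_neg ho, hrun]; simp [Cmd.run, IExpr.eval]
  clear_value τ
  have hL : Loaded L τ := h.congr (by simp [hτ']) (by simp [hτ']) (by simp [hτ'])
    (fun _ _ _ => by simp [hτ']) (by simp [hτ']) (by simp [hτ'])
  refine wp_block_cons (S := A * B * 150 + 57) (T := 1) (wp_for_const 16 _ (fun u υ =>
    L.LabelledOn (fun k' i j => S k' i j ∨ (k' = k ∧ i < x0 + u)) (labels (n + n) υ)
      (gains (n + n) υ) (n + n)) A (B * 120 + 13) rfl ?_ (fun υ hC => ?_)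
    (fun u hu υ hC hIu h16 => ?_) (fun υ hC hIu => ?_) ?_) (by omega)
  · refine Layout.LabelledOn.congr ?_ ?_ (S := S)
    · rw [hτ']; exact hI
    · intro d k' i j hin
      have : k' = k → x0 ≤ i := by
        rintro rfl
        cases d <;> simp only [Layout.InEdge, Bool.false_eq_true, if_false, if_true] at hin <;>
          omega
      exact ⟨Or.inl, fun h => h.resolve_right (by omega)⟩
  · simp only [IExpr.eval, hC.i 12 rfl, hC.i 11 rfl, hτ']
    simpa using hA
  · refine wp_for_const 17 _ (fun w φ =>
      L.LabelledOn (fun k' i j => (S k' i j ∨ (k' = k ∧ i < x0 + u)) ∨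
        (k' = k ∧ i = x0 + u ∧ j < y0 + w))
        (labels (n + n) φ) (gains (n + n) φ) (n + n)) B 100 rfl ?_ (fun φ hD => ?_)
      (fun w hw φ hD hIw h17 => ?_) (fun φ hD hIw => ?_) (by simp [IExpr.cost]; omega)
    · refine Layout.LabelledOn.congr hIu ?_
      intro d k' i j hin
      have : k' = k → y0 ≤ j := by
        rintro rfl
        cases d <;> simp only [Layout.InEdge, Bool.false_eq_true, if_false, if_true] at hin <;>
          omega
      exact ⟨Or.inl, fun h => h.resolve_right (by omega)⟩
    · simp only [IExpr.eval, hD.i 14 rfl, hD.i 13 rfl, hC.i 14 rfl, hC.i 13 rfl, hτ']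
      simpa using hB
    · refine wp_run rfl ?_ (by decide)
      have hLφ := (hL.of_agree hC).of_agree hD
      refine Layout.LabelledOn.congr
          (run_labelPoint hd hLφ (u := u) (w := w) ?_ hk hkr ?_ ?_ ?_ ?_ h17
        (by omega) (by omega) hIw) ?_
      · rintro k' i j ((h1 | ⟨rfl, -⟩) | ⟨rfl, -⟩)
        exacts [hS _ _ _ h1, ⟨hk, hkr⟩, ⟨hk, hkr⟩]
      · rw [hD.i 11 rfl, hC.i 11 rfl, hτ']; simp [hx0]
      · rw [hD.i 13 rfl, hC.i 13 rfl, hτ']; simp [hy0]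
      · rw [hD.i 15 rfl, hC.i 15 rfl, hτ']; simp
      · rw [hD.i 16 rfl, h16]
      · intro d k' i j _
        simp only [← hx0, ← hy0]
        constructor
        · rintro ((h1 | h1) | h1)
          · exact Or.inl h1
          · exact Or.inr ⟨h1.1, h1.2.1, by omega⟩
          · exact Or.inr ⟨h1.1, h1.2.1, by omega⟩
        · rintro (h1 | h1)
          · exact Or.inl (Or.inl h1)
          · rcases Nat.lt_succ_iff_lt_or_eq.1 (show j < (y0 + w) + 1 by omega) with h2 | h2
            · exact Or.inl (Or.inr ⟨h1.1, h1.2.1, h2⟩)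
            · exact Or.inr ⟨h1.1, h1.2.1, h2⟩
    · refine Layout.LabelledOn.congr hIw ?_
      intro d k' i j hin
      have : k' = k → j ≤ y1 := by
        rintro rfl
        cases d <;> simp only [Layout.InEdge, Bool.false_eq_true, if_false, if_true] at hin <;>
          omega
      constructor
      · rintro ((h1 | h1) | h1)
        · exact Or.inl h1
        · exact Or.inr ⟨h1.1, by omega⟩
        · exact Or.inr ⟨h1.1, by omega⟩
      · rintro (h1 | h1)
        · exact Or.inl (Or.inl h1)
        · rcases Nat.lt_succ_iff_lt_or_eq.1 (show i < (x0 + u) + 1 by omega) with h2 | h2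
          · exact Or.inl (Or.inr ⟨h1.1, h2⟩)
          · exact Or.inr ⟨h1.1, h2, by have := this h1.1; omega⟩
  · refine wp_block_nil (Layout.LabelledOn.congr hIu ?_) le_rfl
    intro d k' i j hin
    have : k' = k → i ≤ x1 := by
      rintro rfl
      cases d <;> simp only [Layout.InEdge, Bool.false_eq_true, if_false, if_true] at hin <;> omega
    constructor
    · exact fun h1 => h1.imp_right fun h2 => h2.1
    · exact fun h1 => h1.imp_right fun h2 => ⟨h2, by have := this h2; omega⟩
  · simp [IExpr.cost]
    nlinarith

theorem wp_labelEdges (hd : LeavesDisjoint n r v) {σ : State} (h : Loaded L σ)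
    (hi : ∀ a, a = 6 ∨ a = 7 → ∀ i, σ.iarr a i = 0) (hr : ∀ a, a = 8 ∨ a = 9 → ∀ i, σ.rarr a i =
      0) :
    wp labelEdges (n * 400 + n * n * 2000 + 100) (fun τ =>
      L.Labelled (labels (n + n) τ) (gains (n + n) τ)) σ := by
  refine wp_for 10 _ (fun k τ => L.LabelledOn (fun k' _ _ => k' < k ∧ k' ≠ r) (labels (n + n) τ)
    (gains (n + n) τ) (n + n)) n (fun k => (if k = r then 0 else L.area k) * 150 + 200) rfl ?_
    (fun τ hA => ?_) (fun k hk τ hA hI h10 => ?_) (fun τ hA hI => ?_) ?_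
  · intro d i j _
    refine ⟨fun k hk => absurd hk.1 (by omega), fun _ => ?_⟩
    cases d <;> simp [labels, gains, hi, hr]
  · exact (h.of_agree hA).n_eq
  · have hL := h.of_agree hA
    refine wp_ite (T := (if k = r then 0 else L.area k) * 150 + 180) (fun hb => ?_) (fun hb => ?_)
      (by simp only [Test.cost, Test.ieq, IExpr.cost]; omega)
    · refine wp_run rfl ?_ (by simp [Cmd.size])
      have hkr : k = r := by simpa [IExpr.eval, h10, hL.r_eq] using hb
      refine Layout.LabelledOn.congr hI ?_
      intro d k' i j _
      constructor <;> intro h1 <;> exact ⟨by omega, h1.2⟩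
    · have hkr : k ≠ r := by simpa [IExpr.eval, h10, hL.r_eq] using hb
      refine (wp_labelBox hd hL (fun k' _ _ hk' => ⟨by omega, hk'.2⟩) hk hkr h10 hI).mono
        (by rw [if_neg hkr]; omega) fun υ _ hυ => ?_
      refine Layout.LabelledOn.congr hυ ?_
      intro d k' i j _
      constructor
      · rintro (h1 | rfl)
        · exact ⟨by omega, h1.2⟩
        · exact ⟨by omega, hkr⟩
      · rintro ⟨h1, h2⟩
        rcases Nat.lt_succ_iff_lt_or_eq.1 h1 with h3 | h3
        · exact Or.inl ⟨h3, h2⟩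
        · exact Or.inr h3
  · intro d i j _ hj
    have h4 := h.NY_le
    obtain ⟨h1, h2⟩ := hI d i j (by omega)
    exact ⟨fun k hk hkr => h1 k ⟨hk, hkr⟩, fun hno => h2 fun k hk => hno k hk.1 hk.2⟩
  -- The time of the loop is the sum of the areas of the leaf boxes up to constants, which is
  -- quadratic because the leaves are edge-disjoint; a bound for each box separately would give only
  -- a cubic total.
  · have h1 := L.sum_area_le hd
    have h2 := Nat.mul_le_mul h.NX_le h.NY_le
    rw [Finset.sum_add_distrib, Finset.sum_add_distrib, ← Finset.sum_mul]
    simp [IExpr.cost]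
    nlinarith

end

end RAM

end GMMN


/-! ### Evaluation of the Bellman equation from the target backwards, with stored decisions. -/

namespace GMMN

namespace RAM

/-! ## The dynamic program -/

/-- An optimal decision of the dynamic program at `(i, j)` in context `c`, of value `z`:
  a step in the
direction with code `dir` to the context `nc`, that collects the edge if and only if `col = 1`. -/
def Choice (I : Bool → ℕ → ℕ → ℕ) (G : Bool → ℕ → ℕ → ℝ) (tx ty c i j : ℕ) (z : ℝ)
    (dir col nc : ℕ) : Prop :=
  ∃ d, dir = runCtx d ∧ Avail tx ty i j d ∧
    ((col = 0 ∧ nc = skipCtx I c i j d ∧ z = value I G tx ty nc (nx d i) (ny d j)) ∨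
      (col = 1 ∧ (¬ Same I c i j d ∨ c = runCtx d) ∧ nc = runCtx d ∧
        z = G d (nx d i) (ny d j) + value I G tx ty nc (nx d i) (ny d j)))

/-- Integer register `17` tells if the real register `0` holds the maximum of `A`, for which the
decision is described by the integer registers `23` to `25`. -/
def BestSoFar (P : ℝ → ℕ → ℕ → ℕ → Prop) (A : Set ℝ) (σ : State) : Prop :=
  (σ.ireg 17 = 0 ∧ σ.rreg 0 = 0 ∧ A = ∅) ∨
    (σ.ireg 17 = 1 ∧ (∀ z ∈ A, z ≤ σ.rreg 0) ∧ P (σ.rreg 0) (σ.ireg 23) (σ.ireg 24) (σ.ireg 25))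

/-- Replace the best decision by the one with value in real register `1` if that is better. -/
def keep (d : Bool) (col : ℕ) : Cmd :=
  .ite (.or (.ieq (.reg 17) (.const 0)) (.rlt (.reg 0) (.reg 1)))
    (block [.rset 0 (.reg 1), .iset 17 (.const 1), .iset 23 (.const (runCtx d)),
      .iset 24 (.const col),
      .iset 25 (.reg 22)]) .skip

theorem bestSoFar_keep {P : ℝ → ℕ → ℕ → ℕ → Prop} {A : Set ℝ} {σ : State} (d : Bool) (col : ℕ)
    (h : BestSoFar P A σ) (hP : P (σ.rreg 1) (runCtx d) col (σ.ireg 22)) :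
    BestSoFar P (insert (σ.rreg 1) A) ((keep d col).run σ) := by
  by_cases hc : σ.ireg 17 = 0 ∨ σ.rreg 0 < σ.rreg 1
  · have hrun : (keep d col).run σ = ((((σ.setR 0 (σ.rreg 1)).setI 17 1).setI 23 (runCtx d)).setI 24
        col).setI 25 (σ.ireg 22) := by
      rw [keep, Cmd.run, if_pos (by simpa [IExpr.eval, RExpr.eval] using hc)]
      simp [block, Cmd.run, IExpr.eval, RExpr.eval]
    rw [hrun]
    refine Or.inr ⟨by simp, ?_, by simpa using hP⟩
    simp only [State.setI_rreg, State.setR_rreg, if_true]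
    rintro z (rfl | hz)
    · exact le_rfl
    · rcases h with ⟨-, -, h3⟩ | ⟨h1, h2, -⟩
      · rw [h3] at hz; exact absurd hz (Set.notMem_empty z)
      · exact (h2 z hz).trans (hc.resolve_left (by omega)).le
  · have hrun : (keep d col).run σ = σ := by
      rw [keep, Cmd.run, if_neg (by simpa [IExpr.eval, RExpr.eval] using hc), Cmd.run]
    rw [hrun]
    rw [not_or, not_lt] at hc
    rcases h with ⟨h1, -⟩ | ⟨h1, h2, h3⟩
    · exact absurd h1 hc.1
    · refine Or.inr ⟨h1, ?_, h3⟩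
      rintro z (rfl | hz)
      · exact hc.2
      · exact h2 z hz

/-- The last edge and the next one have the same label. -/
def sameTest : Test := .conj (.neg (.ieq (.reg 18) (.const 0))) (.ieq (.reg 18) (.reg 21))

/-- A step in direction `d` is possible. -/
def availTest (d : Bool) : Test :=
  if d then .ilt (.reg 11) (.get 3 (.reg 1)) else .ilt (.reg 13) (.get 4 (.reg 1))

/-- Five times an integer expression. -/
def five (e : IExpr) : IExpr := .add (.add (.add e e) (.add e e)) e

/-- Compute the position in the tables after a step in direction `d`, and the label of the edge. -/
def locateStep (d : Bool) : Cmd :=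
  block [.iset 19 (.add (.reg 14) (if d then .reg 6 else .const 1)), .iset 20 (five (.reg 19)),
    .iset 21 (.get (if d then 6 else 7) (.reg 19))]

/-- Compute the value of a step that does not collect the edge. -/
def prepareSkip (d : Bool) : Cmd :=
  block [.ite sameTest (.iset 22 (.const (doneCtx d))) (.iset 22 (.const 0)),
    .rset 1 (.get 10 (.add (.reg 20) (.reg 22)))]

/-- Compute the value of a step that collects the edge. -/
def prepareCollect (d : Bool) : Cmd :=
  block [.iset 22 (.const (runCtx d)), .rset 1 (.add (.get (if d then 8 else 9) (.reg 19))
    (.get 10 (.add (.reg 20) (.reg 22))))]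

/-- Try the decisions with a step in direction `d`. -/
def tryDir (d : Bool) : Cmd :=
  .ite (availTest d)
    (block [locateStep d, prepareSkip d, keep d 0,
      .ite (.or (.neg sameTest) (.ieq (.reg 16) (.const (runCtx d))))
        (block [prepareCollect d, keep d 1]) .skip]) .skip

/-- Load the label of the last edge. -/
def loadCtxLabel : Cmd :=
  block [.iset 17 (.const 0), .rset 0 .zero, .ite (.ieq (.reg 16) (.const 0)) (.iset 18 (.const 0))
    (.ite (.or (.ieq (.reg 16) (.const 1)) (.ieq (.reg 16) (.const 3)))
      (.iset 18 (.get 6 (.reg 14))) (.iset 18 (.get 7 (.reg 14))))]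

/-- Store the best decision. -/
def storeBest : Cmd :=
  block [.iset 26 (.add (.reg 15) (.reg 16)), .rput 10 (.reg 26) (.reg 0),
    .iput 10 (.reg 26) (.reg 23), .iput 11 (.reg 26) (.reg 24), .iput 12 (.reg 26) (.reg 25)]

/-- Compute the entry of the tables for the context in integer register `16`. -/
def computeEntry : Cmd := block [loadCtxLabel, tryDir true, tryDir false, storeBest]

/-- Compute the entries for one grid point. -/
def computePoint : Cmd :=
  block [.iset 13 (.sub (.get 4 (.reg 1)) (.reg 12)), .iset 14 (.add (.get 5 (.reg 11)) (.reg 13)),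
    .iset 15 (five (.reg 14)), forLoop 16 (.const 5) computeEntry]

/-- Compute the tables of the dynamic program. -/
def computeTable : Cmd :=
  forLoop 10 (.sub (.add (.get 3 (.reg 1)) (.const 1)) (.get 1 (.reg 1)))
    (block [.iset 11 (.sub (.get 3 (.reg 1)) (.reg 10)),
      forLoop 12 (.sub (.add (.get 4 (.reg 1)) (.const 1)) (.get 2 (.reg 1))) computePoint])

theorem agree_run {c : Cmd} (h : c.loopFree = true) (σ : State) : Agree c σ (c.run σ) := by
  obtain ⟨t, -, h1⟩ := exec_run c h σ
  exact h1.agree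

/-- The position of an entry in the tables. -/
def entry (M i j c : ℕ) : ℕ := 5 * (i * M + j) + c

theorem entry_inj {M i j c i' j' c' : ℕ} (hj : j < M) (hj' : j' < M) (hc : c < 5) (hc' : c' < 5) :
    entry M i j c = entry M i' j' c' ↔ i = i' ∧ j = j' ∧ c = c' := by
  unfold entry
  constructor
  · intro h
    have h1 : i * M + j = i' * M + j' := by omega
    have h2 := (cell_inj hj hj').1 h1
    omega
  · rintro ⟨rfl, rfl, rfl⟩; rfl

/-- The registers while the entry for `(i, j)` and context `c` is computed. -/
structure AtEntry (M tx ty : ℕ) (I : Bool → ℕ → ℕ → ℕ) (G : Bool → ℕ → ℕ → ℝ) (W : ℕ → ℝ)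
    (c i j : ℕ) (σ : State) : Prop where
  x_eq : σ.ireg 11 = i
  y_eq : σ.ireg 13 = j
  cell_eq : σ.ireg 14 = i * M + j
  c_eq : σ.ireg 16 = c
  label_eq : σ.ireg 18 = ctxLabel I c i j
  tx_eq : σ.iarr 3 (σ.ireg 1) = tx
  ty_eq : σ.iarr 4 (σ.ireg 1) = ty
  M_eq : σ.ireg 6 = M
  labels_eq : labels M σ = I
  gains_eq : gains M σ = G
  table_eq : σ.rarr 10 = W

section

variable {M tx ty c i j : ℕ} {I : Bool → ℕ → ℕ → ℕ} {G : Bool → ℕ → ℕ → ℝ} {W : ℕ → ℝ}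

theorem AtEntry.of_agree {σ τ : State} (h : AtEntry M tx ty I G W c i j σ) {p : Cmd}
    (hA : Agree p σ τ) (hi : ∀ x, x = 1 ∨ x = 6 ∨ x = 11 ∨ x = 13 ∨ x = 14 ∨ x = 16 ∨ x = 18 →
      p.wI x = false) (hia : ∀ a, a = 3 ∨ a = 4 ∨ a = 6 ∨ a = 7 → p.wIA a = false)
    (hra : ∀ a, a = 8 ∨ a = 9 ∨ a = 10 → p.wRA a = false) : AtEntry M tx ty I G W c i j τ where
  x_eq := (hA.i 11 (hi _ (by simp))).trans h.x_eq
  y_eq := (hA.i 13 (hi _ (by simp))).trans h.y_eq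
  cell_eq := (hA.i 14 (hi _ (by simp))).trans h.cell_eq
  c_eq := (hA.i 16 (hi _ (by simp))).trans h.c_eq
  label_eq := (hA.i 18 (hi _ (by simp))).trans h.label_eq
  tx_eq := by rw [hA.ia 3 (hia _ (by simp)), hA.i 1 (hi _ (by simp))]; exact h.tx_eq
  ty_eq := by rw [hA.ia 4 (hia _ (by simp)), hA.i 1 (hi _ (by simp))]; exact h.ty_eq
  M_eq := (hA.i 6 (hi _ (by simp))).trans h.M_eq
  labels_eq := by
    rw [← h.labels_eq]; funext d i j
    cases d <;> simp [labels, hA.ia 6 (hia _ (by simp)), hA.ia 7 (hia _ (by simp))]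
  gains_eq := by
    rw [← h.gains_eq]; funext d i j
    cases d <;> simp [gains, hA.ra 8 (hra _ (by simp)), hA.ra 9 (hra _ (by simp))]
  table_eq := (hA.ra 10 (hra _ (by simp))).trans h.table_eq

theorem loopFree_tryDir (d : Bool) : (tryDir d).loopFree = true := by cases d <;> rfl

theorem AtEntry.tryDir {σ : State} (h : AtEntry M tx ty I G W c i j σ) (d : Bool) :
    AtEntry M tx ty I G W c i j ((tryDir d).run σ) := by
  refine h.of_agree (agree_run (loopFree_tryDir d) σ) ?_ ?_ ?_
  · rintro x (rfl | rfl | rfl | rfl | rfl | rfl | rfl) <;> cases d <;> rfl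
  · rintro x (rfl | rfl | rfl | rfl) <;> cases d <;> rfl
  · rintro x (rfl | rfl | rfl) <;> cases d <;> rfl

theorem holds_availTest {σ : State} (h : AtEntry M tx ty I G W c i j σ) (d : Bool) :
    (availTest d).Holds σ ↔ Avail tx ty i j d := by
  cases d <;> simp [availTest, IExpr.eval, Avail, h.x_eq, h.y_eq, h.tx_eq, h.ty_eq]

theorem skipCtx_lt (I : Bool → ℕ → ℕ → ℕ) (c i j : ℕ) (d : Bool) : skipCtx I c i j d < 5 := by
  unfold skipCtx; split_ifs <;> cases d <;> simp [doneCtx]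

theorem runCtx_lt (d : Bool) : runCtx d < 5 := by cases d <;> simp [runCtx]

/-- The set `A'` collects the values tried. It certifies that the stored value dominates the step
value, while `Choice` certifies that the stored value comes from a legal decision. -/
theorem bestSoFar_tryDir {σ : State} (h : AtEntry M tx ty I G W c i j σ) (d : Bool)
    (hW : Avail tx ty i j d → ∀ c' < 5, W (entry M (nx d i) (ny d j) c') =
      value I G tx ty c' (nx d i) (ny d j)) {A : Set ℝ}
    (hb : BestSoFar (Choice I G tx ty c i j) A σ) :
    ∃ A', BestSoFar (Choice I G tx ty c i j) A' ((tryDir d).run σ) ∧ A ⊆ A' ∧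
      (Avail tx ty i j d → ∃ z ∈ A', stepValue I G (value I G tx ty) c i j d ≤ z) := by
  rw [tryDir, Cmd.run]
  by_cases ha : Avail tx ty i j d
  swap
  · rw [if_neg (mt (holds_availTest h d).1 ha), Cmd.run]
    exact ⟨A, hb, subset_rfl, fun h => absurd h ha⟩
  rw [if_pos ((holds_availTest h d).2 ha)]
  have hW := hW ha
  have hcell : i * M + j + (if d then M else 1) = nx d i * M + ny d j := by
    cases d <;> simp [nx, ny] <;> ring
  have hlab : σ.iarr (if d then 6 else 7) (nx d i * M + ny d j) = I d (nx d i) (ny d j) := by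
    rw [← h.labels_eq, labels]
  have hgain : σ.rarr (if d then 8 else 9) (nx d i * M + ny d j) = G d (nx d i) (ny d j) := by
    rw [← h.gains_eq, gains]
  set sc := skipCtx I c i j d with hsc
  have hrun1 : (locateStep d).run σ = ((σ.setI 19 (nx d i * M + ny d j)).setI 20
      (5 * (nx d i * M + ny d j))).setI 21 (I d (nx d i) (ny d j)) := by
    have e3 : ∀ x : ℕ, x + x + (x + x) + x = 5 * x := by intro x; ring
    rw [← hcell] at hlab ⊢
    cases d <;> simp only [Bool.false_eq_true, if_true, if_false] at hlab ⊢ <;>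
      simp [locateStep, block, Cmd.run, five, IExpr.eval, h.cell_eq, h.M_eq, e3, hlab]
  have hsame : ∀ τ : State, τ.ireg 18 = ctxLabel I c i j → τ.ireg 21 = I d (nx d i) (ny d j) →
      (sameTest.Holds τ ↔ Same I c i j d) := by
    intro τ h1 h2
    simp [sameTest, IExpr.eval, h1, h2]
  obtain ⟨τ, hτ⟩ : ∃ τ, τ = (locateStep d).run σ := ⟨_, rfl⟩
  have t18 : τ.ireg 18 = ctxLabel I c i j := by rw [hτ, hrun1]; simp [h.label_eq]
  have t21 : τ.ireg 21 = I d (nx d i) (ny d j) := by rw [hτ, hrun1]; simp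
  have t20 : τ.ireg 20 = 5 * (nx d i * M + ny d j) := by rw [hτ, hrun1]; simp
  have t10 : τ.rarr 10 = W := by rw [hτ, hrun1]; simp [h.table_eq]
  have hrun2 : (prepareSkip d).run τ = (τ.setI 22 sc).setR 1
      (value I G tx ty sc (nx d i) (ny d j)) := by
    rw [← hW sc (skipCtx_lt _ _ _ _ _), entry, hsc, skipCtx]
    by_cases hs : Same I c i j d
    · rw [prepareSkip, block, Cmd.run, Cmd.run, if_pos ((hsame τ t18 t21).2 hs), if_pos hs]
      simp [block, Cmd.run, IExpr.eval, RExpr.eval, t20, t10]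
    · rw [prepareSkip, block, Cmd.run, Cmd.run, if_neg (mt (hsame τ t18 t21).1 hs), if_neg hs]
      simp [block, Cmd.run, IExpr.eval, RExpr.eval, t20, t10]
  have hb2 : BestSoFar (Choice I G tx ty c i j) A ((prepareSkip d).run τ) := by
    rw [hrun2, hτ, hrun1]; simpa [BestSoFar] using hb
  have hb3 := bestSoFar_keep d 0 hb2 ⟨d, rfl, ha,
      Or.inl ⟨rfl, by rw [hrun2]; simp [hsc], by rw [hrun2]; simp⟩⟩
  obtain ⟨υ, hυ⟩ : ∃ υ, υ = (keep d 0).run ((prepareSkip d).run τ) := ⟨_, rfl⟩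
  have hA : Agree (keep d 0) ((prepareSkip d).run τ) υ := hυ ▸ agree_run rfl _
  rw [← hυ] at hb3
  have hz : ((prepareSkip d).run τ).rreg 1 = value I G tx ty sc (nx d i) (ny d j) := by
    rw [hrun2]; simp
  rw [hz] at hb3
  have u18 : υ.ireg 18 = ctxLabel I c i j := by rw [hA.i 18 rfl, hrun2]; simpa using t18
  have u21 : υ.ireg 21 = I d (nx d i) (ny d j) := by rw [hA.i 21 rfl, hrun2]; simpa using t21
  have u20 : υ.ireg 20 = 5 * (nx d i * M + ny d j) := by rw [hA.i 20 rfl, hrun2]; simpa using t20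
  have u10 : υ.rarr 10 = W := by rw [hA.ra 10 rfl, hrun2]; simpa using t10
  have u16 : υ.ireg 16 = c := by rw [hA.i 16 rfl, hrun2, hτ, hrun1]; simpa using h.c_eq
  have u19 : υ.ireg 19 = nx d i * M + ny d j := by rw [hA.i 19 rfl, hrun2, hτ, hrun1]; simp
  have ug : υ.rarr (if d then 8 else 9) (nx d i * M + ny d j) = G d (nx d i) (ny d j) := by
    rw [hA.ra (if d then 8 else 9) (by cases d <;> rfl), hrun2, hτ, hrun1]; simpa using hgain
  simp only [block, Cmd.run, ← hτ, ← hυ, Test.holds_or, Test.holds_neg, hsame υ u18 u21,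
    Test.holds_ieq, IExpr.eval, u16]
  rw [stepValue]
  by_cases hc : ¬ Same I c i j d ∨ c = runCtx d
  · have hrun3 : (prepareCollect d).run υ = (υ.setI 22 (runCtx d)).setR 1
        (G d (nx d i) (ny d j) + value I G tx ty (runCtx d) (nx d i) (ny d j)) := by
      rw [← hW _ (runCtx_lt d), entry, ← ug]
      simp [prepareCollect, block, Cmd.run, IExpr.eval, RExpr.eval, u20, u10, u19]
    have hb4 : BestSoFar (Choice I G tx ty c i j)
        (insert (value I G tx ty sc (nx d i) (ny d j)) A) ((prepareCollect d).run υ) := by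
      rw [hrun3]; simpa [BestSoFar] using hb3
    have hb5 := bestSoFar_keep d 1 hb4 ⟨d, rfl, ha, Or.inr ⟨rfl, hc, by rw [hrun3]; simp,
      by rw [hrun3]; simp⟩⟩
    rw [if_pos hc, if_pos hc]
    have hz' : ((prepareCollect d).run υ).rreg 1 =
        G d (nx d i) (ny d j) + value I G tx ty (runCtx d) (nx d i) (ny d j) := by
      rw [hrun3]; simp
    rw [hz'] at hb5
    refine ⟨_, hb5, fun z hz => Or.inr (Or.inr hz), fun _ => ?_⟩
    rcases max_choice (value I G tx ty sc (nx d i) (ny d j))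
      (G d (nx d i) (ny d j) + value I G tx ty (runCtx d) (nx d i) (ny d j)) with e | e
    · exact ⟨_, Or.inr (Or.inl rfl), e.le⟩
    · exact ⟨_, Or.inl rfl, e.le⟩
  · rw [if_neg hc, if_neg hc]
    exact ⟨_, hb3, fun z hz => Or.inr hz, fun _ => ⟨_, Or.inl rfl, le_rfl⟩⟩

theorem Choice.le_value {z : ℝ} {dir col nc : ℕ} (hi : i ≤ tx) (hj : j ≤ ty)
    (h : Choice I G tx ty c i j z dir col nc) : z ≤ value I G tx ty c i j := by
  obtain ⟨d, -, ha, ⟨-, rfl, rfl⟩ | ⟨-, hc, rfl, rfl⟩⟩ := h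
  · exact skip_le_value hi hj ha
  · exact collect_le_value hi hj ha hc

/-- The stored number is attained by a legal decision and so is at most the value
(`Choice.le_value`). It dominates the step values of all available directions and so is at least the
value. -/
theorem run_computeEntry {σ : State} (hi : i ≤ tx) (hj : j ≤ ty) (h11 : σ.ireg 11 = i)
    (h13 : σ.ireg 13 = j) (h14 : σ.ireg 14 = i * M + j) (h15 : σ.ireg 15 = 5 * (i * M + j))
    (h16 : σ.ireg 16 = c) (htx : σ.iarr 3 (σ.ireg 1) = tx) (hty : σ.iarr 4 (σ.ireg 1) = ty)
    (hM : σ.ireg 6 = M) (hI : labels M σ = I) (hG : gains M σ = G)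
    (hW : ∀ d, Avail tx ty i j d → ∀ c' < 5, σ.rarr 10 (entry M (nx d i) (ny d j) c') =
      value I G tx ty c' (nx d i) (ny d j)) :
    ∃ dir col nc, (i < tx ∨ j < ty → Choice I G tx ty c i j (value I G tx ty c i j) dir col nc) ∧
      (computeEntry.run σ).rarr 10 =
        Function.update (σ.rarr 10) (entry M i j c) (value I G tx ty c i j) ∧
      (computeEntry.run σ).iarr 10 = Function.update (σ.iarr 10) (entry M i j c) dir ∧
      (computeEntry.run σ).iarr 11 = Function.update (σ.iarr 11) (entry M i j c) col ∧
      (computeEntry.run σ).iarr 12 = Function.update (σ.iarr 12) (entry M i j c) nc := by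
  have hl : loadCtxLabel.run σ = ((σ.setI 17 0).setR 0 0).setI 18 (ctxLabel I c i j) := by
    have e1 : σ.iarr 6 (i * M + j) = I true i j := by rw [← hI]; simp [labels]
    have e2 : σ.iarr 7 (i * M + j) = I false i j := by rw [← hI]; simp [labels]
    have e3 : loadCtxLabel.run σ = if c = 0 then ((σ.setI 17 0).setR 0 0).setI 18 0 else
        if c = 1 ∨ c = 3 then ((σ.setI 17 0).setR 0 0).setI 18 (I true i j) else
          ((σ.setI 17 0).setR 0 0).setI 18 (I false i j) := by
      simp [loadCtxLabel, block, Cmd.run, IExpr.eval, RExpr.eval, h16, h14, e1, e2]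
    rw [e3, ctxLabel]
    split_ifs <;> rfl
  have hE : AtEntry M tx ty I G (σ.rarr 10) c i j (loadCtxLabel.run σ) := by
    rw [hl]
    exact ⟨by simpa using h11, by simpa using h13, by simpa using h14, by simpa using h16, by simp,
      by simpa using htx, by simpa using hty, by simpa using hM, hI, hG, rfl⟩
  have hb0 : BestSoFar (Choice I G tx ty c i j) ∅ (loadCtxLabel.run σ) :=
    Or.inl ⟨by rw [hl]; simp, by rw [hl]; simp, rfl⟩
  obtain ⟨A1, hb1, -, hA1⟩ := bestSoFar_tryDir hE true (hW true) hb0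
  obtain ⟨A2, hb2, hA2, hA3⟩ := bestSoFar_tryDir (hE.tryDir true) false (hW false) hb1
  set τ := (tryDir false).run ((tryDir true).run (loadCtxLabel.run σ)) with hτ
  have hAg : Agree (.seq (tryDir true) (tryDir false)) (loadCtxLabel.run σ) τ :=
    agree_run (c := .seq (tryDir true) (tryDir false)) rfl _
  have hrun : computeEntry.run σ = storeBest.run τ := by
    simp only [computeEntry, block, Cmd.run, ← hτ]
  have t15 : τ.ireg 15 + τ.ireg 16 = entry M i j c := by
    rw [hAg.i 15 rfl, hAg.i 16 rfl, hl]; simp [h15, h16, entry]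
  have t10 : τ.rarr 10 = σ.rarr 10 := by rw [hAg.ra 10 rfl, hl]; rfl
  have ti : ∀ a, a = 10 ∨ a = 11 ∨ a = 12 → τ.iarr a = σ.iarr a := by
    rintro a (rfl | rfl | rfl) <;> rw [hAg.ia _ rfl, hl] <;> rfl
  have hz : τ.rreg 0 = value I G tx ty c i j ∧ (i < tx ∨ j < ty →
      Choice I G tx ty c i j (value I G tx ty c i j) (τ.ireg 23) (τ.ireg 24) (τ.ireg 25)) := by
    rcases hb2 with ⟨-, h2, rfl⟩ | ⟨-, h2, h3⟩
    -- Nothing was tried, so this is the target, where the initial `0` is the value and no decision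
    -- is required.
    · have n1 : ¬ i < tx := fun h => by
        obtain ⟨z, hz, -⟩ := hA1 (by simpa [Avail] using h)
        exact hA2 hz
      have n2 : ¬ j < ty := fun h => by
        obtain ⟨z, hz, -⟩ := hA3 (by simpa [Avail] using h)
        exact hz
      refine ⟨?_, fun h => by omega⟩
      rw [h2, show i = tx by omega, show j = ty by omega, value_end]
    · have hle : ∀ d, Avail tx ty i j d → stepValue I G (value I G tx ty) c i j d ≤ τ.rreg 0 := by
        intro d hd
        cases d
        · obtain ⟨z, hz, hz'⟩ := hA3 hd
          exact hz'.trans (h2 z hz)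
        · obtain ⟨z, hz, hz'⟩ := hA1 hd
          exact hz'.trans (h2 z (hA2 hz))
      have hlt : i < tx ∨ j < ty := by
        obtain ⟨d, -, ha, -⟩ := h3
        cases d <;> simp [Avail] at ha <;> simp [ha]
      have heq : τ.rreg 0 = value I G tx ty c i j := by
        refine le_antisymm (h3.le_value hi hj) ?_
        rw [value_eq hi hj hlt]
        split_ifs with c1 c2
        · exact max_le (hle true (by simpa [Avail] using c1))
              (hle false (by simpa [Avail] using c2))
        · exact hle true (by simpa [Avail] using c1)
        · exact hle false (by simp [Avail]; omega)
      exact ⟨heq, fun _ => heq ▸ h3⟩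
  refine ⟨τ.ireg 23, τ.ireg 24, τ.ireg 25, hz.2, ?_, ?_, ?_, ?_⟩ <;> rw [hrun] <;>
    simp [storeBest, block, Cmd.run, IExpr.eval, RExpr.eval, t15, t10, ti, hz.1]

/-- The entries of the tables in `D` have been computed. -/
def Computed (M tx ty : ℕ) (I : Bool → ℕ → ℕ → ℕ) (G : Bool → ℕ → ℕ → ℝ) (D : ℕ → ℕ → ℕ → Prop)
    (σ : State) : Prop :=
  ∀ i j c, j < M → c < 5 → D i j c →
    σ.rarr 10 (entry M i j c) = value I G tx ty c i j ∧
    (i < tx ∨ j < ty → Choice I G tx ty c i j (value I G tx ty c i j) (σ.iarr 10 (entry M i j c))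
      (σ.iarr 11 (entry M i j c)) (σ.iarr 12 (entry M i j c)))

theorem Computed.mono {D D' : ℕ → ℕ → ℕ → Prop} {σ : State} (h : Computed M tx ty I G D σ)
    (hD : ∀ i j c, c < 5 → D' i j c → D i j c) : Computed M tx ty I G D' σ :=
  fun i j c hj hc hd => h i j c hj hc (hD i j c hc hd)

theorem Computed.congr {D : ℕ → ℕ → ℕ → Prop} {σ τ : State} (h : Computed M tx ty I G D σ)
    (h1 : τ.rarr 10 = σ.rarr 10) (h2 : τ.iarr 10 = σ.iarr 10) (h3 : τ.iarr 11 = σ.iarr 11)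
    (h4 : τ.iarr 12 = σ.iarr 12) : Computed M tx ty I G D τ := by
  intro i j c hj hc hd
  rw [h1, h2, h3, h4]
  exact h i j c hj hc hd

variable {n r : ℕ} {v : ℕ → Pt × Pt} {L : Layout n r v}

theorem labels_of_agree {σ τ : State} {p : Cmd} (hA : Agree p σ τ) (h6 : p.wIA 6 = false := by rfl)
    (h7 : p.wIA 7 = false := by rfl) : labels M τ = labels M σ := by
  funext d i j
  cases d <;> simp [labels, hA.ia 6 h6, hA.ia 7 h7]

theorem gains_of_agree {σ τ : State} {p : Cmd} (hA : Agree p σ τ) (h8 : p.wRA 8 = false := by rfl)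
    (h9 : p.wRA 9 = false := by rfl) : gains M τ = gains M σ := by
  funext d i j
  cases d <;> simp [gains, hA.ra 8 h8, hA.ra 9 h9]

theorem wp_computePoint {σ : State} (h : Loaded L σ) {w : ℕ} {D : ℕ → ℕ → ℕ → Prop}
    (hI : labels (n + n) σ = I) (hG : gains (n + n) σ = G) (h11 : σ.ireg 11 = i)
    (h12 : σ.ireg 12 = w) (hi : i ≤ L.tx r) (hw : w ≤ L.ty r)
    (hD : ∀ d c, Avail (L.tx r) (L.ty r) i (L.ty r - w) d → c < 5 →
      D (nx d i) (ny d (L.ty r - w)) c)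
    (hC : Computed (n + n) (L.tx r) (L.ty r) I G D σ) :
    wp computePoint 3500 (Computed (n + n) (L.tx r) (L.ty r) I G
      fun i' j' c' => D i' j' c' ∨ (i' = i ∧ j' = L.ty r - w)) σ := by
  have htx := L.tx_lt r L.hr
  have hty := L.ty_lt r L.hr
  have hNX := h.NX_le
  have hNY := h.NY_le
  set j := L.ty r - w with hj
  refine wp_block_cons (S := 7) (T := 3490) (wp_run rfl ?_ (by decide)) (by omega)
  refine wp_block_cons (S := 5) (T := 3480) (wp_run rfl ?_ (by decide)) (by omega)
  refine wp_block_cons (S := 12) (T := 3460) (wp_run rfl ?_ (by decide)) (by omega)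
  have e3 : ∀ x : ℕ, x + x + (x + x) + x = 5 * x := by intro x; ring
  obtain ⟨τ, hτ⟩ : ∃ τ, τ = ((σ.setI 13 j).setI 14 (i * (n + n) + j)).setI 15
    (5 * (i * (n + n) + j)) := ⟨_, rfl⟩
  have hrun :
      (Cmd.iset 15 (five (.reg 14))).run ((Cmd.iset 14 (.add (.get 5 (.reg 11)) (.reg 13))).run
      ((Cmd.iset 13 (.sub (.get 4 (.reg 1)) (.reg 12))).run σ)) = τ := by
    rw [hτ]
    simp [Cmd.run, IExpr.eval, five, h.r_eq, h.ty, h12, ← hj, h11, h.rows i (by omega), e3]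
  rw [hrun]
  have hLτ : Loaded L τ := h.congr (by simp [hτ]) (by simp [hτ]) (by simp [hτ])
    (fun _ _ _ => by simp [hτ]) (by simp [hτ]) (by simp [hτ])
  refine wp_block_cons (S := 3450) (T := 1) (wp_for_const 16 (.const 5) (fun c0 =>
    Computed (n + n) (L.tx r) (L.ty r) I G fun i' j' c' => D i' j' c' ∨ (i' = i ∧ j' = j ∧ c' < c0))
    5 660 rfl ?_ (fun υ hA => rfl) (fun c hc υ hA hCu h16 => ?_) (fun υ hA hCu => ?_)
    (by simp [IExpr.cost])) (by omega)
  · exact (hC.congr (by simp [hτ]) (by simp [hτ]) (by simp [hτ]) (by simp [hτ])).mono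
      fun i' j' c' _ h => h.resolve_right (by omega)
  · refine wp_run rfl ?_ (by decide)
    have hLυ := hLτ.of_agree hA
    have e1 : υ.iarr 3 (υ.ireg 1) = L.tx r := by rw [hLυ.tx, hLυ.r_eq]
    have e2 : υ.iarr 4 (υ.ireg 1) = L.ty r := by rw [hLυ.ty, hLυ.r_eq]
    have hWυ : ∀ d, Avail (L.tx r) (L.ty r) i j d → ∀ c' < 5,
        υ.rarr 10 (entry (n + n) (nx d i) (ny d j) c') =
          value I G (L.tx r) (L.ty r) c' (nx d i) (ny d j) := by
      intro d hd c' hc'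
      refine (hCu (nx d i) (ny d j) c' ?_ hc' (Or.inl (hD d c' hd hc'))).1
      cases d <;> simp [Avail, ny] at hd ⊢ <;> omega
    obtain ⟨dir, col, nc, h1, h2, h3, h4, h5⟩ :=
        run_computeEntry (σ := υ) (M := n + n) (I := I) (G := G)
      (c := c) hi (show j ≤ L.ty r by omega)
      (by rw [hA.i 11 rfl, hτ]; simpa using h11) (by rw [hA.i 13 rfl, hτ]; simp)
      (by rw [hA.i 14 rfl, hτ]; simp) (by rw [hA.i 15 rfl, hτ]; simp) h16 e1 e2 hLυ.M_eq
      (by rw [labels_of_agree hA, hτ]; exact hI) (by rw [gains_of_agree hA, hτ]; exact hG) hWυ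
    · intro i' j' c' hj' hc' hd
      simp only [State.setI_rarr, State.setI_iarr, h2, h3, h4, h5, Function.update_apply,
        entry_inj hj' (show j < n + n by omega) hc' hc]
      by_cases heq : i' = i ∧ j' = j ∧ c' = c
      · simp only [heq, and_self, if_true, true_and]
        exact h1
      · simp only [heq, if_false]
        refine hCu i' j' c' hj' hc' ?_
        rcases hd with hd | ⟨rfl, rfl, hd⟩
        · exact Or.inl hd
        · exact Or.inr ⟨rfl, rfl, by simp at heq; omega⟩
  · exact wp_block_nil (hCu.mono fun i' j' c' hc' hd => hd.imp_right fun h => ⟨h.1, h.2, hc'⟩)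
        le_rfl

theorem wp_computeTable {σ : State} (h : Loaded L σ) (hI : labels (n + n) σ = I)
    (hG : gains (n + n) σ = G) :
    wp computeTable ((n + n) * ((n + n) * 3600 + 100) + 100) (Computed (n + n) (L.tx r) (L.ty r) I G
      fun i j _ => (L.sx r ≤ i ∧ i ≤ L.tx r) ∧ (L.sy r ≤ j ∧ j ≤ L.ty r)) σ := by
  have htx := L.tx_lt r L.hr
  have hty := L.ty_lt r L.hr
  have hNX := h.NX_le
  have hNY := h.NY_le
  have hsx := L.sx_le
  have hsy := L.sy_le
  -- Columns and, inside them, points are processed from the target backwards, so both successors of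
  -- a point are available. Writing `L.tx r < i + u` avoids a truncated subtraction.
  refine wp_for_const 10 _ (fun u => Computed (n + n) (L.tx r) (L.ty r) I G fun i j _ =>
    (L.tx r < i + u ∧ i ≤ L.tx r) ∧ (L.sy r ≤ j ∧ j ≤ L.ty r)) (L.tx r + 1 - L.sx r)
    ((n + n) * 3600 + 50) rfl ?_ (fun τ hA => ?_) (fun u hu τ hA hC h10 => ?_) (fun τ hA hC =>
      ?_) ?_
  · intro i j c _ _ hd; omega
  · have hL := h.of_agree hA
    simp [IExpr.eval, hL.r_eq, hL.tx, hL.sx]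
  · have hL := h.of_agree hA
    refine wp_block_cons (S := 7) (T := (n + n) * 3600 + 40) (wp_run rfl ?_ (by decide)) (by omega)
    have hr1 : (Cmd.iset 11 (.sub (.get 3 (.reg 1)) (.reg 10))).run τ = τ.setI 11 (L.tx r - u) := by
      simp [Cmd.run, IExpr.eval, hL.r_eq, hL.tx, h10]
    rw [hr1]
    have hL' : Loaded L (τ.setI 11 (L.tx r - u)) := hL.congr (by simp) (by simp) (by simp)
      (fun _ _ _ => by simp) (by simp) (by simp)
    refine wp_block_cons (S := (n + n) * 3600 + 30) (T := 1) (wp_for_const 12 _ (fun w =>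
      Computed (n + n) (L.tx r) (L.ty r) I G fun i j _ =>
        ((L.tx r < i + u ∧ i ≤ L.tx r) ∧ (L.sy r ≤ j ∧ j ≤ L.ty r)) ∨
          (i = L.tx r - u ∧ L.ty r < j + w ∧ j ≤ L.ty r))
      (L.ty r + 1 - L.sy r) 3500 rfl ?_ (fun υ hB => ?_) (fun w hw υ hB hCw h12 => ?_)
      (fun υ hB hCw => ?_) ?_) (by omega)
    · exact (hC.congr (by simp) (by simp) (by simp) (by simp)).mono
        fun i' j' c' _ hd => hd.resolve_right (by omega)
    · have hL2 := hL'.of_agree hB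
      simp [IExpr.eval, hL2.r_eq, hL2.ty, hL2.sy]
    · have hL2 := hL'.of_agree hB
      refine (wp_computePoint hL2 (w := w) (i := L.tx r - u) ?_ ?_ ?_ h12 (by omega) (by omega) ?_
        hCw).mono le_rfl fun φ _ hφ => ?_
      · exact (labels_of_agree hB).trans ((labels_of_agree (τ := τ) hA).trans hI)
      · exact (gains_of_agree hB).trans ((gains_of_agree (τ := τ) hA).trans hG)
      · rw [hB.i 11 rfl]; simp
      · intro d c hd hc
        cases d <;> simp [Avail, nx, ny] at hd ⊢ <;> omega
      · exact (hφ.congr (by simp) (by simp) (by simp) (by simp)).mono fun i' j' c' _ hd => by omega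
    · refine wp_block_nil ?_ le_rfl
      exact (hCw.congr (by simp) (by simp) (by simp) (by simp)).mono fun i' j' c' _ hd => by omega
    · simp only [IExpr.cost]
      have : L.ty r + 1 - L.sy r ≤ n + n := by omega
      nlinarith
  · exact hC.mono fun i' j' c' _ hd => by omega
  · simp only [IExpr.cost]
    have : L.tx r + 1 - L.sx r ≤ n + n := by omega
    nlinarith

end

end RAM

end GMMN


/-! ### Reading an optimal path of the center off the stored decisions. -/

namespace GMMN

namespace RAM

/-! ## Tracing the path of the center -/

/-- One step of the trace. -/
def traceStep : Cmd :=
  block [.iset 11 (.get 8 (.reg 10)), .iset 12 (.get 9 (.reg 10)),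
    .iset 13 (.add (five (.add (.get 5 (.reg 11)) (.reg 12))) (.get 14 (.reg 10))),
    .iset 14 (.add (.reg 10) (.const 1)),
    .iput 13 (.reg 10) (.get 11 (.reg 13)), .iput 14 (.reg 14) (.get 12 (.reg 13)),
    .ite (.ieq (.get 10 (.reg 13)) (.const 1))
      (block [.iput 8 (.reg 14) (.add (.reg 11) (.const 1)), .iput 9 (.reg 14) (.reg 12)])
      (block [.iput 8 (.reg 14) (.reg 11), .iput 9 (.reg 14) (.add (.reg 12) (.const 1))])]

/-- Store the path of the center in the integer arrays `8` and `9`,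
  flags for the collected edges in the
array `13`, and the number of steps in the integer register `8`. -/
def tracePath : Cmd :=
  block [.iset 8
    (.add (.sub (.get 3 (.reg 1)) (.get 1 (.reg 1))) (.sub (.get 4 (.reg 1)) (.get 2 (.reg 1)))),
    .iput 8 (.const 0) (.get 1 (.reg 1)), .iput 9 (.const 0) (.get 2 (.reg 1)),
    .iput 14 (.const 0) (.const 0), forLoop 10 (.reg 8) traceStep]

/-- The first `k` steps of a trace are valid. -/
structure TracePrefix {n r : ℕ} {v : ℕ → Pt × Pt} (L : Layout n r v) (I : Bool → ℕ → ℕ → ℕ)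
    (G : Bool → ℕ → ℕ → ℝ) (k : ℕ) (Pi Pj : ℕ → ℕ) (col : ℕ → ℕ) (ctx : ℕ → ℕ) : Prop where
  start_x : Pi 0 = L.sx r
  start_y : Pj 0 = L.sy r
  start_ctx : ctx 0 = 0
  ctx_lt : ctx k < 5
  sum : Pi k + Pj k = L.sx r + L.sy r + k
  bounds : (L.sx r ≤ Pi k ∧ Pi k ≤ L.tx r) ∧ (L.sy r ≤ Pj k ∧ Pj k ≤ L.ty r)
  step : ∀ e < k, ∃ d, Pi (e + 1) = nx d (Pi e) ∧ Pj (e + 1) = ny d (Pj e) ∧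
    Choice I G (L.tx r) (L.ty r) (ctx e) (Pi e) (Pj e)
      (value I G (L.tx r) (L.ty r) (ctx e) (Pi e) (Pj e)) (runCtx d) (col e) (ctx (e + 1))

theorem runCtx_inj {d d' : Bool} (h : runCtx d = runCtx d') : d = d' :=
  Layout.Trace.runCtx_injective h

section

variable {n r : ℕ} {v : ℕ → Pt × Pt} {L : Layout n r v} {I : Bool → ℕ → ℕ → ℕ}
  {G : Bool → ℕ → ℕ → ℝ}

/-- The new arrays need to agree with the old ones only on the prefix, since a step writes entry `k`
of `col` and entry `k + 1` of the others. -/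
theorem TracePrefix.extend {k : ℕ} {Pi Pj Pi' Pj' col col' ctx ctx' : ℕ → ℕ}
    (h : TracePrefix L I G k Pi Pj col ctx) {dir : ℕ}
    (hc : Choice I G (L.tx r) (L.ty r) (ctx k) (Pi k) (Pj k)
      (value I G (L.tx r) (L.ty r) (ctx k) (Pi k) (Pj k)) dir (col' k) (ctx' (k + 1)))
    (hPi : ∀ e ≤ k, Pi' e = Pi e) (hPj : ∀ e ≤ k, Pj' e = Pj e) (hctx : ∀ e ≤ k, ctx' e = ctx e)
    (hcol : ∀ e < k, col' e = col e) (hi : Pi' (k + 1) = if dir = 1 then Pi k + 1 else Pi k)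
    (hj : Pj' (k + 1) = if dir = 1 then Pj k else Pj k + 1) :
    TracePrefix L I G (k + 1) Pi' Pj' col' ctx' := by
  obtain ⟨d, rfl, ha, hcases⟩ := id hc
  have hi' : Pi' (k + 1) = nx d (Pi k) := by rw [hi]; cases d <;> simp [runCtx, nx]
  have hj' : Pj' (k + 1) = ny d (Pj k) := by rw [hj]; cases d <;> simp [runCtx, ny]
  have hb := h.bounds
  have hs := h.sum
  refine ⟨by rw [hPi 0 (by omega), h.start_x], by rw [hPj 0 (by omega), h.start_y],
    by rw [hctx 0 (by omega), h.start_ctx], ?_, ?_, ?_, fun e he => ?_⟩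
  · rcases hcases with ⟨-, e, -⟩ | ⟨-, -, e, -⟩ <;> rw [e]
    · exact skipCtx_lt _ _ _ _ _
    · exact runCtx_lt _
  · rw [hi', hj']; cases d <;> simp [nx, ny] <;> omega
  · rw [hi', hj']; cases d <;> simp [nx, ny, Avail] at ha ⊢ <;> omega
  · rcases Nat.lt_succ_iff_lt_or_eq.1 he with he | rfl
    · rw [hPi _ he, hPj _ he, hctx _ he, hPi _ he.le, hPj _ he.le, hctx _ he.le, hcol _ he]
      exact h.step e he
    · rw [hPi _ le_rfl, hPj _ le_rfl, hctx _ le_rfl]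
      exact ⟨d, hi', hj', hc⟩

theorem TracePrefix.trace {m : ℕ} {Pi Pj col ctx : ℕ → ℕ} (h : TracePrefix L I G m Pi Pj col ctx)
    (hm : m = (L.tx r - L.sx r) + (L.ty r - L.sy r)) :
    L.Trace I G m Pi Pj (fun e => col e = 1) ctx := by
  refine ⟨hm, h.start_x, h.start_y, h.start_ctx, fun e he => ?_⟩
  obtain ⟨d, h1, h2, d', h3, h4, h5⟩ := h.step e he
  obtain rfl := runCtx_inj h3
  refine ⟨d, h4, h1, h2, ?_⟩
  rcases h5 with ⟨c1, c2, c3⟩ | ⟨c1, c2, c3, c4⟩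
  · refine Or.inl ⟨by omega, c2, ?_⟩
    rw [c3, h1, h2]
  · refine Or.inr ⟨c1, c2, c3, ?_⟩
    rw [c4, h1, h2]

theorem wp_tracePath {σ : State} (h : Loaded L σ)
    (hC : Computed (n + n) (L.tx r) (L.ty r) I G
      (fun i j _ => (L.sx r ≤ i ∧ i ≤ L.tx r) ∧ (L.sy r ≤ j ∧ j ≤ L.ty r)) σ) :
    wp tracePath ((n + n + (n + n)) * 200 + 100) (fun τ => τ.ireg 8 ≤ n + n + (n + n) ∧
      L.Trace I G (τ.ireg 8) (τ.iarr 8) (τ.iarr 9) (fun e => τ.iarr 13 e = 1) (τ.iarr 14)) σ := by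
  have htx := L.tx_lt r L.hr
  have hty := L.ty_lt r L.hr
  have hNX := h.NX_le
  have hNY := h.NY_le
  have hsx := L.sx_le
  have hsy := L.sy_le
  obtain ⟨m, hm⟩ : ∃ m, m = (L.tx r - L.sx r) + (L.ty r - L.sy r) := ⟨_, rfl⟩
  have hmn : m ≤ n + n + (n + n) := by omega
  refine wp_block_cons (S := 12) (T := (n + n + (n + n)) * 200 + 80) (wp_run rfl ?_ (by decide))
      (by omega)
  refine wp_block_cons (S := 5) (T := (n + n + (n + n)) * 200 + 70) (wp_run rfl ?_ (by decide))
      (by omega)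
  refine wp_block_cons (S := 5) (T := (n + n + (n + n)) * 200 + 60) (wp_run rfl ?_ (by decide))
      (by omega)
  refine wp_block_cons (S := 5) (T := (n + n + (n + n)) * 200 + 50) (wp_run rfl ?_ (by decide))
      (by omega)
  obtain ⟨τ, hτ⟩ : ∃ τ, τ = (((σ.setI 8 m).putI 8 0 (L.sx r)).putI 9 0 (L.sy r)).putI 14 0 0 :=
      ⟨_, rfl⟩
  have hrun : (Cmd.iput 14 (.const 0) (.const 0)).run ((Cmd.iput 9 (.const 0) (.get 2 (.reg 1))).run
      ((Cmd.iput 8 (.const 0) (.get 1 (.reg 1))).run ((Cmd.iset 8 (.add (.sub (.get 3 (.reg 1))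
        (.get 1 (.reg 1))) (.sub (.get 4 (.reg 1)) (.get 2 (.reg 1))))).run σ))) = τ := by
    rw [hτ]
    simp [Cmd.run, IExpr.eval, h.r_eq, h.tx, h.ty, h.sx, h.sy, ← hm]
  rw [hrun]
  have hLτ : Loaded L τ := h.congr (by simp [hτ]) (by simp [hτ]) (by simp [hτ])
    (fun a h1 h2 => by
      simp [hτ, show a ≠ 14 by omega, show a ≠ 9 by omega, show a ≠ 8 by omega])
    (by simp [hτ]) (by simp [hτ])
  have hCτ := hC.congr (τ := τ) (by simp [hτ]) (by simp [hτ]) (by simp [hτ]) (by simp [hτ])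
  have hm' : τ.ireg 8 = m := by simp [hτ]
  refine wp_block_cons (S := (n + n + (n + n)) * 200 + 40) (T := 1) (wp_for_const 10 (.reg 8)
    (fun k υ => TracePrefix L I G k (υ.iarr 8) (υ.iarr 9) (υ.iarr 13) (υ.iarr 14)) m 150 rfl ?_
    (fun υ hA => (hA.i 8 rfl).trans hm') (fun k hk υ hA hP h10 => ?_) (fun υ hA hP => ?_) ?_)
      (by omega)
  · exact ⟨by simp [hτ], by simp [hτ], by simp [hτ], by simp [hτ], by simp [hτ],
      by simp [hτ, hsx, hsy], fun e he => absurd he (by omega)⟩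
  · refine wp_run rfl ?_ (by decide)
    have hL := hLτ.of_agree hA
    have hCυ := hCτ.congr (hA.ra 10 rfl) (hA.ia 10 rfl) (hA.ia 11 rfl) (hA.ia 12 rfl)
    have hb := hP.bounds
    have hs := hP.sum
    obtain ⟨i, hi⟩ : ∃ i, i = υ.iarr 8 k := ⟨_, rfl⟩
    obtain ⟨j, hj⟩ : ∃ j, j = υ.iarr 9 k := ⟨_, rfl⟩
    obtain ⟨c, hc⟩ : ∃ c, c = υ.iarr 14 k := ⟨_, rfl⟩
    rw [← hi, ← hj] at hb hs
    -- A decision is stored here: fewer than `m` steps have been made, so the target is not reached.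
    have hch := (hCυ i j c (by omega) (hc ▸ hP.ctx_lt) hb).2 (by omega)
    have e3 : ∀ x : ℕ, x + x + (x + x) + x = 5 * x := by intro x; ring
    have hrow := hL.rows i (by omega)
    have hen : 5 * (i * (n + n) + j) + c = entry (n + n) i j c := rfl
    have hrun : traceStep.run υ = (fun φ : State => if υ.iarr 10 (entry (n + n) i j c) = 1 then
          (φ.putI 8 (k + 1) (i + 1)).putI 9 (k + 1) j else
          (φ.putI 8 (k + 1) i).putI 9 (k + 1) (j + 1))
        ((((((υ.setI 11 i).setI 12 j).setI 13 (entry (n + n) i j c)).setI 14 (k + 1)).putI 13 k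
          (υ.iarr 11 (entry (n + n) i j c))).putI 14 (k + 1)
            (υ.iarr 12 (entry (n + n) i j c))) := by
      simp [traceStep, block, Cmd.run, IExpr.eval, five, h10, ← hi, ← hj, ← hc, hrow, e3, hen]
    refine hP.extend (dir := υ.iarr 10 (entry (n + n) i j c)) ?_ ?_ ?_ ?_ ?_ ?_ ?_
    · rw [← hi, ← hj, ← hc, hrun]
      convert hch using 1 <;> split_ifs <;> simp
    · intro e he; rw [hrun]; dsimp only; split_ifs <;> simp [Function.update_apply] <;> omega
    · intro e he; rw [hrun]; dsimp only; split_ifs <;> simp [Function.update_apply] <;> omega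
    · intro e he; rw [hrun]; dsimp only; split_ifs <;> simp [Function.update_apply] <;> omega
    · intro e he; rw [hrun]; dsimp only; split_ifs <;> simp [Function.update_apply] <;> omega
    · rw [hrun]; dsimp only; split_ifs <;> simp [hi]
    · rw [hrun]; dsimp only; split_ifs <;> simp [hj]
  · refine wp_block_nil ?_ le_rfl
    have e8 : υ.ireg 8 = m := (hA.i 8 rfl).trans hm'
    rw [e8]
    exact ⟨hmn, hP.trace hm⟩
  · simp only [IExpr.cost]
    nlinarith

end

end RAM

end GMMN


/-! ### Walks on the grid and the concatenation of path pieces. -/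

namespace GMMN

/-! ## Assembling paths -/

/-- The points `q 1, …, q N`. -/
def segmentList {α : Type*} (q : ℕ → α) (N : ℕ) : List α := (List.range N).map fun s => q (s + 1)

theorem segmentList_succ {α : Type*} (q : ℕ → α) (N : ℕ) :
    segmentList q (N + 1) = segmentList q N ++ [q (N + 1)] := by
  simp [segmentList, List.range_succ]

@[simp] theorem length_segmentList {α : Type*} (q : ℕ → α) (N : ℕ) :
    (segmentList q N).length = N := by
  simp [segmentList]

theorem getLast?_append_segmentList {α : Type*} {q : ℕ → α} {l : List α} (h : l.getLast? =
    some (q 0))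
    (N : ℕ) : (l ++ segmentList q N).getLast? = some (q N) := by
  cases N with
  | zero => simpa [segmentList] using h
  | succ N => rw [segmentList_succ, ← List.append_assoc]; simp

theorem isChain_append_segmentList {α : Type*} {R : α → α → Prop} {q : ℕ → α} {l : List α}
    (hl : l.IsChain R) (h : l.getLast? = some (q 0)) (N : ℕ) (hq : ∀ s < N, R (q s) (q (s + 1))) :
    (l ++ segmentList q N).IsChain R := by
  induction N with
  | zero => simpa [segmentList] using hl
  | succ N ih =>
    rw [segmentList_succ, ← List.append_assoc]
    refine (ih fun s hs => hq s (by omega)).append (by simp) fun x hx y hy => ?_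
    rw [getLast?_append_segmentList h, Option.mem_some_iff] at hx
    simp only [List.head?_cons, Option.mem_some_iff] at hy
    rw [← hx, ← hy]
    exact hq N (by omega)

theorem exists_append_segmentList {α : Type*} {q : ℕ → α} {l : List α} (h : l.getLast? = some (q 0))
    {N s : ℕ} (hs : s < N) : ∃ a b, l ++ segmentList q N = a ++ q s :: q (s + 1) :: b := by
  induction N with
  | zero => omega
  | succ N ih =>
    rw [segmentList_succ, ← List.append_assoc]
    rcases Nat.lt_succ_iff_lt_or_eq.1 hs with hs | rfl
    · obtain ⟨a, b, e⟩ := ih hs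
      exact ⟨a, b ++ [q (N + 1)], by rw [e]; simp⟩
    · obtain ⟨a, e⟩ := List.getLast?_eq_some_iff.1 (getLast?_append_segmentList h s)
      exact ⟨a, [], by rw [e]; simp⟩

/-- A unit step towards `t`, first horizontally. -/
def toward (t p : ℕ × ℕ) : ℕ × ℕ :=
  if p.1 < t.1 then (p.1 + 1, p.2) else if t.1 < p.1 then (p.1 - 1, p.2)
  else if p.2 < t.2 then (p.1, p.2 + 1) else (p.1, p.2 - 1)

/-- The Manhattan distance of grid points. -/
def gridDist (p t : ℕ × ℕ) : ℕ := ((t.1 - p.1) + (p.1 - t.1)) + ((t.2 - p.2) + (p.2 - t.2))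

/-- The walk from `p` towards `t`. -/
def walkSeq (t p : ℕ × ℕ) : ℕ → ℕ × ℕ
  | 0 => p
  | s + 1 => toward t (walkSeq t p s)

/-- Positivity excludes `p = t`, where the last branch of `toward` may move away from the target. -/
theorem gridDist_toward {t p : ℕ × ℕ} (h : 0 < gridDist p t) :
    gridDist (toward t p) t + 1 = gridDist p t ∧
      (min p.1 t.1 ≤ (toward t p).1 ∧ (toward t p).1 ≤ max p.1 t.1) ∧
      (min p.2 t.2 ≤ (toward t p).2 ∧ (toward t p).2 ≤ max p.2 t.2) := by
  unfold gridDist at *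
  unfold toward
  split_ifs <;> dsimp only <;> omega

theorem walkSeq_spec (t p : ℕ × ℕ) {s : ℕ} (hs : s ≤ gridDist p t) :
    gridDist (walkSeq t p s) t + s = gridDist p t ∧
      (min p.1 t.1 ≤ (walkSeq t p s).1 ∧ (walkSeq t p s).1 ≤ max p.1 t.1) ∧
      (min p.2 t.2 ≤ (walkSeq t p s).2 ∧ (walkSeq t p s).2 ≤ max p.2 t.2) := by
  induction s with
  | zero => simp [walkSeq]
  | succ s ih =>
    have h1 := ih (by omega)
    have h2 := gridDist_toward (t := t) (p := walkSeq t p s) (by omega)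
    simp only [walkSeq]
    omega

theorem walkSeq_gridDist (t p : ℕ × ℕ) : walkSeq t p (gridDist p t) = t := by
  have h := (walkSeq_spec t p le_rfl).1
  have h0 : gridDist (walkSeq t p (gridDist p t)) t = 0 := by omega
  generalize walkSeq t p (gridDist p t) = q at h0
  unfold gridDist at h0
  exact Prod.ext (by omega) (by omega)

namespace Layout

variable {n r : ℕ} {v : ℕ → Pt × Pt} (L : Layout n r v)

/-- The grid point `p` is in the box of `v k`. -/
def InBox (k : ℕ) (p : ℕ × ℕ) : Prop :=
  (min (L.sx k) (L.tx k) ≤ p.1 ∧ p.1 ≤ max (L.sx k) (L.tx k)) ∧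
    (min (L.sy k) (L.ty k) ≤ p.2 ∧ p.2 ≤ max (L.sy k) (L.ty k))

/-- The direction from `p` to `t` agrees with the direction of `v k`. -/
def Along (k : ℕ) (p t : ℕ × ℕ) : Prop :=
  ((p.1 < t.1 → L.sx k < L.tx k) ∧ (t.1 < p.1 → L.tx k < L.sx k)) ∧
    ((p.2 < t.2 → L.sy k < L.ty k) ∧ (t.2 < p.2 → L.ty k < L.sy k))

variable {L} in
-- The walk never leaves the rectangle spanned by `p` and `t`, hence stays in the box, and moves
-- only towards `t`, which `Along` makes a direction of `v k`.
theorem unitStep_walkSeq {k : ℕ} (hk : k < n) {p t : ℕ × ℕ} (hp : L.InBox k p) (ht : L.InBox k t)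
    (h : L.Along k p t) {s : ℕ} (hs : s < gridDist p t) :
    L.UnitStep k (walkSeq t p s) (walkSeq t p (s + 1)) := by
  have h1 := walkSeq_spec t p hs.le
  have h2 := walkSeq_spec t p (Nat.succ_le_of_lt hs)
  have h3 := L.max_x_lt hk
  have h4 := L.max_y_lt hk
  unfold InBox at hp ht
  unfold Along at h
  have h5 : 0 < gridDist (walkSeq t p s) t := by omega
  refine ⟨⟨⟨by omega, by omega⟩, ?_⟩, ?_⟩
  · simp only [Nat.succ_eq_add_one] at h2
    exact ⟨by omega, by omega⟩
  · simp only [walkSeq]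
    generalize walkSeq t p s = q at h1 h5
    unfold gridDist at h5
    unfold toward
    split_ifs <;> dsimp only <;> omega

/-- The list `l` is an initial part of a path for `v k`, up to the point `p`. -/
structure Initial (k : ℕ) (l : List (ℕ × ℕ)) (p : ℕ × ℕ) : Prop where
  head : l.head? = some (L.sx k, L.sy k)
  last : l.getLast? = some p
  chain : l.IsChain (L.UnitStep k)
  mem : L.InBox k p

variable {L} in
theorem Initial.segment {k : ℕ} {l : List (ℕ × ℕ)} {p : ℕ × ℕ} (h : L.Initial k l p)
    {q : ℕ → ℕ × ℕ} {N : ℕ} (h0 : q 0 = p) (hq : ∀ s < N, L.UnitStep k (q s) (q (s + 1)))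
    (hN : L.InBox k (q N)) : L.Initial k (l ++ segmentList q N) (q N) := by
  have hl : l.getLast? = some (q 0) := h0 ▸ h.last
  refine ⟨?_, getLast?_append_segmentList hl N, isChain_append_segmentList h.chain hl N hq, hN⟩
  rw [List.head?_append, h.head]; rfl

variable {L} in
theorem Initial.walk {k : ℕ} (hk : k < n) {l : List (ℕ × ℕ)} {p t : ℕ × ℕ} (h : L.Initial k l p)
    (ht : L.InBox k t) (ha : L.Along k p t) :
    L.Initial k (l ++ segmentList (walkSeq t p) (gridDist p t)) t := by
  have := h.segment (q := walkSeq t p) (N := gridDist p t) rfl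
    (fun s hs => unitStep_walkSeq hk h.mem ht ha hs) (by rwa [walkSeq_gridDist])
  rwa [walkSeq_gridDist] at this

theorem inBox_start (k : ℕ) : L.InBox k (L.sx k, L.sy k) := by
  unfold InBox; dsimp only; omega

theorem inBox_end (k : ℕ) : L.InBox k (L.tx k, L.ty k) := by
  unfold InBox; dsimp only; omega

variable {L} in
theorem InBox.along_start {k : ℕ} {p : ℕ × ℕ} (h : L.InBox k p) : L.Along k (L.sx k, L.sy k) p := by
  unfold InBox at h; unfold Along; dsimp only; omega

variable {L} in
theorem InBox.along_end {k : ℕ} {p : ℕ × ℕ} (h : L.InBox k p) : L.Along k p (L.tx k, L.ty k) := by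
  unfold InBox at h; unfold Along; dsimp only; omega

theorem gridDist_le {k : ℕ} (hk : k < n) {p t : ℕ × ℕ} (hp : L.InBox k p) (ht : L.InBox k t) :
    gridDist p t ≤ L.NX + L.NY := by
  have h3 := L.max_x_lt hk
  have h4 := L.max_y_lt hk
  unfold InBox at hp ht
  unfold gridDist
  omega

end Layout

end GMMN


/-! ### Emission of walks and of parts of the path of the center. -/

namespace GMMN

namespace RAM

/-! ## Writing the paths -/

/-- The points with grid coordinates `tot` have been written. -/
structure Emitted {n r : ℕ} {v : ℕ → Pt × Pt} (L : Layout n r v) (tot : List (ℕ × ℕ)) (σ : State) :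
    Prop where
  len : σ.ireg 7 = tot.length
  x : ∀ s p, tot[s]? = some p → σ.rarr 4 s = L.X p.1
  y : ∀ s p, tot[s]? = some p → σ.rarr 5 s = L.Y p.2

/-- The current grid point, in the integer registers `11` and `12`. -/
def cur (σ : State) : ℕ × ℕ := (σ.ireg 11, σ.ireg 12)

/-- Write the current point. -/
def emit : Cmd :=
  block [.rput 4 (.reg 7) (.get 6 (.reg 11)), .rput 5 (.reg 7) (.get 7 (.reg 12)),
    .iset 7 (.add (.reg 7) (.const 1))]

/-- Move to the neighbouring point in the direction of the target in the registers `13` and `14`. -/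
def moveToward : Cmd :=
  .ite (.ilt (.reg 11) (.reg 13)) (.iset 11 (.add (.reg 11) (.const 1)))
    (.ite (.ilt (.reg 13) (.reg 11)) (.iset 11 (.sub (.reg 11) (.const 1)))
      (.ite (.ilt (.reg 12) (.reg 14)) (.iset 12 (.add (.reg 12) (.const 1)))
        (.iset 12 (.sub (.reg 12) (.const 1)))))

/-- Move to the next point of the path of the center. -/
def moveForward : Cmd :=
  block [.iset 11 (.get 8 (.add (.reg 21) (.add (.reg 16) (.const 1)))),
    .iset 12 (.get 9 (.add (.reg 21) (.add (.reg 16) (.const 1))))]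

/-- Move to the previous point of the path of the center. -/
def moveBackward : Cmd :=
  block [.iset 11 (.get 8 (.sub (.reg 22) (.add (.reg 16) (.const 1)))),
    .iset 12 (.get 9 (.sub (.reg 22) (.add (.reg 16) (.const 1))))]

/-- Repeatedly move and write the current point. -/
def emitLoop (move : Cmd) : Cmd := forLoop 16 (.reg 15) (block [move, emit])

/-- Walk to the target. -/
def walkTo : Cmd :=
  block [.iset 15 (.add (.add (.sub (.reg 13) (.reg 11)) (.sub (.reg 11) (.reg 13)))
    (.add (.sub (.reg 14) (.reg 12)) (.sub (.reg 12) (.reg 14)))), emitLoop moveToward]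

/-- Walk along a part of the path of the center. -/
def followPath (move : Cmd) : Cmd := block [.iset 15 (.sub (.reg 22) (.reg 21)), emitLoop move]

/-- Extend the range of edges that the current path follows by the edge in register `16`, if that is
possible. -/
def scanStep : Cmd :=
  .ite (.conj (.or (.ieq (.reg 10) (.reg 1)) (.ieq (.get 13 (.reg 16)) (.const 1)))
      (.conj (.conj (.neg (.ilt (.get 8 (.reg 16)) (.reg 11)))
        (.neg (.ilt (.reg 12) (.get 8 (.add (.reg 16) (.const 1))))))
        (.conj (.neg (.ilt (.get 9 (.reg 16)) (.reg 13)))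
          (.neg (.ilt (.reg 14) (.get 9 (.add (.reg 16) (.const 1))))))))
    (block [.ite (.ieq (.reg 20) (.const 0)) (block [.iset 20 (.const 1), .iset 21 (.reg 16)])
      .skip,
      .iset 22 (.add (.reg 16) (.const 1))]) .skip

/-- The current path follows the path of the center in forward direction. -/
def forwardTest : Test :=
  .or (.conj (.ilt (.get 8 (.reg 21)) (.get 8 (.reg 22)))
    (.ilt (.get 1 (.reg 10)) (.get 3 (.reg 10))))
    (.conj (.ilt (.get 9 (.reg 21)) (.get 9 (.reg 22)))
      (.ilt (.get 2 (.reg 10)) (.get 4 (.reg 10))))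

/-- Follow the path of the center. -/
def followPart : Cmd :=
  .ite forwardTest
    (block [.iset 13 (.get 8 (.reg 21)), .iset 14 (.get 9 (.reg 21)), walkTo,
      followPath moveForward])
    (block [.iset 13 (.get 8 (.reg 22)), .iset 14 (.get 9 (.reg 22)), walkTo,
      followPath moveBackward])

/-- Find the edges of the path of the center that the path of the pair with the index in integer
register `10` follows. -/
def findPart : Cmd := block [loadBox, .iset 20 (.const 0), forLoop 16 (.reg 8) scanStep]

/-- Write the first point of a path. -/
def startPath : Cmd := block [.iset 11 (.get 1 (.reg 10)), .iset 12 (.get 2 (.reg 10)), emit]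

/-- Walk to the end of a path. -/
def finishPath : Cmd := block [.iset 13 (.get 3 (.reg 10)), .iset 14 (.get 4 (.reg 10)), walkTo]

/-- Write the points of the path for the pair with the index in integer register `10`. -/
def writePoints : Cmd :=
  block [findPart, startPath, .ite (.ieq (.reg 20) (.const 1)) followPart .skip, finishPath]

/-- Write the paths for all pairs. -/
def writePaths : Cmd :=
  forLoop 10 (.reg 0) (block [writePoints, .iput 0 (.add (.reg 10) (.const 1)) (.reg 7)])

section

variable {n r : ℕ} {v : ℕ → Pt × Pt} {L : Layout n r v} {tot : List (ℕ × ℕ)}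

theorem Emitted.congr {σ τ : State} (h : Emitted L tot σ) (h7 : τ.ireg 7 = σ.ireg 7)
    (h4 : τ.rarr 4 = σ.rarr 4) (h5 : τ.rarr 5 = σ.rarr 5) : Emitted L tot τ :=
  ⟨h7.trans h.len, fun s p hs => h4 ▸ h.x s p hs, fun s p hs => h5 ▸ h.y s p hs⟩

theorem Emitted.of_agree {σ τ : State} {c : Cmd} (h : Emitted L tot σ) (hA : Agree c σ τ)
    (h7 : c.wI 7 = false := by rfl) (h4 : c.wRA 4 = false := by rfl)
    (h5 : c.wRA 5 = false := by rfl) : Emitted L tot τ :=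
  h.congr (hA.i 7 h7) (hA.ra 4 h4) (hA.ra 5 h5)

theorem emitted_emit {σ : State} (hL : Loaded L σ) (h : Emitted L tot σ) :
    Emitted L (tot ++ [cur σ]) (emit.run σ) ∧ cur (emit.run σ) = cur σ := by
  have hrun : emit.run σ = ((σ.putR 4 tot.length (L.X (σ.ireg 11))).putR 5 tot.length
      (L.Y (σ.ireg 12))).setI 7 (tot.length + 1) := by
    simp [emit, block, Cmd.run, IExpr.eval, RExpr.eval, h.len, hL.X, hL.Y]
  rw [hrun]
  have hget : ∀ s p, (tot ++ [cur σ])[s]? = some p →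
      (s ≠ tot.length ∧ tot[s]? = some p) ∨ (s = tot.length ∧ p = cur σ) := by
    intro s p hs
    rcases lt_trichotomy s tot.length with hlt | rfl | hgt
    · rw [List.getElem?_append_left hlt] at hs
      exact Or.inl ⟨hlt.ne, hs⟩
    · simp at hs; exact Or.inr ⟨rfl, hs.symm⟩
    · rw [List.getElem?_eq_none (by simp; omega)] at hs; exact absurd hs (by simp)
  refine ⟨⟨by simp, fun s p hs => ?_, fun s p hs => ?_⟩, by simp [cur]⟩
  · rcases hget s p hs with ⟨h1, h2⟩ | ⟨rfl, rfl⟩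
    · simpa [Function.update_apply, h1] using h.x s p h2
    · simp [cur]
  · rcases hget s p hs with ⟨h1, h2⟩ | ⟨rfl, rfl⟩
    · simpa [Function.update_apply, h1] using h.y s p h2
    · simp [cur]

/-- A command that only changes the current point. -/
structure IsMove (c : Cmd) : Prop where
  free : c.loopFree = true
  size : c.size ≤ 60
  i : ∀ x, x ≠ 11 → x ≠ 12 → c.wI x = false
  ia : ∀ a, c.wIA a = false
  ra : ∀ a, c.wRA a = false

theorem isMove_toward : IsMove moveToward :=
  ⟨rfl, by decide, fun x h1 h2 => by simp [moveToward, Cmd.wI, h1, h2], fun _ => rfl, fun _ => rfl⟩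

theorem isMove_forward : IsMove moveForward :=
  ⟨rfl, by decide, fun x h1 h2 => by simp [moveForward, block, Cmd.wI, h1,
    h2], fun _ => rfl, fun _ => rfl⟩

theorem isMove_backward : IsMove moveBackward :=
  ⟨rfl, by decide, fun x h1 h2 => by simp [moveBackward, block, Cmd.wI, h1,
    h2], fun _ => rfl, fun _ => rfl⟩

theorem IsMove.wI_emitLoop {c : Cmd} (h : IsMove c) {x : ℕ} (hx : x ≠ 7 ∧ x ≠ 11 ∧ x ≠ 12 ∧
    x ≠ 16) :
    (emitLoop c).wI x = false := by
  simp [emitLoop, forLoop, block, emit, Cmd.wI, h.i x hx.2.1 hx.2.2.1, hx]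

theorem IsMove.wIA_emitLoop {c : Cmd} (h : IsMove c) (a : ℕ) : (emitLoop c).wIA a = false := by
  simp [emitLoop, forLoop, block, emit, Cmd.wIA, h.ia]

theorem IsMove.wRA_emitLoop {c : Cmd} (h : IsMove c) {a : ℕ} (ha : a ≠ 4 ∧ a ≠ 5) :
    (emitLoop c).wRA a = false := by
  simp [emitLoop, forLoop, block, emit, Cmd.wRA, h.ra, ha]

theorem IsMove.loaded {c : Cmd} (h : IsMove c) {σ τ : State} (hL : Loaded L σ)
    (hA : Agree (emitLoop c) σ τ) : Loaded L τ :=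
  hL.of_agree hA (h.wI_emitLoop (by omega)) (h.wI_emitLoop (by omega)) (h.wI_emitLoop (by omega))
    ⟨h.wIA_emitLoop _, h.wIA_emitLoop _, h.wIA_emitLoop _, h.wIA_emitLoop _, h.wIA_emitLoop _⟩
    (h.wRA_emitLoop (by omega)) (h.wRA_emitLoop (by omega))

theorem wp_emitLoop {move : Cmd} (hm : IsMove move) {σ : State} (hL : Loaded L σ)
    (h : Emitted L tot σ) {q : ℕ → ℕ × ℕ} {N : ℕ} (h0 : cur σ = q 0) (hN : σ.ireg 15 = N)
    (hq : ∀ s < N, ∀ τ, Agree (emitLoop move) σ τ → τ.ireg 16 = s → cur τ = q s →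
      cur (move.run τ) = q (s + 1)) :
    wp (emitLoop move) (N * 100 + 10) (fun τ => Emitted L (tot ++ segmentList q N) τ ∧ cur τ = q N)
      σ := by
  refine wp_for_const 16 (.reg 15) (fun s τ => Emitted L (tot ++ segmentList q s) τ ∧ cur τ =
      q s) N 85
    ?_ ?_ (fun τ hA => ?_) (fun s hs τ hA hI h16 => ?_) (fun τ hA hI => hI)
      (by simp [IExpr.cost]; omega)
  · simp [block, emit, Cmd.wI, hm.i]
  · refine ⟨?_, by simpa [cur] using h0⟩
    have : tot ++ segmentList q 0 = tot := by simp [segmentList]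
    rw [this]
    exact h.congr (by simp) rfl rfl
  · exact (hA.i 15 (hm.wI_emitLoop (by omega))).trans hN
  · have hfree : (block [move, emit]).loopFree = true := by
      simp [block, emit, Cmd.loopFree, hm.free]
    have hsz := hm.size
    refine wp_run hfree ?_ ?_
    · have hAm := agree_run hm.free τ
      have hL' : Loaded L (move.run τ) :=
          (hm.loaded hL hA).of_agree hAm (hm.i _ (by omega) (by omega))
        (hm.i _ (by omega) (by omega)) (hm.i _ (by omega) (by omega))
        ⟨hm.ia _, hm.ia _, hm.ia _, hm.ia _, hm.ia _⟩ (hm.ra _) (hm.ra _)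
      obtain ⟨h1, h2⟩ :=
          emitted_emit hL' (hI.1.of_agree hAm (hm.i _ (by omega) (by omega)) (hm.ra _)
        (hm.ra _))
      rw [hq s hs τ hA h16 hI.2] at h1 h2
      rw [segmentList_succ, ← List.append_assoc]
      exact ⟨h1.congr (by simp [block, Cmd.run]) rfl rfl, by simpa [block, Cmd.run, cur] using h2⟩
    · have : emit.size ≤ 20 := by decide
      simp only [block, Cmd.size]; omega

theorem wp_walkTo {σ : State} (hL : Loaded L σ) (h : Emitted L tot σ) {p t : ℕ × ℕ} (hp : cur σ = p)
    (ht : (σ.ireg 13, σ.ireg 14) = t) {B : ℕ} (hB : gridDist p t ≤ B) :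
    wp walkTo (B * 100 + 40) (fun τ =>
      Emitted L (tot ++ segmentList (walkSeq t p) (gridDist p t)) τ ∧ cur τ = t) σ := by
  have hp1 : σ.ireg 11 = p.1 := congrArg Prod.fst hp
  have hp2 : σ.ireg 12 = p.2 := congrArg Prod.snd hp
  have ht1 : σ.ireg 13 = t.1 := congrArg Prod.fst ht
  have ht2 : σ.ireg 14 = t.2 := congrArg Prod.snd ht
  refine wp_block_cons (S := 16) (T := B * 100 + 20) (wp_run rfl ?_ (by decide)) (by omega)
  have hrun : (Cmd.iset 15 (.add (.add (.sub (.reg 13) (.reg 11)) (.sub (.reg 11) (.reg 13)))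
    (.add (.sub (.reg 14) (.reg 12)) (.sub (.reg 12) (.reg 14))))).run σ =
      σ.setI 15 (gridDist p t) := by
    simp [Cmd.run, IExpr.eval, hp1, hp2, ht1, ht2, gridDist]
  rw [hrun]
  have hL' : Loaded L (σ.setI 15 (gridDist p t)) := hL.congr (by simp) (by simp) (by simp)
    (fun _ _ _ => by simp) rfl rfl
  refine wp_block_cons (S := B * 100 + 10) (T := 1) ((wp_emitLoop isMove_toward hL'
    (h.congr (by simp) rfl rfl) (q := walkSeq t p) (N := gridDist p t)
      (by simpa [cur, walkSeq] using hp)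
    (by simp) (fun s hs τ hA _ hc => ?_)).mono (by nlinarith) fun τ hA hτ => ?_) (by omega)
  · have e1 : τ.ireg 13 = t.1 := by rw [hA.i 13 rfl]; simpa using ht1
    have e2 : τ.ireg 14 = t.2 := by rw [hA.i 14 rfl]; simpa using ht2
    have c1 : τ.ireg 11 = (walkSeq t p s).1 := congrArg Prod.fst hc
    have c2 : τ.ireg 12 = (walkSeq t p s).2 := congrArg Prod.snd hc
    simp only [walkSeq, moveToward, toward, Cmd.run, Test.holds_ilt, IExpr.eval, e1, e2, c1, c2]
    split_ifs <;> simp [cur, c1, c2]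
  · refine wp_block_nil ⟨hτ.1, ?_⟩ le_rfl
    rw [hτ.2, walkSeq_gridDist]

theorem wp_followPath {move : Cmd} (hm : IsMove move) {σ : State} (hL : Loaded L σ)
    (h : Emitted L tot σ) {q : ℕ → ℕ × ℕ} {a b B : ℕ} (h0 : cur σ = q 0) (ha : σ.ireg 21 = a)
    (hb : σ.ireg 22 = b) (hq : ∀ s < b - a, ∀ τ : State, τ.iarr = σ.iarr → τ.ireg 21 = a →
      τ.ireg 22 = b → τ.ireg 16 = s → cur (move.run τ) = q (s + 1)) (hB : b - a ≤ B) :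
    wp (followPath move) (B * 100 + 20) (fun τ =>
      Emitted L (tot ++ segmentList q (b - a)) τ ∧ cur τ = q (b - a)) σ := by
  refine wp_block_cons (S := 4) (T := B * 100 + 15) (wp_run rfl ?_ (by decide)) (by omega)
  have hrun : (Cmd.iset 15 (.sub (.reg 22) (.reg 21))).run σ = σ.setI 15 (b - a) := by
    simp [Cmd.run, IExpr.eval, ha, hb]
  rw [hrun]
  have hL' : Loaded L (σ.setI 15 (b - a)) := hL.congr (by simp) (by simp) (by simp)
    (fun _ _ _ => by simp) rfl rfl
  refine wp_block_cons (S := B * 100 + 10) (T := 1) ((wp_emitLoop hm hL'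
    (h.congr (by simp) rfl rfl) (q := q) (N := b - a) (by simpa [cur] using h0)
    (by simp) (fun s hs τ hA h16 _ => ?_)).mono (by nlinarith) fun τ hA hτ =>
      wp_block_nil hτ le_rfl)
    (by omega)
  refine hq s hs τ ?_ ?_ ?_ h16
  · funext a'
    rw [hA.ia a' (hm.wIA_emitLoop a')]; rfl
  · rw [hA.i 21 (hm.wI_emitLoop (by omega))]; simpa using ha
  · rw [hA.i 22 (hm.wI_emitLoop (by omega))]; simpa using hb

/-- The memory while the path of the pair `k` is written. -/
structure Ready {n r : ℕ} {v : ℕ → Pt × Pt} (L : Layout n r v) (k m : ℕ) (Pi Pj col : ℕ → ℕ)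
    (σ : State) : Prop where
  loaded : Loaded L σ
  k_eq : σ.ireg 10 = k
  m_eq : σ.ireg 8 = m
  Pi_eq : σ.iarr 8 = Pi
  Pj_eq : σ.iarr 9 = Pj
  col_eq : σ.iarr 13 = col

variable {k m : ℕ} {Pi Pj col : ℕ → ℕ}

theorem Ready.of_agree {σ τ : State} {c : Cmd} (h : Ready L k m Pi Pj col σ) (hA : Agree c σ τ)
    (hi : c.wI 0 = false ∧ c.wI 1 = false ∧ c.wI 6 = false ∧ c.wI 8 = false ∧ c.wI 10 = false :=
      by exact ⟨rfl, rfl, rfl, rfl, rfl⟩)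
    (hia : (∀ a, c.wIA (a + 1) = false) := by exact fun _ => rfl)
    (hra : (c.wRA 6 = false ∧ c.wRA 7 = false) := by exact ⟨rfl, rfl⟩) :
    Ready L k m Pi Pj col τ :=
  ⟨h.loaded.of_agree hA hi.1 hi.2.1 hi.2.2.1 ⟨hia 0, hia 1, hia 2, hia 3, hia 4⟩ hra.1 hra.2,
    (hA.i 10 hi.2.2.2.2).trans h.k_eq, (hA.i 8 hi.2.2.2.1).trans h.m_eq,
    (hA.ia 8 (hia 7)).trans h.Pi_eq, (hA.ia 9 (hia 8)).trans h.Pj_eq,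
    (hA.ia 13 (hia 12)).trans h.col_eq⟩

/-- The path of the pair `k` follows the edge `e` of the path of the center. -/
def Followed {n r : ℕ} {v : ℕ → Pt × Pt} (L : Layout n r v) (k : ℕ) (Pi Pj col : ℕ → ℕ) (e : ℕ) :
    Prop :=
  (k = r ∨ col e = 1) ∧
    ((min (L.sx k) (L.tx k) ≤ Pi e ∧ Pi (e + 1) ≤ max (L.sx k) (L.tx k)) ∧
      (min (L.sy k) (L.ty k) ≤ Pj e ∧ Pj (e + 1) ≤ max (L.sy k) (L.ty k)))

/-- The range of the first `e₀` edges with property `Q` goes from `a` to `b`, if `f = 1`. -/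
def IsRange (Q : ℕ → Prop) (e₀ f a b : ℕ) : Prop :=
  (f = 0 ∧ ∀ e < e₀, ¬ Q e) ∨
    (f = 1 ∧ (a < b ∧ b ≤ e₀) ∧ (Q a ∧ Q (b - 1)) ∧ ∀ e < e₀, Q e → a ≤ e ∧ e < b)

/-- Only the first and the last followed edge are recorded. Edges between them may not be collected,
but following them too is harmless by `Trace.unitStep_part`. -/
theorem wp_findPart {σ : State} (h : Ready L k m Pi Pj col σ) {B : ℕ} (hm : m ≤ B) :
    wp findPart (B * 120 + 100) (fun τ =>
      IsRange (Followed L k Pi Pj col) m (τ.ireg 20) (τ.ireg 21) (τ.ireg 22)) σ := by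
  refine wp_block_cons (S := 56) (T := B * 120 + 40) (wp_run rfl ?_ (by decide)) (by omega)
  refine wp_block_cons (S := 2) (T := B * 120 + 30) (wp_run rfl ?_ (by decide)) (by omega)
  obtain ⟨τ, hτ⟩ : ∃ τ, τ = ((((σ.setI 11 (min (L.sx k) (L.tx k))).setI 12
    (max (L.sx k) (L.tx k))).setI 13 (min (L.sy k) (L.ty k))).setI 14
      (max (L.sy k) (L.ty k))).setI 20 0 := ⟨_, rfl⟩
  have hrun : (Cmd.iset 20 (.const 0)).run (loadBox.run σ) = τ := by
    simp [hτ, loadBox, block, Cmd.run, IExpr.eval, h.k_eq, h.loaded.sx, h.loaded.sy, h.loaded.tx,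
      h.loaded.ty]
  rw [hrun]
  have hA0 : Agree (block [loadBox, .iset 20 (.const 0)]) σ τ :=
      hrun ▸ agree_run (c := block [loadBox, .iset 20 (.const 0)]) rfl σ
  have hR := h.of_agree hA0
  refine wp_block_cons (S := B * 120 + 20) (T := 1) (wp_for_const 16 (.reg 8) (fun e υ =>
    IsRange (Followed L k Pi Pj col) e (υ.ireg 20) (υ.ireg 21) (υ.ireg 22)) m 110 rfl ?_
    (fun υ hA => (hA.i 8 rfl).trans hR.m_eq) (fun e he υ hA hI h16 => ?_)
    (fun υ hA hI => wp_block_nil hI le_rfl) (by simp [IExpr.cost]; nlinarith)) (by omega)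
  · exact Or.inl ⟨by simp [hτ], fun e he => absurd he (by omega)⟩
  · refine wp_run rfl ?_ (by decide)
    have hRυ := hR.of_agree hA
    have e11 : υ.ireg 11 = min (L.sx k) (L.tx k) := by rw [hA.i 11 rfl, hτ]; simp
    have e12 : υ.ireg 12 = max (L.sx k) (L.tx k) := by rw [hA.i 12 rfl, hτ]; simp
    have e13 : υ.ireg 13 = min (L.sy k) (L.ty k) := by rw [hA.i 13 rfl, hτ]; simp
    have e14 : υ.ireg 14 = max (L.sy k) (L.ty k) := by rw [hA.i 14 rfl, hτ]; simp
    rw [scanStep, Cmd.run]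
    by_cases hQ : Followed L k Pi Pj col e
    · rw [if_pos]
      swap
      · simp only [Test.holds_conj, Test.holds_or, Test.holds_neg, Test.holds_ieq, Test.holds_ilt,
          IExpr.eval, h16, hRυ.k_eq, hRυ.loaded.r_eq, hRυ.Pi_eq, hRυ.Pj_eq, hRυ.col_eq, e11, e12,
            e13,
          e14, not_lt]
        exact ⟨hQ.1, hQ.2⟩
      by_cases h20 : υ.ireg 20 = 0
      · have hno := hI.resolve_right (by rintro ⟨h1, -⟩; omega)
        refine Or.inr ?_
        simp [block, Cmd.run, IExpr.eval, h20, h16, hQ]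
        exact fun e' he' hQ' => by
          rcases he'.lt_or_eq with h1 | h1
          · exact absurd hQ' (hno.2 e' h1)
          · omega
      · obtain ⟨h1, h2, h3, h4⟩ := hI.resolve_left (by rintro ⟨h1, -⟩; omega)
        refine Or.inr ?_
        simp [block, Cmd.run, IExpr.eval, h16, hQ, h1, h3]
        refine ⟨by omega, fun e' he' hQ' => ⟨?_, by omega⟩⟩
        rcases he'.lt_or_eq with h5 | h5
        · exact (h4 e' h5 hQ').1
        · omega
    · rw [if_neg]
      swap
      · simp only [Test.holds_conj, Test.holds_or, Test.holds_neg, Test.holds_ieq, Test.holds_ilt,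
          IExpr.eval, h16, hRυ.k_eq, hRυ.loaded.r_eq, hRυ.Pi_eq, hRυ.Pj_eq, hRυ.col_eq, e11, e12,
            e13,
          e14, not_lt]
        exact fun hh => hQ ⟨hh.1, hh.2⟩
      simp only [Cmd.run, State.setI_ireg]
      have hlt : ∀ e' < e + 1, Followed L k Pi Pj col e' → e' < e := by
        intro e' he' hQ'
        rcases Nat.lt_succ_iff_lt_or_eq.1 he' with h5 | rfl
        · exact h5
        · exact absurd hQ' hQ
      rcases hI with ⟨h1, h2⟩ | ⟨h1, h2, h3, h4⟩
      · exact Or.inl ⟨by simpa using h1, fun e' he' hQ' => h2 e' (hlt e' he' hQ') hQ'⟩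
      · exact Or.inr ⟨by simpa using h1, by simpa using ⟨h2.1, by omega⟩, by simpa using h3,
          fun e' he' hQ' => by simpa using h4 e' (hlt e' he' hQ') hQ'⟩

theorem wp_startPath {σ : State} (h : Ready L k m Pi Pj col σ) (hE : Emitted L tot σ) :
    wp startPath 30 (fun τ => Emitted L (tot ++ [(L.sx k, L.sy k)]) τ ∧
      cur τ = (L.sx k, L.sy k)) σ := by
  refine wp_run rfl ?_ (by decide)
  have hrun : startPath.run σ = emit.run ((σ.setI 11 (L.sx k)).setI 12 (L.sy k)) := by
    simp [startPath, block, Cmd.run, IExpr.eval, h.k_eq, h.loaded.sx, h.loaded.sy]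
  rw [hrun]
  have := emitted_emit (σ := (σ.setI 11 (L.sx k)).setI 12 (L.sy k)) (tot := tot)
    (h.loaded.congr (by simp) (by simp) (by simp) (fun _ _ _ => by simp) rfl rfl)
    (hE.congr (by simp) rfl rfl)
  simpa [cur] using this

theorem wp_finishPath {σ : State} (h : Ready L k m Pi Pj col σ) (hE : Emitted L tot σ)
    {p : ℕ × ℕ} (hp : cur σ = p) {B : ℕ} (hB : gridDist p (L.tx k, L.ty k) ≤ B) :
    wp finishPath (B * 100 + 50) (fun τ => Emitted L (tot ++
      segmentList (walkSeq (L.tx k, L.ty k) p) (gridDist p (L.tx k, L.ty k))) τ) σ := by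
  refine wp_block_cons (S := 3) (T := B * 100 + 46) (wp_run rfl ?_ (by decide)) (by omega)
  refine wp_block_cons (S := 3) (T := B * 100 + 43) (wp_run rfl ?_ (by decide)) (by omega)
  have hrun : (Cmd.iset 14 (.get 4 (.reg 10))).run ((Cmd.iset 13 (.get 3 (.reg 10))).run σ) =
      (σ.setI 13 (L.tx k)).setI 14 (L.ty k) := by
    simp [Cmd.run, IExpr.eval, h.k_eq, h.loaded.tx, h.loaded.ty]
  rw [hrun]
  refine wp_block_cons (S := B * 100 + 40) (T := 1) ((wp_walkTo
    (σ := (σ.setI 13 (L.tx k)).setI 14 (L.ty k)) (h.loaded.congr (by simp) (by simp)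
    (by simp) (fun _ _ _ => by simp) rfl rfl) (hE.congr (by simp) rfl rfl) (p := p)
    (t := (L.tx k, L.ty k)) (by simpa [cur] using hp) (by simp) hB).mono le_rfl
    fun τ _ hτ => wp_block_nil hτ.1 le_rfl) (by omega)

end

end RAM

end GMMN


/-! ### Paths of the pairs that follow the center, and their complete output. -/

namespace GMMN

namespace Layout

variable {n r : ℕ} {v : ℕ → Pt × Pt} {L : Layout n r v}

/-- The part of the path of the center between the first and the last edge that the path of the pair
`k` follows is a path for `k`, in one direction or the other. -/
theorem Trace.unitStep_part {I : Bool → ℕ → ℕ → ℕ} {G : Bool → ℕ → ℕ → ℝ} {m : ℕ}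
    {Pi Pj col ctx : ℕ → ℕ} (hI : L.Labelled I G) (h : L.Trace I G m Pi Pj (fun e => col e = 1) ctx)
    {k : ℕ} (hk : k < n) {a b : ℕ} (hab : a < b) (hb : b ≤ m) (ha : RAM.Followed L k Pi Pj col a)
    (hb' : RAM.Followed L k Pi Pj col (b - 1)) {e : ℕ} (hae : a ≤ e) (heb : e < b) :
    (L.InBox k (Pi e, Pj e) ∧ L.InBox k (Pi (e + 1), Pj (e + 1))) ∧
    ((Pi a < Pi b ∧ L.sx k < L.tx k) ∨ (Pj a < Pj b ∧ L.sy k < L.ty k) →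
      L.UnitStep k (Pi e, Pj e) (Pi (e + 1), Pj (e + 1))) ∧
    (¬ ((Pi a < Pi b ∧ L.sx k < L.tx k) ∨ (Pj a < Pj b ∧ L.sy k < L.ty k)) →
      L.UnitStep k (Pi (e + 1), Pj (e + 1)) (Pi e, Pj e)) := by
  have hb1 : b - 1 + 1 = b := by omega
  -- If the slopes are opposite, the part from the first to the last collected edge is straight. The
  -- center itself does not have slope opposite to its own.
  have hst : L.Opp k → Pi a = Pi b ∨ Pj a = Pj b := by
    intro ho
    by_cases hkr : k = r
    · subst hkr
      have h1 := L.sx_le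
      have h2 := L.sy_le
      unfold Opp at ho
      omega
    · have := h.straight hI hk hkr ho (e := a) (f := b - 1) (by omega) (by omega)
        (ha.1.resolve_left hkr) (hb'.1.resolve_left hkr) ((h.inEdge_iff (by omega) k).2 ha.2)
        ((h.inEdge_iff (by omega) k).2 hb'.2)
      rwa [hb1] at this
  obtain ⟨-, ha1, ha2⟩ := ha
  obtain ⟨-, hb2, hb3⟩ := hb'
  rw [hb1] at hb2 hb3
  have m1 := h.mono hae (by omega)
  have m2 := h.mono (show e + 1 ≤ b by omega) hb
  have n1 := h.lt_N (e := e) (by omega)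
  have n2 := h.lt_N (e := e + 1) (by omega)
  have m3 := h.mono (show a ≤ a + 1 by omega) (by omega)
  have m4 := h.mono (show b - 1 ≤ b by omega) hb
  have hx : min (L.sx k) (L.tx k) ≤ Pi a ∧ Pi b ≤ max (L.sx k) (L.tx k) := ⟨ha1.1, hb2.2⟩
  have hy : min (L.sy k) (L.ty k) ≤ Pj a ∧ Pj b ≤ max (L.sy k) (L.ty k) := ⟨ha2.1, hb3.2⟩
  have m5 := h.mono (Nat.le_succ e) (by omega)
  clear ha1 ha2 hb2 hb3 m3 m4
  simp only [Nat.succ_eq_add_one] at m5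
  obtain ⟨-, e1, e2, -⟩ := h.step_dir (show e < m by omega)
  unfold Opp at hst
  refine ⟨?_, fun hf => ⟨⟨n1, n2⟩, ?_⟩, fun hf => ⟨⟨n2, n1⟩, ?_⟩⟩
  · unfold InBox; dsimp only; omega
  · dsimp only
    cases hd : Trace.dir Pi e <;> simp only [hd, nx, ny, if_true, Bool.false_eq_true,
      if_false] at e1 e2
    · right
      refine ⟨e1.symm, Or.inl ⟨e2, ?_⟩⟩
      -- The edge is vertical. If the part is forward because of its horizontal extent and `v k` did
      -- not go up, then `v k` would have opposite slope, and the part, having extent in both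
      -- directions, would have to be straight.
      rcases hf with hf | hf
      · by_contra hc
        have := hst (Or.inl (by omega))
        omega
      · exact hf.2
    · left
      refine ⟨e2.symm, Or.inl ⟨e1, ?_⟩⟩
      rcases hf with hf | hf
      · exact hf.2
      · by_contra hc
        have := hst (Or.inr (by omega))
        omega
  · dsimp only
    -- The edge lies in the box, so `v k` has positive extent in its direction; as the forward
    -- condition fails, `v k` runs against it.
    rw [not_or] at hf
    cases hd : Trace.dir Pi e <;> simp only [hd, nx, ny, if_true, Bool.false_eq_true,
      if_false] at e1 e2
    · exact Or.inr ⟨e1, Or.inr ⟨e2, by omega⟩⟩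
    · exact Or.inl ⟨e2, Or.inr ⟨e1, by omega⟩⟩

theorem Consecutive.append {l : List (ℕ × ℕ)} {p q : ℕ × ℕ} (h : Consecutive l p q)
    (l' : List (ℕ × ℕ)) : Consecutive (l ++ l') p q := by
  rcases h with ⟨a, b, rfl⟩ | ⟨a, b, rfl⟩
  · exact Or.inl ⟨a, b ++ l', by simp⟩
  · exact Or.inr ⟨a, b ++ l', by simp⟩

end Layout

namespace RAM

section

variable {n r : ℕ} {v : ℕ → Pt × Pt} {L : Layout n r v} {tot : List (ℕ × ℕ)}
  {k m : ℕ} {Pi Pj col ctx : ℕ → ℕ} {I : Bool → ℕ → ℕ → ℕ} {G : Bool → ℕ → ℕ → ℝ}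

/-- A walk to the first point of the part that is to be followed, and this part. -/
theorem wp_walk_follow {move : Cmd} (hm : IsMove move) (f : ℕ) {f' : ℕ} {σ : State}
    (h : Ready L k m Pi Pj col σ) (hk : k < n) (hf : σ.ireg f = f') (hff : f = 21 ∨ f = 22)
    {a b : ℕ} (ha : σ.ireg 21 = a) (hb : σ.ireg 22 = b) {q : ℕ → ℕ × ℕ} {l : List (ℕ × ℕ)}
    (hE : Emitted L (tot ++ l) σ) (hl : L.Initial k l (L.sx k, L.sy k))
    (hc : cur σ = (L.sx k, L.sy k)) (h0 : q 0 = (Pi f', Pj f'))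
    (hmove : ∀ s < b - a, ∀ τ : State, τ.iarr 8 = Pi → τ.iarr 9 = Pj → τ.ireg 21 = a →
      τ.ireg 22 = b → τ.ireg 16 = s → cur (move.run τ) = q (s + 1))
    (hq : ∀ s < b - a, L.UnitStep k (q s) (q (s + 1))) (hq0 : L.InBox k (q 0))
    (hqN : L.InBox k (q (b - a))) {B : ℕ} (hB : L.NX + L.NY ≤ B) (hB' : b - a ≤ B) :
    wp (block [.iset 13 (.get 8 (.reg f)), .iset 14 (.get 9 (.reg f)), walkTo, followPath move])
      (B * 200 + 100) (fun τ => ∃ mid : List (ℕ × ℕ), mid.length ≤ B + B ∧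
        Emitted L (tot ++ (l ++ mid)) τ ∧ cur τ = q (b - a) ∧ L.Initial k (l ++ mid) (q (b - a)) ∧
        ∀ s < b - a, ∃ x y, l ++ mid = x ++ q s :: q (s + 1) :: y) σ := by
  have hf13 : f ≠ 13 := by omega
  refine wp_block_cons (S := 3) (T := B * 200 + 90) (wp_run rfl ?_ (by simp [Cmd.size, IExpr.cost]))
      (by omega)
  refine wp_block_cons (S := 3) (T := B * 200 + 80) (wp_run rfl ?_ (by simp [Cmd.size, IExpr.cost]))
      (by omega)
  have hrun : (Cmd.iset 14 (.get 9 (.reg f))).run ((Cmd.iset 13 (.get 8 (.reg f))).run σ) =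
      (σ.setI 13 (Pi f')).setI 14 (Pj f') := by
    simp [Cmd.run, IExpr.eval, h.Pi_eq, h.Pj_eq, hf, hf13]
  rw [hrun]
  have hR : Ready L k m Pi Pj col ((σ.setI 13 (Pi f')).setI 14 (Pj f')) :=
    hrun ▸ h.of_agree
      (agree_run (c := .seq (.iset 13 (.get 8 (.reg f))) (.iset 14 (.get 9 (.reg f)))) rfl σ)
  set t : ℕ × ℕ := (Pi f', Pj f') with ht
  have hbox : L.InBox k t := h0 ▸ hq0
  refine wp_block_cons (S := B * 100 + 40) (T := B * 100 + 30) ((wp_walkTo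
    (σ := (σ.setI 13 (Pi f')).setI 14 (Pj f')) hR.loaded (hE.congr (by simp) rfl rfl)
    (p := (L.sx k, L.sy k)) (t := t) (by simpa [cur] using hc) (by simp [ht])
    ((L.gridDist_le hk (L.inBox_start k) hbox).trans hB)).mono le_rfl fun τ hA hτ => ?_) (by omega)
  have hRτ := hR.of_agree hA
  have hini := hl.walk hk hbox hbox.along_start
  have hlast :
      (l ++ segmentList (walkSeq t (L.sx k, L.sy k)) (gridDist (L.sx k, L.sy k) t)).getLast? =
      some (q 0) := by rw [hini.last, h0]
  refine wp_block_cons (S := B * 100 + 20) (T := 1)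
      ((wp_followPath hm hRτ.loaded hτ.1 (q := q) (a := a)
    (b := b) (by rw [hτ.2, h0]) (by rw [hA.i 21 rfl]; simpa using ha)
    (by rw [hA.i 22 rfl]; simpa using hb) (fun s hs υ h1 h2 h3 h4 =>
      hmove s hs υ (by rw [h1, hRτ.Pi_eq])
      (by rw [h1, hRτ.Pj_eq]) h2 h3 h4) hB').mono le_rfl fun υ _ hυ => wp_block_nil ?_ le_rfl)
        (by omega)
  refine ⟨segmentList (walkSeq t (L.sx k, L.sy k)) (gridDist (L.sx k, L.sy k) t) ++
    segmentList q (b - a), ?_, ?_, hυ.2, ?_, fun s hs => ?_⟩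
  · have := L.gridDist_le hk (L.inBox_start k) hbox
    simp only [List.length_append, length_segmentList]
    omega
  · simpa only [List.append_assoc] using hυ.1
  · rw [← List.append_assoc]
    exact hini.segment h0 hq hqN
  · rw [← List.append_assoc]
    exact exists_append_segmentList hlast hs

theorem wp_followPart (hI : L.Labelled I G) (hT : L.Trace I G m Pi Pj (fun e => col e = 1) ctx)
    {σ : State} (h : Ready L k m Pi Pj col σ) (hk : k < n) {a b : ℕ} (ha : σ.ireg 21 = a)
    (hb : σ.ireg 22 = b) (hab : a < b) (hbm : b ≤ m) (hfa : Followed L k Pi Pj col a)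
    (hfb : Followed L k Pi Pj col (b - 1)) {l : List (ℕ × ℕ)}
    (hE : Emitted L (tot ++ l) σ) (hl : L.Initial k l (L.sx k, L.sy k))
    (hc : cur σ = (L.sx k, L.sy k)) {B : ℕ} (hB : L.NX + L.NY ≤ B) (hB' : m ≤ B) :
    wp followPart (B * 200 + 140) (fun τ => ∃ (mid : List (ℕ × ℕ)) (p : ℕ × ℕ), mid.length ≤ B + B ∧
        Emitted L (tot ++ (l ++ mid)) τ ∧ cur τ = p ∧ L.Initial k (l ++ mid) p ∧
        ∀ e, a ≤ e → e < b → Layout.Consecutive (l ++ mid) (Pi e, Pj e) (Pi (e + 1), Pj (e + 1)))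
          σ := by
  have hpart := fun e (h1 : a ≤ e) (h2 : e < b) => hT.unitStep_part hI hk hab hbm hfa hfb h1 h2
  have htest : forwardTest.Holds σ ↔
      (Pi a < Pi b ∧ L.sx k < L.tx k) ∨ (Pj a < Pj b ∧ L.sy k < L.ty k) := by
    simp [forwardTest, IExpr.eval, h.Pi_eq, h.Pj_eq, ha, hb, h.k_eq, h.loaded.sx, h.loaded.sy,
      h.loaded.tx, h.loaded.ty]
  have hb1 : b - 1 + 1 = b := by omega
  have hbx := (hpart (b - 1) (by omega) (by omega)).1.2
  rw [hb1] at hbx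
  refine wp_ite (T := B * 200 + 100) (fun ht => ?_) (fun ht => ?_)
      (by simp [forwardTest, Test.cost, Test.or, IExpr.cost]; omega)
  · rw [htest] at ht
    refine (wp_walk_follow isMove_forward 21 h hk ha (by simp) ha hb (q := fun s =>
        (Pi (a + s), Pj (a + s))) hE hl hc rfl
      (fun s hs τ h1 h2 h3 _ h5 => ?_) (fun s hs => ?_) (hpart a le_rfl hab).1.1 ?_ hB
      (by omega)).mono le_rfl fun τ _ hτ => ?_
    · simp [moveForward, block, Cmd.run, IExpr.eval, cur, h1, h2, h3, h5]
    · exact (hpart (a + s) (by omega) (by omega)).2.1 ht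
    · simpa only [show a + (b - a) = b by omega] using hbx
    · obtain ⟨mid, h1, h2, h3, h4, h5⟩ := hτ
      refine ⟨mid, _, h1, h2, h3, h4, fun e he he' => Or.inl ?_⟩
      obtain ⟨x, y, hxy⟩ := h5 (e - a) (by omega)
      refine ⟨x, y, ?_⟩
      rw [hxy]
      simp only [show a + (e - a) = e by omega, show a + (e - a + 1) = e + 1 by omega]
  · rw [htest] at ht
    -- The part is traversed from `b` down to `a`, so its edges occur reversed, which `Consecutive`
    -- admits.
    refine (wp_walk_follow isMove_backward 22 h hk hb (by simp) ha hb (q := fun s =>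
        (Pi (b - s), Pj (b - s))) hE hl hc rfl
      (fun s hs τ h1 h2 _ h4 h5 => ?_) (fun s hs => ?_) hbx ?_ hB
      (by omega)).mono le_rfl fun τ _ hτ => ?_
    · simp [moveBackward, block, Cmd.run, IExpr.eval, cur, h1, h2, h4, h5]
    · have := (hpart (b - (s + 1)) (by omega) (by omega)).2.2 ht
      rwa [show b - (s + 1) + 1 = b - s by omega] at this
    · simpa only [show b - (b - a) = a by omega] using (hpart a le_rfl hab).1.1
    · obtain ⟨mid, h1, h2, h3, h4, h5⟩ := hτ
      refine ⟨mid, _, h1, h2, h3, h4, fun e he he' => Or.inr ?_⟩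
      obtain ⟨x, y, hxy⟩ := h5 (b - (e + 1)) (by omega)
      refine ⟨x, y, ?_⟩
      rw [hxy]
      simp only [show b - (b - (e + 1)) = e + 1 by omega, show b - (b - (e + 1) + 1) = e by omega]

/-- The list `l` is a path for the pair `k` that follows the path of the center. -/
structure GoodPath {n r : ℕ} {v : ℕ → Pt × Pt} (L : Layout n r v) (m : ℕ) (Pi Pj col : ℕ → ℕ)
    (k : ℕ)
    (l : List (ℕ × ℕ)) : Prop where
  head : l.head? = some (L.sx k, L.sy k)
  last : l.getLast? = some (L.tx k, L.ty k)
  chain : l.IsChain (L.UnitStep k)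
  share : ∀ e < m, Followed L k Pi Pj col e →
    Layout.Consecutive l (Pi e, Pj e) (Pi (e + 1), Pj (e + 1))

/-- The path is a first point, a walk to the followed part, this part, and a walk to the end, with
at most `B` further points in each piece. The pieces fit because a walk from the start to a point of
the box, or from there to the end, always goes in the direction of `v k`. -/
theorem wp_writePoints (hI : L.Labelled I G) (hT : L.Trace I G m Pi Pj (fun e => col e = 1) ctx)
    {σ : State} (h : Ready L k m Pi Pj col σ) (hk : k < n) (hE : Emitted L tot σ) {B : ℕ}
    (hB : L.NX + L.NY ≤ B) (hB' : m ≤ B) :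
    wp writePoints (B * 420 + 400) (fun τ => ∃ l : List (ℕ × ℕ), l.length ≤ B * 3 + 1 ∧
      Emitted L (tot ++ l) τ ∧ GoodPath L m Pi Pj col k l) σ := by
  refine wp_block_cons (S := B * 120 + 100) (T := B * 300 + 280) ((wp_findPart h hB').mono le_rfl
    fun τ hA hr => ?_) (by omega)
  have hRτ := h.of_agree hA
  refine wp_block_cons (S := 30) (T := B * 300 + 240)
      ((wp_startPath hRτ (hE.of_agree hA)).mono le_rfl
    fun υ hA' hυ => ?_) (by omega)
  have hRυ := hRτ.of_agree hA'
  rw [← hA'.i 20 rfl, ← hA'.i 21 rfl, ← hA'.i 22 rfl] at hr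
  have hini : L.Initial k [(L.sx k, L.sy k)] (L.sx k, L.sy k) :=
    ⟨rfl, rfl, by simp, L.inBox_start k⟩
  refine wp_block_cons (S := B * 200 + 160) (T := B * 100 + 70) ?_ (by omega)
  refine wp.mono (T := B * 200 + 160) (Q := fun φ => ∃ (mid : List (ℕ × ℕ)) (p : ℕ × ℕ),
      mid.length ≤ B + B ∧
        Emitted L (tot ++ ([(L.sx k, L.sy k)] ++ mid)) φ ∧ cur φ = p ∧
        L.Initial k ([(L.sx k, L.sy k)] ++ mid) p ∧ ∀ e < m, Followed L k Pi Pj col e →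
          Layout.Consecutive ([(L.sx k, L.sy k)] ++ mid) (Pi e, Pj e) (Pi (e + 1), Pj (e + 1)))
    (wp_ite (T := B * 200 + 140) (fun hb => ?_) (fun hb => ?_) ?_) le_rfl fun φ hA'' hφ => ?_
  · have h20 : υ.ireg 20 = 1 := by simpa [IExpr.eval] using hb
    obtain ⟨-, hr1, hr2, hr3⟩ := hr.resolve_left (by omega)
    refine (wp_followPart hI hT hRυ hk rfl rfl hr1.1 hr1.2 hr2.1 hr2.2 hυ.1 hini hυ.2 hB hB').mono
        le_rfl
      fun φ _ hφ => ?_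
    obtain ⟨mid, p, h1, h2, h3, h4, h5⟩ := hφ
    exact ⟨mid, p, h1, h2, h3, h4, fun e he hf => h5 e (hr3 e he hf).1 (hr3 e he hf).2⟩
  · have h20 : ¬ υ.ireg 20 = 1 := by simpa [IExpr.eval] using hb
    obtain ⟨-, hno⟩ := hr.resolve_right (by omega)
    refine wp_run rfl ⟨[], _, by simp, by simpa [Cmd.run] using hυ.1, hυ.2, by simpa using hini,
      fun e he hf => absurd hf (hno e he)⟩ (by simp [Cmd.size])
  · simp [Test.ieq, Test.cost, IExpr.cost]; omega
  · obtain ⟨mid, p, h1, h2, h3, h4, h5⟩ := hφ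
    have hRφ : Ready L k m Pi Pj col φ := hRυ.of_agree hA''
    have hd := (L.gridDist_le hk h4.mem (L.inBox_end k)).trans hB
    refine wp_block_cons (S := B * 100 + 50) (T := 1) ((wp_finishPath hRφ h2 h3 hd).mono le_rfl
      fun ψ _ hψ => wp_block_nil ?_ le_rfl) (by omega)
    have h6 := h4.walk hk (L.inBox_end k) h4.mem.along_end
    refine ⟨_, ?_, by simpa only [List.append_assoc] using hψ, ?_⟩
    · simp only [List.length_append, length_segmentList, List.length_cons, List.length_nil]
      omega
    · simp only [← List.append_assoc]
      exact ⟨h6.head, h6.last, h6.chain, fun e he hf => (h5 e he hf).append _⟩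

/-- The paths for the first `k` pairs have been written. -/
structure Written {n r : ℕ} {v : ℕ → Pt × Pt} (L : Layout n r v) (m : ℕ) (Pi Pj col : ℕ → ℕ) (k : ℕ)
    (tot : List (ℕ × ℕ)) (σ : State) : Prop where
  emitted : Emitted L tot σ
  pos : σ.iarr 0 k = tot.length
  paths : ∀ k' < k, ∃ pre l post, tot = pre ++ l ++ post ∧ σ.iarr 0 k' = pre.length ∧
    σ.iarr 0 (k' + 1) = pre.length + l.length ∧ GoodPath L m Pi Pj col k' l

theorem wp_writePaths (hI : L.Labelled I G) {σ : State} (hL : Loaded L σ)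
    (hT : L.Trace I G (σ.ireg 8) (σ.iarr 8) (σ.iarr 9) (fun e => σ.iarr 13 e = 1) ctx)
    (h7 : σ.ireg 7 = 0) (h0 : σ.iarr 0 0 = 0) {B : ℕ} (hB : L.NX + L.NY ≤ B) (hB' : σ.ireg 8 ≤ B) :
    wp writePaths (n * (B * 420 + 500) + 100) (fun τ => ∃ tot, tot.length ≤ n * (B * 3 + 1) ∧
      Written L (σ.ireg 8) (σ.iarr 8) (σ.iarr 9) (σ.iarr 13) n tot τ) σ := by
  refine wp_for_const 10 (.reg 0) (fun k τ => ∃ tot, tot.length ≤ k * (B * 3 + 1) ∧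
      Written L (σ.ireg 8) (σ.iarr 8) (σ.iarr 9) (σ.iarr 13) k tot τ) n (B * 420 + 450) rfl
    ?_ (fun τ hA => ?_) (fun k hk τ hA hW h10 => ?_) (fun τ hA hW => hW)
      (by simp [IExpr.cost]; nlinarith)
  · exact ⟨[], by simp, ⟨by simpa using h7, by simp, by simp⟩, by simpa using h0,
      fun k' hk' => absurd hk' (by omega)⟩
  · exact (hL.of_agree hA).n_eq
  · obtain ⟨tot, hlen, hE, hpos, hpaths⟩ := hW
    have hR : Ready L k (σ.ireg 8) (σ.iarr 8) (σ.iarr 9) (σ.iarr 13) τ :=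
      ⟨hL.of_agree hA, h10, hA.i 8 rfl, hA.ia 8 rfl, hA.ia 9 rfl, hA.ia 13 rfl⟩
    refine wp_block_cons (S := B * 420 + 400) (T := 20) ((wp_writePoints hI hT hR hk hE hB hB').mono
      le_rfl fun υ hA' hυ => ?_) (by omega)
    obtain ⟨l, hl, hEl, hgood⟩ := hυ
    refine wp_block_cons (S := 10) (T := 1) (wp_run rfl ?_ (by decide)) (by omega)
    have h10' : υ.ireg 10 = k := (hA'.i 10 rfl).trans h10
    have h00 : υ.iarr 0 = τ.iarr 0 := hA'.ia 0 rfl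
    have hrun : (Cmd.iput 0 (.add (.reg 10) (.const 1)) (.reg 7)).run υ =
        υ.putI 0 (k + 1) (tot.length + l.length) := by
      simp [Cmd.run, IExpr.eval, h10', hEl.len]
    rw [hrun]
    refine wp_block_nil ⟨tot ++ l, ?_, hEl.congr (by simp) rfl rfl, by simp, fun k' hk' => ?_⟩
        le_rfl
    · rw [List.length_append]; nlinarith
    · rcases Nat.lt_succ_iff_lt_or_eq.1 hk' with hk' | rfl
      · obtain ⟨pre, l', post, e1, e2, e3, e4⟩ := hpaths k' hk'
        refine ⟨pre, l', post ++ l, by rw [e1]; simp, ?_, ?_, e4⟩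
        · simp [show k' ≠ k + 1 by omega, h00, e2]
        · simp [show k' ≠ k by omega, h00, e3]
      · exact ⟨tot, l, [], by simp, by simp [h00, hpos], by simp, hgood⟩

theorem Written.exists_follows {τ : State} (hW : Written L m Pi Pj col n tot τ)
    (hT : L.Trace I G m Pi Pj (fun e => col e = 1) ctx) :
    ∃ ls : ℕ → List (ℕ × ℕ), L.Follows m Pi Pj (fun e => col e = 1) ls ∧
      ∀ k < n, τ.iarr 0 (k + 1) ≤ tot.length ∧ outputPath τ k = (ls k).map L.pt := by
  choose! pre ls post h1 h2 h3 h4 using hW.paths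
  refine ⟨ls, ⟨fun k hk => (h4 k hk).head, fun k hk => (h4 k hk).last, fun k hk => (h4 k hk).chain,
    fun k hk e he hc hin => (h4 k hk).share e he ⟨hc, (hT.inEdge_iff he k).1 hin⟩⟩, fun k hk =>
      ⟨?_, ?_⟩⟩
  · rw [h3 k hk, h1 k hk]; simp
  · rw [outputPath, h2 k hk, h3 k hk, Nat.add_sub_cancel_left]
    refine List.ext_getElem (by simp) fun s hs hs' => ?_
    have hs' : s < (ls k).length := by simpa using hs'
    have hget : tot[(pre k).length + s]? = some (ls k)[s] := by
      rw [h1 k hk, List.append_assoc, List.getElem?_append_right (by omega),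
          Nat.add_sub_cancel_left,
        List.getElem?_append_left hs', List.getElem?_eq_getElem hs']
    simp only [List.getElem_map, List.getElem_range', one_mul, Layout.pt]
    rw [hW.emitted.x _ _ hget, hW.emitted.y _ _ hget]

end

end RAM

end GMMN


/-! ### Assembly of the whole program and the quadratic time bound. -/

namespace GMMN

theorem mem_box_of_mem_box_scalePair {a b : ℝ} (ha : a = 1 ∨ a = -1) (hb : b = 1 ∨ b = -1)
    {v : Pt × Pt} {p : Pt} (h : p ∈ box (scalePair a b v)) : scale a b p ∈ box v := by
  rw [mem_box_iff] at h ⊢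
  simp only [scalePair, scale, min_le_iff, le_max_iff] at h ⊢
  obtain ⟨⟨h1, h2⟩, h3, h4⟩ := h
  constructor
  · rcases ha with rfl | rfl
    · simpa only [one_mul] using And.intro h1 h2
    · simp only [neg_mul, one_mul] at *
      exact ⟨h2.imp (fun h => by linarith) fun h => by linarith,
        h1.imp (fun h => by linarith) fun h => by linarith⟩
  · rcases hb with rfl | rfl
    · simpa only [one_mul] using And.intro h3 h4
    · simp only [neg_mul, one_mul] at *
      exact ⟨h4.imp (fun h => by linarith) fun h => by linarith,
        h3.imp (fun h => by linarith) fun h => by linarith⟩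

theorem LeavesDisjoint.scale {a b : ℝ} (ha : a = 1 ∨ a = -1) (hb : b = 1 ∨ b = -1) {n r : ℕ}
    {v : ℕ → Pt × Pt} (h : LeavesDisjoint n r v) :
    LeavesDisjoint n r fun k => scalePair a b (v k) := by
  intro k hk k' hk' hr hr' hne p hp q hq
  exact scale_injective ha hb (h k hk k' hk' hr hr' hne
    ⟨mem_box_of_mem_box_scalePair ha hb hp.1, mem_box_of_mem_box_scalePair ha hb hp.2⟩
    ⟨mem_box_of_mem_box_scalePair ha hb hq.1, mem_box_of_mem_box_scalePair ha hb hq.2⟩)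

namespace RAM

/-! ## The program -/

/-- Find the center and reflect the plane such that the center goes up and to the right. -/
def normalize : Cmd := block [findCenter, flip 2 0 2, flip 3 1 3]

/-- Compute the positions of all points in the grid. -/
def buildGrid : Cmd :=
  block [sortDistinct 4 0 2 6, sortDistinct 5 1 3 7, indexOf 4 0 6 1, indexOf 5 1 7 2,
    indexOf 4 2 6 3, indexOf 5 3 7 4, multiples]

/-- Solve the dynamic program and output the paths. -/
def solve : Cmd := block [labelEdges, computeTable, tracePath, writePaths]

/-- Reflect the output back. -/
def restore : Cmd := block [unflip 2 4, unflip 3 5]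

/-- The whole algorithm. -/
def program : Cmd := block [normalize, buildGrid, solve, restore]

variable {n : ℕ} {v : ℕ → Pt × Pt} {σ : State}

theorem wp_normalize (h : Stores n v σ) (hc : ∃ r, IsCenter n v r) (h2 : σ.ireg 2 = 0)
    (h3 : σ.ireg 3 = 0) :
    wp normalize (n * (n * 300 + 300) + n * 60 + 161) (fun τ => IsCenter n v (τ.ireg 1) ∧
      Stores n (fun k => scalePair (sign (τ.ireg 2)) (sign (τ.ireg 3)) (v k)) τ ∧
      τ.rarr 0 (τ.ireg 1) ≤ τ.rarr 2 (τ.ireg 1) ∧ τ.rarr 1 (τ.ireg 1) ≤ τ.rarr 3 (τ.ireg 1)) σ := by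
  refine wp_block_cons (S := n * (n * 300 + 300) + 100) (T := n * 60 + 61)
    ((wp_findCenter h hc).mono le_rfl fun τ1 A1 hr => ?_) (by omega)
  have hS1 : Stores n v τ1 := h.congr (A1.i 0 rfl) fun a ha => by
    interval_cases a <;> exact A1.ra _ rfl
  refine wp_block_cons (S := n * 30 + 30) (T := n * 30 + 31) ((wp_flip 2 0 2 (by decide) (by decide)
    hS1.n_eq hr.1 ((A1.i 2 rfl).trans h2)).mono le_rfl fun τ2 A2 hx => ?_) (by omega)
  have e1 : τ2.ireg 1 = τ1.ireg 1 := A2.i 1 rfl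
  refine wp_block_cons (S := n * 30 + 30) (T := 1) ((wp_flip 3 1 3 (by decide) (by decide)
    ((A2.i 0 rfl).trans hS1.n_eq) (by rw [e1]; exact hr.1)
    ((A2.i 3 rfl).trans ((A1.i 3 rfl).trans h3))).mono le_rfl fun τ3 A3 hy => ?_) (by omega)
  have e1' : τ3.ireg 1 = τ1.ireg 1 := (A3.i 1 rfl).trans e1
  have e2 : τ3.ireg 2 = τ2.ireg 2 := A3.i 2 rfl
  have r0 : τ3.rarr 0 = τ2.rarr 0 := A3.ra 0 rfl
  have r2 : τ3.rarr 2 = τ2.rarr 2 := A3.ra 2 rfl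
  have r1 : τ2.rarr 1 = τ1.rarr 1 := A2.ra 1 rfl
  have r3 : τ2.rarr 3 = τ1.rarr 3 := A2.ra 3 rfl
  rw [e1] at hy
  rw [r1, r3] at hy
  refine wp_block_nil ⟨by rwa [e1'],
      ⟨(A3.i 0 rfl).trans ((A2.i 0 rfl).trans hS1.n_eq), ?_, ?_, ?_, ?_⟩,
    ?_, ?_⟩ le_rfl
  · intro k hk
    rw [r0, e2, (hx.1 k hk).1, hS1.sx k hk]; rfl
  · intro k hk
    rw [(hy.1 k hk).1, hS1.sy k hk]; rfl
  · intro k hk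
    rw [r2, e2, (hx.1 k hk).2, hS1.tx k hk]; rfl
  · intro k hk
    rw [(hy.1 k hk).2, hS1.ty k hk]; rfl
  · rw [e1', r0, r2]; exact hx.2
  · rw [e1']; exact hy.2

theorem Enumerates.le_of_le {X : ℕ → ℝ} {N : ℕ} {S : Set ℝ} (h : Enumerates X N S) {i j : ℕ}
    (hi : i < N) (hij : X i ≤ X j) : i ≤ j := by
  by_contra hlt
  exact absurd (h.lt j i (by omega) hi) (not_lt.2 hij)

theorem wp_buildGrid (h : Stores n v σ) (hr : σ.ireg 1 < n)
    (hx : σ.rarr 0 (σ.ireg 1) ≤ σ.rarr 2 (σ.ireg 1))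
    (hy : σ.rarr 1 (σ.ireg 1) ≤ σ.rarr 3 (σ.ireg 1)) :
    wp buildGrid (((n + n + 1) * (n * 100 + 100) + 100) * 2 + (n * (n * 100 + 100) + 100) * 4 +
      (n * 60 + 40) + 1) (fun τ => ∃ L : Layout n (σ.ireg 1) v, L.Tight ∧ Loaded L τ) σ := by
  have hxS : entries (σ.rarr 0) (σ.rarr 2) n = xCoords n v := by
    ext x
    exact exists_congr fun k => and_congr_right fun hk => by rw [h.sx k hk, h.tx k hk]
  have hyS : entries (σ.rarr 1) (σ.rarr 3) n = yCoords n v := by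
    ext x
    exact exists_congr fun k => and_congr_right fun hk => by rw [h.sy k hk, h.ty k hk]
  -- The nonlinear time bounds become atoms, so that the budgets below are compared linearly.
  generalize hSo : (n + n + 1) * (n * 100 + 100) + 100 = So
  generalize hIn : n * (n * 100 + 100) + 100 = In
  refine wp_block_cons (S := So) (T := So + In * 4 + (n * 60 + 40) + 1) ((wp_sortDistinct 4 0 2 6
    (by decide) (by decide) (by decide) h.n_eq).mono hSo.le fun τ1 A1 h1 => ?_) (by omega)
  obtain ⟨hX, hNX⟩ := h1
  refine wp_block_cons (S := So) (T := In * 4 + (n * 60 + 40) + 1) ((wp_sortDistinct 5 1 3 7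
    (by decide) (by decide) (by decide) ((A1.i 0 rfl).trans h.n_eq)).mono hSo.le fun τ2 A2 h2 => ?_)
      (by omega)
  obtain ⟨hY, hNY⟩ := h2
  have r1 : τ1.rarr 1 = σ.rarr 1 := A1.ra 1 rfl
  have r3 : τ1.rarr 3 = σ.rarr 3 := A1.ra 3 rfl
  rw [hxS] at hX
  rw [r1, r3, hyS] at hY
  have n2 : τ2.ireg 0 = n := (A2.i 0 rfl).trans ((A1.i 0 rfl).trans h.n_eq)
  have m1 : τ2.ireg 1 = σ.ireg 1 := (A2.i 1 rfl).trans (A1.i 1 rfl)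
  have q0 : τ2.rarr 0 = σ.rarr 0 := (A2.ra 0 rfl).trans (A1.ra 0 rfl)
  have q1 : τ2.rarr 1 = σ.rarr 1 := (A2.ra 1 rfl).trans r1
  have q2 : τ2.rarr 2 = σ.rarr 2 := (A2.ra 2 rfl).trans (A1.ra 2 rfl)
  have q3 : τ2.rarr 3 = σ.rarr 3 := (A2.ra 3 rfl).trans r3
  have q6 : τ2.rarr 6 = τ1.rarr 6 := A2.ra 6 rfl
  have m4 : τ2.ireg 4 = τ1.ireg 4 := A2.i 4 rfl
  rw [← q6, ← m4] at hX
  rw [← m4] at hNX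
  rw [← q0, ← q2, ← m1] at hx
  rw [← q1, ← q3, ← m1] at hy
  rw [← m1] at hr
  have hS : Stores n v τ2 :=
      ⟨n2, by rw [q0]; exact h.sx, by rw [q1]; exact h.sy, by rw [q2]; exact h.tx,
    by rw [q3]; exact h.ty⟩
  rw [← m1]
  clear r1 r3 q0 q1 q2 q3 q6 m4 m1 hxS hyS A1 A2 h τ1
  have c0 : ∀ k < n, ∃ i < τ2.ireg 4, τ2.rarr 6 i = τ2.rarr 0 k := fun k hk =>
    hX.cover _ ⟨k, hk, Or.inl (hS.sx k hk)⟩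
  have c2 : ∀ k < n, ∃ i < τ2.ireg 4, τ2.rarr 6 i = τ2.rarr 2 k := fun k hk =>
    hX.cover _ ⟨k, hk, Or.inr (hS.tx k hk)⟩
  have c1 : ∀ k < n, ∃ i < τ2.ireg 5, τ2.rarr 7 i = τ2.rarr 1 k := fun k hk =>
    hY.cover _ ⟨k, hk, Or.inl (hS.sy k hk)⟩
  have c3 : ∀ k < n, ∃ i < τ2.ireg 5, τ2.rarr 7 i = τ2.rarr 3 k := fun k hk =>
    hY.cover _ ⟨k, hk, Or.inr (hS.ty k hk)⟩
  refine wp_block_cons (S := In) (T := In * 3 + (n * 60 + 40) + 1) ((wp_indexOf 4 0 6 1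
    (by decide) n2 hNX hX.lt c0).mono hIn.le fun τ3 A3 i1 => ?_) (by omega)
  have B3 : ∀ a, τ3.rarr a = τ2.rarr a := fun a => A3.ra a rfl
  have p4 : τ3.ireg 4 = τ2.ireg 4 := A3.i 4 rfl
  have p5 : τ3.ireg 5 = τ2.ireg 5 := A3.i 5 rfl
  have p0 : τ3.ireg 0 = n := (A3.i 0 rfl).trans n2
  refine wp_block_cons (S := In) (T := In * 2 + (n * 60 + 40) + 1) ((wp_indexOf 5 1 7 2
    (by decide) p0 (by rwa [p5]) (by rw [p5, B3]; exact hY.lt) (by rw [p5, B3, B3]; exact c1)).mono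
    hIn.le fun τ4 A4 i2 => ?_) (by omega)
  rw [p5, B3, B3] at i2
  have B4 : ∀ a, τ4.rarr a = τ2.rarr a := fun a => (A4.ra a rfl).trans (B3 a)
  have u4 : τ4.ireg 4 = τ2.ireg 4 := (A4.i 4 rfl).trans p4
  have u5 : τ4.ireg 5 = τ2.ireg 5 := (A4.i 5 rfl).trans p5
  have u0 : τ4.ireg 0 = n := (A4.i 0 rfl).trans p0
  refine wp_block_cons (S := In) (T := In + (n * 60 + 40) + 1) ((wp_indexOf 4 2 6 3
    (by decide) u0 (by rwa [u4]) (by rw [u4, B4]; exact hX.lt) (by rw [u4, B4, B4]; exact c2)).mono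
    hIn.le fun τ5 A5 i3 => ?_) (by omega)
  rw [u4, B4, B4] at i3
  have B5 : ∀ a, τ5.rarr a = τ2.rarr a := fun a => (A5.ra a rfl).trans (B4 a)
  have w5 : τ5.ireg 5 = τ2.ireg 5 := (A5.i 5 rfl).trans u5
  have w0 : τ5.ireg 0 = n := (A5.i 0 rfl).trans u0
  refine wp_block_cons (S := In) (T := (n * 60 + 40) + 1) ((wp_indexOf 5 3 7 4
    (by decide) w0 (by rwa [w5]) (by rw [w5, B5]; exact hY.lt) (by rw [w5, B5, B5]; exact c3)).mono
    hIn.le fun τ6 A6 i4 => ?_) (by omega)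
  rw [w5, B5, B5] at i4
  refine wp_block_cons (S := n * 60 + 40) (T := 1)
      ((wp_multiples ((A6.i 0 rfl).trans w0)).mono le_rfl
    fun τ7 A7 hM => ?_) (by omega)
  have a1 : τ7.iarr 1 = τ3.iarr 1 :=
    (A7.ia 1 rfl).trans ((A6.ia 1 rfl).trans ((A5.ia 1 rfl).trans (A4.ia 1 rfl)))
  have a2 : τ7.iarr 2 = τ4.iarr 2 := (A7.ia 2 rfl).trans ((A6.ia 2 rfl).trans (A5.ia 2 rfl))
  have a3 : τ7.iarr 3 = τ5.iarr 3 := (A7.ia 3 rfl).trans (A6.ia 3 rfl)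
  have a4 : τ7.iarr 4 = τ6.iarr 4 := A7.ia 4 rfl
  rw [← a1] at i1
  rw [← a2] at i2
  rw [← a3] at i3
  rw [← a4] at i4
  have B7 : ∀ a, τ7.rarr a = τ2.rarr a := fun a => (A7.ra a rfl).trans ((A6.ra a rfl).trans (B5 a))
  refine wp_block_nil ?_ le_rfl
  refine ⟨⟨τ2.rarr 6, τ2.rarr 7, τ2.ireg 4, τ2.ireg 5, τ7.iarr 1, τ7.iarr 2, τ7.iarr 3, τ7.iarr 4,
    hX.lt, hY.lt, fun k hk => (i1 k hk).1, fun k hk => (i3 k hk).1, fun k hk => (i2 k hk).1,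
    fun k hk => (i4 k hk).1, fun k hk => ?_, hr, ?_, ?_⟩, ⟨hX.mem, hY.mem⟩, ?_⟩
  · rw [(i1 k hk).2, (i2 k hk).2, (i3 k hk).2, (i4 k hk).2, hS.sx k hk, hS.sy k hk, hS.tx k hk,
      hS.ty k hk]
  · exact hX.le_of_le (i1 _ hr).1 (by rw [(i1 _ hr).2, (i3 _ hr).2]; exact hx)
  · exact hY.le_of_le (i2 _ hr).1 (by rw [(i2 _ hr).2, (i4 _ hr).2]; exact hy)
  · exact ⟨(A7.i 0 rfl).trans ((A6.i 0 rfl).trans w0),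
      (A7.i 1 rfl).trans
        ((A6.i 1 rfl).trans ((A5.i 1 rfl).trans ((A4.i 1 rfl).trans (A3.i 1 rfl)))),
      hM.1, hNX, hNY, hM.2, rfl, rfl, rfl, rfl, B7 6, B7 7⟩

theorem wp_solve {r : ℕ} {L : Layout n r v} (hd : LeavesDisjoint n r v) (hT : L.Tight)
    (h : Loaded L σ) (hi : ∀ a, a = 6 ∨ a = 7 → ∀ i, σ.iarr a i = 0)
    (hr : ∀ a, a = 8 ∨ a = 9 → ∀ i, σ.rarr a i = 0) (h7 : σ.ireg 7 = 0) (h0 : σ.iarr 0 0 = 0) :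
    wp solve ((n * 400 + n * n * 2000 + 100) + ((n + n) * ((n + n) * 3600 + 100) + 100) +
      ((n + n + (n + n)) * 200 + 100) + (n * ((n + n + (n + n)) * 420 + 500) + 100) + 1)
      (fun τ => τ.ireg 7 ≤ n * ((n + n + (n + n)) * 3 + 1) ∧ ∃ out, Solved n v out ∧
        ∀ k < n, τ.iarr 0 (k + 1) ≤ τ.ireg 7 ∧ outputPath τ k = out k) σ := by
  refine wp_block_cons (S := n * 400 + n * n * 2000 + 100) (T := ((n + n) * ((n + n) * 3600 + 100) +
      100) + ((n + n + (n + n)) * 200 + 100) + (n * ((n + n + (n + n)) * 420 + 500) + 100) + 1)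
    ((wp_labelEdges hd h hi hr).mono le_rfl fun τ1 A1 hL => ?_) (by omega)
  have h1 := h.of_agree A1
  refine wp_block_cons (S := ((n + n) * ((n + n) * 3600 + 100) + 100))
      (T := ((n + n + (n + n)) * 200 + 100) + (n * ((n + n + (n + n)) * 420 + 500) + 100) + 1)
    ((wp_computeTable h1 rfl rfl).mono le_rfl fun τ2 A2 hC => ?_) (by omega)
  have h2 := h1.of_agree A2
  refine wp_block_cons (S := (n + n + (n + n)) * 200 + 100)
      (T := (n * ((n + n + (n + n)) * 420 + 500) + 100) + 1)
    ((wp_tracePath h2 hC).mono le_rfl fun τ3 A3 hTr => ?_) (by omega)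
  have h3 := h2.of_agree A3
  have e7 : τ3.ireg 7 = 0 := (A3.i 7 rfl).trans ((A2.i 7 rfl).trans ((A1.i 7 rfl).trans h7))
  have e0 : τ3.iarr 0 0 = 0 := by rw [A3.ia 0 rfl, A2.ia 0 rfl, A1.ia 0 rfl, h0]
  have hNX := h.NX_le
  have hNY := h.NY_le
  -- The grid has at most `2n` lines in each direction, so `B = 4n` bounds both `L.NX + L.NY` and
  -- the number of steps of the center.
  refine wp_block_cons (S := (n * ((n + n + (n + n)) * 420 + 500) + 100)) (T := 1)
      ((wp_writePaths hL h3 hTr.2 e7 e0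
    (B := n + n + (n + n)) (by omega) hTr.1).mono le_rfl fun τ4 A4 hW => ?_) (by omega)
  obtain ⟨tot, hlen, hW⟩ := hW
  obtain ⟨ls, hF, hout⟩ := hW.exists_follows hTr.2
  refine wp_block_nil ⟨by rw [hW.emitted.len]; exact hlen, _, hF.solved hd hT hL hTr.2, ?_⟩ le_rfl
  rw [hW.emitted.len]
  exact hout

theorem wp_restore {K : ℕ} (hK : σ.ireg 7 ≤ K) :
    wp restore (K * 60 + 61) (fun τ => ∀ k, σ.iarr 0 (k + 1) ≤ σ.ireg 7 →
      outputPath τ k = (outputPath σ k).map (scale (sign (σ.ireg 2)) (sign (σ.ireg 3)))) σ := by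
  refine wp_block_cons (S := K * 30 + 30) (T := K * 30 + 31) ((wp_unflip 2 4).mono (by omega)
    fun τ1 A1 h1 => ?_) (by omega)
  have e7 : τ1.ireg 7 = σ.ireg 7 := A1.i 7 rfl
  refine wp_block_cons (S := K * 30 + 30) (T := 1) ((wp_unflip 3 5).mono (by omega)
    fun τ2 A2 h2 => ?_) (by omega)
  refine wp_block_nil (fun k hk => ?_) le_rfl
  rw [e7] at h2
  have e0 : τ2.iarr 0 = σ.iarr 0 := (A2.ia 0 rfl).trans (A1.ia 0 rfl)
  rw [outputPath, outputPath, e0, List.map_map]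
  refine List.map_congr_left fun i hi => ?_
  have hi : i < σ.ireg 7 := by
    rw [List.mem_range'_1] at hi
    omega
  rw [Function.comp, h2 i hi, A2.ra 4 rfl, h1 i hi, A1.ra 5 rfl, A1.i 3 rfl]
  rfl

theorem wp_program (h : Stores n v σ) (hc : ∃ r, IsCenter n v r)
    (hd : ∀ r, IsCenter n v r → LeavesDisjoint n r v) (hn : 1 ≤ n) (h2 : σ.ireg 2 = 0)
    (h3 : σ.ireg 3 = 0) (h7 : σ.ireg 7 = 0) (hi : ∀ a i, σ.iarr a i = 0)
    (hr : ∀ a, a = 8 ∨ a = 9 → ∀ i, σ.rarr a i = 0) :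
    wp program (100000 * n ^ 2) (fun τ => ∃ out, Solved n v out ∧ ∀ k < n, outputPath τ k =
      out k) σ := by
  -- Since `1 ≤ n`, each phase fits into a multiple of `n ^ 2`; the multiples used are 1000, 3000,
  -- 40000 and 2000, and the constant 100000 leaves slack.
  refine wp_block_cons (S := 1000 * n ^ 2) (T := 99000 * n ^ 2) ((wp_normalize h hc h2 h3).mono
    (by nlinarith) fun τ1 A1 hN => ?_) (by omega)
  obtain ⟨hcen, hS1, hx, hy⟩ := hN
  have e7 : τ1.ireg 7 = 0 := (A1.i 7 rfl).trans h7
  refine wp_block_cons (S := 3000 * n ^ 2) (T := 96000 * n ^ 2)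
      ((wp_buildGrid hS1 hcen.1 hx hy).mono
    (by nlinarith) fun τ2 A2 hL => ?_) (by omega)
  obtain ⟨L, hT, hL⟩ := hL
  refine wp_block_cons (S := 40000 * n ^ 2) (T := 40000 * n ^ 2) ((wp_solve
    ((hd _ hcen).scale (sign_eq _) (sign_eq _)) hT hL (fun a ha i => ?_) (fun a ha i => ?_)
    ((A2.i 7 rfl).trans e7) ?_).mono (by nlinarith) fun τ3 A3 hO => ?_) (by omega)
  · rcases ha with rfl | rfl
    · rw [A2.ia 6 rfl, A1.ia 6 rfl, hi]
    · rw [A2.ia 7 rfl, A1.ia 7 rfl, hi]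
  · rcases ha with rfl | rfl
    · rw [A2.ra 8 rfl, A1.ra 8 rfl, hr 8 (Or.inl rfl)]
    · rw [A2.ra 9 rfl, A1.ra 9 rfl, hr 9 (Or.inr rfl)]
  · rw [A2.ia 0 rfl, A1.ia 0 rfl, hi]
  obtain ⟨hlen, out, hsol, hout⟩ := hO
  refine wp_block_cons (S := 2000 * n ^ 2) (T := 1 * n ^ 2) ((wp_restore hlen).mono
    (by nlinarith) fun τ4 A4 hR => ?_) (by omega)
  refine wp_block_nil ⟨_, solved_scale (sign_eq _) (sign_eq _) hsol, fun k hk => ?_⟩ (by nlinarith)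
  rw [hR k (hout k hk).1, (hout k hk).2, A3.i 2 rfl, A3.i 3 rfl, A2.i 2 rfl, A2.i 3 rfl]

end RAM

end GMMN

open GMMN in
theorem theorem1 :
    ∃ (prog : RAM.Cmd) (C : ℕ), ∀ P : Finset (Pt × Pt), IsStar (intersectionGraph P) →
      ∀ L : List (Pt × Pt), L.Nodup → (∀ v, v ∈ L ↔ v ∈ P) →
        ∃ (σ : RAM.State) (T : ℕ), RAM.Exec prog (RAM.input L) σ T ∧ T ≤ C * P.card ^ 2 ∧
          ∃ π : {v // v ∈ P} → Network,
            (∀ (i : ℕ) (v : {v // v ∈ P}), L[i]? = some v.1 →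
              (π v).IsPathAlong v.1.1 v.1.2 (RAM.outputPath σ i)) ∧
            π ∈ Opt P ∧ IsMinimumNetwork P (Network.iUnion π) := by
  refine ⟨RAM.program, 100000, fun P hs L hn hL => ?_⟩
  have hcard : P.card = L.length := by
    rw [← List.toFinset_card_of_nodup hn]
    congr 1
    ext v
    rw [List.mem_toFinset, hL]
  have hc := exists_isCenter hn hL hs
  -- A star has a center, so `P` is not empty; this replaces a hypothesis on `n`.
  have hpos : 1 ≤ L.length := by
    obtain ⟨r, hr⟩ := hc
    exact Nat.one_le_of_lt hr.1
  have hS : RAM.Stores L.length (pairs L) (RAM.input L) := by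
    constructor <;> simp [RAM.input, pairs]
  obtain ⟨σ, T, hE, hT, out, hsol, hout⟩ := RAM.wp_program hS hc
    (fun r hr => leavesDisjoint_of_isCenter hn hL hs hr) hpos (by simp [RAM.input])
    (by simp [RAM.input]) (by simp [RAM.input]) (by simp [RAM.input])
    (by rintro a (rfl | rfl) i <;> simp [RAM.input])
  obtain ⟨π, h1, h2⟩ := exists_solution_of_solved hn hL hsol
  refine ⟨σ, T, hE, by rwa [hcard], π, fun i v hv => ?_, h2⟩
  rw [hout i (List.getElem?_eq_some_iff.1 hv).1]
  exact h1 i v hv
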